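/- Let $(M,F)$ be a connected Finsler manifold of dimension $n\ge 2$, with metric tensor $g_{ij}(x,y)=\tfrac12\,\partial^2F^2/\partial y^i\partial y^j$, and let $\rho:M\to\mathbb R$ be a smooth function satisfying $$\nabla^H_k\nabla^H_l\,\rho=\frac{\partial^2\rho}{\partial x^k\partial x^l}-\Gamma^{*j}_{lk}(x,y)\frac{\partial\rho}{\partial x^j}=\phi(x)\,g_{kl}(x,y)\qquad\text{for all }x\in M,\ 0\ne y\in T_xM,$$ where $\nabla^H$ is the Cartan horizontal covariant derivative, with coefficients $\Gamma^{*i}_{jk}=\tfrac12 g^{ih}\left(\frac{\delta g_{hk}}{\delta x^j}+\frac{\delta g_{hj}}{\delta x^k}-\frac{\delta g_{jk}}{\delta x^h}\right)$, and $\phi$ is a function on $M$. Suppose that $\rho$ has exactly one critical point $o$. Then $\phi(o)^2>0$, and there is an open neighbourhood $U$ of $o$, which is all of $M$ when $(M,F)$ is complete, such that the following holds for every $p\in U\setminus\{o\}$. Let $\overline M$ be the level set of $\rho$ through $p$, i.e. the connected component containing $p$ of the regular hypersurface $\{\rho=\rho(p)\}$. (i) The norm $\|\mathrm{grad}\,\rho\|=(g^{ij}(x,y)\,\partial_i\rho\,\partial_j\rho)^{1/2}$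 is equal to a constant $\rho'>0$ at all $x\in\overline M$ and all $0\ne y\in T_xM$. (ii) If $g_{\gamma\beta}(u,v)$ denotes the Finsler metric tensor induced by $g$ on the $(n-1)$-dimensional manifold $\overline M$, then the tensor $f_{\gamma\beta}$ defined by $$g_{\gamma\beta}=\rho'^{\,2}f_{\gamma\beta}$$ is the metric tensor of a Finsler structure on $\overline M$, and $(\overline M,f)$ is a space of positive constant curvature $\phi(o)^2$: for every $u\in\overline M$ and all linearly independent $v,X\in T_u\overline M$, $$K(u,v,X)=\frac{f(R(X,v)v,X)}{f(X,X)f(v,v)-f(X,v)^2}=\phi(o)^2,$$ where $f$ and the $h$-curvature $R$ of its Cartan connection are taken at $(u,v)$. (For $n=2$ there are no such $v,X$, and the curvature condition is empty.) Here complete means that every Cauchy sequence for $d(p,q)=\inf_\gamma\int F(\gamma,\dot\gamma)\,dt$ converges, the infimum being over piecewise smooth curves from $p$ to $q$. -/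

import Mathlib

open scoped Manifold ContDiff Topology ENNReal BigOperators

noncomputable section

namespace FinslerGeom

/-- Coordinate space of dimension `k`. -/
abbrev Coord (k : ℕ) : Type := EuclideanSpace ℝ (Fin k)

/-! ### Finsler calculus in local coordinates `(x, y)` (line elements)

Scalar quantities on an open subset of the tangent bundle are functions `A x y` of the position `x`
and of the direction `y`. -/

section LocalCalculus

variable {k : ℕ}

/-- The partial derivative of a function of the position alone. -/
def partialD (i : Fin k) (h : Coord k → ℝ) (x : Coord k) : ℝ :=
  fderiv ℝ h x (EuclideanSpace.single i 1)

/-- `∂A / ∂x^i`. -/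
def dPos (i : Fin k) (A : Coord k → Coord k → ℝ) (x y : Coord k) : ℝ :=
  partialD i (fun x' => A x' y) x

/-- `∂A / ∂y^i`. -/
def dDir (i : Fin k) (A : Coord k → Coord k → ℝ) (x y : Coord k) : ℝ :=
  partialD i (fun y' => A x y') y

/-- The Finsler metric tensor `g_{ij} = (1/2) ∂²(L²) / ∂y^i ∂y^j`. -/
def gLow (L : Coord k → Coord k → ℝ) (i j : Fin k) (x y : Coord k) : ℝ :=
  (1 / 2) * dDir i (dDir j (fun x' y' => L x' y' ^ 2)) x y

/-- The matrix `(g_{ij})`. -/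
def gMat (L : Coord k → Coord k → ℝ) (x y : Coord k) : Matrix (Fin k) (Fin k) ℝ :=
  Matrix.of fun i j => gLow L i j x y

/-- The inverse matrix `g^{ij}`. -/
def gUp (L : Coord k → Coord k → ℝ) (i j : Fin k) (x y : Coord k) : ℝ :=
  (gMat L x y)⁻¹ i j

/-- The mixed Cartan torsion `C^i_{jl} = g^{ih} C_{hjl}`, `C_{hjl} = (1/2) ∂g_{hj} / ∂y^l`. -/
def cartanTorsion (L : Coord k → Coord k → ℝ) (i j l : Fin k) (x y : Coord k) : ℝ :=
  ∑ h, gUp L i h x y * ((1 / 2) * dDir l (gLow L h j) x y)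

/-- The formal Christoffel symbols `γ^i_{jl}`. -/
def formalChristoffel (L : Coord k → Coord k → ℝ) (i j l : Fin k) (x y : Coord k) : ℝ :=
  (1 / 2) * ∑ h, gUp L i h x y *
    (dPos j (gLow L h l) x y + dPos l (gLow L h j) x y - dPos h (gLow L j l) x y)

/-- The spray coefficients `G^i = (1/2) γ^i_{jl} y^j y^l`. -/
def spray (L : Coord k → Coord k → ℝ) (i : Fin k) (x y : Coord k) : ℝ :=
  (1 / 2) * ∑ j, ∑ l, formalChristoffel L i j l x y * y j * y l

/-- The coefficients `G^i_j = ∂G^i / ∂y^j` of the nonlinear connection. -/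
def nonlin (L : Coord k → Coord k → ℝ) (i j : Fin k) (x y : Coord k) : ℝ :=
  dDir j (spray L i) x y

/-- The horizontal derivative `δA / δx^i = ∂A / ∂x^i - G^j_i ∂A / ∂y^j`. -/
def dHor (L : Coord k → Coord k → ℝ) (i : Fin k) (A : Coord k → Coord k → ℝ)
    (x y : Coord k) : ℝ :=
  dPos i A x y - ∑ j, nonlin L j i x y * dDir j A x y

/-- The horizontal coefficients `Γ*^i_{jl}` of the Cartan connection. -/
def cartanGamma (L : Coord k → Coord k → ℝ) (i j l : Fin k) (x y : Coord k) : ℝ :=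
  (1 / 2) * ∑ h, gUp L i h x y *
    (dHor L j (gLow L h l) x y + dHor L l (gLow L h j) x y - dHor L h (gLow L j l) x y)

/-- The Cartan horizontal Hessian `∇^H_a ∇^H_b ρ = ∂_a ∂_b ρ - Γ*^j_{ba} ∂_j ρ` of a function `ρ` of
the position alone. -/
def hessHor (L : Coord k → Coord k → ℝ) (ρ : Coord k → ℝ) (a b : Fin k) (x y : Coord k) : ℝ :=
  partialD a (partialD b ρ) x - ∑ j, cartanGamma L j b a x y * partialD j ρ x

/-- The norm `‖grad ρ‖ = (g_{ij} ρ^i ρ^j)^{1/2} = (g^{ij} ρ_i ρ_j)^{1/2}` at the line element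
`(x, y)`, where `ρ^i = g^{ij} ρ_j`. -/
def gradNorm (L : Coord k → Coord k → ℝ) (ρ : Coord k → ℝ) (x y : Coord k) : ℝ :=
  Real.sqrt (∑ i, ∑ j, gUp L i j x y * partialD i ρ x * partialD j ρ x)

/-- The torsion `R^i_{jl} = δG^i_j / δx^l - δG^i_l / δx^j` of the nonlinear connection. -/
def nonlinCurv (L : Coord k → Coord k → ℝ) (i j l : Fin k) (x y : Coord k) : ℝ :=
  dHor L l (nonlin L i j) x y - dHor L j (nonlin L i l) x y

/-- The `h`-curvature `R^i_{hjl} = K^i_{hjl} + C^i_{hr} R^r_{jl}` of the Cartan connection, with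
`K^i_{hjl} = δ_l Γ*^i_{hj} + Γ*^r_{hj} Γ*^i_{rl} - (j ↔ l)`. -/
def hCurv (L : Coord k → Coord k → ℝ) (i h j l : Fin k) (x y : Coord k) : ℝ :=
  (dHor L l (cartanGamma L i h j) x y
      + ∑ r, cartanGamma L r h j x y * cartanGamma L i r l x y)
    - (dHor L j (cartanGamma L i h l) x y
      + ∑ r, cartanGamma L r h l x y * cartanGamma L i r j x y)
    + ∑ r, cartanTorsion L i h r x y * nonlinCurv L r j l x y

/-- `g(X, Z)` at the line element `(x, y)`. -/
def gInner (L : Coord k → Coord k → ℝ) (x y X Z : Coord k) : ℝ :=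
  ∑ i, ∑ j, gLow L i j x y * X i * Z j

/-- The vector `R(X, v) v` at the line element `(x, v)`. In the index convention of `hCurv` its
components are `R^i_{hjl} v^h v^j X^l`, so that round spheres have positive curvature. -/
def curvVec (L : Coord k → Coord k → ℝ) (x v X : Coord k) : Coord k :=
  WithLp.toLp 2 fun i => ∑ h, ∑ j, ∑ l, hCurv L i h j l x v * v h * v j * X l

/-- The sectional curvature of the plane spanned by `v` and `X`, at the line element `(x, v)`. -/
def secCurv (L : Coord k → Coord k → ℝ) (x v X : Coord k) : ℝ :=
  gInner L x v (curvVec L x v X) X /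
    (gInner L x v X X * gInner L x v v v - gInner L x v X v ^ 2)

/-- `L` is the coordinate expression of a Finsler structure on the open set `W`. -/
structure IsFinslerOn (W : Set (Coord k)) (L : Coord k → Coord k → ℝ) : Prop where
  nonneg : ∀ x ∈ W, ∀ y, 0 ≤ L x y
  smooth : ContDiffOn ℝ ∞ (fun p : Coord k × Coord k => L p.1 p.2) (W ×ˢ {y | y ≠ 0})
  homogeneous : ∀ x ∈ W, ∀ y, ∀ c : ℝ, 0 < c → L x (c • y) = c * L x y
  posDef : ∀ x ∈ W, ∀ y, y ≠ 0 → (gMat L x y).PosDef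

end LocalCalculus

/-! ### Finsler structures on manifolds -/

section Manifold

/-- A real function on the tangent bundle of a `k`-dimensional manifold. -/
abbrev TangentFun (k : ℕ) (M : Type*) [TopologicalSpace M] [ChartedSpace (Coord k) M] :=
  (x : M) → TangentSpace (𝓡 k) x → ℝ

variable {k n : ℕ}
variable {M : Type*} [TopologicalSpace M] [ChartedSpace (Coord n) M]
variable {N : Type*} [TopologicalSpace N] [ChartedSpace (Coord k) N]

/-- The function `(u, v) ↦ F (χ u, χ_* v)` induced on the source of a map `χ` into `M`. -/
def induced (F : TangentFun n M) (χ : N → M) : TangentFun k N :=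
  fun u v => F (χ u) (mfderiv (𝓡 k) (𝓡 n) χ u v)

/-- The expression of `F` in the chart `e` and the induced coordinates `(x, y)` of the tangent
bundle. -/
def inChart (F : TangentFun n M) (e : OpenPartialHomeomorph M (Coord n)) :
    Coord n → Coord n → ℝ :=
  fun x y => induced (k := n) F (e.symm : Coord n → M) x y

/-- `F` is a Finsler structure on the smooth manifold `M`: in every smooth chart it is nonnegative,
smooth away from the zero section, positively homogeneous of degree one, with positive definite
`g_{ij}`. -/
def IsFinsler (F : TangentFun n M) : Prop :=
  ∀ e ∈ IsManifold.maximalAtlas (𝓡 n) ∞ M, IsFinslerOn e.target (inChart F e)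

/-- The equation `∇^H ∇^H ρ = φ g` on the nonzero tangent vectors, `φ` a function on `M`. -/
def SolvesHessianEq (F : TangentFun n M) (ρ φ : M → ℝ) : Prop :=
  ∀ e ∈ IsManifold.maximalAtlas (𝓡 n) ∞ M, ∀ x ∈ e.target, ∀ y : Coord n, y ≠ 0 →
    ∀ a b : Fin n,
      hessHor (inChart F e) (fun z => ρ (e.symm z)) a b x y
        = φ (e.symm x) * gLow (inChart F e) a b x y

/-- Critical points of `ρ`: `dρ = 0`, equivalently `grad ρ = 0`. -/
def IsCritical (n : ℕ) {M : Type*} [TopologicalSpace M] [ChartedSpace (Coord n) M]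
    (ρ : M → ℝ) (p : M) : Prop :=
  mfderiv (𝓡 n) 𝓘(ℝ, ℝ) ρ p = 0

/-- The level set of `ρ` through `p`: the connected component containing `p` of the regular
hypersurface `ρ = ρ p`. -/
def tLevel (n : ℕ) {M : Type*} [TopologicalSpace M] [ChartedSpace (Coord n) M]
    (ρ : M → ℝ) (p : M) : Set M :=
  connectedComponentIn {x | ρ x = ρ p ∧ ¬ IsCritical n ρ x} p

/-- `(N, f)` has constant curvature `κ`: the sectional curvature of every plane spanned by `v` and
`X`, at every line element `(u, v)`, equals `κ`. -/
def HasConstantCurvature (f : TangentFun k N) (κ : ℝ) : Prop :=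
  ∀ e ∈ IsManifold.maximalAtlas (𝓡 k) ∞ N, ∀ u ∈ e.target, ∀ v X : Coord k,
    LinearIndependent ℝ ![v, X] → secCurv (inChart f e) u v X = κ

/-- `γ` is a piecewise smooth curve on `[a, b]`. -/
def IsPiecewiseSmooth (n : ℕ) {M : Type*} [TopologicalSpace M] [ChartedSpace (Coord n) M]
    (γ : ℝ → M) (a b : ℝ) : Prop :=
  ∃ (s : ℕ → ℝ) (l : ℕ), Monotone s ∧ s 0 = a ∧ s l = b ∧
    ∀ i < l, ContMDiffOn 𝓘(ℝ, ℝ) (𝓡 n) ∞ γ (Set.Icc (s i) (s (i + 1)))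

/-- The length `∫_a^b F (γ, dγ/dt) dt`. -/
def curveLength (F : TangentFun n M) (γ : ℝ → M) (a b : ℝ) : ℝ≥0∞ :=
  ∫⁻ t in Set.Icc a b, ENNReal.ofReal (F (γ t) (mfderiv 𝓘(ℝ, ℝ) (𝓡 n) γ t (1 : ℝ)))

/-- The distance `d(p, q)`: the infimum of the lengths of the piecewise smooth curves from `p` to
`q`. It need not be symmetric. -/
def finslerDist (F : TangentFun n M) (p q : M) : ℝ≥0∞ :=
  ⨅ (γ : ℝ → M) (a : ℝ) (b : ℝ) (_ : IsPiecewiseSmooth n γ a b ∧ γ a = p ∧ γ b = q),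
    curveLength F γ a b

/-- `(M, F)` is complete: Cauchy sequences for `d` converge. As `d` need not be symmetric, both
`d(x_i, x_j)` and `d(x_j, x_i)` are required to be small for a Cauchy sequence; hence forward
complete and backward complete Finsler manifolds are complete in this sense. -/
def FinslerComplete (F : TangentFun n M) : Prop :=
  ∀ s : ℕ → M,
    (∀ ε : ℝ≥0∞, 0 < ε → ∃ l, ∀ i j, l ≤ i → l ≤ j → finslerDist F (s i) (s j) < ε) →
    ∃ p, Filter.Tendsto s Filter.atTop (𝓝 p)

end Manifold

end FinslerGeom

end

/-! The equation forces `F` to be Riemannian; what remains is a rigidity argument for a Riemannian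
metric with a function whose Hessian is a multiple of the metric.

Reduction. Put H(x, y) = g^{ij}(x, y) ρ_i ρ_j. Wherever H(x, ·) is critical in the direction, the
nonlinear connection drops out and the equation gives ∂H/∂x^k = 2φρ_k (`dPos_dualNorm`). The right
side does not involve y, so the maximum and the minimum of H(x, ·) over directions move at the same
rate along a segment, and their difference, zero at `o` because dρ = 0 there, stays zero
(`dir_indep_of_segment`). In dimension at least two, a Minkowski metric for which g^{ij}(y) r_i r_j
is the same for all y, with one fixed covector r ≠ 0, is Euclidean (`const_of_dual_norm_const`): the
vector V = g^{ij} r_j turns out not to depend on y, g is constant on lines parallel to V, and these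
lines all tend to the directions ±V. Off `o` this makes g independent of y, at `o` continuity does,
and connectedness of M gives that F² is quadratic on every tangent space (`HessData.quadAt`).

Riemannian part. With N = grad ρ the equation reads ∇N = φ Id. Hence dH = 2φ dρ, and the Ricci
identity gives dφ ∧ dρ = 0 and determines R(·, N). Level sets are umbilic, with second fundamental
form proportional to φg, so by the Gauss equation g/H has curvature κ on them when HR − (κ −
φ²)(round part) vanishes on tangent vectors. The tensor `defect` adds a term that is zero on tangent
vectors, with the coefficient for which the contraction with N vanishes identically. The second
Bianchi identity then yields ∇_N `defect` = 0 (`dGrad_defect`); in coordinates the square u of the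
defect obeys |N u| ≤ C √H u.

Starting value. φ(o) ≠ 0: otherwise the pair (N, φ) solves a homogeneous linear differential
equation along segments from `o` with zero initial value, and `o` would not be the only critical
point (`phi_ne_zero`). So `o` is a strict local extremum, and with κ = φ(o)² the defect tends to
zero at `o`. Since √H changes along N at the rate φ√H, the bound on N u does not let a positive u
reach zero at `o`; a maximum principle for u exp(−λ√H) makes this precise and gives u = 0 near `o`
(`exists_defect_eq_zero`).

Spreading. A small core around `o` meets every level in a closed set, hence contains the level
component of each of its noncritical points; without completeness this core is U. If M is complete,
N/(1 + H) has length at most one and thus a global flow. The vanishing of the defect is carried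
along its flow lines, and the points whose flow line meets the core form an open and closed set
(`defectZero_of_complete`). Finally `riem_levelSet` turns a vanishing defect into constant curvature
of any hypersurface immersed in a level set. -/

namespace FinslerGeom

/-! ### Partial derivatives, and smoothness of inverse matrices. -/

section PartialDerivatives

variable {k : ℕ}

theorem coord_eq_sum_single (v : Coord k) : v = ∑ i, v i • EuclideanSpace.single i (1 : ℝ) := by
  ext j
  simp [Finset.sum_apply, Pi.single_apply]

theorem fderiv_eq_sum_partialD (f : Coord k → ℝ) (x v : Coord k) :
    fderiv ℝ f x v = ∑ i, v i * partialD i f x := by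
  conv_lhs => rw [coord_eq_sum_single v]
  simp [partialD, map_sum]

theorem partialD_congr {f h : Coord k → ℝ} {x : Coord k} (i : Fin k) (e : f =ᶠ[𝓝 x] h) :
    partialD i f x = partialD i h x := by
  simp [partialD, e.fderiv_eq]

theorem partialD_congr_of_eqOn {f h : Coord k → ℝ} {W : Set (Coord k)} (hW : IsOpen W)
    {x : Coord k} (hx : x ∈ W) (i : Fin k) (e : Set.EqOn f h W) :
    partialD i f x = partialD i h x :=
  partialD_congr i (e.eventuallyEq_of_mem (hW.mem_nhds hx))

@[simp] theorem partialD_const (i : Fin k) (c : ℝ) (x : Coord k) :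
    partialD i (fun _ => c) x = 0 := by
  simp [partialD]

theorem partialD_add {f h : Coord k → ℝ} {x : Coord k} (i : Fin k) (hf : DifferentiableAt ℝ f x)
    (hh : DifferentiableAt ℝ h x) :
    partialD i (fun z => f z + h z) x = partialD i f x + partialD i h x := by
  simp [partialD, fderiv_fun_add hf hh]

theorem partialD_sub {f h : Coord k → ℝ} {x : Coord k} (i : Fin k) (hf : DifferentiableAt ℝ f x)
    (hh : DifferentiableAt ℝ h x) :
    partialD i (fun z => f z - h z) x = partialD i f x - partialD i h x := by
  simp [partialD, fderiv_fun_sub hf hh]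

theorem partialD_neg (f : Coord k → ℝ) (x : Coord k) (i : Fin k) :
    partialD i (fun z => - f z) x = - partialD i f x := by
  simp [partialD, fderiv_fun_neg]

theorem partialD_mul {f h : Coord k → ℝ} {x : Coord k} (i : Fin k) (hf : DifferentiableAt ℝ f x)
    (hh : DifferentiableAt ℝ h x) :
    partialD i (fun z => f z * h z) x = partialD i f x * h x + f x * partialD i h x := by
  simp [partialD, fderiv_fun_mul hf hh]; ring

theorem partialD_const_mul (f : Coord k → ℝ) (x : Coord k) (i : Fin k) (c : ℝ) :
    partialD i (fun z => c * f z) x = c * partialD i f x := by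
  have : (fun z => c * f z) = c • f := rfl
  simp [partialD, this, fderiv_const_smul_field]

theorem partialD_sum {ι : Type*} (s : Finset ι) {f : ι → Coord k → ℝ} {x : Coord k} (i : Fin k)
    (hf : ∀ a ∈ s, DifferentiableAt ℝ (f a) x) :
    partialD i (fun z => ∑ a ∈ s, f a z) x = ∑ a ∈ s, partialD i (f a) x := by
  simp [partialD, fderiv_fun_sum hf]

theorem contDiffOn_partialD {f : Coord k → ℝ} {W : Set (Coord k)} (hW : IsOpen W)
    (hf : ContDiffOn ℝ ∞ f W) (i : Fin k) : ContDiffOn ℝ ∞ (partialD i f) W :=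
  (hf.fderiv_of_isOpen hW (m := ∞) (by simp)).clm_apply contDiffOn_const

theorem differentiableAt_of_contDiffOn {E F : Type*} [NormedAddCommGroup E] [NormedSpace ℝ E]
    [NormedAddCommGroup F] [NormedSpace ℝ F] {f : E → F} {W : Set E} (hW : IsOpen W)
    (hf : ContDiffOn ℝ ∞ f W) {x : E} (hx : x ∈ W) : DifferentiableAt ℝ f x :=
  (hf.differentiableOn (by simp)).differentiableAt (hW.mem_nhds hx)

theorem partialD_comm {f : Coord k → ℝ} {W : Set (Coord k)} (hW : IsOpen W)
    (hf : ContDiffOn ℝ ∞ f W) {x : Coord k} (hx : x ∈ W) (i j : Fin k) :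
    partialD i (partialD j f) x = partialD j (partialD i f) x := by
  have hc : ContDiffAt ℝ ∞ f x := hf.contDiffAt (hW.mem_nhds hx)
  have hs : IsSymmSndFDerivAt ℝ f x := hc.isSymmSndFDerivAt (by
    simp [minSmoothness_of_isRCLikeNormedField]; exact WithTop.coe_le_coe.2 le_top)
  have hd : DifferentiableAt ℝ (fderiv ℝ f) x :=
    differentiableAt_of_contDiffOn hW (hf.fderiv_of_isOpen hW (m := ∞) (by simp)) hx
  have key : ∀ a b : Fin k, partialD a (partialD b f) x
      = fderiv ℝ (fderiv ℝ f) x (EuclideanSpace.single a 1) (EuclideanSpace.single b 1) := by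
    intro a b
    have : partialD b f = fun z => fderiv ℝ f z (EuclideanSpace.single b 1) := rfl
    rw [this, partialD, fderiv_clm_apply hd (differentiableAt_const _)]
    simp
  rw [key, key]
  exact hs _ _

theorem hasDerivAt_along_line {f : Coord k → ℝ} {x w : Coord k} {t : ℝ}
    (hf : DifferentiableAt ℝ f (x + t • w)) :
    HasDerivAt (fun s : ℝ => f (x + s • w)) (∑ i, w i * partialD i f (x + t • w)) t := by
  rw [← fderiv_eq_sum_partialD]
  have hl : HasDerivAt (fun s : ℝ => x + s • w) w t := by
    simpa using ((hasDerivAt_id t).smul_const w).const_add x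
  exact hf.hasFDerivAt.comp_hasDerivAt t hl

theorem contDiffOn_matrix_det {E ι : Type*} [NormedAddCommGroup E] [NormedSpace ℝ E] [Fintype ι]
    [DecidableEq ι] {A : E → Matrix ι ι ℝ} {W : Set E}
    (hA : ∀ i j, ContDiffOn ℝ ∞ (fun p => A p i j) W) :
    ContDiffOn ℝ ∞ (fun p => (A p).det) W := by
  simp only [Matrix.det_apply']
  exact ContDiffOn.sum fun σ _ => contDiffOn_const.mul (contDiffOn_prod fun i _ => hA _ _)

theorem contDiffOn_matrix_inv {E ι : Type*} [NormedAddCommGroup E] [NormedSpace ℝ E] [Fintype ι]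
    [DecidableEq ι] {A : E → Matrix ι ι ℝ} {W : Set E}
    (hA : ∀ i j, ContDiffOn ℝ ∞ (fun p => A p i j) W) (hdet : ∀ p ∈ W, (A p).det ≠ 0) (i j : ι) :
    ContDiffOn ℝ ∞ (fun p => (A p)⁻¹ i j) W := by
  have h1 : ∀ p, (A p)⁻¹ i j = ((A p).det)⁻¹ * (A p).adjugate i j := by
    intro p; simp [Matrix.inv_def]
  simp only [h1, Matrix.adjugate_apply]
  refine ((contDiffOn_matrix_det hA).inv hdet).mul (contDiffOn_matrix_det fun a b => ?_)
  by_cases hb : a = j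
  · subst hb; simp only [Matrix.updateRow_self]; exact contDiffOn_const
  · simp only [Matrix.updateRow_ne hb]; exact hA _ _

/-- The derivative of `∑ R^i r_i` along a direction, where `r_i = g_{ij} R^j`. -/
theorem fderiv_sum_mul_of_dual {E ι : Type*} [NormedAddCommGroup E] [NormedSpace ℝ E] [Fintype ι]
    {g : ι → ι → E → ℝ} {r R : ι → E → ℝ} {p : E} (v : E)
    (hg : ∀ i j, DifferentiableAt ℝ (g i j) p) (hR : ∀ i, DifferentiableAt ℝ (R i) p)
    (hsym : ∀ i j, g i j p = g j i p)
    (hr : ∀ i, (r i) =ᶠ[𝓝 p] fun q => ∑ j, g i j q * R j q) :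
    fderiv ℝ (fun q => ∑ i, R i q * r i q) p v
      = 2 * ∑ i, R i p * fderiv ℝ (r i) p v
        - ∑ i, ∑ j, R i p * R j p * fderiv ℝ (g i j) p v := by
  have hr' : ∀ i, HasFDerivAt (r i)
      (∑ j, (g i j p • fderiv ℝ (R j) p + R j p • fderiv ℝ (g i j) p)) p := fun i =>
    (HasFDerivAt.fun_sum fun j _ => (hg i j).hasFDerivAt.mul (hR j).hasFDerivAt).congr_of_eventuallyEq
      (hr i)
  have h1 : fderiv ℝ (fun q => ∑ i, R i q * r i q) p
      = ∑ i, (R i p • fderiv ℝ (r i) p + r i p • fderiv ℝ (R i) p) :=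
    (HasFDerivAt.fun_sum fun i _ =>
      (hR i).hasFDerivAt.mul (hr' i).differentiableAt.hasFDerivAt).fderiv
  -- Differentiating r_i = g_{ij} R^j trades the derivatives of R for those of g, so that none of R
  -- survives in the result.
  have h2 : ∑ i, R i p * fderiv ℝ (r i) p v
      = ∑ i, r i p * fderiv ℝ (R i) p v + ∑ i, ∑ j, R i p * R j p * fderiv ℝ (g i j) p v := by
    have : ∀ i, r i p * fderiv ℝ (R i) p v = ∑ j, R j p * (g j i p * fderiv ℝ (R i) p v) := by
      intro i
      rw [(hr i).eq_of_nhds, Finset.sum_mul]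
      exact Finset.sum_congr rfl fun j _ => by rw [hsym i j]; ring
    simp only [this]
    rw [Finset.sum_comm, ← Finset.sum_add_distrib]
    refine Finset.sum_congr rfl fun i _ => ?_
    rw [(hr' i).fderiv, ← Finset.sum_add_distrib]
    simp only [sum_apply, add_apply,
      smul_apply, smul_eq_mul, Finset.mul_sum]
    exact Finset.sum_congr rfl fun j _ => by ring
  rw [h1]
  simp only [sum_apply, add_apply,
      smul_apply, smul_eq_mul, Finset.sum_add_distrib]
  linarith

end PartialDerivatives

/-! ### A maximum principle for the dependence on the direction. -/

section MaximumPrinciple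

variable {k : ℕ}

theorem exists_normalize {y : Coord k} (hy : y ≠ 0) :
    ∃ c : ℝ, 0 < c ∧ ‖c • y‖ = 1 := by
  refine ⟨‖y‖⁻¹, by positivity, ?_⟩
  rw [norm_smul, norm_inv, norm_norm, inv_mul_cancel₀ (norm_ne_zero_iff.2 hy)]

/-- The oscillation of H over directions cannot grow along the segment: a maximising and a
minimising direction are both critical, and there both position derivatives equal the same ψ. One
inequality suffices, because y and y' can be exchanged. -/
theorem dir_indep_of_segment {H : Coord k → Coord k → ℝ} {W : Set (Coord k)} (hW : IsOpen W)
    (hH : ContDiffOn ℝ ∞ (fun p : Coord k × Coord k => H p.1 p.2) (W ×ˢ {y | y ≠ 0}))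
    (hom : ∀ x ∈ W, ∀ y, y ≠ 0 → ∀ c : ℝ, 0 < c → H x (c • y) = H x y)
    {ψ : Fin k → Coord k → ℝ}
    (hcrit : ∀ x ∈ W, ∀ y, y ≠ 0 → (∀ j, dDir j H x y = 0) → ∀ i, dPos i H x y = ψ i x)
    {x w : Coord k} (hseg : ∀ t ∈ Set.Icc (0 : ℝ) 1, x + t • w ∈ W)
    (h0 : ∀ y y' : Coord k, y ≠ 0 → y' ≠ 0 → H x y = H x y')
    {y y' : Coord k} (hy : y ≠ 0) (hy' : y' ≠ 0) : H (x + w) y ≤ H (x + w) y' := by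
  have hO : IsOpen (W ×ˢ {y : Coord k | y ≠ 0}) := hW.prod isOpen_ne
  set S := Metric.sphere (0 : Coord k) 1
  have hS0 : ∀ z ∈ S, z ≠ 0 := fun z hz h => by simp [S, h] at hz
  obtain ⟨c, hc, hcy⟩ := exists_normalize hy
  obtain ⟨c', hc', hcy'⟩ := exists_normalize hy'
  have hx1 : x + w ∈ W := by simpa using hseg 1 (by simp)
  set K := Set.Icc (0 : ℝ) 1 ×ˢ (S ×ˢ S)
  have hK : IsCompact K := isCompact_Icc.prod ((isCompact_sphere _ _).prod (isCompact_sphere _ _))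
  have key : ∀ lam : ℝ, 0 < lam → H (x + w) y - H (x + w) y' ≤ lam := by
    intro lam hlam
    -- Unit directions form a compact set and, by homogeneity of degree zero, represent all
    -- directions. The term λt makes the derivative in t strictly negative at a maximum; λ tends to
    -- zero at the end.
    set Q : ℝ × Coord k × Coord k → ℝ := fun p =>
      H (x + p.1 • w) p.2.1 - H (x + p.1 • w) p.2.2 - lam * p.1
    have hQ : ContinuousOn Q K := by
      refine ContinuousOn.sub (ContinuousOn.sub ?_ ?_) (by fun_prop)
      · refine hH.continuousOn.comp (f := fun p : ℝ × Coord k × Coord k => (x + p.1 • w, p.2.1))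
          (by fun_prop) ?_
        rintro ⟨t, a, b⟩ ⟨ht, ha, hb⟩
        exact ⟨hseg t ht, hS0 _ ha⟩
      · refine hH.continuousOn.comp (f := fun p : ℝ × Coord k × Coord k => (x + p.1 • w, p.2.2))
          (by fun_prop) ?_
        rintro ⟨t, a, b⟩ ⟨ht, ha, hb⟩
        exact ⟨hseg t ht, hS0 _ hb⟩
    have hmem : ∀ t ∈ Set.Icc (0 : ℝ) 1, (t, c • y, c' • y') ∈ K := fun t ht =>
      ⟨ht, by simpa [S] using hcy, by simpa [S] using hcy'⟩
    obtain ⟨⟨t, a, b⟩, ⟨ht, ha, hb⟩, hmax⟩ := hK.exists_isMaxOn ⟨_, hmem 0 (by simp)⟩ hQ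
    have ha0 := hS0 a ha
    have hb0 := hS0 b hb
    have hxt := hseg t ht
    have hle := hmax (hmem 1 (by simp))
    simp only [Q, Set.mem_ofPred_eq, one_smul] at hle
    rw [hom _ hx1 _ hy _ hc, hom _ hx1 _ hy' _ hc'] at hle
    -- A maximum at t = 0 already gives the bound, since H is direction free there.
    rcases eq_or_lt_of_le ht.1 with h | htpos
    · subst h
      simp only [zero_smul, add_zero] at hle
      rw [h0 a b ha0 hb0] at hle
      linarith
    · exfalso
      have hslice : ∀ z, z ≠ 0 → DifferentiableAt ℝ (fun y => H (x + t • w) y) z := fun z hz =>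
        (differentiableAt_of_contDiffOn hO hH (x := (x + t • w, z)) ⟨hxt, hz⟩).comp z
          ((differentiableAt_const _).prodMk differentiableAt_id)
      have hslice' : ∀ z, z ≠ 0 → DifferentiableAt ℝ (fun x' => H x' z) (x + t • w) := fun z hz =>
        (differentiableAt_of_contDiffOn hO hH (x := (x + t • w, z)) ⟨hxt, hz⟩).comp
          (f := fun x' : Coord k => (x', z)) (x + t • w)
          (differentiableAt_id.prodMk (differentiableAt_const _))
      have hA : ∀ z, z ≠ 0 → H (x + t • w) z ≤ H (x + t • w) a := by
        intro z hz
        obtain ⟨d, hd, hdz⟩ := exists_normalize hz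
        have := hmax (show (t, d • z, b) ∈ K from ⟨ht, by simpa [S] using hdz, hb⟩)
        simp only [Q, Set.mem_ofPred_eq] at this
        rw [hom _ hxt _ hz _ hd] at this
        linarith
      have hB : ∀ z, z ≠ 0 → H (x + t • w) b ≤ H (x + t • w) z := by
        intro z hz
        obtain ⟨d, hd, hdz⟩ := exists_normalize hz
        have := hmax (show (t, a, d • z) ∈ K from ⟨ht, ha, by simpa [S] using hdz⟩)
        simp only [Q, Set.mem_ofPred_eq] at this
        rw [hom _ hxt _ hz _ hd] at this
        linarith
      have hdA : ∀ j, dDir j H (x + t • w) a = 0 := by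
        intro j
        have : IsLocalMax (fun y => H (x + t • w) y) a := by
          filter_upwards [isOpen_ne.mem_nhds ha0] with z hz using hA z hz
        simp [dDir, partialD, this.fderiv_eq_zero]
      have hdB : ∀ j, dDir j H (x + t • w) b = 0 := by
        intro j
        have : IsLocalMin (fun y => H (x + t • w) y) b := by
          filter_upwards [isOpen_ne.mem_nhds hb0] with z hz using hB z hz
        simp [dDir, partialD, this.fderiv_eq_zero]
      have dA := hasDerivAt_along_line (hslice' a ha0)
      have dB := hasDerivAt_along_line (hslice' b hb0)
      have eA : ∀ i, partialD i (fun x' => H x' a) (x + t • w) = ψ i (x + t • w) :=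
        hcrit _ hxt a ha0 hdA
      have eB : ∀ i, partialD i (fun x' => H x' b) (x + t • w) = ψ i (x + t • w) :=
        hcrit _ hxt b hb0 hdB
      have dQ : HasDerivAt (fun s => Q (s, a, b)) (-lam) t := by
        have := (dA.sub dB).sub ((hasDerivAt_id t).const_mul lam)
        simp only [eA, eB] at this
        exact this.congr_deriv (by simp)
      -- Only the left slope is used, so the maximum may also sit at t = 1.
      have hslope := (hasDerivAt_iff_tendsto_slope_left_right.1 dQ).1
      have hev : ∀ᶠ s in 𝓝[<] t, 0 ≤ slope (fun s => Q (s, a, b)) t s := by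
        filter_upwards [Ioo_mem_nhdsLT htpos] with s hs
        have hq : Q (s, a, b) ≤ Q (t, a, b) :=
          hmax (show (s, a, b) ∈ K from ⟨⟨hs.1.le, hs.2.le.trans ht.2⟩, ha, hb⟩)
        rw [slope_def_field]
        exact div_nonneg_of_nonpos (by linarith) (by linarith [hs.2])
      have := ge_of_tendsto hslope hev
      linarith
  by_contra! hcon
  have := key ((H (x + w) y - H (x + w) y') / 2) (by linarith)
  linarith

end MaximumPrinciple

end FinslerGeom

namespace FinslerGeom

/-! ### Rigidity of Minkowski metrics for which one covector has a direction-free norm. -/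

section Rigidity

variable {k : ℕ}

/-- Euler's relation in degree zero, from the constancy of f on the ray s ↦ (1 + s)y. -/
theorem sum_mul_partialD_eq_zero_of_homogeneous {f : Coord k → ℝ} {y : Coord k}
    (hf : DifferentiableAt ℝ f y) (hom : ∀ c : ℝ, 0 < c → f (c • y) = f y) :
    ∑ i, y i * partialD i f y = 0 := by
  have h1 : HasDerivAt (fun s : ℝ => f (y + s • y)) (∑ i, y i * partialD i f (y + (0 : ℝ) • y)) 0 :=
    hasDerivAt_along_line (by simpa using hf)
  have h2 : (fun s : ℝ => f (y + s • y)) =ᶠ[𝓝 0] fun _ => f y := by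
    filter_upwards [Ioi_mem_nhds (show (-1 : ℝ) < 0 by norm_num)] with s hs
    have : y + s • y = (1 + s) • y := by rw [add_smul, one_smul]
    rw [this, hom _ (by linarith [Set.mem_Ioi.1 hs])]
  have h3 := h1.unique ((hasDerivAt_const (0 : ℝ) (f y)).congr_of_eventuallyEq h2)
  simpa using h3

/-- A family of positive definite metrics `g_{ij}(y)` which behaves like the metric tensor of a
Minkowski norm. -/
structure IsMinkowskiTensor (g : Fin k → Fin k → Coord k → ℝ) : Prop where
  smooth : ∀ i j, ContDiffOn ℝ ∞ (g i j) {y | y ≠ 0}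
  homogeneous : ∀ i j y, y ≠ 0 → ∀ c : ℝ, 0 < c → g i j (c • y) = g i j y
  symm : ∀ i j y, y ≠ 0 → g i j y = g j i y
  posDef : ∀ y, y ≠ 0 → (Matrix.of fun i j => g i j y).PosDef
  cartan_symm : ∀ i j l y, y ≠ 0 → partialD l (g i j) y = partialD i (g l j) y

namespace IsMinkowskiTensor

variable {g : Fin k → Fin k → Coord k → ℝ} (hg : IsMinkowskiTensor g)
include hg

theorem quad_pos {y : Coord k} (hy : y ≠ 0) {w : Coord k} (hw : w ≠ 0) :
    0 < ∑ i, ∑ j, g i j y * w i * w j := by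
  have hw' : (w : Fin k → ℝ) ≠ 0 := fun h => hw (by ext i; exact congrFun h i)
  have := (hg.posDef y hy).dotProduct_mulVec_pos hw'
  simp only [dotProduct, Matrix.mulVec, Matrix.of_apply, star_trivial, Finset.mul_sum] at this
  refine this.trans_eq (Finset.sum_congr rfl fun i _ => Finset.sum_congr rfl fun j _ => by ring)

theorem differentiableAt {y : Coord k} (hy : y ≠ 0) (i j : Fin k) :
    DifferentiableAt ℝ (g i j) y :=
  differentiableAt_of_contDiffOn isOpen_ne (hg.smooth i j) hy

/-- The Legendre transform is injective. -/
theorem legendre_injective {r : Fin k → ℝ} {y₁ y₂ : Coord k} (h₁ : y₁ ≠ 0) (h₂ : y₂ ≠ 0)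
    (e₁ : ∀ i, ∑ j, g i j y₁ * y₁ j = r i) (e₂ : ∀ i, ∑ j, g i j y₂ * y₂ j = r i) : y₁ = y₂ := by
  by_contra hne
  set w := y₂ - y₁
  have hw : w ≠ 0 := sub_ne_zero.2 (Ne.symm hne)
  have pos : ∀ y : Coord k, y ≠ 0 → (∀ i, ∑ j, g i j y * y j = r i) → 0 < ∑ i, r i * y i := by
    intro y hy e
    refine (hg.quad_pos hy hy).trans_eq (Finset.sum_congr rfl fun i _ => ?_)
    rw [← e i, Finset.sum_mul]
    exact Finset.sum_congr rfl fun j _ => by ring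
  -- The pairing with r is positive at both ends, hence on the whole segment, which therefore avoids
  -- the origin, where g need not be smooth.
  have hz : ∀ s ∈ Set.Icc (0 : ℝ) 1, y₁ + s • w ≠ 0 := by
    intro s hs h0
    have : ∑ i, r i * (y₁ + s • w) i = (1 - s) * ∑ i, r i * y₁ i + s * ∑ i, r i * y₂ i := by
      rw [Finset.mul_sum, Finset.mul_sum, ← Finset.sum_add_distrib]
      refine Finset.sum_congr rfl fun i _ => ?_
      simp [w]; ring
    rw [h0] at this
    simp only [PiLp.zero_apply, mul_zero, Finset.sum_const_zero] at this
    have p1 := pos y₁ h₁ e₁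
    have p2 := pos y₂ h₂ e₂
    rcases eq_or_lt_of_le hs.2 with h | h
    · subst h; linarith
    · nlinarith [hs.1, mul_pos (sub_pos.2 h) p1, mul_nonneg hs.1 p2.le]
  -- The Legendre transform paired with w. The Cartan tensor contracted with its own direction
  -- vanishes, so the derivative along the segment is g(w, w) > 0; equal values at the ends
  -- contradict Rolle's theorem.
  set f : Coord k → ℝ := fun z => ∑ i, (∑ j, g i j z * z j) * w i
  have hcoord : ∀ (j : Fin k) (z : Coord k), DifferentiableAt ℝ (fun z : Coord k => z j) z :=
    fun j z => by fun_prop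
  have hcd : ∀ (c j : Fin k) (z : Coord k), partialD c (fun z : Coord k => z j) z
      = if c = j then 1 else 0 := by
    intro c j z
    have : HasFDerivAt (fun z : Coord k => z j) (EuclideanSpace.proj j : Coord k →L[ℝ] ℝ) z :=
      (EuclideanSpace.proj j : Coord k →L[ℝ] ℝ).hasFDerivAt
    simp [partialD, this.fderiv, eq_comm]
  have hfd : ∀ z : Coord k, z ≠ 0 → DifferentiableAt ℝ f z := fun z hz => by
    refine DifferentiableAt.fun_sum fun i _ => DifferentiableAt.mul_const
      (DifferentiableAt.fun_sum fun j _ => (hg.differentiableAt hz i j).fun_mul (hcoord j z)) _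
  have hpd : ∀ z : Coord k, z ≠ 0 → ∀ c, partialD c f z = ∑ i, g i c z * w i := by
    intro z hz c
    have hi : ∀ i, partialD c (fun z => ∑ j, g i j z * z j) z = g i c z := by
      intro i
      rw [partialD_sum _ _ fun j _ => (hg.differentiableAt hz i j).fun_mul (hcoord j z)]
      have : ∀ j, partialD c (fun z => g i j z * z j) z
          = z j * partialD j (g c i) z + if c = j then g i j z else 0 := by
        intro j
        rw [partialD_mul c (hg.differentiableAt hz i j) (hcoord j z), hcd]
        have hs : partialD c (g i j) z = partialD j (g c i) z := by
          rw [hg.cartan_symm i j c z hz,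
            partialD_congr_of_eqOn isOpen_ne hz i (fun y hy => hg.symm c j y hy),
            hg.cartan_symm j c i z hz,
            partialD_congr_of_eqOn isOpen_ne hz j (fun y hy => hg.symm i c y hy)]
        rw [hs]; split_ifs <;> ring
      simp only [this, Finset.sum_add_distrib]
      rw [sum_mul_partialD_eq_zero_of_homogeneous (hg.differentiableAt hz c i)
        (fun d hd => hg.homogeneous c i z hz d hd)]
      simp
    rw [partialD_sum _ _ fun i _ => DifferentiableAt.mul_const
      (DifferentiableAt.fun_sum fun j _ => (hg.differentiableAt hz i j).fun_mul (hcoord j z)) _]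
    refine Finset.sum_congr rfl fun i _ => ?_
    rw [partialD_mul c (DifferentiableAt.fun_sum fun j _ =>
      (hg.differentiableAt hz i j).fun_mul (hcoord j z)) (differentiableAt_const _), hi]
    simp
  have hder : ∀ s ∈ Set.Icc (0 : ℝ) 1, HasDerivAt (fun s : ℝ => f (y₁ + s • w))
      (∑ c, w c * ∑ i, g i c (y₁ + s • w) * w i) s := by
    intro s hs
    have := hasDerivAt_along_line (hfd _ (hz s hs))
    simpa only [hpd _ (hz s hs)] using this
  have hends : (fun s : ℝ => f (y₁ + s • w)) 0 = (fun s : ℝ => f (y₁ + s • w)) 1 := by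
    have a1 : y₁ + (1 : ℝ) • w = y₂ := by simp [w]
    simp only [a1, zero_smul, add_zero, f, e₁, e₂]
  obtain ⟨s, hs, hs0⟩ := exists_hasDerivAt_eq_zero (f := fun s : ℝ => f (y₁ + s • w))
    (f' := fun s => ∑ c, w c * ∑ i, g i c (y₁ + s • w) * w i) (by norm_num : (0 : ℝ) < 1)
    (fun s hs => (hder s hs).continuousAt.continuousWithinAt) hends
    (fun s hs => hder s ⟨hs.1.le, hs.2.le⟩)
  have hp := hg.quad_pos (hz s ⟨hs.1.le, hs.2.le⟩) hw
  rw [Finset.sum_comm] at hp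
  refine hp.ne' (Eq.trans ?_ hs0)
  refine Finset.sum_congr rfl fun c _ => ?_
  rw [Finset.mul_sum]
  exact Finset.sum_congr rfl fun i _ => by ring

theorem det_ne_zero {y : Coord k} (hy : y ≠ 0) : (Matrix.of fun i j => g i j y).det ≠ 0 :=
  (hg.posDef y hy).det_pos.ne'

/-- If `g^{ij}(y) r_i r_j` does not depend on `y`, then neither does `g_{ij}(y)`. -/
theorem const_of_dual_norm_const {r : Fin k → ℝ} (hk : 2 ≤ k) (hr0 : r ≠ 0)
    (hH : ∀ y y' : Coord k, y ≠ 0 → y' ≠ 0 →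
      ∑ i, ∑ j, (Matrix.of fun i j => g i j y)⁻¹ i j * r i * r j
        = ∑ i, ∑ j, (Matrix.of fun i j => g i j y')⁻¹ i j * r i * r j)
    {y y' : Coord k} (hy : y ≠ 0) (hy' : y' ≠ 0) (i j : Fin k) : g i j y = g i j y' := by
  set G : Coord k → Matrix (Fin k) (Fin k) ℝ := fun y => Matrix.of fun i j => g i j y
  -- R(y) is the gradient of r for the metric at y. It is constant on the line from y along ±R(y),
  -- hence, by homogeneity and a limit, equal to its value in the direction ±R(y). So ±R(y) is the
  -- Legendre preimage of ±r, which does not depend on y.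
  set R : Fin k → Coord k → ℝ := fun i y => ∑ j, (G y)⁻¹ i j * r j
  have hRs : ∀ i, ContDiffOn ℝ ∞ (R i) {y | y ≠ 0} := fun i =>
    ContDiffOn.sum fun j _ => (contDiffOn_matrix_inv (fun a b => hg.smooth a b)
      (fun p hp => hg.det_ne_zero hp) i j).mul contDiffOn_const
  have hRd : ∀ i {y : Coord k}, y ≠ 0 → DifferentiableAt ℝ (R i) y := fun i y hy =>
    differentiableAt_of_contDiffOn isOpen_ne (hRs i) hy
  have hgR : ∀ i {y : Coord k}, y ≠ 0 → ∑ j, g i j y * R j y = r i := by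
    intro i y hy
    have h1 : (G y).mulVec ((G y)⁻¹.mulVec r) = r := by
      rw [Matrix.mulVec_mulVec, Matrix.mul_nonsing_inv _ (hg.det_ne_zero hy).isUnit,
        Matrix.one_mulVec]
    exact congrFun h1 i
  have hRhom : ∀ i {y : Coord k}, y ≠ 0 → ∀ c : ℝ, 0 < c → R i (c • y) = R i y := by
    intro i y hy c hc
    have : G (c • y) = G y := by ext a b; exact hg.homogeneous a b y hy c hc
    simp only [R, this]
  have hsymm := hg.symm
  -- vanishing of the contracted Cartan tensor
  have hC : ∀ {y : Coord k}, y ≠ 0 → ∀ c, ∑ i, ∑ j, R i y * R j y * partialD c (g i j) y = 0 := by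
    intro y hy c
    have h1 := fderiv_sum_mul_of_dual (g := g) (r := fun i _ => r i) (R := R) (p := y)
      (EuclideanSpace.single c 1) (fun i j => hg.differentiableAt hy i j) (fun i => hRd i hy)
      (fun i j => hsymm i j y hy)
      (fun i => by filter_upwards [isOpen_ne.mem_nhds hy] with q hq using (hgR i hq).symm)
    have h2 : (fun q => ∑ i, R i q * r i) =ᶠ[𝓝 y] fun _ => ∑ i, R i y * r i := by
      filter_upwards [isOpen_ne.mem_nhds hy] with q hq
      have := hH q y hq hy
      simp only [R, Finset.sum_mul]
      refine Eq.trans ?_ (this.trans ?_) <;>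
      exact Finset.sum_congr rfl fun a _ => Finset.sum_congr rfl fun b _ => by ring
    rw [h2.fderiv_eq] at h1
    simp only [fderiv_fun_const, Pi.zero_apply, zero_apply, mul_zero,
      Finset.sum_const_zero, zero_sub] at h1
    have h3 := neg_eq_zero.1 h1.symm
    simpa only [partialD] using h3
  have hCR : ∀ {y : Coord k}, y ≠ 0 → ∀ a,
      ∑ b, ∑ c, R b y * R c y * partialD c (g a b) y = 0 := by
    intro y hy a
    rw [← hC hy a, Finset.sum_comm]
    refine Finset.sum_congr rfl fun c _ => Finset.sum_congr rfl fun b _ => ?_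
    rw [hg.cartan_symm a b c y hy]; ring
  -- The total symmetry of the Cartan tensor gives R^b R^c ∂_c g_{ab} = 0; differentiating gR = r
  -- then shows that R does not change along itself.
  have hDR : ∀ {y : Coord k}, y ≠ 0 → ∀ i, ∑ c, R c y * partialD c (R i) y = 0 := by
    intro y hy
    have h1 : ∀ a, ∑ b, g a b y * ∑ c, R c y * partialD c (R b) y = 0 := by
      intro a
      have h2 : ∀ c, ∑ b, g a b y * partialD c (R b) y
          = - ∑ b, R b y * partialD c (g a b) y := by
        intro c
        have h3 : partialD c (fun y => ∑ b, g a b y * R b y) y = 0 := by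
          rw [partialD_congr_of_eqOn isOpen_ne hy c (fun z hz => hgR a hz), partialD_const]
        rw [partialD_sum _ _ fun b _ => (hg.differentiableAt hy a b).fun_mul (hRd b hy)] at h3
        simp only [partialD_mul c (hg.differentiableAt hy a _) (hRd _ hy),
          Finset.sum_add_distrib] at h3
        rw [← sub_eq_zero, sub_neg_eq_add, add_comm, ← h3]
        congr 1
        exact Finset.sum_congr rfl fun b _ => mul_comm _ _
      have h4 : ∑ b, g a b y * ∑ c, R c y * partialD c (R b) y
          = ∑ c, R c y * ∑ b, g a b y * partialD c (R b) y := by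
        simp only [Finset.mul_sum]
        rw [Finset.sum_comm]
        exact Finset.sum_congr rfl fun b _ => Finset.sum_congr rfl fun c _ => by ring
      rw [h4]
      simp only [h2]
      have h5 := hCR hy a
      rw [Finset.sum_comm] at h5
      rw [← neg_eq_zero, ← Finset.sum_neg_distrib, ← h5]
      refine Finset.sum_congr rfl fun c _ => ?_
      rw [mul_neg, neg_neg, Finset.mul_sum]
      exact Finset.sum_congr rfl fun b _ => by ring
    have h6 : (G y).mulVec (fun b => ∑ c, R c y * partialD c (R b) y) = 0 := funext h1
    intro i
    exact congrFun (Matrix.eq_zero_of_mulVec_eq_zero (hg.det_ne_zero hy) h6) i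
  have hRpos : ∀ {y : Coord k}, y ≠ 0 → 0 < ∑ i, r i * R i y := by
    intro y hy
    set w : Coord k := WithLp.toLp 2 fun i => R i y
    have hw : w ≠ 0 := by
      intro h
      apply hr0
      ext i
      rw [← hgR i hy]
      have : ∀ j, R j y = 0 := fun j => congrArg (fun v : Coord k => v j) h
      simp [this]
    refine (hg.quad_pos hy hw).trans_eq (Finset.sum_congr rfl fun a _ => ?_)
    rw [← hgR a hy, Finset.sum_mul]
    exact Finset.sum_congr rfl fun b _ => by simp only [w]; ring
  set V : Coord k → Coord k := fun y => WithLp.toLp 2 fun i => R i y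
  have hVR : ∀ i y, V y i = R i y := fun i y => rfl
  -- lines in the direction `± w` on which `± r` increases avoid the origin
  have hline : ∀ {ε : ℝ} {y w : Coord k}, y ≠ 0 → 0 ≤ ε * ∑ i, r i * y i → ε ^ 2 = 1 →
      0 < ∑ i, r i * w i → ∀ s : ℝ, 0 ≤ s → y + s • (ε • w) ≠ 0 := by
    intro ε y w hy hε hε2 hw s hs h0
    rcases eq_or_lt_of_le hs with h | h
    · subst h; simp at h0; exact hy h0
    · have e1 : ∑ i, r i * (y + s • (ε • w)) i = ∑ i, r i * y i + s * ε * ∑ i, r i * w i := by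
        rw [Finset.mul_sum, ← Finset.sum_add_distrib]
        exact Finset.sum_congr rfl fun i _ => by simp; ring
      rw [h0] at e1
      simp only [PiLp.zero_apply, mul_zero, Finset.sum_const_zero] at e1
      have e2 : ε * ∑ i, r i * y i + s * ε ^ 2 * ∑ i, r i * w i = 0 := by
        linear_combination -ε * e1
      rw [hε2] at e2
      nlinarith [mul_pos h hw]
  -- limits along lines
  have hlim : ∀ {f : Coord k → ℝ} {y v : Coord k}, ContinuousAt f v →
      (∀ {y : Coord k}, y ≠ 0 → ∀ c : ℝ, 0 < c → f (c • y) = f y) →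
      (∀ s : ℝ, 0 ≤ s → y + s • v ≠ 0) → (∀ s : ℝ, 0 ≤ s → f (y + s • v) = f y) → f v = f y := by
    intro f y v hf hom hne hconst
    have h1 : Filter.Tendsto (fun t : ℝ => f (t • y + v)) (𝓝[>] 0) (𝓝 (f v)) := by
      have : Filter.Tendsto (fun t : ℝ => t • y + v) (𝓝[>] 0) (𝓝 v) := by
        have hc : Continuous fun t : ℝ => t • y + v := by fun_prop
        have := hc.tendsto 0
        simp only [zero_smul, zero_add] at this
        exact this.mono_left nhdsWithin_le_nhds
      exact hf.tendsto.comp this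
    refine tendsto_nhds_unique h1 (tendsto_const_nhds.congr' ?_)
    filter_upwards [self_mem_nhdsWithin] with t ht
    have ht' : 0 < t := ht
    have e : t • y + v = t • (y + t⁻¹ • v) := by
      rw [smul_add, smul_smul, mul_inv_cancel₀ ht'.ne', one_smul]
    rw [e, hom (hne _ (by positivity)) t ht', hconst _ (by positivity)]
  have hsign : ∀ {ε : ℝ} {w : Coord k}, ε ^ 2 = 1 → 0 < ∑ i, r i * w i → ε • w ≠ 0 := by
    intro ε w hε hw h
    have hε0 : ε ≠ 0 := by rintro rfl; norm_num at hε
    rcases smul_eq_zero.1 h with h | h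
    · exact hε0 h
    · subst h; simp at hw
  have hVpos : ∀ {y : Coord k}, y ≠ 0 → 0 < ∑ i, r i * V y i := fun hy => hRpos hy
  -- The direction V(y) of the line is fixed, while the derivative at c(t) is only known to
  -- annihilate V(c(t)). Hence it is linear in V(c(t)) − V(y), and Grönwall keeps this difference
  -- zero. The sign ε keeps the line away from the origin.
  have hVV : ∀ {ε : ℝ} {y : Coord k}, y ≠ 0 → 0 ≤ ε * ∑ i, r i * y i → ε ^ 2 = 1 →
      V (ε • V y) = V y := by
    intro ε y hy hε hε2
    have hne := hline hy hε hε2 (hVpos hy)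
    have hVsmooth : ContDiffOn ℝ ∞ V {y | y ≠ 0} := (contDiffOn_piLp 2).2 fun i => hRs i
    have hconst : ∀ s : ℝ, 0 ≤ s → V (y + s • (ε • V y)) = V y := by
      intro s hs
      set c : ℝ → Coord k := fun t => y + t • (ε • V y)
      have hc : ∀ t, HasDerivAt c (ε • V y) t := fun t => by
        have := ((hasDerivAt_id t).smul_const (ε • V y)).const_add y
        rw [one_smul] at this
        exact this
      have hVd : ∀ t, 0 ≤ t → DifferentiableAt ℝ V (c t) := fun t ht =>
        differentiableAt_of_contDiffOn isOpen_ne hVsmooth (hne t ht)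
      have hVder : ∀ t, 0 ≤ t → ∀ u, fderiv ℝ V (c t) (V (c t) + u) = fderiv ℝ V (c t) u := by
        intro t ht u
        rw [map_add]
        have : fderiv ℝ V (c t) (V (c t)) = 0 := by
          ext i
          have hcomp : HasFDerivAt (R i) ((EuclideanSpace.proj i : Coord k →L[ℝ] ℝ).comp
              (fderiv ℝ V (c t))) (c t) :=
            (EuclideanSpace.proj i : Coord k →L[ℝ] ℝ).hasFDerivAt.comp (c t)
              (hVd t ht).hasFDerivAt
          have h1 := hDR (hne t ht) i
          rw [← fderiv_eq_sum_partialD (R i) _ (V (c t)), hcomp.fderiv] at h1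
          simpa using h1
        rw [this, zero_add]
      have hK : ∃ K, ∀ t ∈ Set.Icc (0 : ℝ) s, ‖fderiv ℝ V (c t)‖ ≤ K := by
        refine isCompact_Icc.exists_bound_of_continuousOn ?_
        have h1 := (hVsmooth.continuousOn_fderiv_of_isOpen isOpen_ne (by simp))
        refine h1.comp (f := c) (fun t _ => (hc t).continuousAt.continuousWithinAt) ?_
        exact fun t ht => hne t ht.1
      obtain ⟨K, hK⟩ := hK
      have hder : ∀ t, 0 ≤ t → HasDerivAt (fun t => V (c t) - V y)
          (fderiv ℝ V (c t) (ε • V y)) t := fun t ht =>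
        ((hVd t ht).hasFDerivAt.comp_hasDerivAt t (hc t)).sub_const _
      have hz := eq_zero_of_abs_deriv_le_mul_abs_self_of_eq_zero_right
        (f := fun t => V (c t) - V y) (f' := fun t => fderiv ℝ V (c t) (ε • V y)) (K := |ε| * K)
        (a := 0) (b := s) (fun t ht => (hder t ht.1).continuousAt.continuousWithinAt)
        (fun t ht => (hder t ht.1).hasDerivWithinAt) (by simp [c]) (by
          intro t ht
          have e1 : fderiv ℝ V (c t) (ε • V y) = - (ε • fderiv ℝ V (c t) (V (c t) - V y)) := by
            have := hVder t ht.1 (- V y)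
            rw [← sub_eq_add_neg] at this
            rw [this, map_neg, map_smul, smul_neg, neg_neg]
          rw [e1, norm_neg, norm_smul, Real.norm_eq_abs, mul_assoc]
          refine mul_le_mul_of_nonneg_left ?_ (abs_nonneg _)
          exact (ContinuousLinearMap.le_opNorm _ _).trans
            (mul_le_mul_of_nonneg_right (hK t ⟨ht.1, ht.2.le⟩) (norm_nonneg _)))
      exact sub_eq_zero.1 (hz s ⟨hs, le_rfl⟩)
    ext i
    have hd : ε • V y ≠ 0 := hsign hε2 (hVpos hy)
    exact hlim (f := R i) ((hRd i hd).continuousAt) (fun hy c hc => hRhom i hy c hc) hne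
      (fun s hs => congrArg (fun v : Coord k => v i) (hconst s hs))
  -- At the direction εV(y) the gradient of r is V(y) itself, so this direction is a Legendre
  -- preimage of εr.
  have hleg : ∀ {ε : ℝ} {y : Coord k}, y ≠ 0 → 0 ≤ ε * ∑ i, r i * y i → ε ^ 2 = 1 →
      ε • V y ≠ 0 ∧ ∀ i, ∑ j, g i j (ε • V y) * (ε • V y) j = ε * r i := by
    intro ε y hy hε hε2
    have hd : ε • V y ≠ 0 := hsign hε2 (hVpos hy)
    refine ⟨hd, fun i => ?_⟩
    rw [← hgR i hd, Finset.mul_sum]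
    refine Finset.sum_congr rfl fun j _ => ?_
    have : R j (ε • V y) = V y j := congrArg (fun v : Coord k => v j) (hVV hy hε hε2)
    rw [this]; simp; ring
  -- a nonzero vector in the kernel of `r`
  obtain ⟨y₀, hy₀, hry₀⟩ : ∃ y₀ : Coord k, y₀ ≠ 0 ∧ ∑ i, r i * y₀ i = 0 := by
    set l : Coord k →ₗ[ℝ] ℝ :=
      { toFun := fun y => ∑ i, r i * y i
        map_add' := fun a b => by simp [mul_add, Finset.sum_add_distrib]
        map_smul' := fun c a => by
          simp only [PiLp.smul_apply, smul_eq_mul, RingHom.id_apply, Finset.mul_sum]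
          exact Finset.sum_congr rfl fun i _ => by ring }
    have : LinearMap.ker l ≠ ⊥ := LinearMap.ker_ne_bot_of_finrank_lt (by simp; omega)
    obtain ⟨z, hz, hz0⟩ := (Submodule.ne_bot_iff _).1 this
    exact ⟨z, hz0, hz⟩
  have hε : ∀ y : Coord k, ∃ ε : ℝ, ε ^ 2 = 1 ∧ 0 ≤ ε * ∑ i, r i * y i := by
    intro y
    rcases le_total 0 (∑ i, r i * y i) with h | h
    · exact ⟨1, by norm_num, by linarith⟩
    · exact ⟨-1, by norm_num, by linarith⟩
  -- As y₀ is annihilated by r, it is admissible for both signs and can be compared with every y.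
  -- Its existence is where k ≥ 2 enters.
  have hVconst : ∀ {y : Coord k}, y ≠ 0 → V y = V y₀ := by
    intro y hy
    obtain ⟨ε, hε2, h⟩ := hε y
    have l1 := hleg hy h hε2
    have l2 := hleg (ε := ε) hy₀ (by rw [hry₀]; simp) hε2
    have := hg.legendre_injective l1.1 l2.1 l1.2 l2.2
    have hε0 : ε ≠ 0 := by rintro rfl; norm_num at hε2
    exact smul_right_injective _ hε0 this
  -- Once V is constant, differentiating gV = r and the symmetry of the Cartan tensor show that g is
  -- constant along V; the limit along lines then applies to g as it did to R.
  have hdir : ∀ i j {y : Coord k}, y ≠ 0 → ∑ c, V y₀ c * partialD c (g i j) y = 0 := by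
    intro i j y hy
    have h1 : partialD i (fun z => ∑ c, g j c z * V y₀ c) y = 0 := by
      have : Set.EqOn (fun z => ∑ c, g j c z * V y₀ c) (fun _ => r j) {y | y ≠ 0} := by
        intro z hz
        rw [← hgR j hz, ← hVconst hz]
      rw [partialD_congr_of_eqOn isOpen_ne hy i this, partialD_const]
    rw [partialD_sum _ _ fun c _ => (hg.differentiableAt hy j c).mul_const _] at h1
    rw [← h1]
    refine Finset.sum_congr rfl fun c _ => ?_
    rw [partialD_mul i (hg.differentiableAt hy j c) (differentiableAt_const _), partialD_const,
      mul_zero, add_zero, hg.cartan_symm i j c y hy, mul_comm,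
      partialD_congr_of_eqOn isOpen_ne hy i (fun z hz => hg.symm c j z hz)]
  have hend : ∀ {ε : ℝ} {y : Coord k}, y ≠ 0 → 0 ≤ ε * ∑ i, r i * y i → ε ^ 2 = 1 →
      g i j (ε • V y₀) = g i j y := by
    intro ε y hy hε hε2
    have hne := hline hy hε hε2 (hVpos hy₀)
    refine hlim (hg.differentiableAt (hsign hε2 (hVpos hy₀)) i j).continuousAt
      (fun {y} hy c hc => hg.homogeneous i j y hy c hc) hne fun s hs => ?_
    have hder : ∀ t, 0 ≤ t → HasDerivAt (fun t : ℝ => g i j (y + t • (ε • V y₀))) 0 t := by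
      intro t ht
      have h1 := hasDerivAt_along_line (hg.differentiableAt (hne t ht) i j)
      have h2 := hdir i j (hne t ht)
      refine h1.congr_deriv ?_
      rw [← mul_zero ε, ← h2, Finset.mul_sum]
      exact Finset.sum_congr rfl fun c _ => by simp; ring
    have := constant_of_has_deriv_right_zero
      (f := fun t : ℝ => g i j (y + t • (ε • V y₀))) (a := 0) (b := s)
      (fun t ht => (hder t ht.1).continuousAt.continuousWithinAt)
      (fun t ht => (hder t ht.1).hasDerivWithinAt) s ⟨hs, le_rfl⟩
    simpa using this
  have hall : ∀ {y : Coord k}, y ≠ 0 → g i j y = g i j y₀ := by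
    intro y hy
    obtain ⟨ε, hε2, h⟩ := hε y
    rw [← hend hy h hε2, ← hend hy₀ (by rw [hry₀]; simp) hε2]
  rw [hall hy, hall hy']

end IsMinkowskiTensor

end Rigidity

end FinslerGeom

namespace FinslerGeom

/-! ### The Hessian equation in a chart forces the metric to be direction free. -/

section FinslerChart

variable {k : ℕ}

/-- Joint smoothness in `(x, y)`, for `x ∈ W` and `y ≠ 0`. -/
def JSmooth (W : Set (Coord k)) (A : Coord k → Coord k → ℝ) : Prop :=
  ContDiffOn ℝ ∞ (fun p : Coord k × Coord k => A p.1 p.2) (W ×ˢ {y | y ≠ 0})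

namespace JSmooth

variable {W : Set (Coord k)} {A : Coord k → Coord k → ℝ}

theorem slice_dir (hA : JSmooth W A) {x : Coord k} (hx : x ∈ W) :
    ContDiffOn ℝ ∞ (A x) {y | y ≠ 0} :=
  hA.comp (f := fun y => (x, y)) (by fun_prop) fun _ hy => ⟨hx, hy⟩

theorem slice_pos (hA : JSmooth W A) {y : Coord k} (hy : y ≠ 0) :
    ContDiffOn ℝ ∞ (fun x => A x y) W :=
  hA.comp (f := fun x => (x, y)) (by fun_prop) fun _ hx => ⟨hx, hy⟩

theorem dDir (hW : IsOpen W) (hA : JSmooth W A) (j : Fin k) : JSmooth W (dDir j A) := by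
  have hO : IsOpen (W ×ˢ {y : Coord k | y ≠ 0}) := hW.prod isOpen_ne
  have h1 : ContDiffOn ℝ ∞ (fun p : Coord k × Coord k =>
      fderiv ℝ (fun p : Coord k × Coord k => A p.1 p.2) p (0, EuclideanSpace.single j 1))
      (W ×ˢ {y | y ≠ 0}) :=
    (ContDiffOn.fderiv_of_isOpen hA hO (m := ∞) (by simp)).clm_apply contDiffOn_const
  refine h1.congr ?_
  rintro ⟨x, y⟩ hp
  have hd := (differentiableAt_of_contDiffOn hO hA hp).hasFDerivAt
  have hc : HasFDerivAt (fun y' : Coord k => (x, y')) (ContinuousLinearMap.inr ℝ _ _) y :=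
    hasFDerivAt_prodMk_right x y
  have := (hd.comp y hc).fderiv
  simp only [FinslerGeom.dDir, partialD]
  erw [this]
  simp

end JSmooth

theorem gLow_symm' {L : Coord k → Coord k → ℝ} {x : Coord k}
    (hL : ContDiffOn ℝ ∞ (fun y => L x y ^ 2) {y | y ≠ 0}) (i j : Fin k) {y : Coord k}
    (hy : y ≠ 0) : gLow L i j x y = gLow L j i x y := by
  have := partialD_comm isOpen_ne hL hy i j
  simp only [gLow, dDir]
  rw [show (fun y' => partialD j (fun y' => L x y' ^ 2) y') = partialD j fun y' => L x y' ^ 2 from rfl,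
    show (fun y' => partialD i (fun y' => L x y' ^ 2) y') = partialD i fun y' => L x y' ^ 2 from rfl,
    this]

/-- The factor c from the chain rule cancels the one from the homogeneity of f: a derivative lowers
the degree of homogeneity by one. -/
theorem partialD_smul_arg {f h : Coord k → ℝ} {c : ℝ} (hc : c ≠ 0)
    (hf : ∀ z, f (c • z) = c * h z) (i : Fin k) (y : Coord k) :
    partialD i f (c • y) = partialD i h y := by
  have h1 : (fun z => f (c • z)) = fun z => c * h z := funext hf
  have h2 : partialD i (fun z => f (c • z)) y = c * partialD i f (c • y) := by
    simp only [partialD]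
    rw [fderiv_comp_smul]; simp
  rw [h1, partialD_const_mul] at h2
  exact (mul_left_cancel₀ hc h2).symm

namespace IsFinslerOn

variable {W : Set (Coord k)} {L : Coord k → Coord k → ℝ} (hL : IsFinslerOn W L) (hW : IsOpen W)
include hL

theorem jsmooth_sq : JSmooth W fun x y => L x y ^ 2 := ContDiffOn.pow hL.smooth 2

theorem sq_smul {x : Coord k} (hx : x ∈ W) (y : Coord k) {c : ℝ} (hc : 0 < c) :
    L x (c • y) ^ 2 = c ^ 2 * L x y ^ 2 := by
  rw [hL.homogeneous x hx y c hc, mul_pow]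

theorem map_zero {x : Coord k} (hx : x ∈ W) : L x 0 = 0 := by
  have := hL.homogeneous x hx 0 2 (by norm_num)
  rw [smul_zero] at this
  linarith

theorem gLow_smul {x : Coord k} (hx : x ∈ W) (i j : Fin k) (y : Coord k) {c : ℝ} (hc : 0 < c) :
    gLow L i j x (c • y) = gLow L i j x y := by
  have h1 : ∀ z, partialD j (fun y' => L x y' ^ 2) (c • z)
      = partialD j (fun y' => c * L x y' ^ 2) z := fun z =>
    partialD_smul_arg hc.ne' (fun z => by rw [hL.sq_smul hx z hc]; ring) j z
  simp only [gLow, dDir]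
  congr 1
  refine partialD_smul_arg (f := fun y' => partialD j (fun y' => L x y' ^ 2) y') hc.ne'
    (fun z => ?_) i y
  rw [h1, partialD_const_mul]

include hW

theorem jsmooth_gLow (i j : Fin k) : JSmooth W (gLow L i j) :=
  ContDiffOn.mul contDiffOn_const ((hL.jsmooth_sq.dDir hW j).dDir hW i)

theorem jsmooth_gUp (i j : Fin k) : JSmooth W (gUp L i j) :=
  contDiffOn_matrix_inv (A := fun p : Coord k × Coord k => gMat L p.1 p.2)
    (fun a b => hL.jsmooth_gLow hW a b)
    (fun p hp => (hL.posDef p.1 hp.1 p.2 hp.2).det_pos.ne') i j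

omit hW in
theorem gLow_symm {x : Coord k} (hx : x ∈ W) (i j : Fin k) {y : Coord k} (hy : y ≠ 0) :
    gLow L i j x y = gLow L j i x y :=
  gLow_symm' (hL.jsmooth_sq.slice_dir hx) i j hy

/-- The symmetry of the Cartan tensor is that of the third derivatives of L² in the direction. -/
theorem isMinkowskiTensor {x : Coord k} (hx : x ∈ W) :
    IsMinkowskiTensor fun i j y => gLow L i j x y where
  smooth i j := (hL.jsmooth_gLow hW i j).slice_dir hx
  homogeneous i j y hy c hc := hL.gLow_smul hx i j y hc
  symm i j y hy := hL.gLow_symm hx i j hy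
  posDef y hy := hL.posDef x hx y hy
  cartan_symm i j l y hy := by
    have hs := (hL.jsmooth_sq).slice_dir hx
    have hsj : ContDiffOn ℝ ∞ (partialD j fun y' => L x y' ^ 2) {y | y ≠ 0} :=
      contDiffOn_partialD isOpen_ne hs j
    have := partialD_comm isOpen_ne hsj hy l i
    simp only [gLow, dDir]
    rw [partialD_const_mul (fun y => partialD i (fun y' => partialD j (fun y' => L x y' ^ 2) y') y),
      partialD_const_mul (fun y => partialD l (fun y' => partialD j (fun y' => L x y' ^ 2) y') y)]
    congr 1

omit hW in
/-- Euler's relation `L² = g_{ij} y^i y^j`. -/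
theorem sq_eq_sum {x : Coord k} (hx : x ∈ W) {y : Coord k} (hy : y ≠ 0) :
    L x y ^ 2 = ∑ i, ∑ j, gLow L i j x y * y i * y j := by
  set f : Coord k → ℝ := fun y => L x y ^ 2
  have hs : ContDiffOn ℝ ∞ f {y | y ≠ 0} := hL.jsmooth_sq.slice_dir hx
  have hne : ∀ s : ℝ, -1 < s → y + s • y = (1 + s) • y ∧ y + s • y ≠ 0 := by
    intro s hs
    have : y + s • y = (1 + s) • y := by rw [add_smul, one_smul]
    exact ⟨this, by rw [this]; exact smul_ne_zero (by linarith) hy⟩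
  have hf : ∀ s : ℝ, -1 < s → f (y + s • y) = (1 + s) ^ 2 * f y := by
    intro s hs
    rw [(hne s hs).1]
    exact hL.sq_smul hx y (by linarith)
  have h1 : ∀ s : ℝ, -1 < s → ∑ i, y i * partialD i f (y + s • y) = 2 * (1 + s) * f y := by
    intro s hs'
    have d1 := hasDerivAt_along_line (w := y) (t := s)
      (differentiableAt_of_contDiffOn isOpen_ne hs (hne s hs').2)
    have d2 : HasDerivAt (fun s : ℝ => (1 + s) ^ 2 * f y) (2 * (1 + s) * f y) s := by
      have := (((hasDerivAt_id s).const_add 1).pow 2).mul_const (f y)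
      simpa using this
    refine d1.unique (d2.congr_of_eventuallyEq ?_)
    filter_upwards [Ioi_mem_nhds hs'] with t ht using hf t ht
  have d1 : HasDerivAt (fun s : ℝ => ∑ i, y i * partialD i f (y + s • y))
      (∑ i, y i * ∑ j, y j * partialD j (partialD i f) (y + (0 : ℝ) • y)) 0 := by
    refine HasDerivAt.fun_sum fun i _ => HasDerivAt.const_mul _ ?_
    exact hasDerivAt_along_line (differentiableAt_of_contDiffOn isOpen_ne
      (contDiffOn_partialD isOpen_ne hs i) (hne 0 (by norm_num)).2)
  have d2 : HasDerivAt (fun s : ℝ => 2 * (1 + s) * f y) (2 * f y) 0 := by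
    have := (((hasDerivAt_id (0 : ℝ)).const_add 1).const_mul 2).mul_const (f y)
    simpa using this
  have h2 := d1.unique (d2.congr_of_eventuallyEq (by
    filter_upwards [Ioi_mem_nhds (show (-1 : ℝ) < 0 by norm_num)] with t ht using h1 t ht))
  have h3 : ∀ i j, gLow L i j x y = 1 / 2 * partialD i (partialD j f) y := fun i j => rfl
  simp only [zero_smul, add_zero] at h2
  have h4 : ∑ i, ∑ j, gLow L i j x y * y i * y j
      = 1 / 2 * ∑ i, y i * ∑ j, y j * partialD j (partialD i f) y := by
    rw [Finset.mul_sum, Finset.sum_comm]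
    refine Finset.sum_congr rfl fun i _ => ?_
    rw [Finset.mul_sum, Finset.mul_sum]
    exact Finset.sum_congr rfl fun j _ => by rw [h3]; ring
  rw [h4, h2]
  simp only [f]; ring

variable {r φ : Coord k → ℝ} (hr : ContDiffOn ℝ ∞ r W)
  (heq : ∀ x ∈ W, ∀ y : Coord k, y ≠ 0 → ∀ a b, hessHor L r a b x y = φ x * gLow L a b x y)
include hr heq

/-- Where `‖grad r‖²` is critical in the direction `y`, its position derivative is `2 φ r_k`. -/
theorem dPos_dualNorm {x : Coord k} (hx : x ∈ W) {y : Coord k} (hy : y ≠ 0)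
    (hcrit : ∀ j, dDir j
      (fun x y => ∑ i, (∑ j, gUp L i j x y * partialD j r x) * partialD i r x) x y = 0)
    (c : Fin k) :
    dPos c (fun x y => ∑ i, (∑ j, gUp L i j x y * partialD j r x) * partialD i r x) x y
      = 2 * φ x * partialD c r x := by
  have hO : IsOpen (W ×ˢ {y : Coord k | y ≠ 0}) := hW.prod isOpen_ne
  set R : Fin k → Coord k → Coord k → ℝ := fun i x y => ∑ j, gUp L i j x y * partialD j r x
  have hr1 : ∀ i, ContDiffOn ℝ ∞ (partialD i r) W := fun i => contDiffOn_partialD hW hr i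
  have hR : ∀ i, JSmooth W (R i) := fun i => ContDiffOn.sum fun j _ =>
    ContDiffOn.mul (hL.jsmooth_gUp hW i j) ((hr1 j).comp contDiffOn_fst fun p hp => hp.1)
  have hgR : ∀ i, ∀ x ∈ W, ∀ y : Coord k, y ≠ 0 →
      ∑ j, gLow L i j x y * R j x y = partialD i r x := by
    intro i x hx y hy
    have h1 : (gMat L x y).mulVec ((gMat L x y)⁻¹.mulVec fun j => partialD j r x)
        = fun j => partialD j r x := by
      rw [Matrix.mulVec_mulVec, Matrix.mul_nonsing_inv _ (hL.posDef x hx y hy).det_pos.ne'.isUnit,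
        Matrix.one_mulVec]
    exact congrFun h1 i
  have hsym : ∀ i j, gLow L i j x y = gLow L j i x y := fun i j => hL.gLow_symm hx i j hy
  have hUsym : ∀ i j, gUp L i j x y = gUp L j i x y := by
    intro i j
    have h : ((gMat L x y)⁻¹).IsHermitian := (hL.posDef x hx y hy).isHermitian.inv
    simpa [gUp] using (h.apply j i)
  -- derivatives in the position
  have e1 : ∀ a, dPos a (fun x y => ∑ i, R i x y * partialD i r x) x y
      = 2 * ∑ i, R i x y * partialD a (partialD i r) x
        - ∑ i, ∑ j, R i x y * R j x y * dPos a (gLow L i j) x y := by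
    intro a
    exact fderiv_sum_mul_of_dual (g := fun i j x => gLow L i j x y) (r := fun i => partialD i r)
      (R := fun i x => R i x y) (p := x) (EuclideanSpace.single a 1)
      (fun i j => differentiableAt_of_contDiffOn hW ((hL.jsmooth_gLow hW i j).slice_pos hy) hx)
      (fun i => differentiableAt_of_contDiffOn hW ((hR i).slice_pos hy) hx) hsym
      (fun i => by filter_upwards [hW.mem_nhds hx] with q hq using (hgR i q hq y hy).symm)
  -- Since dr does not involve the direction, criticality in y says exactly that ∂g/∂y contracted
  -- twice with R vanishes.
  have e2 : ∀ a, ∑ i, ∑ j, R i x y * R j x y * dDir a (gLow L i j) x y = 0 := by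
    intro a
    have h := fderiv_sum_mul_of_dual (g := fun i j y => gLow L i j x y)
      (r := fun i _ => partialD i r x)
      (R := fun i y => R i x y) (p := y) (EuclideanSpace.single a 1)
      (fun i j => differentiableAt_of_contDiffOn isOpen_ne
        ((hL.jsmooth_gLow hW i j).slice_dir hx) hy)
      (fun i => differentiableAt_of_contDiffOn isOpen_ne ((hR i).slice_dir hx) hy) hsym
      (fun i => by filter_upwards [isOpen_ne.mem_nhds hy] with q hq using (hgR i x hx q hq).symm)
    have h0 := h.symm.trans (hcrit a)
    simp only [fderiv_fun_const, Pi.zero_apply, zero_apply, mul_zero, Finset.sum_const_zero,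
      zero_sub] at h0
    exact neg_eq_zero.1 h0
  -- Hence δ/δx and ∂/∂x agree on g contracted twice with R, whatever the nonlinear connection is.
  have e3 : ∀ a, ∑ i, ∑ j, R i x y * R j x y * dHor L a (gLow L i j) x y
      = ∑ i, ∑ j, R i x y * R j x y * dPos a (gLow L i j) x y := by
    intro a
    have : ∑ i, ∑ j, R i x y * R j x y * ∑ b, nonlin L b a x y * dDir b (gLow L i j) x y = 0 := by
      have h1 : ∀ b, nonlin L b a x y *
          ∑ i, ∑ j, R i x y * R j x y * dDir b (gLow L i j) x y = 0 := fun b => by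
        rw [e2, mul_zero]
      have h2 := Finset.sum_eq_zero (s := Finset.univ) fun b _ => h1 b
      rw [← h2]
      simp only [Finset.mul_sum]
      rw [Finset.sum_comm]
      conv_rhs => rw [Finset.sum_comm' (t' := Finset.univ) (s' := fun _ => Finset.univ) (by simp)]
      rw [Finset.sum_comm]
      refine Finset.sum_congr rfl fun i _ => ?_
      conv_rhs => rw [Finset.sum_comm]
      exact Finset.sum_congr rfl fun j _ => Finset.sum_congr rfl fun b _ => by ring
    simp only [dHor, mul_sub, Finset.sum_sub_distrib]
    rw [this, sub_zero]
  have e4 : ∀ b, ∑ j, cartanGamma L j b c x y * partialD j r x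
      = 1 / 2 * ∑ h, R h x y * (dHor L b (gLow L h c) x y + dHor L c (gLow L h b) x y
        - dHor L h (gLow L b c) x y) := by
    intro b
    simp only [cartanGamma, R, Finset.mul_sum, Finset.sum_mul]
    rw [Finset.sum_comm]
    refine Finset.sum_congr rfl fun h _ => Finset.sum_congr rfl fun j _ => ?_
    rw [hUsym h j]; ring
  -- Of the three terms of the Christoffel symbol, two cancel after exchanging the summation
  -- indices, and half of RR δ_c g remains.
  have e5 : ∑ b, R b x y * ∑ j, cartanGamma L j b c x y * partialD j r x
      = 1 / 2 * ∑ i, ∑ j, R i x y * R j x y * dHor L c (gLow L i j) x y := by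
    simp only [e4]
    have s1 : ∑ b, ∑ h, R b x y * R h x y * dHor L b (gLow L h c) x y
        = ∑ b, ∑ h, R b x y * R h x y * dHor L h (gLow L b c) x y := by
      rw [Finset.sum_comm]
      exact Finset.sum_congr rfl fun h _ => Finset.sum_congr rfl fun b _ => by ring
    have s2 : ∑ b, ∑ h, R b x y * R h x y * dHor L c (gLow L h b) x y
        = ∑ b, ∑ h, R b x y * R h x y * dHor L c (gLow L b h) x y := by
      rw [Finset.sum_comm]
      exact Finset.sum_congr rfl fun h _ => Finset.sum_congr rfl fun b _ => by ring
    have s3 : ∑ b, R b x y * (1 / 2 * ∑ h, R h x y * (dHor L b (gLow L h c) x y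
        + dHor L c (gLow L h b) x y - dHor L h (gLow L b c) x y))
        = 1 / 2 * (∑ b, ∑ h, R b x y * R h x y * dHor L b (gLow L h c) x y
        + ∑ b, ∑ h, R b x y * R h x y * dHor L c (gLow L h b) x y
        - ∑ b, ∑ h, R b x y * R h x y * dHor L h (gLow L b c) x y) := by
      rw [← Finset.sum_add_distrib, ← Finset.sum_sub_distrib, Finset.mul_sum]
      refine Finset.sum_congr rfl fun b _ => ?_
      rw [← Finset.sum_add_distrib, ← Finset.sum_sub_distrib, Finset.mul_sum, Finset.mul_sum,
        Finset.mul_sum]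
      exact Finset.sum_congr rfl fun h _ => by ring
    rw [s3, s1, s2]; ring
  have e6 : ∑ b, R b x y * (partialD c (partialD b r) x
      - ∑ j, cartanGamma L j b c x y * partialD j r x) = φ x * partialD c r x := by
    have : ∀ b, R b x y * (partialD c (partialD b r) x
      - ∑ j, cartanGamma L j b c x y * partialD j r x) = φ x * (gLow L c b x y * R b x y) := by
      intro b
      have := heq x hx y hy c b
      rw [hessHor] at this
      rw [this]; ring
    simp only [this]
    rw [← Finset.mul_sum, hgR c x hx y hy]
  rw [e1, ← e3]
  simp only [mul_sub, Finset.sum_sub_distrib] at e6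
  rw [e5] at e6
  linarith

/-- If `‖grad r‖` is independent of the direction at `x`, then the metric tensor is independent of
the direction at the end of a segment from `x` where `dr ≠ 0`. -/
theorem gLow_const_of_segment (hk : 2 ≤ k) {x w : Coord k}
    (hseg : ∀ t ∈ Set.Icc (0 : ℝ) 1, x + t • w ∈ W)
    (h0 : (∀ i, partialD i r x = 0) ∨
      ∀ i j, ∀ y y' : Coord k, y ≠ 0 → y' ≠ 0 → gLow L i j x y = gLow L i j x y')
    (hd : ∃ i, partialD i r (x + w) ≠ 0) (i j : Fin k) {y y' : Coord k} (hy : y ≠ 0)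
    (hy' : y' ≠ 0) : gLow L i j (x + w) y = gLow L i j (x + w) y' := by
  set H : Coord k → Coord k → ℝ :=
    fun x y => ∑ i, (∑ j, gUp L i j x y * partialD j r x) * partialD i r x
  have hr1 : ∀ i, ContDiffOn ℝ ∞ (partialD i r) W := fun i => contDiffOn_partialD hW hr i
  have hr2 : ∀ i, ContDiffOn ℝ ∞ (fun p : Coord k × Coord k => partialD i r p.1)
      (W ×ˢ {y | y ≠ 0}) := fun i => (hr1 i).comp contDiffOn_fst fun p hp => hp.1
  have hH : JSmooth W H := ContDiffOn.sum fun i _ => ContDiffOn.mul (ContDiffOn.sum fun j _ =>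
    ContDiffOn.mul (hL.jsmooth_gUp hW i j) (hr2 j)) (hr2 i)
  have hx0 : x ∈ W := by simpa using hseg 0 (by simp)
  have hx1 : x + w ∈ W := by simpa using hseg 1 (by simp)
  -- At the start of the segment H is direction free in either case: it is zero where dr = 0, and
  -- otherwise the metric itself is direction free.
  have hle := fun (y y' : Coord k) (hy : y ≠ 0) (hy' : y' ≠ 0) =>
    dir_indep_of_segment hW hH (x := x) (w := w) (y := y) (y' := y')
    (fun x hx y hy c hc => by
      have : gMat L x (c • y) = gMat L x y := by ext a b; exact hL.gLow_smul hx a b y hc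
      simp only [H, gUp, this])
    (fun x hx y hy hcr c => hL.dPos_dualNorm hW hr heq hx hy hcr c) hseg
    (by
      intro y y' hy hy'
      rcases h0 with h0 | h0
      · simp [H, h0]
      · have : gMat L x y = gMat L x y' := by ext a b; exact h0 a b y y' hy hy'
        simp only [H, gUp, this]) hy hy'
  refine (hL.isMinkowskiTensor hW hx1).const_of_dual_norm_const
    (r := fun i => partialD i r (x + w)) hk (fun h => ?_) ?_ hy hy' i j
  · obtain ⟨i, hi⟩ := hd
    exact hi (congrFun h i)
  · have hform : ∀ y, H (x + w) y = ∑ i, ∑ j, (Matrix.of fun i j => gLow L i j (x + w) y)⁻¹ i j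
        * partialD i r (x + w) * partialD j r (x + w) := by
      intro y
      simp only [H, Finset.sum_mul]
      refine Finset.sum_congr rfl fun i _ => Finset.sum_congr rfl fun j _ => ?_
      simp only [gUp, gMat]; ring
    intro y y' hy hy'
    rw [← hform, ← hform]
    exact le_antisymm (hle y y' hy hy') (hle y' y hy' hy)

end IsFinslerOn

end FinslerChart

end FinslerGeom

namespace FinslerGeom

/-! ### Entrywise calculus of matrix valued functions. -/

section MatrixCalculus

variable {k : ℕ} {p q s : Type*}

/-- Entrywise partial derivative of a matrix valued function. -/
noncomputable def matD (i : Fin k) (A : Coord k → Matrix p q ℝ) (x : Coord k) : Matrix p q ℝ :=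
  Matrix.of fun a b => partialD i (fun z => A z a b) x

/-- Entrywise smoothness of a matrix valued function. -/
def MSmooth (W : Set (Coord k)) (A : Coord k → Matrix p q ℝ) : Prop :=
  ∀ a b, ContDiffOn ℝ ∞ (fun z => A z a b) W

variable {W : Set (Coord k)}

theorem MSmooth.differentiableAt (hW : IsOpen W) {A : Coord k → Matrix p q ℝ} (hA : MSmooth W A)
    {x : Coord k} (hx : x ∈ W) (a : p) (b : q) : DifferentiableAt ℝ (fun z => A z a b) x :=
  differentiableAt_of_contDiffOn hW (hA a b) hx

theorem MSmooth.matD (hW : IsOpen W) {A : Coord k → Matrix p q ℝ} (hA : MSmooth W A) (i : Fin k) :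
    MSmooth W (matD i A) := fun a b => contDiffOn_partialD hW (hA a b) i

theorem MSmooth.add {A B : Coord k → Matrix p q ℝ} (hA : MSmooth W A) (hB : MSmooth W B) :
    MSmooth W fun z => A z + B z := fun a b => (hA a b).add (hB a b)

theorem MSmooth.sub {A B : Coord k → Matrix p q ℝ} (hA : MSmooth W A) (hB : MSmooth W B) :
    MSmooth W fun z => A z - B z := fun a b => (hA a b).sub (hB a b)

theorem MSmooth.mul [Fintype q] {A : Coord k → Matrix p q ℝ} {B : Coord k → Matrix q s ℝ}
    (hA : MSmooth W A) (hB : MSmooth W B) : MSmooth W fun z => A z * B z := fun a b => by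
  simp only [Matrix.mul_apply]
  exact ContDiffOn.sum fun c _ => (hA a c).mul (hB c b)

theorem MSmooth.transpose {A : Coord k → Matrix p q ℝ} (hA : MSmooth W A) :
    MSmooth W fun z => (A z).transpose := fun a b => hA b a

theorem matD_congr (hW : IsOpen W) {A B : Coord k → Matrix p q ℝ} (h : Set.EqOn A B W)
    {x : Coord k} (hx : x ∈ W) (i : Fin k) : matD i A x = matD i B x := by
  ext a b
  exact partialD_congr_of_eqOn hW hx i fun z hz => by simp only [h hz]

variable (hW : IsOpen W)
include hW

theorem matD_add {A B : Coord k → Matrix p q ℝ} (hA : MSmooth W A) (hB : MSmooth W B)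
    {x : Coord k} (hx : x ∈ W) (i : Fin k) :
    matD i (fun z => A z + B z) x = matD i A x + matD i B x := by
  ext a b
  exact partialD_add i (hA.differentiableAt hW hx a b) (hB.differentiableAt hW hx a b)

theorem matD_sub {A B : Coord k → Matrix p q ℝ} (hA : MSmooth W A) (hB : MSmooth W B)
    {x : Coord k} (hx : x ∈ W) (i : Fin k) :
    matD i (fun z => A z - B z) x = matD i A x - matD i B x := by
  ext a b
  exact partialD_sub i (hA.differentiableAt hW hx a b) (hB.differentiableAt hW hx a b)

theorem matD_mul [Fintype q] {A : Coord k → Matrix p q ℝ} {B : Coord k → Matrix q s ℝ}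
    (hA : MSmooth W A) (hB : MSmooth W B) {x : Coord k} (hx : x ∈ W) (i : Fin k) :
    matD i (fun z => A z * B z) x = matD i A x * B x + A x * matD i B x := by
  ext a b
  simp only [matD, Matrix.mul_apply, Matrix.add_apply, Matrix.of_apply]
  rw [partialD_sum _ _ fun c _ => (hA.differentiableAt hW hx a c).fun_mul
    (hB.differentiableAt hW hx c b), ← Finset.sum_add_distrib]
  exact Finset.sum_congr rfl fun c _ =>
    partialD_mul i (hA.differentiableAt hW hx a c) (hB.differentiableAt hW hx c b)

theorem matD_comm {A : Coord k → Matrix p q ℝ} (hA : MSmooth W A) {x : Coord k} (hx : x ∈ W)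
    (i j : Fin k) : matD i (matD j A) x = matD j (matD i A) x := by
  ext a b
  exact partialD_comm hW (hA a b) hx i j

end MatrixCalculus

/-! ### Christoffel symbols, curvature and its symmetries in matrix form. -/

section Riemannian

variable {k : ℕ}

/-- A smooth Riemannian metric on the open set `W`. -/
structure IsRiem (W : Set (Coord k)) (g : Coord k → Matrix (Fin k) (Fin k) ℝ) : Prop where
  isOpen : IsOpen W
  smooth : MSmooth W g
  posDef : ∀ x ∈ W, (g x).PosDef

/-- The Christoffel symbols as matrices: `(Γ_i)^a_b`. -/
noncomputable def chrMat (g : Coord k → Matrix (Fin k) (Fin k) ℝ) (i : Fin k) (x : Coord k) :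
    Matrix (Fin k) (Fin k) ℝ :=
  Matrix.of fun a b => (1 / 2) * ∑ h, (g x)⁻¹ a h *
    (partialD i (fun z => g z h b) x + partialD b (fun z => g z h i) x
      - partialD h (fun z => g z i b) x)

/-- The curvature matrices `R_{il} = ∂_i Γ_l - ∂_l Γ_i + [Γ_i, Γ_l]`. -/
noncomputable def riem (g : Coord k → Matrix (Fin k) (Fin k) ℝ) (i l : Fin k) (x : Coord k) :
    Matrix (Fin k) (Fin k) ℝ :=
  matD i (chrMat g l) x - matD l (chrMat g i) x
    + (chrMat g i x * chrMat g l x - chrMat g l x * chrMat g i x)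

theorem riem_swap (g : Coord k → Matrix (Fin k) (Fin k) ℝ) (i l : Fin k) (x : Coord k) :
    riem g l i x = - riem g i l x := by
  simp only [riem]; abel

namespace IsRiem

variable {W : Set (Coord k)} {g : Coord k → Matrix (Fin k) (Fin k) ℝ} (hg : IsRiem W g)
include hg

theorem isUnit_det {x : Coord k} (hx : x ∈ W) : IsUnit (g x).det :=
  (hg.posDef x hx).det_pos.ne'.isUnit

theorem symm {x : Coord k} (hx : x ∈ W) (a b : Fin k) : g x a b = g x b a := by
  simpa using (hg.posDef x hx).isHermitian.apply b a

theorem transpose {x : Coord k} (hx : x ∈ W) : (g x).transpose = g x := by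
  ext a b; exact hg.symm hx b a

theorem partialD_symm {x : Coord k} (hx : x ∈ W) (i a b : Fin k) :
    partialD i (fun z => g z a b) x = partialD i (fun z => g z b a) x :=
  partialD_congr_of_eqOn hg.isOpen hx i fun _ hz => hg.symm hz a b

theorem inv_smooth : MSmooth W fun x => (g x)⁻¹ := fun a b =>
  contDiffOn_matrix_inv hg.smooth (fun x hx => (hg.posDef x hx).det_pos.ne') a b

theorem chrMat_smooth (i : Fin k) : MSmooth W (chrMat g i) := fun a b => by
  refine contDiffOn_const.mul (ContDiffOn.sum fun h _ => (hg.inv_smooth a h).mul ?_)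
  exact ((contDiffOn_partialD hg.isOpen (hg.smooth _ _) _).add
    (contDiffOn_partialD hg.isOpen (hg.smooth _ _) _)).sub
    (contDiffOn_partialD hg.isOpen (hg.smooth _ _) _)

theorem riem_smooth (i l : Fin k) : MSmooth W (riem g i l) :=
  (((hg.chrMat_smooth l).matD hg.isOpen i).sub ((hg.chrMat_smooth i).matD hg.isOpen l)).add
    (((hg.chrMat_smooth i).mul (hg.chrMat_smooth l)).sub
      ((hg.chrMat_smooth l).mul (hg.chrMat_smooth i)))

theorem chrMat_symm {x : Coord k} (hx : x ∈ W) (i a b : Fin k) :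
    chrMat g i x a b = chrMat g b x a i := by
  simp only [chrMat, Matrix.of_apply]
  congr 1
  refine Finset.sum_congr rfl fun h _ => ?_
  rw [hg.partialD_symm hx h i b]; ring

theorem mul_chrMat {x : Coord k} (hx : x ∈ W) (i : Fin k) :
    g x * chrMat g i x = Matrix.of fun h b => (1 / 2) *
      (partialD i (fun z => g z h b) x + partialD b (fun z => g z h i) x
      - partialD h (fun z => g z i b) x) := by
  have : chrMat g i x = (g x)⁻¹ * Matrix.of fun h b => (1 / 2) *
      (partialD i (fun z => g z h b) x + partialD b (fun z => g z h i) x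
      - partialD h (fun z => g z i b) x) := by
    ext a b
    simp only [chrMat, Matrix.mul_apply, Matrix.of_apply, Finset.mul_sum]
    exact Finset.sum_congr rfl fun h _ => by ring
  rw [this, ← Matrix.mul_assoc, Matrix.mul_nonsing_inv _ (hg.isUnit_det hx), Matrix.one_mul]

theorem compat {x : Coord k} (hx : x ∈ W) (i : Fin k) :
    matD i g x = (chrMat g i x).transpose * g x + g x * chrMat g i x := by
  have h1 : (chrMat g i x).transpose * g x = (g x * chrMat g i x).transpose := by
    rw [Matrix.transpose_mul, hg.transpose hx]
  rw [h1, hg.mul_chrMat hx]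
  ext a b
  simp only [matD, Matrix.add_apply, Matrix.transpose_apply, Matrix.of_apply]
  rw [hg.partialD_symm hx i b a, hg.partialD_symm hx a b i, hg.partialD_symm hx b i a]
  ring

/-- Second derivatives of the metric commute; expanding both orders by `compat` leaves the symmetric
part of the lowered curvature. -/
theorem riem_antisymm {x : Coord k} (hx : x ∈ W) (i l : Fin k) :
    (riem g i l x).transpose * g x + g x * riem g i l x = 0 := by
  have hW := hg.isOpen
  have key : ∀ i l : Fin k, matD i (matD l g) x
      = (matD i (chrMat g l) x).transpose * g x
        + (chrMat g l x).transpose * ((chrMat g i x).transpose * g x + g x * chrMat g i x)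
        + (((chrMat g i x).transpose * g x + g x * chrMat g i x) * chrMat g l x
        + g x * matD i (chrMat g l) x) := by
    intro i l
    have e : Set.EqOn (matD l g)
        (fun z => (chrMat g l z).transpose * g z + g z * chrMat g l z) W :=
      fun z hz => hg.compat hz l
    have s1 := (hg.chrMat_smooth l).transpose
    rw [matD_congr hW e hx, matD_add hW (s1.mul hg.smooth) (hg.smooth.mul (hg.chrMat_smooth l)) hx,
      matD_mul hW s1 hg.smooth hx, matD_mul hW hg.smooth (hg.chrMat_smooth l) hx, hg.compat hx i]
    rfl
  have h := matD_comm hW hg.smooth hx i l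
  rw [key i l, key l i, ← sub_eq_zero] at h
  rw [← h]
  simp only [riem, Matrix.transpose_add, Matrix.transpose_sub, Matrix.transpose_mul]
  noncomm_ring

/-- Torsion freeness: in the cyclic sum every ∂Γ and ΓΓ term meets its negative after exchanging the
lower indices of Γ. -/
theorem bianchi_first {x : Coord k} (hx : x ∈ W) (i l b a : Fin k) :
    riem g i l x a b + riem g l b x a i + riem g b i x a l = 0 := by
  have hs : ∀ i l b : Fin k, matD i (chrMat g l) x a b = matD i (chrMat g b) x a l := by
    intro i l b
    exact partialD_congr_of_eqOn hg.isOpen hx i fun z hz => hg.chrMat_symm hz l a b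
  have hm : ∀ i l b : Fin k, (chrMat g i x * chrMat g l x) a b
      = (chrMat g i x * chrMat g b x) a l := by
    intro i l b
    simp only [Matrix.mul_apply]
    exact Finset.sum_congr rfl fun c _ => by rw [hg.chrMat_symm hx l c b]
  simp only [riem, Matrix.add_apply, Matrix.sub_apply]
  rw [hs i l b, hm i l b, hs l i b, hm l i b, hs b l i, hm b l i]
  ring

/-- A formal consequence of the two skew symmetries and the first Bianchi identity; linear
arithmetic finds the combination. -/
theorem riem_pair_symm {x : Coord k} (hx : x ∈ W) (a b i l : Fin k) :
    (g x * riem g i l x) a b = (g x * riem g a b x) i l := by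
  set R : Fin k → Fin k → Fin k → Fin k → ℝ := fun a b i l => (g x * riem g i l x) a b
  have h1 : ∀ a b i l, R a b i l = - R b a i l := by
    intro a b i l
    have := congrFun (congrFun (hg.riem_antisymm hx i l) b) a
    have h2 : ((riem g i l x).transpose * g x) b a = (g x * riem g i l x) a b := by
      rw [← hg.transpose hx, ← Matrix.transpose_mul, Matrix.transpose_apply, hg.transpose hx]
    simp only [Matrix.add_apply, h2, Matrix.zero_apply] at this
    simp only [R]; linarith
  have h2 : ∀ a b i l, R a b i l = - R a b l i := by
    intro a b i l
    simp only [R]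
    rw [riem_swap g l i, Matrix.mul_neg, Matrix.neg_apply]
  have h3 : ∀ a b i l, R a b i l + R a i l b + R a l b i = 0 := by
    intro a b i l
    simp only [R, Matrix.mul_apply, ← Finset.sum_add_distrib, ← mul_add]
    exact Finset.sum_eq_zero fun c _ => by rw [hg.bianchi_first hx, mul_zero]
  show R a b i l = R i l a b
  linarith [h1 a b i l, h1 a b l i, h1 i l a b, h1 i l b a, h2 a b i l, h2 i l a b,
    h3 a b i l, h3 b i l a, h3 i l a b, h3 l a b i, h1 a i l b, h1 a l b i, h1 b i l a, h1 b l a i,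
    h2 a i l b, h2 a l b i, h2 b i l a, h2 b l a i, h1 i a b l, h1 l a b i, h2 i a b l, h2 l a b i,
    h1 b l i a, h1 b a i l, h2 b a i l, h1 l b i a, h1 i b l a, h2 i b l a, h2 l b i a, h1 l i a b, h2 l i a b]

/-- The Jacobi identity for the operators ∂_c + Γ_c. No Christoffel terms act on the two form
indices, since in the cyclic sum these cancel by torsion freeness. -/
theorem bianchi_second {x : Coord k} (hx : x ∈ W) (c i l : Fin k) :
    (matD c (riem g i l) x + (chrMat g c x * riem g i l x - riem g i l x * chrMat g c x))
    + (matD i (riem g l c) x + (chrMat g i x * riem g l c x - riem g l c x * chrMat g i x))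
    + (matD l (riem g c i) x + (chrMat g l x * riem g c i x - riem g c i x * chrMat g l x)) = 0 := by
  have hW := hg.isOpen
  have key : ∀ c i l : Fin k, matD c (riem g i l) x
      = matD c (matD i (chrMat g l)) x - matD c (matD l (chrMat g i)) x
      + ((matD c (chrMat g i) x * chrMat g l x + chrMat g i x * matD c (chrMat g l) x)
       - (matD c (chrMat g l) x * chrMat g i x + chrMat g l x * matD c (chrMat g i) x)) := by
    intro c i l
    have s := fun i => hg.chrMat_smooth i
    have e : riem g i l = fun z => (matD i (chrMat g l) z - matD l (chrMat g i) z)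
        + (chrMat g i z * chrMat g l z - chrMat g l z * chrMat g i z) := rfl
    rw [e, matD_add hW (((s l).matD hW i).sub ((s i).matD hW l))
      (((s i).mul (s l)).sub ((s l).mul (s i))) hx,
      matD_sub hW ((s l).matD hW i) ((s i).matD hW l) hx,
      matD_sub hW ((s i).mul (s l)) ((s l).mul (s i)) hx, matD_mul hW (s i) (s l) hx,
      matD_mul hW (s l) (s i) hx]
  rw [key, key, key, matD_comm hW (hg.chrMat_smooth l) hx c i,
    matD_comm hW (hg.chrMat_smooth i) hx c l, matD_comm hW (hg.chrMat_smooth c) hx i l]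
  simp only [riem]
  noncomm_ring

end IsRiem

end Riemannian

/-! ### For a quadratic norm the Finsler objects are the Riemannian ones. -/

section QuadraticFinsler

variable {k : ℕ}

theorem partialD_coord (c j : Fin k) (z : Coord k) :
    partialD c (fun z : Coord k => z j) z = if j = c then 1 else 0 := by
  have : HasFDerivAt (fun z : Coord k => z j) (EuclideanSpace.proj j : Coord k →L[ℝ] ℝ) z :=
    (EuclideanSpace.proj j : Coord k →L[ℝ] ℝ).hasFDerivAt
  simp [partialD, this.fderiv]

/-- Since L² is a polynomial in y, no condition y ≠ 0 is needed. -/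
theorem gLow_of_quadratic {L : Coord k → Coord k → ℝ} {x : Coord k} {G : Matrix (Fin k) (Fin k) ℝ}
    (hG : ∀ a b, G a b = G b a) (h : ∀ y : Coord k, L x y ^ 2 = ∑ a, ∑ b, G a b * y a * y b)
    (i j : Fin k) (y : Coord k) : gLow L i j x y = G i j := by
  have hc : ∀ (j : Fin k) (z : Coord k), DifferentiableAt ℝ (fun z : Coord k => z j) z :=
    fun j z => by fun_prop
  have h1 : (fun y' => partialD j (fun y' => L x y' ^ 2) y') = fun y' => ∑ a, 2 * G j a * y' a := by
    funext z
    have : (fun y' => L x y' ^ 2) = fun y' : Coord k => ∑ a, ∑ b, G a b * y' a * y' b := funext h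
    have h5 : partialD j (fun y' : Coord k => ∑ a, ∑ b, G a b * y' a * y' b) z
        = ∑ a, partialD j (fun y' : Coord k => ∑ b, G a b * y' a * y' b) z :=
      partialD_sum _ _ fun a _ => DifferentiableAt.fun_sum fun b _ =>
        ((hc a z).const_mul (G a b)).fun_mul (hc b z)
    rw [this, h5]
    have h2 : ∀ a, partialD j (fun z : Coord k => ∑ b, G a b * z a * z b) z
        = (if a = j then ∑ b, G a b * z b else 0) + G a j * z a := by
      intro a
      have h6 : partialD j (fun y' : Coord k => ∑ b, G a b * y' a * y' b) z
          = ∑ b, partialD j (fun y' : Coord k => G a b * y' a * y' b) z :=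
        partialD_sum _ _ fun b _ => ((hc a z).const_mul (G a b)).fun_mul (hc b z)
      rw [h6]
      have h3 : ∀ b, partialD j (fun z : Coord k => G a b * z a * z b) z
          = (if a = j then G a b * z b else 0) + (if b = j then G a b * z a else 0) := by
        intro b
        rw [partialD_mul j ((hc a z).const_mul _) (hc b z), partialD_const_mul, partialD_coord,
          partialD_coord]
        split_ifs <;> ring
      simp only [h3, Finset.sum_add_distrib]
      simp
    simp only [h2, Finset.sum_add_distrib]
    rw [Finset.sum_ite_eq' Finset.univ j]
    simp only [Finset.mem_univ, if_true]
    rw [← Finset.sum_add_distrib]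
    exact Finset.sum_congr rfl fun a _ => by rw [hG a j]; ring
  simp only [gLow, dDir, h1]
  rw [partialD_sum _ _ fun a _ => (hc a y).const_mul _]
  have h4 : ∀ a, partialD i (fun z : Coord k => 2 * G j a * z a) y
      = if a = i then 2 * G j a else 0 := by
    intro a
    rw [partialD_const_mul, partialD_coord]; split_ifs <;> ring
  simp only [h4]
  simp only [Finset.sum_ite_eq', Finset.mem_univ, if_true]
  rw [hG j i]; ring

/-- `L` is the norm of the Riemannian metric `g` on `W`. -/
def IsNormOf (W : Set (Coord k)) (L : Coord k → Coord k → ℝ)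
    (g : Coord k → Matrix (Fin k) (Fin k) ℝ) : Prop :=
  ∀ x ∈ W, ∀ y : Coord k, L x y ^ 2 = ∑ a, ∑ b, g x a b * y a * y b

namespace IsRiem

variable {W : Set (Coord k)} {g : Coord k → Matrix (Fin k) (Fin k) ℝ} (hg : IsRiem W g)
  {L : Coord k → Coord k → ℝ} (hL : IsNormOf W L g)
include hg hL

theorem gLow_eq {x : Coord k} (hx : x ∈ W) (i j : Fin k) (y : Coord k) :
    gLow L i j x y = g x i j :=
  gLow_of_quadratic (fun a b => hg.symm hx a b) (hL x hx) i j y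

theorem gUp_eq {x : Coord k} (hx : x ∈ W) (i j : Fin k) (y : Coord k) :
    gUp L i j x y = (g x)⁻¹ i j := by
  have : gMat L x y = g x := by ext a b; exact hg.gLow_eq hL hx a b y
  rw [gUp, this]

omit hL in
theorem dHor_of_position {A : Coord k → Coord k → ℝ} {B : Coord k → ℝ}
    (hA : ∀ x ∈ W, ∀ y, A x y = B x) {x : Coord k} (hx : x ∈ W) (i : Fin k) (y : Coord k) :
    dHor L i A x y = partialD i B x := by
  have h1 : ∀ j, dDir j A x y = 0 := by
    intro j
    have : (fun y' => A x y') = fun _ => B x := funext (hA x hx)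
    rw [dDir, this, partialD_const]
  simp only [dHor, h1, mul_zero, Finset.sum_const_zero, sub_zero, dPos]
  exact partialD_congr_of_eqOn hg.isOpen hx i fun z hz => hA z hz y

theorem cartanGamma_eq {x : Coord k} (hx : x ∈ W) (a i b : Fin k) (y : Coord k) :
    cartanGamma L a i b x y = chrMat g i x a b := by
  have h : ∀ c h b, dHor L c (gLow L h b) x y = partialD c (fun z => g z h b) x := fun c h b =>
    hg.dHor_of_position (B := fun z => g z h b) (fun x hx y => hg.gLow_eq hL hx h b y) hx c y
  simp only [cartanGamma, h, chrMat, Matrix.of_apply, hg.gUp_eq hL hx]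

/-- The Cartan torsion vanishes and δ/δx becomes ∂/∂x. In `hCurv` the derivative in the last index
comes with the plus sign, so the form indices appear as l, j. -/
theorem hCurv_eq {x : Coord k} (hx : x ∈ W) (i h j l : Fin k) (y : Coord k) :
    hCurv L i h j l x y = riem g l j x i h := by
  have t : ∀ a b c, cartanTorsion L a b c x y = 0 := by
    intro a b c
    have : ∀ d, dDir c (gLow L d b) x y = 0 := by
      intro d
      have : (fun y' => gLow L d b x y') = fun _ => g x d b := funext (hg.gLow_eq hL hx d b)
      rw [dDir, this, partialD_const]
    simp [cartanTorsion, this]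
  have d : ∀ c j, dHor L c (cartanGamma L i h j) x y = matD c (chrMat g j) x i h := by
    intro c j
    refine hg.dHor_of_position (B := fun z => chrMat g j z i h) (fun x hx y => ?_) hx c y
    rw [hg.cartanGamma_eq hL hx, hg.chrMat_symm hx]
  simp only [hCurv, t, d, hg.cartanGamma_eq hL hx, zero_mul, Finset.sum_const_zero, add_zero, riem,
    Matrix.add_apply, Matrix.sub_apply, Matrix.mul_apply]
  have e : ∀ j l, ∑ r, chrMat g h x r j * chrMat g r x i l
      = ∑ r, chrMat g l x i r * chrMat g j x r h := by
    intro j l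
    refine Finset.sum_congr rfl fun r _ => ?_
    rw [hg.chrMat_symm hx h r j, hg.chrMat_symm hx r i l, mul_comm]
  rw [e, e]; ring

theorem hessHor_eq {x : Coord k} (hx : x ∈ W) (ρ : Coord k → ℝ) (a b : Fin k) (y : Coord k) :
    hessHor L ρ a b x y = partialD a (partialD b ρ) x
      - ∑ j, chrMat g b x j a * partialD j ρ x := by
  simp only [hessHor, hg.cartanGamma_eq hL hx]

end IsRiem

end QuadraticFinsler

end FinslerGeom

namespace FinslerGeom

/-! ### Integrability conditions of the Riemannian equation ∇∇r = φg. -/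

section HessianEquation

variable {k : ℕ}

/-- A Riemannian metric `g` with a solution `r` of `∇∇r = φ g` on `W`. -/
structure IsHess (W : Set (Coord k)) (g : Coord k → Matrix (Fin k) (Fin k) ℝ)
    (r φ : Coord k → ℝ) : Prop extends IsRiem W g where
  smooth_fun : ContDiffOn ℝ ∞ r W
  hess : ∀ x ∈ W, ∀ a b, partialD a (partialD b r) x
    = ∑ j, chrMat g b x j a * partialD j r x + φ x * g x a b

/-- The gradient `N^a = g^{ab} ∂_b r`. -/
noncomputable def grad (g : Coord k → Matrix (Fin k) (Fin k) ℝ) (r : Coord k → ℝ) (a : Fin k)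
    (x : Coord k) : ℝ :=
  ∑ b, (g x)⁻¹ a b * partialD b r x

/-- `‖grad r‖²`. -/
noncomputable def gradSq (g : Coord k → Matrix (Fin k) (Fin k) ℝ) (r : Coord k → ℝ)
    (x : Coord k) : ℝ :=
  ∑ a, grad g r a x * partialD a r x

/-- The derivative of `f` along the gradient of `r`. -/
noncomputable def dGrad (g : Coord k → Matrix (Fin k) (Fin k) ℝ) (r : Coord k → ℝ)
    (f : Coord k → ℝ) (x : Coord k) : ℝ :=
  ∑ c, grad g r c x * partialD c f x

/-- The endomorphism `Q = N^c Γ_c`. -/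
noncomputable def gradChr (g : Coord k → Matrix (Fin k) (Fin k) ℝ) (r : Coord k → ℝ)
    (x : Coord k) : Matrix (Fin k) (Fin k) ℝ :=
  ∑ c, grad g r c x • chrMat g c x

/-- The curvature of a space of constant curvature one, `e_i ⊗ g_l - e_l ⊗ g_i`. -/
noncomputable def roundCurv (g : Coord k → Matrix (Fin k) (Fin k) ℝ) (i l : Fin k) (x : Coord k) :
    Matrix (Fin k) (Fin k) ℝ :=
  Matrix.of fun a b => (if a = i then g x l b else 0) - (if a = l then g x i b else 0)

/-- The Kulkarni-Nomizu type product of `g` and `dr ⊗ dr`. -/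
noncomputable def mixedCurv (g : Coord k → Matrix (Fin k) (Fin k) ℝ) (r : Coord k → ℝ)
    (i l : Fin k) (x : Coord k) : Matrix (Fin k) (Fin k) ℝ :=
  Matrix.of fun a b => (if a = i then partialD l r x * partialD b r x else 0)
    - (if a = l then partialD i r x * partialD b r x else 0)
    + grad g r a x * (partialD i r x * g x l b - partialD l r x * g x i b)

/-- The tensor whose vanishing says that the level sets of `r`, with the metric
`g / ‖grad r‖²`, have constant curvature `κ`. -/
noncomputable def defect (g : Coord k → Matrix (Fin k) (Fin k) ℝ) (r φ : Coord k → ℝ) (κ : ℝ)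
    (i l : Fin k) (x : Coord k) : Matrix (Fin k) (Fin k) ℝ :=
  gradSq g r x • riem g i l x - (κ - φ x ^ 2) • roundCurv g i l x
    + ((κ - φ x ^ 2 + dGrad g r φ x) / gradSq g r x) • mixedCurv g r i l x

/-- The action of the endomorphism `Q` on a two-form with values in endomorphisms. -/
def endAct (Q : Matrix (Fin k) (Fin k) ℝ) (T : Fin k → Fin k → Matrix (Fin k) (Fin k) ℝ)
    (i l : Fin k) : Matrix (Fin k) (Fin k) ℝ :=
  T i l * Q - Q * T i l + ∑ c, Q c i • T c l + ∑ c, Q c l • T i c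

theorem dGrad_congr {g : Coord k → Matrix (Fin k) (Fin k) ℝ} {r f h : Coord k → ℝ}
    {W : Set (Coord k)} (hW : IsOpen W) {x : Coord k} (hx : x ∈ W) (e : Set.EqOn f h W) :
    dGrad g r f x = dGrad g r h x := by
  simp only [dGrad]
  exact Finset.sum_congr rfl fun c _ => by rw [partialD_congr_of_eqOn hW hx c e]

theorem gradChr_apply (g : Coord k → Matrix (Fin k) (Fin k) ℝ) (r : Coord k → ℝ) (x : Coord k)
    (a b : Fin k) :
    gradChr g r x a b = ∑ c, grad g r c x * chrMat g c x a b := by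
  simp [gradChr, Matrix.sum_apply]

section dGradRules

variable {g : Coord k → Matrix (Fin k) (Fin k) ℝ} {r f h : Coord k → ℝ} {x : Coord k}

theorem dGrad_mul (hf : DifferentiableAt ℝ f x) (hh : DifferentiableAt ℝ h x) :
    dGrad g r (fun z => f z * h z) x = dGrad g r f x * h x + f x * dGrad g r h x := by
  simp only [dGrad, Finset.sum_mul, Finset.mul_sum, ← Finset.sum_add_distrib]
  exact Finset.sum_congr rfl fun c _ => by rw [partialD_mul c hf hh]; ring

theorem dGrad_add (hf : DifferentiableAt ℝ f x) (hh : DifferentiableAt ℝ h x) :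
    dGrad g r (fun z => f z + h z) x = dGrad g r f x + dGrad g r h x := by
  simp only [dGrad, ← Finset.sum_add_distrib]
  exact Finset.sum_congr rfl fun c _ => by rw [partialD_add c hf hh]; ring

theorem dGrad_sub (hf : DifferentiableAt ℝ f x) (hh : DifferentiableAt ℝ h x) :
    dGrad g r (fun z => f z - h z) x = dGrad g r f x - dGrad g r h x := by
  simp only [dGrad, ← Finset.sum_sub_distrib]
  exact Finset.sum_congr rfl fun c _ => by rw [partialD_sub c hf hh]; ring

theorem dGrad_const (c : ℝ) : dGrad g r (fun _ => c) x = 0 := by simp [dGrad]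

theorem dGrad_ite (p : Prop) [Decidable p] :
    dGrad g r (fun z => if p then f z else 0) x = if p then dGrad g r f x else 0 := by
  split_ifs
  · rfl
  · exact dGrad_const 0

end dGradRules

namespace IsHess

variable {W : Set (Coord k)} {g : Coord k → Matrix (Fin k) (Fin k) ℝ} {r φ : Coord k → ℝ}
  (h : IsHess W g r φ)
include h

theorem smooth_partialD (a : Fin k) : ContDiffOn ℝ ∞ (partialD a r) W :=
  contDiffOn_partialD h.isOpen h.smooth_fun a

theorem smooth_grad (a : Fin k) : ContDiffOn ℝ ∞ (grad g r a) W :=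
  ContDiffOn.sum fun b _ => (h.inv_smooth a b).mul (h.smooth_partialD b)

theorem smooth_gradSq : ContDiffOn ℝ ∞ (gradSq g r) W :=
  ContDiffOn.sum fun a _ => (h.smooth_grad a).mul (h.smooth_partialD a)

/-- No smoothness of φ is assumed; it follows on dividing a diagonal component of the equation by
g_{ii} > 0. The index only serves to provide such a component. -/
theorem smooth_phi (i : Fin k) : ContDiffOn ℝ ∞ φ W := by
  have h1 : ContDiffOn ℝ ∞ (fun x => (partialD i (partialD i r) x
      - ∑ j, chrMat g i x j i * partialD j r x) / g x i i) W := by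
    refine ((contDiffOn_partialD h.isOpen (h.smooth_partialD i) i).sub
      (ContDiffOn.sum fun j _ => (h.chrMat_smooth i j i).mul (h.smooth_partialD j))).div
      (h.smooth i i) fun x hx => ((h.posDef x hx).diag_pos).ne'
  refine h1.congr fun x hx => ?_
  rw [h.hess x hx i i, eq_div_iff ((h.posDef x hx).diag_pos).ne']
  ring

theorem sum_mul_grad {x : Coord k} (hx : x ∈ W) (a : Fin k) :
    ∑ b, g x a b * grad g r b x = partialD a r x := by
  have h1 : (g x).mulVec ((g x)⁻¹.mulVec fun j => partialD j r x) = fun j => partialD j r x := by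
    rw [Matrix.mulVec_mulVec, Matrix.mul_nonsing_inv _ (h.isUnit_det hx), Matrix.one_mulVec]
  exact congrFun h1 a

theorem eq_of_sum_mul_eq {x : Coord k} (hx : x ∈ W) {u v : Fin k → ℝ}
    (e : ∀ a, ∑ b, g x a b * u b = ∑ b, g x a b * v b) : u = v := by
  have h1 : (g x).mulVec u = (g x).mulVec v := funext e
  exact Matrix.mulVec_injective_of_isUnit ((Matrix.isUnit_iff_isUnit_det _).2 (h.isUnit_det hx)) h1

theorem partialD_metric {x : Coord k} (hx : x ∈ W) (i a b : Fin k) :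
    partialD i (fun z => g z a b) x
      = ∑ c, chrMat g i x c a * g x c b + ∑ c, g x a c * chrMat g i x c b := by
  have := congrFun (congrFun (h.compat hx i) a) b
  simpa [matD, Matrix.mul_apply] using this

/-- This is ∇N = φ Id for N = grad r, checked after lowering the free index with the invertible g.
-/
theorem partialD_grad {x : Coord k} (hx : x ∈ W) (i a : Fin k) :
    partialD i (grad g r a) x
      = (if a = i then φ x else 0) - ∑ b, chrMat g i x a b * grad g r b x := by
  have hd : ∀ b, DifferentiableAt ℝ (grad g r b) x := fun b =>
    differentiableAt_of_contDiffOn h.isOpen (h.smooth_grad b) hx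
  have hgd : ∀ a b, DifferentiableAt ℝ (fun z => g z a b) x := fun a b =>
    differentiableAt_of_contDiffOn h.isOpen (h.smooth a b) hx
  have key := h.eq_of_sum_mul_eq hx (u := fun a => partialD i (grad g r a) x)
    (v := fun a => (if a = i then φ x else 0) - ∑ b, chrMat g i x a b * grad g r b x) (by
      intro a
      have h1 : partialD i (fun z => ∑ b, g z a b * grad g r b z) x
          = partialD i (partialD a r) x :=
        partialD_congr_of_eqOn h.isOpen hx i fun z hz => h.sum_mul_grad hz a
      rw [partialD_sum _ _ fun b _ => (hgd a b).fun_mul (hd b)] at h1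
      simp only [partialD_mul i (hgd a _) (hd _), Finset.sum_add_distrib] at h1
      rw [h.hess x hx i a] at h1
      have h2 : ∑ b, partialD i (fun z => g z a b) x * grad g r b x
          = ∑ c, chrMat g i x c a * partialD c r x
            + ∑ c, g x a c * ∑ b, chrMat g i x c b * grad g r b x := by
        simp only [h.partialD_metric hx, add_mul, Finset.sum_add_distrib]
        congr 1
        · simp only [Finset.sum_mul]
          rw [Finset.sum_comm]
          refine Finset.sum_congr rfl fun c _ => ?_
          rw [← h.sum_mul_grad hx c, Finset.mul_sum]
          exact Finset.sum_congr rfl fun b _ => by ring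
        · simp only [Finset.sum_mul, Finset.mul_sum]
          rw [Finset.sum_comm]
          exact Finset.sum_congr rfl fun c _ => Finset.sum_congr rfl fun b _ => by ring
      have h3 : ∑ j, chrMat g a x j i * partialD j r x
          = ∑ c, chrMat g i x c a * partialD c r x :=
        Finset.sum_congr rfl fun c _ => by rw [h.chrMat_symm hx]
      simp only [mul_sub, Finset.sum_sub_distrib, mul_ite, mul_zero, Finset.sum_ite_eq',
        Finset.mem_univ, if_true]
      rw [h.symm hx i a] at h1
      linarith)
  exact congrFun key a

/-- Differentiate g(N, N) using ∇N = φ Id. In particular the norm of the gradient does not vary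
along level sets. -/
theorem partialD_gradSq {x : Coord k} (hx : x ∈ W) (i : Fin k) :
    partialD i (gradSq g r) x = 2 * φ x * partialD i r x := by
  have hd : ∀ b, DifferentiableAt ℝ (grad g r b) x := fun b =>
    differentiableAt_of_contDiffOn h.isOpen (h.smooth_grad b) hx
  have hrd : ∀ b, DifferentiableAt ℝ (partialD b r) x := fun b =>
    differentiableAt_of_contDiffOn h.isOpen (h.smooth_partialD b) hx
  have e : gradSq g r = fun x => ∑ a, grad g r a x * partialD a r x := rfl
  rw [e, partialD_sum _ _ fun a _ => (hd a).fun_mul (hrd a)]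
  simp only [partialD_mul i (hd _) (hrd _), h.partialD_grad hx, h.hess x hx, sub_mul, mul_add,
    Finset.sum_add_distrib, Finset.sum_sub_distrib, ite_mul, zero_mul, Finset.sum_ite_eq',
    Finset.mem_univ, if_true]
  have h1 : ∑ a, grad g r a x * (φ x * g x i a) = φ x * partialD i r x := by
    rw [← h.sum_mul_grad hx i, Finset.mul_sum]
    exact Finset.sum_congr rfl fun a _ => by ring
  have h2 : ∑ a, (∑ b, chrMat g i x a b * grad g r b x) * partialD a r x
      = ∑ a, grad g r a x * ∑ j, chrMat g a x j i * partialD j r x := by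
    simp only [Finset.sum_mul, Finset.mul_sum]
    rw [Finset.sum_comm]
    refine Finset.sum_congr rfl fun c _ => Finset.sum_congr rfl fun b _ => ?_
    rw [h.chrMat_symm hx c b i]; ring
  rw [h1, h2]; ring

/-- The Ricci identity for the gradient. -/
theorem riem_grad {x : Coord k} (hx : x ∈ W) (i l a : Fin k) :
    ∑ b, riem g i l x a b * grad g r b x
      = (if a = l then partialD i φ x else 0) - (if a = i then partialD l φ x else 0) := by
  have hW := h.isOpen
  set N : Coord k → Matrix (Fin k) Unit ℝ := fun z => Matrix.of fun a _ => grad g r a z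
  set e : Fin k → Coord k → Matrix (Fin k) Unit ℝ := fun i z =>
    Matrix.of fun a _ => if a = i then φ z else 0
  have hφ := h.smooth_phi i
  have hN : MSmooth W N := fun a _ => h.smooth_grad a
  have he : ∀ i, MSmooth W (e i) := fun i a _ => by
    by_cases hai : a = i
    · simpa [e, hai] using hφ
    · simpa [e, hai] using contDiffOn_const
  have h1 : ∀ i, Set.EqOn (matD i N) (fun z => e i z - chrMat g i z * N z) W := by
    intro i z hz
    ext a u
    have := h.partialD_grad hz i a
    simpa [matD, N, e, Matrix.mul_apply] using this
  have h2 : ∀ i l, matD i (matD l N) x = matD i (e l) x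
      - (matD i (chrMat g l) x * N x + chrMat g l x * (e i x - chrMat g i x * N x)) := by
    intro i l
    rw [matD_congr hW (h1 l) hx, matD_sub hW (he l) ((h.chrMat_smooth l).mul hN) hx,
      matD_mul hW (h.chrMat_smooth l) hN hx, h1 i hx]
  have h3 := matD_comm hW hN hx i l
  rw [h2, h2] at h3
  have h4 := congrFun (congrFun h3 a) ()
  have h5 : ∀ i l, (chrMat g l x * e i x) a () = φ x * chrMat g l x a i := by
    intro i l
    simp [e, Matrix.mul_apply, mul_comm]
  have h6 : ∀ i l, matD i (e l) x a () = if a = l then partialD i φ x else 0 := by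
    intro i l
    by_cases hal : a = l
    · simp [matD, e, hal]
    · simp [matD, e, hal]
  have h7 : ∑ b, riem g i l x a b * grad g r b x = (riem g i l x * N x) a () := by
    simp [Matrix.mul_apply, N]
  rw [h7]
  simp only [riem, Matrix.add_mul, Matrix.sub_mul, Matrix.add_apply, Matrix.sub_apply,
    Matrix.mul_assoc]
  simp only [Matrix.mul_sub, Matrix.add_apply, Matrix.sub_apply, h5, h6] at h4
  have h8 := h.chrMat_symm hx l a i
  rw [h8] at h4
  linarith

/-- g(R(∂_i, ∂_l)N, N) vanishes by skew symmetry, and the Ricci identity evaluates it in terms of dφ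
and dr. -/
theorem partialD_phi_wedge {x : Coord k} (hx : x ∈ W) (i l : Fin k) :
    partialD i φ x * partialD l r x = partialD l φ x * partialD i r x := by
  set n : Fin k → ℝ := fun a => grad g r a x
  set G := g x * riem g i l x
  have h1 : G.transpose = - G := by
    have := h.riem_antisymm hx i l
    rw [Matrix.transpose_mul, h.transpose hx]
    exact eq_neg_of_add_eq_zero_left this
  have h2 : n ⬝ᵥ G.mulVec n = 0 := by
    have : n ⬝ᵥ G.mulVec n = - (n ⬝ᵥ G.mulVec n) := by
      conv_lhs => rw [Matrix.dotProduct_mulVec, ← Matrix.mulVec_transpose, h1, Matrix.neg_mulVec,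
        neg_dotProduct, dotProduct_comm]
    linarith
  have h3 : (riem g i l x).mulVec n
      = fun a => (if a = l then partialD i φ x else 0) - (if a = i then partialD l φ x else 0) :=
    funext fun a => h.riem_grad hx i l a
  have h4 : ∀ a, G.mulVec n a = partialD i φ x * g x a l - partialD l φ x * g x a i := by
    intro a
    rw [← Matrix.mulVec_mulVec, h3]
    simp [Matrix.mulVec, dotProduct, mul_sub, mul_comm]
  have h5 : ∀ l, ∑ a, n a * g x a l = partialD l r x := by
    intro l
    rw [← h.sum_mul_grad hx l]
    exact Finset.sum_congr rfl fun a _ => by rw [h.symm hx a l, mul_comm]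
  simp only [dotProduct, h4, mul_sub, Finset.sum_sub_distrib] at h2
  have h6 : ∀ (c : ℝ) l, ∑ a, n a * (c * g x a l) = c * partialD l r x := by
    intro c l
    rw [← h5 l, Finset.mul_sum]
    exact Finset.sum_congr rfl fun a _ => by ring
  rw [h6, h6] at h2
  linarith

/-- Contracting dφ ∧ dr = 0 with N. Off the critical points this is dφ = σ dr with σ = N(φ)/‖N‖². -/
theorem partialD_phi_mul {x : Coord k} (hx : x ∈ W) (i : Fin k) :
    partialD i φ x * gradSq g r x = dGrad g r φ x * partialD i r x := by
  simp only [gradSq, dGrad, Finset.mul_sum, Finset.sum_mul]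
  refine Finset.sum_congr rfl fun a _ => ?_
  linear_combination grad g r a x * h.partialD_phi_wedge hx i a

/-- The off-critical part of the domain. -/
theorem isOpen_regular : IsOpen {x ∈ W | gradSq g r x ≠ 0} :=
  h.smooth_gradSq.continuousOn.isOpen_inter_preimage h.isOpen isOpen_ne

theorem smooth_dGrad_phi (i : Fin k) : ContDiffOn ℝ ∞ (dGrad g r φ) W :=
  ContDiffOn.sum fun c _ => (h.smooth_grad c).mul
    (contDiffOn_partialD h.isOpen (h.smooth_phi i) c)

/-- `dφ = σ dr`, and `dσ` is proportional to `dr` too. -/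
theorem partialD_sigma {x : Coord k} (hx : x ∈ W) (hH : gradSq g r x ≠ 0) (i : Fin k) :
    gradSq g r x * partialD i (fun z => dGrad g r φ z / gradSq g r z) x
      = dGrad g r (fun z => dGrad g r φ z / gradSq g r z) x * partialD i r x := by
  set σ : Coord k → ℝ := fun z => dGrad g r φ z / gradSq g r z
  have hO := h.isOpen_regular
  have hxO : x ∈ {x ∈ W | gradSq g r x ≠ 0} := ⟨hx, hH⟩
  have hσ : ContDiffOn ℝ ∞ σ {x ∈ W | gradSq g r x ≠ 0} :=
    ((h.smooth_dGrad_phi i).mono fun _ hz => hz.1).div (h.smooth_gradSq.mono fun _ hz => hz.1)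
      fun _ hz => hz.2
  have hσd := differentiableAt_of_contDiffOn hO hσ hxO
  have e : ∀ j, Set.EqOn (partialD j φ) (fun z => σ z * partialD j r z)
      {x ∈ W | gradSq g r x ≠ 0} := by
    intro j z hz
    have := h.partialD_phi_mul hz.1 j
    simp only [σ]
    rw [div_mul_eq_mul_div, eq_div_iff hz.2, this]
  -- The symmetry of the second derivatives of φ, with dφ = σ dr, is dσ ∧ dr = 0.
  have w : ∀ j, partialD i σ x * partialD j r x = partialD j σ x * partialD i r x := by
    intro j
    have h1 := partialD_comm h.isOpen (h.smooth_phi i) hx i j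
    have hrd : ∀ b, DifferentiableAt ℝ (partialD b r) x := fun b =>
      differentiableAt_of_contDiffOn h.isOpen (h.smooth_partialD b) hx
    rw [partialD_congr_of_eqOn hO hxO i (e j), partialD_congr_of_eqOn hO hxO j (e i),
      partialD_mul i hσd (hrd j), partialD_mul j hσd (hrd i),
      partialD_comm h.isOpen h.smooth_fun hx i j] at h1
    linarith
  simp only [gradSq, dGrad, Finset.sum_mul]
  refine Finset.sum_congr rfl fun a _ => ?_
  have := w a
  linear_combination grad g r a x * this

/-- The pair symmetry and the Ricci identity determine `R(·, grad r)`. -/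
theorem sum_grad_riem {x : Coord k} (hx : x ∈ W) (hH : gradSq g r x ≠ 0) (l a b : Fin k) :
    ∑ c, grad g r c x * riem g l c x a b = dGrad g r φ x / gradSq g r x *
      (grad g r a x * g x l b - if a = l then partialD b r x else 0) := by
  set σ := dGrad g r φ x / gradSq g r x
  have hσ : ∀ j, partialD j φ x = σ * partialD j r x := fun j => by
    have := h.partialD_phi_mul hx j
    simp only [σ]
    rw [div_mul_eq_mul_div, eq_div_iff hH, this]
  have key := h.eq_of_sum_mul_eq hx (u := fun a => ∑ c, grad g r c x * riem g l c x a b)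
    (v := fun a => σ * (grad g r a x * g x l b - if a = l then partialD b r x else 0)) (by
      intro a
      have h1 : ∑ d, g x a d * ∑ c, grad g r c x * riem g l c x d b
          = ∑ c, grad g r c x * (g x * riem g l c x) a b := by
        simp only [Matrix.mul_apply, Finset.mul_sum]
        rw [Finset.sum_comm]
        exact Finset.sum_congr rfl fun c _ => Finset.sum_congr rfl fun d _ => by ring
      have h2 : ∑ c, grad g r c x * (g x * riem g a b x) l c
          = ∑ d, g x l d * ∑ c, riem g a b x d c * grad g r c x := by
        simp only [Matrix.mul_apply, Finset.mul_sum]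
        rw [Finset.sum_comm]
        exact Finset.sum_congr rfl fun c _ => Finset.sum_congr rfl fun d _ => by ring
      rw [h1]
      simp only [h.riem_pair_symm hx a b l]
      rw [h2]
      simp only [h.riem_grad hx, mul_sub, mul_ite, mul_zero, Finset.sum_sub_distrib,
        Finset.sum_ite_eq', Finset.mem_univ, if_true, hσ]
      have h3 : ∑ d, g x a d * (σ * (grad g r d x * g x l b)) = σ * partialD a r x * g x l b := by
        rw [← h.sum_mul_grad hx a, Finset.mul_sum, Finset.sum_mul]
        exact Finset.sum_congr rfl fun d _ => by ring
      rw [h3, h.symm hx l a]; ring)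
  exact congrFun key a

/-- By the symmetry of Γ, Q is also the Christoffel part of ∇N, so that ∂N = φ Id − Q. -/
theorem gradChr_apply' {x : Coord k} (hx : x ∈ W) (a b : Fin k) :
    gradChr g r x a b = ∑ c, chrMat g b x a c * grad g r c x := by
  rw [gradChr_apply]
  exact Finset.sum_congr rfl fun c _ => by rw [h.chrMat_symm hx c a b, mul_comm]

/-- ∇_N g = 0 in coordinates. The next two lemmas say likewise ∇_N N = φN and ∇_N dr = φ dr. -/
theorem dGrad_metric {x : Coord k} (hx : x ∈ W) (a b : Fin k) :
    dGrad g r (fun z => g z a b) x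
      = ∑ c, gradChr g r x c a * g x c b + ∑ c, g x a c * gradChr g r x c b := by
  simp only [dGrad, h.partialD_metric hx, gradChr_apply, mul_add, Finset.sum_add_distrib,
    Finset.mul_sum, Finset.sum_mul]
  congr 1
  · rw [Finset.sum_comm]
    exact Finset.sum_congr rfl fun c _ => Finset.sum_congr rfl fun d _ => by ring
  · rw [Finset.sum_comm]
    exact Finset.sum_congr rfl fun c _ => Finset.sum_congr rfl fun d _ => by ring

theorem dGrad_grad {x : Coord k} (hx : x ∈ W) (a : Fin k) :
    dGrad g r (grad g r a) x = φ x * grad g r a x - ∑ b, gradChr g r x a b * grad g r b x := by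
  simp only [dGrad, h.partialD_grad hx, gradChr_apply, mul_sub, Finset.sum_sub_distrib,
    mul_ite, mul_zero, Finset.sum_ite_eq, Finset.mem_univ, if_true, Finset.mul_sum,
    Finset.sum_mul]
  rw [mul_comm]
  congr 1
  rw [Finset.sum_comm]
  exact Finset.sum_congr rfl fun c _ => Finset.sum_congr rfl fun d _ => by ring

theorem dGrad_partialD {x : Coord k} (hx : x ∈ W) (a : Fin k) :
    dGrad g r (partialD a r) x = φ x * partialD a r x + ∑ b, gradChr g r x b a * partialD b r x := by
  have h1 : ∀ c, partialD c (partialD a r) x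
      = ∑ j, chrMat g c x j a * partialD j r x + φ x * g x a c := by
    intro c
    rw [h.hess x hx c a, h.symm hx c a]
    congr 1
    exact Finset.sum_congr rfl fun j _ => by rw [h.chrMat_symm hx]
  simp only [dGrad, h1, gradChr_apply, mul_add, Finset.sum_add_distrib]
  rw [add_comm]
  congr 1
  · rw [← h.sum_mul_grad hx a, Finset.mul_sum]
    exact Finset.sum_congr rfl fun c _ => by ring
  · simp only [Finset.mul_sum, Finset.sum_mul]
    rw [Finset.sum_comm]
    exact Finset.sum_congr rfl fun c _ => Finset.sum_congr rfl fun d _ => by ring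

theorem dGrad_gradSq {x : Coord k} (hx : x ∈ W) :
    dGrad g r (gradSq g r) x = 2 * φ x * gradSq g r x := by
  simp only [dGrad, h.partialD_gradSq hx, gradSq, Finset.mul_sum]
  exact Finset.sum_congr rfl fun c _ => by ring

end IsHess

end HessianEquation

end FinslerGeom

namespace FinslerGeom

/-! ### The defect tensor is parallel along the gradient. -/

section Defect

variable {k : ℕ}

theorem endAct_apply (Q : Matrix (Fin k) (Fin k) ℝ)
    (T : Fin k → Fin k → Matrix (Fin k) (Fin k) ℝ) (i l a b : Fin k) :
    endAct Q T i l a b = ∑ c, T i l a c * Q c b - ∑ c, Q a c * T i l c b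
      + ∑ c, Q c i * T c l a b + ∑ c, Q c l * T i c a b := by
  simp [endAct, Matrix.mul_apply, Matrix.sum_apply]

namespace IsHess

variable {W : Set (Coord k)} {g : Coord k → Matrix (Fin k) (Fin k) ℝ} {r φ : Coord k → ℝ}
  (h : IsHess W g r φ)
include h

theorem roundCurv_smooth (i l : Fin k) : MSmooth W (roundCurv g i l) := fun a b => by
  refine ContDiffOn.sub ?_ ?_
  · split_ifs
    · exact h.smooth l b
    · exact contDiffOn_const
  · split_ifs
    · exact h.smooth i b
    · exact contDiffOn_const

theorem mixedCurv_smooth (i l : Fin k) : MSmooth W (mixedCurv g r i l) := fun a b => by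
  refine (ContDiffOn.sub ?_ ?_).add ((h.smooth_grad a).mul
    (((h.smooth_partialD i).mul (h.smooth l b)).sub ((h.smooth_partialD l).mul (h.smooth i b))))
  · split_ifs
    · exact (h.smooth_partialD l).mul (h.smooth_partialD b)
    · exact contDiffOn_const
  · split_ifs
    · exact (h.smooth_partialD i).mul (h.smooth_partialD b)
    · exact contDiffOn_const

theorem defect_smooth (κ : ℝ) (i l : Fin k) :
    MSmooth {x ∈ W | gradSq g r x ≠ 0} (defect g r φ κ i l) := fun a b => by
  have hs : {x ∈ W | gradSq g r x ≠ 0} ⊆ W := fun _ hx => hx.1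
  have hφ := h.smooth_phi i
  refine ContDiffOn.add (ContDiffOn.sub ?_ ?_) ?_
  · exact (h.smooth_gradSq.mul (h.riem_smooth i l a b)).mono hs
  · exact ((contDiffOn_const.sub (hφ.pow 2)).mul (h.roundCurv_smooth i l a b)).mono hs
  · exact ContDiffOn.mul ((((contDiffOn_const.sub (hφ.pow 2)).add (h.smooth_dGrad_phi i)).mono
      hs).div (h.smooth_gradSq.mono hs) fun x hx => hx.2) ((h.mixedCurv_smooth i l a b).mono hs)

/-- A tensor made of g and the identity is parallel; equality with `endAct` of Q is the coordinate
form of ∇_N T = 0. -/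
theorem dGrad_roundCurv {x : Coord k} (hx : x ∈ W) (i l a b : Fin k) :
    dGrad g r (fun z => roundCurv g i l z a b) x
      = endAct (gradChr g r x) (fun i l => roundCurv g i l x) i l a b := by
  have hgd : ∀ a b, DifferentiableAt ℝ (fun z => g z a b) x := fun a b =>
    differentiableAt_of_contDiffOn h.isOpen (h.smooth a b) hx
  have hd : ∀ (p : Prop) [Decidable p] a b,
      DifferentiableAt ℝ (fun z => if p then g z a b else 0) x := by
    intro p _ a b
    split_ifs
    · exact hgd a b
    · exact differentiableAt_const _
  simp only [roundCurv, Matrix.of_apply, endAct_apply]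
  rw [dGrad_sub (hd _ _ _) (hd _ _ _), dGrad_ite, dGrad_ite, h.dGrad_metric hx,
    h.dGrad_metric hx]
  simp only [mul_sub, sub_mul, Finset.sum_sub_distrib, ite_mul, mul_ite, zero_mul, mul_zero,
    Finset.sum_ite_irrel, Finset.sum_const_zero, Finset.sum_ite_eq, Finset.sum_ite_eq',
    Finset.mem_univ, if_true]
  split_ifs <;> ring

/-- Every term contains two factors among N and dr, each reproduced by ∇_N with the factor φ,
besides g and the identity, which are parallel. Hence ∇_N of this tensor is 2φ times it. -/
theorem dGrad_mixedCurv {x : Coord k} (hx : x ∈ W) (i l a b : Fin k) :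
    dGrad g r (fun z => mixedCurv g r i l z a b) x
      = endAct (gradChr g r x) (fun i l => mixedCurv g r i l x) i l a b
        + 2 * φ x * mixedCurv g r i l x a b := by
  have hgd : ∀ a b, DifferentiableAt ℝ (fun z => g z a b) x := fun a b =>
    differentiableAt_of_contDiffOn h.isOpen (h.smooth a b) hx
  have hrd : ∀ b, DifferentiableAt ℝ (partialD b r) x := fun b =>
    differentiableAt_of_contDiffOn h.isOpen (h.smooth_partialD b) hx
  have hnd : ∀ b, DifferentiableAt ℝ (grad g r b) x := fun b =>
    differentiableAt_of_contDiffOn h.isOpen (h.smooth_grad b) hx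
  have hd : ∀ (p : Prop) [Decidable p] a b,
      DifferentiableAt ℝ (fun z => if p then partialD a r z * partialD b r z else 0) x := by
    intro p _ a b
    split_ifs
    · exact (hrd a).fun_mul (hrd b)
    · exact differentiableAt_const _
  simp only [mixedCurv, Matrix.of_apply, endAct_apply]
  rw [dGrad_add ((hd _ _ _).fun_sub (hd _ _ _)) ((hnd a).fun_mul (((hrd i).fun_mul (hgd l b)).fun_sub
      ((hrd l).fun_mul (hgd i b)))), dGrad_sub (hd _ _ _) (hd _ _ _), dGrad_ite, dGrad_ite,
    dGrad_mul (hnd a) (((hrd i).fun_mul (hgd l b)).fun_sub ((hrd l).fun_mul (hgd i b))),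
    dGrad_sub ((hrd i).fun_mul (hgd l b)) ((hrd l).fun_mul (hgd i b)),
    dGrad_mul (hrd _) (hrd _), dGrad_mul (hrd _) (hrd _), dGrad_mul (hrd _) (hgd _ _),
    dGrad_mul (hrd _) (hgd _ _), h.dGrad_metric hx, h.dGrad_metric hx, h.dGrad_grad hx,
    h.dGrad_partialD hx, h.dGrad_partialD hx, h.dGrad_partialD hx]
  set Q := gradChr g r x
  have s1 : ∀ u v : ℝ, ∑ c, grad g r a x * (u * g x l c - v * g x i c) * Q c b
      = grad g r a x * (u * ∑ c, g x l c * Q c b - v * ∑ c, g x i c * Q c b) := by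
    intro u v
    simp only [Finset.mul_sum, ← Finset.sum_sub_distrib]
    exact Finset.sum_congr rfl fun c _ => by ring
  have s2 : ∀ u : ℝ, ∑ c, Q a c * (grad g r c x * u) = u * ∑ c, Q a c * grad g r c x := by
    intro u
    rw [Finset.mul_sum]
    exact Finset.sum_congr rfl fun c _ => by ring
  have s3 : ∀ j l : Fin k, ∀ u : ℝ, ∑ c, Q c j * (grad g r a x * (partialD c r x * g x l b
      - u * g x c b)) = grad g r a x * (g x l b * ∑ c, Q c j * partialD c r x
        - u * ∑ c, Q c j * g x c b) := by
    intro j l u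
    simp only [Finset.mul_sum, ← Finset.sum_sub_distrib]
    exact Finset.sum_congr rfl fun c _ => by ring
  have s4 : ∀ j l : Fin k, ∀ u : ℝ, ∑ c, Q c j * (grad g r a x * (u * g x c b
      - partialD c r x * g x l b)) = grad g r a x * (u * ∑ c, Q c j * g x c b
        - g x l b * ∑ c, Q c j * partialD c r x) := by
    intro j l u
    simp only [Finset.mul_sum, ← Finset.sum_sub_distrib]
    exact Finset.sum_congr rfl fun c _ => by ring
  have s5 : ∀ u : ℝ, ∑ c, u * partialD c r x * Q c b = u * ∑ c, Q c b * partialD c r x := by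
    intro u
    rw [Finset.mul_sum]
    exact Finset.sum_congr rfl fun c _ => by ring
  have s6 : ∀ (j : Fin k) (u : ℝ), ∑ c, Q c j * (partialD c r x * u)
      = (∑ c, Q c j * partialD c r x) * u := by
    intro j u
    rw [Finset.sum_mul]
    exact Finset.sum_congr rfl fun c _ => by ring
  simp only [mul_add, add_mul, Finset.sum_add_distrib, s1, s2, s3, s4]
  simp only [mul_sub, sub_mul, Finset.sum_sub_distrib, ite_mul, mul_ite, zero_mul, mul_zero,
    Finset.sum_ite_irrel, Finset.sum_const_zero, Finset.sum_ite_eq, Finset.sum_ite_eq',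
    Finset.mem_univ, if_true, s5, s6]
  split_ifs <;> ring

/-- The curvature is parallel along the gradient, up to explicit terms. -/
theorem dGrad_riem {x : Coord k} (hx : x ∈ W) (hH : gradSq g r x ≠ 0) (i l a b : Fin k) :
    gradSq g r x * dGrad g r (fun z => riem g i l z a b) x
      = gradSq g r x * endAct (gradChr g r x) (fun i l => riem g i l x) i l a b
        - 2 * φ x * gradSq g r x * riem g i l x a b
        - dGrad g r (fun z => dGrad g r φ z / gradSq g r z) x * mixedCurv g r i l x a b
        - 2 * φ x * dGrad g r φ x * roundCurv g i l x a b := by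
  have hW := h.isOpen
  set σ : Coord k → ℝ := fun z => dGrad g r φ z / gradSq g r z
  have hO := h.isOpen_regular
  have hxO : x ∈ {x ∈ W | gradSq g r x ≠ 0} := ⟨hx, hH⟩
  have hσd : DifferentiableAt ℝ σ x := differentiableAt_of_contDiffOn hO
    (((h.smooth_dGrad_phi i).mono fun _ hz => hz.1).div (h.smooth_gradSq.mono fun _ hz => hz.1)
      fun _ hz => hz.2) hxO
  have hgd : ∀ a b, DifferentiableAt ℝ (fun z => g z a b) x := fun a b =>
    differentiableAt_of_contDiffOn hW (h.smooth a b) hx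
  have hrd : ∀ b, DifferentiableAt ℝ (partialD b r) x := fun b =>
    differentiableAt_of_contDiffOn hW (h.smooth_partialD b) hx
  have hnd : ∀ b, DifferentiableAt ℝ (grad g r b) x := fun b =>
    differentiableAt_of_contDiffOn hW (h.smooth_grad b) hx
  have hRd : ∀ i l, ∀ a b, DifferentiableAt ℝ (fun z => riem g i l z a b) x := fun i l a b =>
    (h.riem_smooth i l).differentiableAt hW hx a b
  set Q := gradChr g r x
  -- M_l = R(∂_l, N) is known explicitly off the critical points, and so are its covariant
  -- derivatives. Contracting the second Bianchi identity with N expresses ∇_N R through them.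
  set M : Fin k → Coord k → Matrix (Fin k) (Fin k) ℝ := fun l z =>
    ∑ c, grad g r c z • riem g l c z
  have hM : ∀ l a b z, M l z a b = ∑ c, grad g r c z * riem g l c z a b := fun l a b z => by
    simp [M, Matrix.sum_apply]
  have hM' : ∀ l a b, ∀ z ∈ {x ∈ W | gradSq g r x ≠ 0}, M l z a b
      = σ z * (grad g r a z * g z l b - if a = l then partialD b r z else 0) := fun l a b z hz => by
    rw [hM, h.sum_grad_riem hz.1 hz.2]
  -- contraction of one cyclic term of the second Bianchi identity
  have t1 : ∀ i l, ∑ c, grad g r c x * (matD i (riem g l c) x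
      + (chrMat g i x * riem g l c x - riem g l c x * chrMat g i x)) a b
      = (matD i (M l) x + (chrMat g i x * M l x - M l x * chrMat g i x)) a b
        - φ x * riem g l i x a b + ∑ c, Q c i * riem g l c x a b := by
    intro i l
    have e1 : matD i (M l) x a b = ∑ c, partialD i (grad g r c) x * riem g l c x a b
        + ∑ c, grad g r c x * matD i (riem g l c) x a b := by
      have : (fun z => M l z a b) = fun z => ∑ c, grad g r c z * riem g l c z a b :=
        funext fun z => hM l a b z
      simp only [matD, Matrix.of_apply, this]
      rw [partialD_sum _ _ fun c _ => (hnd c).fun_mul (hRd l c a b), ← Finset.sum_add_distrib]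
      exact Finset.sum_congr rfl fun c _ => partialD_mul i (hnd c) (hRd l c a b)
    have e2 : ∑ c, partialD i (grad g r c) x * riem g l c x a b
        = φ x * riem g l i x a b - ∑ c, Q c i * riem g l c x a b := by
      simp only [h.partialD_grad hx, ← h.gradChr_apply' hx, sub_mul, Finset.sum_sub_distrib,
        ite_mul, zero_mul, Finset.sum_ite_eq', Finset.mem_univ, if_true, Q]
    have e3 : (chrMat g i x * M l x - M l x * chrMat g i x) a b = ∑ c, grad g r c x *
        (chrMat g i x * riem g l c x - riem g l c x * chrMat g i x) a b := by
      simp only [M, Finset.mul_sum, Finset.sum_mul, Matrix.mul_smul, Matrix.smul_mul,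
        ← Finset.sum_sub_distrib, ← smul_sub, Matrix.sum_apply, Matrix.smul_apply, smul_eq_mul]
    simp only [Matrix.add_apply, mul_add, Finset.sum_add_distrib]
    rw [e1, e2, e3]; ring
  have t2 : ∑ c, grad g r c x * (matD c (riem g i l) x
      + (chrMat g c x * riem g i l x - riem g i l x * chrMat g c x)) a b
      = dGrad g r (fun z => riem g i l z a b) x + (Q * riem g i l x - riem g i l x * Q) a b := by
    simp only [Matrix.add_apply, mul_add, Finset.sum_add_distrib]
    congr 1
    simp only [Q, gradChr, Finset.mul_sum, Finset.sum_mul, Matrix.mul_smul, Matrix.smul_mul,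
        ← Finset.sum_sub_distrib, ← smul_sub, Matrix.sum_apply, Matrix.smul_apply, smul_eq_mul]
  have t3 : ∑ c, grad g r c x * (matD l (riem g c i) x
      + (chrMat g l x * riem g c i x - riem g c i x * chrMat g l x)) a b
      = - ∑ c, grad g r c x * (matD l (riem g i c) x
      + (chrMat g l x * riem g i c x - riem g i c x * chrMat g l x)) a b := by
    rw [← Finset.sum_neg_distrib]
    refine Finset.sum_congr rfl fun c _ => ?_
    have e1 : matD l (riem g c i) x = - matD l (riem g i c) x := by
      have : riem g c i = fun z => - riem g i c z := funext fun z => riem_swap g i c z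
      ext a b
      simp only [matD, this, Matrix.of_apply, Matrix.neg_apply]
      exact partialD_neg _ _ _
    rw [e1, riem_swap g i c]
    simp only [Matrix.add_apply, Matrix.sub_apply, Matrix.mul_neg, Matrix.neg_mul,
      Matrix.neg_apply]
    ring
  have t4 : (dGrad g r (fun z => riem g i l z a b) x
      + (Q * riem g i l x - riem g i l x * Q) a b)
      + ((matD i (M l) x + (chrMat g i x * M l x - M l x * chrMat g i x)) a b
        - φ x * riem g l i x a b + ∑ c, Q c i * riem g l c x a b)
      - ((matD l (M i) x + (chrMat g l x * M i x - M i x * chrMat g l x)) a b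
        - φ x * riem g i l x a b + ∑ c, Q c l * riem g i c x a b) = 0 := by
    rw [← t1, ← t1, ← t2, sub_eq_add_neg, ← t3, ← Finset.sum_add_distrib, ← Finset.sum_add_distrib]
    refine Finset.sum_eq_zero fun c _ => ?_
    have := congrFun (congrFun (h.bianchi_second hx c i l) a) b
    simp only [Matrix.add_apply, Matrix.zero_apply] at this ⊢
    linear_combination grad g r c x * this
  have t5 : ∀ i l, (matD i (M l) x + (chrMat g i x * M l x - M l x * chrMat g i x)) a b
      = partialD i σ x * (grad g r a x * g x l b - if a = l then partialD b r x else 0)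
        + σ x * ((if a = i then φ x * g x l b else 0)
          + grad g r a x * ∑ c, chrMat g i x c l * g x c b
          - (if a = l then φ x * g x i b else 0) - chrMat g i x a l * partialD b r x) := by
    intro i l
    have hid : DifferentiableAt ℝ (fun z => if a = l then partialD b r z else 0) x := by
      split_ifs
      · exact hrd b
      · exact differentiableAt_const _
    have e0 : partialD i (fun z => if a = l then partialD b r z else 0) x
        = if a = l then partialD i (partialD b r) x else 0 := by
      split_ifs
      · rfl
      · exact partialD_const _ _ _
    have e1 : matD i (M l) x a b
        = partialD i σ x * (grad g r a x * g x l b - if a = l then partialD b r x else 0)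
        + σ x * ((((if a = i then φ x else 0) - ∑ b, chrMat g i x a b * grad g r b x) * g x l b
          + grad g r a x * (∑ c, chrMat g i x c l * g x c b + ∑ c, g x l c * chrMat g i x c b))
          - if a = l then (∑ j, chrMat g i x j b * partialD j r x + φ x * g x i b) else 0) := by
      have : matD i (M l) x a b = partialD i (fun z => σ z * (grad g r a z * g z l b
          - if a = l then partialD b r z else 0)) x :=
        partialD_congr_of_eqOn hO hxO i fun z hz => hM' l a b z hz
      rw [this, partialD_mul i hσd (((hnd a).fun_mul (hgd l b)).fun_sub hid),
        partialD_sub i ((hnd a).fun_mul (hgd l b)) hid, partialD_mul i (hnd a) (hgd l b), e0,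
        h.partialD_grad hx, h.partialD_metric hx, h.hess x hx i b]
      have : ∑ j, chrMat g b x j i * partialD j r x = ∑ j, chrMat g i x j b * partialD j r x :=
        Finset.sum_congr rfl fun j _ => by rw [h.chrMat_symm hx]
      rw [this]
    have e2 : (chrMat g i x * M l x) a b = σ x * ((∑ b, chrMat g i x a b * grad g r b x) * g x l b
        - chrMat g i x a l * partialD b r x) := by
      simp only [Matrix.mul_apply, hM' l _ b x hxO]
      have : ∀ c, chrMat g i x a c * (σ x * (grad g r c x * g x l b
          - if c = l then partialD b r x else 0)) = σ x * (chrMat g i x a c * grad g r c x * g x l b)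
          - if c = l then σ x * (chrMat g i x a c * partialD b r x) else 0 := by
        intro c; split_ifs <;> ring
      simp only [this, Finset.sum_sub_distrib, Finset.sum_ite_eq', Finset.mem_univ, if_true]
      rw [← Finset.mul_sum, Finset.sum_mul]; ring
    have e3 : (M l x * chrMat g i x) a b = σ x * (grad g r a x * ∑ c, g x l c * chrMat g i x c b
        - if a = l then ∑ j, chrMat g i x j b * partialD j r x else 0) := by
      simp only [Matrix.mul_apply, hM' l a _ x hxO]
      by_cases hal : a = l
      · simp only [hal, if_true, Finset.mul_sum, ← Finset.sum_sub_distrib]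
        exact Finset.sum_congr rfl fun c _ => by ring
      · simp only [hal, if_false, sub_zero, Finset.mul_sum]
        exact Finset.sum_congr rfl fun c _ => by ring
    simp only [Matrix.add_apply, Matrix.sub_apply]
    rw [e1, e2, e3]
    split_ifs <;> ring
  have t6 : ∑ c, chrMat g l x c i * g x c b = ∑ c, chrMat g i x c l * g x c b :=
    Finset.sum_congr rfl fun c _ => by rw [h.chrMat_symm hx]
  rw [t5, t5, t6, h.chrMat_symm hx l a i, riem_swap g i l] at t4
  have hσi := h.partialD_sigma hx hH i
  have hσl := h.partialD_sigma hx hH l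
  have t7 : ∑ c, Q c i * riem g l c x a b = - ∑ c, Q c i * riem g c l x a b := by
    rw [← Finset.sum_neg_distrib]
    exact Finset.sum_congr rfl fun c _ => by rw [riem_swap g c l]; simp
  have hHσ : gradSq g r x * σ x = dGrad g r φ x := by simp only [σ]; field_simp
  rw [t7] at t4
  change gradSq g r x * partialD i σ x = dGrad g r σ x * _ at hσi
  change gradSq g r x * partialD l σ x = dGrad g r σ x * _ at hσl
  clear_value σ
  -- Kronecker deltas become scalars, so that the remaining identity is a linear combination of
  -- known ones.
  have hδ : ∀ j : Fin k, ∃ δ : ℝ, ∀ u : ℝ, (if a = j then u else 0) = δ * u := fun j =>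
    ⟨if a = j then 1 else 0, fun u => by split_ifs <;> simp⟩
  obtain ⟨δi, hδi⟩ := hδ i
  obtain ⟨δl, hδl⟩ := hδ l
  simp only [endAct, Matrix.add_apply, Matrix.sub_apply, Matrix.sum_apply, Matrix.smul_apply,
    smul_eq_mul, mixedCurv, roundCurv, Matrix.of_apply, Matrix.neg_apply, hδi, hδl] at t4 ⊢
  linear_combination gradSq g r x * t4
    - (grad g r a x * g x l b - δl * partialD b r x) * hσi
    + (grad g r a x * g x i b - δi * partialD b r x) * hσl
    - 2 * φ x * (δi * g x l b - δl * g x i b) * hHσ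

/-- The defect tensor is parallel along the gradient. -/
theorem dGrad_defect {x : Coord k} (hx : x ∈ W) (hH : gradSq g r x ≠ 0) (κ : ℝ) (i l a b : Fin k) :
    dGrad g r (fun z => defect g r φ κ i l z a b) x
      = endAct (gradChr g r x) (fun i l => defect g r φ κ i l x) i l a b := by
  have hW := h.isOpen
  have hO := h.isOpen_regular
  have hxO : x ∈ {x ∈ W | gradSq g r x ≠ 0} := ⟨hx, hH⟩
  set σ : Coord k → ℝ := fun z => dGrad g r φ z / gradSq g r z
  have hσd : DifferentiableAt ℝ σ x := differentiableAt_of_contDiffOn hO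
    (((h.smooth_dGrad_phi i).mono fun _ hz => hz.1).div (h.smooth_gradSq.mono fun _ hz => hz.1)
      fun _ hz => hz.2) hxO
  have hHd := differentiableAt_of_contDiffOn hW h.smooth_gradSq hx
  have hφd := differentiableAt_of_contDiffOn hW (h.smooth_phi i) hx
  set ψ : Coord k → ℝ := fun z => κ - φ z * φ z
  have hψd : DifferentiableAt ℝ ψ x := (differentiableAt_const _).fun_sub (hφd.fun_mul hφd)
  set τ : Coord k → ℝ := fun z => ψ z / gradSq g r z + σ z
  have hτ1 : DifferentiableAt ℝ (fun z => ψ z / gradSq g r z) x := by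
    simpa only [div_eq_mul_inv] using hψd.fun_mul (hHd.fun_inv hH)
  have hτd : DifferentiableAt ℝ τ x := hτ1.fun_add hσd
  have hRd := (h.riem_smooth i l).differentiableAt hW hx a b
  have hAd := (h.roundCurv_smooth i l).differentiableAt hW hx a b
  have hBd := (h.mixedCurv_smooth i l).differentiableAt hW hx a b
  have eD : ∀ i l z, defect g r φ κ i l z = gradSq g r z • riem g i l z - ψ z • roundCurv g i l z
      + τ z • mixedCurv g r i l z := by
    intro i l z
    simp only [defect, ψ, τ, σ, add_div, pow_two]
  have eD' : (fun z => defect g r φ κ i l z a b) = fun z => gradSq g r z * riem g i l z a b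
      - ψ z * roundCurv g i l z a b + τ z * mixedCurv g r i l z a b := by
    funext z
    rw [eD]; simp
  have dψ : dGrad g r ψ x = - (2 * φ x * dGrad g r φ x) := by
    simp only [ψ]
    rw [dGrad_sub (differentiableAt_const _) (hφd.fun_mul hφd), dGrad_const, dGrad_mul hφd hφd]
    ring
  have dH := h.dGrad_gradSq hx
  -- τ = ψ/H + σ, with N(H) = 2φH and N(ψ) = −2φ N(φ) = −2φHσ. The term −2φτ cancels the factor 2φ
  -- by which the mixed tensor grows, and N(σ) cancels the one in `dGrad_riem`.
  have dτ : gradSq g r x * dGrad g r τ x = - (2 * φ x * gradSq g r x * τ x)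
      + gradSq g r x * dGrad g r σ x := by
    have e1 : dGrad g r ψ x = dGrad g r (fun z => ψ z / gradSq g r z) x * gradSq g r x
        + ψ x / gradSq g r x * dGrad g r (gradSq g r) x := by
      rw [← dGrad_mul hτ1 hHd]
      refine dGrad_congr hO hxO fun z hz => ?_
      have := hz.2
      field_simp
    have e2 : dGrad g r τ x = dGrad g r (fun z => ψ z / gradSq g r z) x + dGrad g r σ x :=
      dGrad_add hτ1 hσd
    rw [e2]
    rw [dψ, dH] at e1
    have e3 : σ x * gradSq g r x = dGrad g r φ x := by simp only [σ]; field_simp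
    simp only [τ]
    linear_combination -e1 + 2 * φ x * e3
  have dR := h.dGrad_riem hx hH i l a b
  have dA := h.dGrad_roundCurv hx i l a b
  have dB := h.dGrad_mixedCurv hx i l a b
  rw [eD', dGrad_add ((hHd.fun_mul hRd).fun_sub (hψd.fun_mul hAd)) (hτd.fun_mul hBd),
    dGrad_sub (hHd.fun_mul hRd) (hψd.fun_mul hAd), dGrad_mul hHd hRd, dGrad_mul hψd hAd,
    dGrad_mul hτd hBd]
  have hend : endAct (gradChr g r x) (fun i l => defect g r φ κ i l x) i l a b
      = gradSq g r x * endAct (gradChr g r x) (fun i l => riem g i l x) i l a b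
      - ψ x * endAct (gradChr g r x) (fun i l => roundCurv g i l x) i l a b
      + τ x * endAct (gradChr g r x) (fun i l => mixedCurv g r i l x) i l a b := by
    simp only [endAct_apply, eD, Matrix.add_apply, Matrix.sub_apply, Matrix.smul_apply,
      smul_eq_mul, mul_add, mul_sub, Finset.mul_sum, ← Finset.sum_add_distrib,
      ← Finset.sum_sub_distrib]
    exact Finset.sum_congr rfl fun c _ => by ring
  refine mul_left_cancel₀ hH ?_
  rw [hend, dH, dψ, dA, dB]
  change gradSq g r x * dGrad g r (fun z => riem g i l z a b) x = _
    - dGrad g r σ x * _ - _ at dR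
  linear_combination gradSq g r x * dR + mixedCurv g r i l x a b * dτ

end IsHess

end Defect

end FinslerGeom

namespace FinslerGeom

/-! ### The critical point is nondegenerate and a strict local extremum. -/

section NearCriticalPoint

variable {k : ℕ}

theorem exists_uniform_bound {E ι : Type*} [TopologicalSpace E] [Fintype ι] {f : ι → E → ℝ}
    {K : Set E} (hK : IsCompact K) (hf : ∀ i, ContinuousOn (f i) K) :
    ∃ C, 0 ≤ C ∧ ∀ i, ∀ x ∈ K, |f i x| ≤ C := by
  have h := fun i => hK.exists_bound_of_continuousOn (hf i)
  choose C hC using h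
  refine ⟨∑ i, |C i|, Finset.sum_nonneg fun i _ => abs_nonneg _, fun i x hx => ?_⟩
  exact (hC i x hx).trans ((le_abs_self _).trans
    (Finset.single_le_sum (f := fun i => |C i|) (fun j _ => abs_nonneg _) (Finset.mem_univ i)))

theorem abs_sum_le_of_forall_le {ι : Type*} [Fintype ι] {f : ι → ℝ} {c : ℝ} (hf : ∀ i, |f i| ≤ c) :
    |∑ i, f i| ≤ Fintype.card ι * c := by
  refine (Finset.abs_sum_le_sum_abs _ _).trans ?_
  refine (Finset.sum_le_sum fun i _ => hf i).trans ?_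
  simp

/-- The Cauchy-Schwarz inequality `v_a² ≤ G^{aa} G(v, v)`. -/
theorem sq_coord_le_of_posDef {G : Matrix (Fin k) (Fin k) ℝ} (hG : G.PosDef) (v : Fin k → ℝ)
    (a : Fin k) : v a ^ 2 ≤ G⁻¹ a a * (v ⬝ᵥ G.mulVec v) := by
  have hpos : 0 < G⁻¹ a a := hG.inv.diag_pos
  set e : Fin k → ℝ := fun b => G⁻¹ b a
  have hGT : G.transpose = G := by
    have := hG.isHermitian
    ext i j
    simpa using this.apply i j
  have he : G.mulVec e = Pi.single a 1 := by
    have h1 : G * G⁻¹ = 1 := Matrix.mul_nonsing_inv _ hG.det_pos.ne'.isUnit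
    ext i
    have := congrFun (congrFun h1 i) a
    rw [Matrix.one_apply] at this
    simpa [Matrix.mulVec, dotProduct, Matrix.mul_apply, e, Pi.single_apply] using this
  have key : ∀ s : ℝ, 0 ≤ v ⬝ᵥ G.mulVec v - 2 * s * v a + s ^ 2 * G⁻¹ a a := by
    intro s
    have h1 := hG.posSemidef.dotProduct_mulVec_nonneg (v - s • e)
    have h2 : e ⬝ᵥ G.mulVec v = v a := by
      rw [Matrix.dotProduct_mulVec, ← Matrix.mulVec_transpose, hGT, he]; simp
    have h3 : v ⬝ᵥ G.mulVec e = v a := by rw [he]; simp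
    have h4 : e ⬝ᵥ G.mulVec e = G⁻¹ a a := by rw [he]; simp [e]
    simp only [star_trivial, Matrix.mulVec_sub, Matrix.mulVec_smul, sub_dotProduct,
      dotProduct_sub, smul_dotProduct, dotProduct_smul, smul_eq_mul, h2, h3, h4] at h1
    linarith
  -- The value of s that minimises the quadratic polynomial.
  have h5 := key (v a / G⁻¹ a a)
  have h6 : v ⬝ᵥ G.mulVec v - 2 * (v a / G⁻¹ a a) * v a + (v a / G⁻¹ a a) ^ 2 * G⁻¹ a a
      = v ⬝ᵥ G.mulVec v - v a ^ 2 / G⁻¹ a a := by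
    field_simp; ring
  rw [h6, sub_nonneg, div_le_iff₀ hpos] at h5
  linarith

namespace IsHess

variable {W : Set (Coord k)} {g : Coord k → Matrix (Fin k) (Fin k) ℝ} {r φ : Coord k → ℝ}
  (h : IsHess W g r φ)
include h

theorem gradSq_eq_grad {x : Coord k} (hx : x ∈ W) :
    gradSq g r x = (fun a => grad g r a x) ⬝ᵥ (g x).mulVec fun a => grad g r a x := by
  have : (g x).mulVec (fun a => grad g r a x) = fun a => partialD a r x :=
    funext fun a => h.sum_mul_grad hx a
  rw [this]; rfl

theorem gradSq_nonneg {x : Coord k} (hx : x ∈ W) : 0 ≤ gradSq g r x := by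
  rw [h.gradSq_eq_grad hx]
  simpa using (h.posDef x hx).posSemidef.dotProduct_mulVec_nonneg fun a => grad g r a x

theorem grad_sq_le {x : Coord k} (hx : x ∈ W) (a : Fin k) :
    grad g r a x ^ 2 ≤ (g x)⁻¹ a a * gradSq g r x := by
  rw [h.gradSq_eq_grad hx]
  exact sq_coord_le_of_posDef (h.posDef x hx) (fun a => grad g r a x) a

theorem partialD_sq_le {x : Coord k} (hx : x ∈ W) (a : Fin k) :
    partialD a r x ^ 2 ≤ g x a a * gradSq g r x := by
  have h1 := sq_coord_le_of_posDef (h.posDef x hx).inv (fun a => partialD a r x) a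
  rw [Matrix.nonsing_inv_nonsing_inv _ (h.isUnit_det hx)] at h1
  refine h1.trans_eq ?_
  congr 1
  simp only [gradSq, dotProduct]
  exact Finset.sum_congr rfl fun b _ => by rw [mul_comm]; rfl

theorem gradSq_eq_zero_iff {x : Coord k} (hx : x ∈ W) :
    gradSq g r x = 0 ↔ ∀ a, partialD a r x = 0 := by
  constructor
  · intro h0 a
    have := h.partialD_sq_le hx a
    rw [h0, mul_zero] at this
    exact pow_eq_zero_iff (two_ne_zero) |>.1 (le_antisymm this (sq_nonneg _))
  · intro h0
    simp [gradSq, h0]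

/-- If φ vanished at x₀, the pair (N, φ) would solve a homogeneous linear differential equation on a
segment from x₀ with zero initial value: ∂N = φ Id − ΓN, and ∂φ is a curvature component applied to
N. Then N would vanish on the whole segment, against the uniqueness of the critical point. -/
theorem phi_ne_zero (hk : 2 ≤ k) {x₀ : Coord k} (hx₀ : x₀ ∈ W)
    (hcrit : ∀ x ∈ W, (∀ a, partialD a r x = 0) ↔ x = x₀) : φ x₀ ≠ 0 := by
  intro hφ0
  have hW := h.isOpen
  have i0 : Fin k := ⟨0, by omega⟩
  obtain ⟨ρ, hρ, hball⟩ := Metric.nhds_basis_closedBall.mem_iff.1 (hW.mem_nhds hx₀)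
  have hKc : IsCompact (Metric.closedBall x₀ ρ) := isCompact_closedBall _ _
  obtain ⟨C, hC0, hC⟩ := exists_uniform_bound
    (f := fun (p : Fin k × Fin k × Fin k) x => chrMat g p.1 x p.2.1 p.2.2) hKc
    fun p => ((h.chrMat_smooth p.1 p.2.1 p.2.2).continuousOn).mono hball
  obtain ⟨D, hD0, hD⟩ := exists_uniform_bound
    (f := fun (p : (Fin k × Fin k) × Fin k × Fin k) x => riem g p.1.1 p.1.2 x p.2.1 p.2.2) hKc
    fun p => ((h.riem_smooth p.1.1 p.1.2 p.2.1 p.2.2).continuousOn).mono hball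
  set w : Coord k := EuclideanSpace.single i0 ρ
  have hwn : ‖w‖ = ρ := by simp [w, abs_of_pos hρ]
  have hseg : ∀ t ∈ Set.Icc (0 : ℝ) 1, x₀ + t • w ∈ Metric.closedBall x₀ ρ := by
    intro t ht
    rw [Metric.mem_closedBall, dist_eq_norm, add_sub_cancel_left, norm_smul, hwn, Real.norm_eq_abs,
      abs_of_nonneg ht.1]
    nlinarith [ht.2]
  set f : ℝ → (Fin k → ℝ) × ℝ := fun t => (fun a => grad g r a (x₀ + t • w), φ (x₀ + t • w))
  set f' : ℝ → (Fin k → ℝ) × ℝ := fun t =>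
    (fun a => ∑ i, w i * partialD i (grad g r a) (x₀ + t • w), ∑ i, w i * partialD i φ (x₀ + t • w))
  have hf : ∀ t ∈ Set.Icc (0 : ℝ) 1, HasDerivAt f (f' t) t := by
    intro t ht
    have hxt := hball (hseg t ht)
    refine HasDerivAt.prodMk (hasDerivAt_pi.2 fun a => ?_) ?_
    · exact hasDerivAt_along_line (differentiableAt_of_contDiffOn hW (h.smooth_grad a) hxt)
    · exact hasDerivAt_along_line (differentiableAt_of_contDiffOn hW (h.smooth_phi i0) hxt)
  have hwi : ∀ i, |w i| ≤ ρ := fun i => by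
    rw [← hwn]; exact PiLp.norm_apply_le w i
  have hbound : ∀ t ∈ Set.Ico (0 : ℝ) 1,
      ‖f' t‖ ≤ (k * (ρ * (1 + k * C + k * D))) * ‖f t‖ := by
    intro t ht
    have hxK := hseg t ⟨ht.1, ht.2.le⟩
    have hxt := hball hxK
    have hn : ∀ b, |grad g r b (x₀ + t • w)| ≤ ‖f t‖ := fun b =>
      (norm_le_pi_norm (fun a => grad g r a (x₀ + t • w)) b).trans (norm_fst_le (f t))
    have hp : |φ (x₀ + t • w)| ≤ ‖f t‖ := norm_snd_le (f t)
    have hf0 := norm_nonneg (f t)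
    have e1 : ∀ a i, |partialD i (grad g r a) (x₀ + t • w)| ≤ (1 + k * C) * ‖f t‖ := by
      intro a i
      rw [h.partialD_grad hxt]
      refine (abs_sub _ _).trans ?_
      have a1 : |if a = i then φ (x₀ + t • w) else 0| ≤ ‖f t‖ := by
        split_ifs
        · exact hp
        · rw [abs_zero]; exact hf0
      have a2 : |∑ b, chrMat g i (x₀ + t • w) a b * grad g r b (x₀ + t • w)| ≤ k * (C * ‖f t‖) := by
        have := abs_sum_le_of_forall_le (f := fun b =>
          chrMat g i (x₀ + t • w) a b * grad g r b (x₀ + t • w)) (c := C * ‖f t‖) fun b => by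
            rw [abs_mul]
            exact mul_le_mul (hC (i, a, b) _ hxK) (hn b) (abs_nonneg _) hC0
        simpa using this
      linarith
    -- The Ricci identity with free index l ≠ i isolates ∂_i φ; such an l exists because k ≥ 2.
    have e2 : ∀ i, |partialD i φ (x₀ + t • w)| ≤ (k * D) * ‖f t‖ := by
      intro i
      obtain ⟨l, hl⟩ : ∃ l : Fin k, l ≠ i := by
        have : Nontrivial (Fin k) := Fin.nontrivial_iff_two_le.2 hk
        exact exists_ne i
      have := h.riem_grad hxt i l l
      rw [if_pos rfl, if_neg hl, sub_zero] at this
      rw [← this, mul_assoc]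
      have := abs_sum_le_of_forall_le (f := fun b =>
          riem g i l (x₀ + t • w) l b * grad g r b (x₀ + t • w)) (c := D * ‖f t‖) fun b => by
            rw [abs_mul]
            exact mul_le_mul (hD ((i, l), l, b) _ hxK) (hn b) (abs_nonneg _) hD0
      simpa using this
    have hkC : 0 ≤ k * C * ‖f t‖ := by positivity
    have hkD : 0 ≤ k * D * ‖f t‖ := by positivity
    have e3 : ∀ (q : Fin k → ℝ), (∀ i, |q i| ≤ (1 + k * C + k * D) * ‖f t‖) →
        |∑ i, w i * q i| ≤ (k * (ρ * (1 + k * C + k * D))) * ‖f t‖ := by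
      intro q hq
      have := abs_sum_le_of_forall_le (f := fun i => w i * q i)
        (c := ρ * ((1 + k * C + k * D) * ‖f t‖)) fun i => by
          rw [abs_mul]
          exact mul_le_mul (hwi i) (hq i) (abs_nonneg _) hρ.le
      refine this.trans_eq ?_
      simp; ring
    refine norm_prod_le_iff.2 ⟨(pi_norm_le_iff_of_nonneg (by positivity)).2 fun a => ?_, ?_⟩
    · exact e3 _ fun i => (e1 a i).trans (by linarith)
    · exact e3 _ fun i => (e2 i).trans (by linarith)
  have hgrad0 : ∀ a, grad g r a x₀ = 0 := fun a => by
    simp [grad, (hcrit x₀ hx₀).2 rfl]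
  have hz := eq_zero_of_abs_deriv_le_mul_abs_self_of_eq_zero_right (a := (0 : ℝ)) (b := 1)
    (fun t ht => (hf t ht).continuousAt.continuousWithinAt)
    (fun t ht => (hf t ⟨ht.1, ht.2.le⟩).hasDerivWithinAt)
    (by ext a <;> simp [f, hgrad0, hφ0]) hbound 1 (by simp)
  have hx1 := hball (hseg 1 (by simp))
  have h1 : ∀ a, partialD a r (x₀ + (1 : ℝ) • w) = 0 := by
    intro a
    rw [← h.sum_mul_grad hx1]
    refine Finset.sum_eq_zero fun b _ => ?_
    have : grad g r b (x₀ + (1 : ℝ) • w) = 0 := congrFun (congrArg Prod.fst hz) b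
    rw [this, mul_zero]
  have h2 := (hcrit _ hx1).1 h1
  have : w = 0 := by simpa using h2
  rw [this, norm_zero] at hwn
  exact hρ.ne hwn

/-- A nondegenerate critical point is a strict local extremum. -/
theorem strict_extremum {x₀ : Coord k} (hx₀ : x₀ ∈ W) (hc : ∀ a, partialD a r x₀ = 0)
    (hφ : φ x₀ ≠ 0) :
    ∀ᶠ ρ in 𝓝[>] (0 : ℝ), ∀ x ∈ Metric.closedBall x₀ ρ, x ≠ x₀ → 0 < φ x₀ * (r x - r x₀) := by
  have hW := h.isOpen
  -- the gradient covector as a vector valued map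
  set P : Coord k → Coord k := fun x => WithLp.toLp 2 fun a => partialD a r x
  have hP : ContDiffOn ℝ ∞ P W := (contDiffOn_piLp 2).2 fun a => h.smooth_partialD a
  have hPd := (differentiableAt_of_contDiffOn hW hP hx₀).hasFDerivAt
  have hP0 : P x₀ = 0 := by ext a; exact hc a
  have hPder : ∀ z a, (fderiv ℝ P x₀ z) a = φ x₀ * ∑ b, g x₀ a b * z b := by
    intro z a
    have hcomp : HasFDerivAt (partialD a r) ((EuclideanSpace.proj a : Coord k →L[ℝ] ℝ).comp
        (fderiv ℝ P x₀)) x₀ :=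
      (EuclideanSpace.proj a : Coord k →L[ℝ] ℝ).hasFDerivAt.comp x₀ hPd
    have h1 : (fderiv ℝ P x₀ z) a = fderiv ℝ (partialD a r) x₀ z := by rw [hcomp.fderiv]; rfl
    rw [h1, fderiv_eq_sum_partialD, Finset.mul_sum]
    refine Finset.sum_congr rfl fun b _ => ?_
    rw [h.hess x₀ hx₀ b a, h.symm hx₀ b a]
    simp only [hc, mul_zero, Finset.sum_const_zero, zero_add]
    ring
  -- Summing the coordinatewise Cauchy-Schwarz inequality bounds ‖z‖² by the trace of the inverse
  -- metric times g(z, z). The trace is increased by one to be certainly positive.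
  obtain ⟨c, hc0, hcz⟩ : ∃ c, 0 < c ∧ ∀ z : Coord k, c * ‖z‖ ^ 2
      ≤ ∑ a, z a * ∑ b, g x₀ a b * z b := by
    set S := ∑ a, (g x₀)⁻¹ a a
    have hS : 0 ≤ S := Finset.sum_nonneg fun a _ => (h.posDef x₀ hx₀).inv.diag_pos.le
    refine ⟨(S + 1)⁻¹, by positivity, fun z => ?_⟩
    have hq : 0 ≤ ∑ a, z a * ∑ b, g x₀ a b * z b := by
      simpa [dotProduct, Matrix.mulVec] using
        (h.posDef x₀ hx₀).posSemidef.dotProduct_mulVec_nonneg (z : Fin k → ℝ)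
    have h1 : ‖z‖ ^ 2 ≤ S * ∑ a, z a * ∑ b, g x₀ a b * z b := by
      rw [EuclideanSpace.norm_sq_eq, Finset.sum_mul]
      refine Finset.sum_le_sum fun a _ => ?_
      rw [Real.norm_eq_abs, sq_abs]
      exact sq_coord_le_of_posDef (h.posDef x₀ hx₀) (z : Fin k → ℝ) a
    rw [inv_mul_le_iff₀ (by positivity)]
    nlinarith
  have hκ : 0 < φ x₀ ^ 2 := by positivity
  have hlo := hPd.isLittleO
  -- At x₀ the derivative of dr is φg. Half of the resulting lower bound |φ|c is allowed for the
  -- remainder, so the radial derivative of φ(x₀)r stays positive.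
  have hbd := hlo.def (show 0 < |φ x₀| * c / 2 by positivity)
  obtain ⟨ρ₀, hρ₀, hb⟩ := Metric.eventually_nhds_iff_ball.1 (hbd.and (hW.mem_nhds hx₀))
  filter_upwards [Ioo_mem_nhdsGT hρ₀] with ρ hρ x hx hne
  set z := x - x₀
  have hz : z ≠ 0 := sub_ne_zero.2 hne
  have hzn : 0 < ‖z‖ := norm_pos_iff.2 hz
  have hmem : ∀ t ∈ Set.Icc (0 : ℝ) 1, x₀ + t • z ∈ Metric.ball x₀ ρ₀ := by
    intro t ht
    rw [Metric.mem_ball, dist_eq_norm, add_sub_cancel_left, norm_smul, Real.norm_eq_abs,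
      abs_of_nonneg ht.1]
    have : ‖z‖ ≤ ρ := by simpa [z, dist_eq_norm] using hx
    nlinarith [ht.2, hρ.2]
  have hder : ∀ t ∈ Set.Icc (0 : ℝ) 1, HasDerivAt (fun t : ℝ => φ x₀ * r (x₀ + t • z))
      (φ x₀ * ∑ a, z a * partialD a r (x₀ + t • z)) t := fun t ht =>
    (hasDerivAt_along_line (differentiableAt_of_contDiffOn hW h.smooth_fun
      (hb _ (hmem t ht)).2)).const_mul _
  have hpos : ∀ t ∈ Set.Ioo (0 : ℝ) 1, 0 < φ x₀ * ∑ a, z a * partialD a r (x₀ + t • z) := by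
    intro t ht
    have h1 := (hb _ (hmem t ⟨ht.1.le, ht.2.le⟩)).1
    rw [hP0, sub_zero, add_sub_cancel_left] at h1
    set e := P (x₀ + t • z) - fderiv ℝ P x₀ (t • z)
    have h2 : ∑ a, z a * partialD a r (x₀ + t • z)
        = t * φ x₀ * ∑ a, z a * ∑ b, g x₀ a b * z b + ∑ a, z a * e a := by
      rw [Finset.mul_sum, ← Finset.sum_add_distrib]
      refine Finset.sum_congr rfl fun a _ => ?_
      have : e a = partialD a r (x₀ + t • z) - t * (φ x₀ * ∑ b, g x₀ a b * z b) := by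
        simp only [e, map_smul, PiLp.sub_apply, PiLp.smul_apply, hPder, smul_eq_mul]; rfl
      rw [this]; ring
    have h3 : |∑ a, z a * e a| ≤ ‖z‖ * ‖e‖ := by
      have := abs_real_inner_le_norm e z
      rw [mul_comm]
      simpa [PiLp.inner_apply] using this
    have h4 : ‖e‖ ≤ |φ x₀| * c / 2 * (t * ‖z‖) := by
      rwa [norm_smul, Real.norm_eq_abs, abs_of_pos ht.1] at h1
    have h5 := hcz z
    rw [h2, mul_add]
    have h6 : |φ x₀ * ∑ a, z a * e a| ≤ φ x₀ ^ 2 * c / 2 * t * ‖z‖ ^ 2 := by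
      rw [abs_mul]
      calc |φ x₀| * |∑ a, z a * e a| ≤ |φ x₀| * (‖z‖ * (|φ x₀| * c / 2 * (t * ‖z‖))) := by
            gcongr; exact h3.trans (by gcongr)
        _ = |φ x₀| ^ 2 * c / 2 * t * ‖z‖ ^ 2 := by ring
        _ = _ := by rw [sq_abs]
    have h7 : φ x₀ ^ 2 * t * (c * ‖z‖ ^ 2)
        ≤ φ x₀ * (t * φ x₀ * ∑ a, z a * ∑ b, g x₀ a b * z b) := by
      have : φ x₀ * (t * φ x₀ * ∑ a, z a * ∑ b, g x₀ a b * z b)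
          = φ x₀ ^ 2 * t * ∑ a, z a * ∑ b, g x₀ a b * z b := by ring
      rw [this]
      exact mul_le_mul_of_nonneg_left h5 (by have := ht.1; positivity)
    have h8 : 0 < φ x₀ ^ 2 * t * (c * ‖z‖ ^ 2) := by have := ht.1; positivity
    have h9 := (abs_le.1 h6).1
    nlinarith
  have hmono : StrictMonoOn (fun t : ℝ => φ x₀ * r (x₀ + t • z)) (Set.Icc 0 1) := by
    refine strictMonoOn_of_deriv_pos (convex_Icc 0 1)
      (fun t ht => (hder t ht).continuousAt.continuousWithinAt) fun t ht => ?_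
    rw [interior_Icc] at ht
    rw [(hder t ⟨ht.1.le, ht.2.le⟩).deriv]
    exact hpos t ht
  have := hmono (by simp : (0 : ℝ) ∈ Set.Icc (0 : ℝ) 1) (by simp : (1 : ℝ) ∈ Set.Icc (0 : ℝ) 1)
    one_pos
  simp only [zero_smul, add_zero, one_smul, z, add_sub_cancel] at this
  linarith

end IsHess

end NearCriticalPoint

end FinslerGeom

namespace FinslerGeom

/-! ### A maximum principle kills the defect near the critical point. -/

section DefectVanishes

variable {k : ℕ}

theorem abs_endAct_le {Q : Matrix (Fin k) (Fin k) ℝ} {T : Fin k → Fin k → Matrix (Fin k) (Fin k) ℝ}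
    {q s : ℝ} (hq : ∀ a b, |Q a b| ≤ q) (hs : ∀ i l a b, |T i l a b| ≤ s) (hq0 : 0 ≤ q)
    (i l a b : Fin k) : |endAct Q T i l a b| ≤ 4 * k * (q * s) := by
  rw [endAct_apply]
  have e1 : ∀ f : Fin k → ℝ, (∀ c, |f c| ≤ q * s) → |∑ c, f c| ≤ k * (q * s) := fun f hf => by
    simpa using abs_sum_le_of_forall_le hf
  have hm : ∀ x y : ℝ, |x| ≤ q → |y| ≤ s → |x * y| ≤ q * s := fun x y hx hy => by
    rw [abs_mul]; exact mul_le_mul hx hy (abs_nonneg _) hq0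
  have a1 := e1 (fun c => T i l a c * Q c b) fun c => by rw [mul_comm]; exact hm _ _ (hq _ _) (hs _ _ _ _)
  have a2 := e1 (fun c => Q a c * T i l c b) fun c => hm _ _ (hq _ _) (hs _ _ _ _)
  have a3 := e1 (fun c => Q c i * T c l a b) fun c => hm _ _ (hq _ _) (hs _ _ _ _)
  have a4 := e1 (fun c => Q c l * T i c a b) fun c => hm _ _ (hq _ _) (hs _ _ _ _)
  rw [abs_le] at *
  constructor <;> linarith [a1.1, a2.1, a3.1, a4.1, a1.2, a2.2, a3.2, a4.2]

/-- The sum of the squares of the components of `defect`. -/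
noncomputable def defectSq (g : Coord k → Matrix (Fin k) (Fin k) ℝ) (r φ : Coord k → ℝ) (κ : ℝ)
    (x : Coord k) : ℝ :=
  ∑ p : (Fin k × Fin k) × Fin k × Fin k, defect g r φ κ p.1.1 p.1.2 x p.2.1 p.2.2 ^ 2

theorem defectSq_nonneg (g : Coord k → Matrix (Fin k) (Fin k) ℝ) (r φ : Coord k → ℝ) (κ : ℝ)
    (x : Coord k) : 0 ≤ defectSq g r φ κ x :=
  Finset.sum_nonneg fun _ _ => sq_nonneg _

theorem abs_defect_le_sqrt (g : Coord k → Matrix (Fin k) (Fin k) ℝ) (r φ : Coord k → ℝ) (κ : ℝ)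
    (x : Coord k) (i l a b : Fin k) : |defect g r φ κ i l x a b| ≤ √(defectSq g r φ κ x) := by
  have := Finset.single_le_sum
    (f := fun p : (Fin k × Fin k) × Fin k × Fin k => defect g r φ κ p.1.1 p.1.2 x p.2.1 p.2.2 ^ 2)
    (fun _ _ => sq_nonneg _) (Finset.mem_univ ((i, l), a, b))
  exact Real.abs_le_sqrt this

theorem defect_eq_zero_of_defectSq {g : Coord k → Matrix (Fin k) (Fin k) ℝ} {r φ : Coord k → ℝ}
    {κ : ℝ} {x : Coord k} (h0 : defectSq g r φ κ x = 0) (i l : Fin k) :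
    defect g r φ κ i l x = 0 := by
  ext a b
  have := abs_defect_le_sqrt g r φ κ x i l a b
  rw [h0, Real.sqrt_zero] at this
  exact abs_eq_zero.1 (le_antisymm this (abs_nonneg _))

theorem defectSq_eq_zero {g : Coord k → Matrix (Fin k) (Fin k) ℝ} {r φ : Coord k → ℝ}
    {κ : ℝ} {x : Coord k} (h0 : ∀ i l, defect g r φ κ i l x = 0) : defectSq g r φ κ x = 0 :=
  Finset.sum_eq_zero fun p _ => by rw [h0]; simp

namespace IsHess

variable {W : Set (Coord k)} {g : Coord k → Matrix (Fin k) (Fin k) ℝ} {r φ : Coord k → ℝ}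
  (h : IsHess W g r φ)
include h

theorem defectSq_smooth (κ : ℝ) : ContDiffOn ℝ ∞ (defectSq g r φ κ) {x ∈ W | gradSq g r x ≠ 0} :=
  ContDiffOn.sum fun p _ => (h.defect_smooth κ p.1.1 p.1.2 p.2.1 p.2.2).pow 2

/-- Along N the derivative of the defect is a linear expression in the defect with coefficients from
Q. As Q is linear in N, the bound q can later be taken of order √H. -/
theorem abs_dGrad_defectSq_le {x : Coord k} (hx : x ∈ W) (hH : gradSq g r x ≠ 0) (κ : ℝ) {q : ℝ}
    (hq0 : 0 ≤ q) (hq : ∀ a b, |gradChr g r x a b| ≤ q) :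
    |dGrad g r (defectSq g r φ κ) x| ≤ (k * k * (k * k)) * (8 * k * q) * defectSq g r φ κ x := by
  set s := √(defectSq g r φ κ x)
  have hs2 : s * s = defectSq g r φ κ x := Real.mul_self_sqrt (defectSq_nonneg _ _ _ _ _)
  have hd : ∀ i l a b, DifferentiableAt ℝ (fun z => defect g r φ κ i l z a b) x := fun i l a b =>
    (h.defect_smooth κ i l).differentiableAt h.isOpen_regular ⟨hx, hH⟩ a b
  have e1 : dGrad g r (defectSq g r φ κ) x = ∑ p : (Fin k × Fin k) × Fin k × Fin k,
      2 * (defect g r φ κ p.1.1 p.1.2 x p.2.1 p.2.2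
        * dGrad g r (fun z => defect g r φ κ p.1.1 p.1.2 z p.2.1 p.2.2) x) := by
    have e2 : ∀ c, partialD c (defectSq g r φ κ) x = ∑ p : (Fin k × Fin k) × Fin k × Fin k,
        2 * (defect g r φ κ p.1.1 p.1.2 x p.2.1 p.2.2
        * partialD c (fun z => defect g r φ κ p.1.1 p.1.2 z p.2.1 p.2.2) x) := by
      intro c
      have : defectSq g r φ κ = fun x => ∑ p : (Fin k × Fin k) × Fin k × Fin k,
        (defect g r φ κ p.1.1 p.1.2 x p.2.1 p.2.2 * defect g r φ κ p.1.1 p.1.2 x p.2.1 p.2.2) := by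
        funext z; simp only [defectSq, sq]
      rw [this, partialD_sum _ _ fun p _ => (hd _ _ _ _).fun_mul (hd _ _ _ _)]
      exact Finset.sum_congr rfl fun p _ => by
        rw [partialD_mul c (hd _ _ _ _) (hd _ _ _ _)]; ring
    simp only [dGrad, e2, Finset.mul_sum]
    rw [Finset.sum_comm]
    exact Finset.sum_congr rfl fun p _ => Finset.sum_congr rfl fun c _ => by ring
  rw [e1, ← hs2]
  have := abs_sum_le_of_forall_le (f := fun p : (Fin k × Fin k) × Fin k × Fin k =>
      2 * (defect g r φ κ p.1.1 p.1.2 x p.2.1 p.2.2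
        * dGrad g r (fun z => defect g r φ κ p.1.1 p.1.2 z p.2.1 p.2.2) x))
      (c := 2 * (s * (4 * k * (q * s)))) fun p => by
    rw [h.dGrad_defect hx hH, abs_mul, abs_mul, abs_two]
    gcongr
    · exact abs_defect_le_sqrt g r φ κ x _ _ _ _
    · exact abs_endAct_le hq (fun i l a b => abs_defect_le_sqrt g r φ κ x i l a b) hq0 _ _ _ _
  refine this.trans_eq ?_
  simp only [Fintype.card_prod, Fintype.card_fin, Nat.cast_mul]
  ring

theorem continuousOn_gradChr (a b : Fin k) : ContinuousOn (fun x => gradChr g r x a b) W := by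
  simp only [gradChr_apply]
  exact continuousOn_finsetSum _ fun c _ =>
    (h.smooth_grad c).continuousOn.mul (h.chrMat_smooth c a b).continuousOn

/-- On a compact set the components of `mixedCurv` are bounded by a multiple of `gradSq`. -/
theorem exists_mixedCurv_le {K : Set (Coord k)} (hK : IsCompact K) (hKW : K ⊆ W) :
    ∃ C, 0 ≤ C ∧ ∀ x ∈ K, ∀ i l a b, |mixedCurv g r i l x a b| ≤ C * gradSq g r x := by
  obtain ⟨C, hC0, hC⟩ := exists_uniform_bound (f := fun (p : Fin k × Fin k) x => g x p.1 p.2) hK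
    fun p => (h.smooth p.1 p.2).continuousOn.mono hKW
  obtain ⟨D, hD0, hD⟩ := exists_uniform_bound (f := fun (p : Fin k × Fin k) x => (g x)⁻¹ p.1 p.2) hK
    fun p => (h.inv_smooth p.1 p.2).continuousOn.mono hKW
  refine ⟨2 * C + 2 * (C + D) * C, by positivity, fun x hx i l a b => ?_⟩
  set H := gradSq g r x
  have hH : 0 ≤ H := h.gradSq_nonneg (hKW hx)
  -- The components of dr and of N are bounded by multiples of √H, and the mixed tensor is quadratic
  -- in them.
  have hp : ∀ i, |partialD i r x| ^ 2 ≤ C * H := fun i => by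
    rw [sq_abs]
    exact (h.partialD_sq_le (hKW hx) i).trans
      (mul_le_mul_of_nonneg_right ((le_abs_self _).trans (hC (i, i) x hx)) hH)
  have hg : ∀ i, |grad g r i x| ^ 2 ≤ D * H := fun i => by
    rw [sq_abs]
    exact (h.grad_sq_le (hKW hx) i).trans
      (mul_le_mul_of_nonneg_right ((le_abs_self _).trans (hD (i, i) x hx)) hH)
  have a1 : ∀ i l, |partialD i r x * partialD l r x| ≤ C * H := fun i l => by
    rw [abs_mul]; nlinarith [hp i, hp l, sq_nonneg (|partialD i r x| - |partialD l r x|)]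
  have a2 : ∀ i l m n, |grad g r i x * (partialD l r x * g x m n)| ≤ (C + D) * C * H :=
    fun i l m n => by
      rw [← mul_assoc, abs_mul, abs_mul]
      have b1 : |grad g r i x| * |partialD l r x| ≤ (C + D) * H := by
        have := sq_nonneg (|grad g r i x| - |partialD l r x|)
        have := hg i
        have := hp l
        have : 0 ≤ D * H := by positivity
        have : 0 ≤ C * H := by positivity
        nlinarith
      calc _ ≤ ((C + D) * H) * C := mul_le_mul b1 (hC (m, n) x hx) (abs_nonneg _) (by positivity)
        _ = _ := by ring
  have hCH : 0 ≤ C * H := by positivity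
  have a3 : ∀ (p : Prop) [Decidable p] (z : ℝ), |z| ≤ C * H → |if p then z else 0| ≤ C * H := by
    intro p _ z hz
    split_ifs
    · exact hz
    · simpa using hCH
  have b1 := a3 (a = i) _ (a1 l b)
  have b2 := a3 (a = l) _ (a1 i b)
  have b3 := a2 a i l b
  have b4 := a2 a l i b
  simp only [mixedCurv, Matrix.of_apply, mul_sub]
  rw [abs_le] at *
  constructor <;> linarith [b1.1, b1.2, b2.1, b2.2, b3.1, b3.2, b4.1, b4.2]

/-- At a critical point the defect, with `κ` the square of `φ` there, tends to zero. -/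
theorem tendsto_defect_of_critical {x₀ : Coord k} (hx₀ : x₀ ∈ W) (hc : ∀ a, partialD a r x₀ = 0)
    (i l a b : Fin k) :
    Filter.Tendsto (fun x => defect g r φ (φ x₀ ^ 2) i l x a b) (𝓝 x₀) (𝓝 0) := by
  have hW := h.isOpen
  obtain ⟨ρ, hρ, hball⟩ := Metric.nhds_basis_closedBall.mem_iff.1 (hW.mem_nhds hx₀)
  obtain ⟨C, hC0, hC⟩ := h.exists_mixedCurv_le (isCompact_closedBall x₀ ρ) hball
  have hcont : ∀ f : Coord k → ℝ, ContDiffOn ℝ ∞ f W → Filter.Tendsto f (𝓝 x₀) (𝓝 (f x₀)) :=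
    fun f hf => (hf.continuousOn.continuousAt (hW.mem_nhds hx₀)).tendsto
  have hH0 : gradSq g r x₀ = 0 := (h.gradSq_eq_zero_iff hx₀).2 hc
  have hG0 : dGrad g r φ x₀ = 0 := by simp [dGrad, grad, hc]
  have t1 := (hcont _ h.smooth_gradSq).mul (hcont _ (h.riem_smooth i l a b))
  have t0 : Filter.Tendsto (fun x => φ x₀ ^ 2 - φ x ^ 2) (𝓝 x₀) (𝓝 0) := by
    have := ((hcont _ (h.smooth_phi i)).pow 2).const_sub (φ x₀ ^ 2)
    rwa [sub_self] at this
  have t2 := t0.mul (hcont _ (h.roundCurv_smooth i l a b))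
  have t3 : Filter.Tendsto (fun x => |φ x₀ ^ 2 - φ x ^ 2 + dGrad g r φ x| * C) (𝓝 x₀) (𝓝 0) := by
    have := ((t0.add (hcont _ (h.smooth_dGrad_phi i))).abs).mul_const C
    simpa [hG0] using this
  have t4 : Filter.Tendsto (fun x => (φ x₀ ^ 2 - φ x ^ 2 + dGrad g r φ x) / gradSq g r x
      * mixedCurv g r i l x a b) (𝓝 x₀) (𝓝 0) := by
    refine squeeze_zero_norm' ?_ t3
    filter_upwards [Metric.closedBall_mem_nhds x₀ hρ] with x hx
    rw [Real.norm_eq_abs, abs_mul, abs_div, div_mul_eq_mul_div, mul_div_assoc]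
    refine mul_le_mul_of_nonneg_left ?_ (abs_nonneg _)
    have hn := h.gradSq_nonneg (hball hx)
    rw [abs_of_nonneg hn]
    exact div_le_of_le_mul₀ hn hC0 (hC x hx i l a b)
  have := (t1.sub t2).add t4
  simpa [defect, hH0] using this

/-- With |N u| ≤ c√H u and N(√H) = φ√H, for λ large u exp(−λ√H) strictly increases in the direction
−φ(x₀)N wherever u > 0 and H ≠ 0. This direction leads into smaller sublevels of φ(x₀)r, so a
positive maximum over a compact sublevel could only sit at x₀, where u = 0. The bound ε on the
sphere keeps that sublevel inside the ball. -/
theorem exists_defect_eq_zero (hk : 2 ≤ k) {x₀ : Coord k} (hx₀ : x₀ ∈ W)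
    (hcrit : ∀ x ∈ W, (∀ a, partialD a r x = 0) ↔ x = x₀) :
    ∃ ρ > 0, ∃ ε > 0, Metric.closedBall x₀ ρ ⊆ W ∧
      (∀ x ∈ Metric.sphere x₀ ρ, ε ≤ φ x₀ * (r x - r x₀)) ∧
      (∀ x ∈ Metric.closedBall x₀ ρ, x ≠ x₀ → 0 < φ x₀ * (r x - r x₀)) ∧
      ∀ x ∈ Metric.closedBall x₀ ρ, φ x₀ * (r x - r x₀) < ε →
        ∀ i l, defect g r φ (φ x₀ ^ 2) i l x = 0 := by
  have hW := h.isOpen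
  have hφ := h.phi_ne_zero hk hx₀ hcrit
  have i0 : Fin k := ⟨0, by omega⟩
  have hc := (hcrit x₀ hx₀).2 rfl
  have hκ : 0 < φ x₀ ^ 2 := by positivity
  have hH0 : gradSq g r x₀ = 0 := (h.gradSq_eq_zero_iff hx₀).2 hc
  have hφc : Filter.Tendsto (fun x => φ x₀ * φ x) (𝓝 x₀) (𝓝 (φ x₀ ^ 2)) := by
    rw [sq]
    exact (((h.smooth_phi i0).continuousOn.continuousAt (hW.mem_nhds hx₀)).tendsto).const_mul _
  -- On this neighbourhood φ keeps its sign and more than half of its size at x₀.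
  have hnear : {x | x ∈ W ∧ φ x₀ ^ 2 / 2 < φ x₀ * φ x} ∈ 𝓝 x₀ :=
    Filter.inter_mem (hW.mem_nhds hx₀) (hφc.eventually_const_lt (by linarith))
  obtain ⟨ρ₀, hρ₀, hball₀⟩ := Metric.nhds_basis_closedBall.mem_iff.1 hnear
  obtain ⟨ρ, hpos, hρpos, hρle⟩ :=
    ((h.strict_extremum hx₀ hc hφ).and (Ioo_mem_nhdsGT hρ₀)).exists
  have hball : Metric.closedBall x₀ ρ ⊆ {x | x ∈ W ∧ φ x₀ ^ 2 / 2 < φ x₀ * φ x} :=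
    (Metric.closedBall_subset_closedBall hρle.le).trans hball₀
  have hballW : Metric.closedBall x₀ ρ ⊆ W := fun x hx => (hball hx).1
  have hrc : ContinuousOn (fun x => φ x₀ * (r x - r x₀)) W :=
    continuousOn_const.mul (h.smooth_fun.continuousOn.sub continuousOn_const)
  obtain ⟨ε, hε, hsph⟩ : ∃ ε > 0, ∀ x ∈ Metric.sphere x₀ ρ, ε ≤ φ x₀ * (r x - r x₀) := by
    have hne : (Metric.sphere x₀ ρ).Nonempty := by
      refine ⟨x₀ + EuclideanSpace.single i0 ρ, ?_⟩
      simp [hρpos.le]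
    obtain ⟨z, hz, hmin⟩ := (isCompact_sphere x₀ ρ).exists_isMinOn hne
      (hrc.mono fun x hx => hballW (Metric.sphere_subset_closedBall hx))
    refine ⟨_, hpos z (Metric.sphere_subset_closedBall hz) ?_, fun x hx => hmin hx⟩
    rintro rfl
    simp at hz; exact hρpos.ne hz
  refine ⟨ρ, hρpos, ε, hε, hballW, hsph, hpos, fun x₁ hx₁ hlt i l =>
    defect_eq_zero_of_defectSq ?_ i l⟩
  -- the compact set on which `u exp (-λ √H)` is maximized
  set ε' := φ x₀ * (r x₁ - r x₀)
  set K := Metric.closedBall x₀ ρ ∩ {x | φ x₀ * (r x - r x₀) ≤ ε'}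
  have hKc : IsCompact K := by
    refine (isCompact_closedBall x₀ ρ).of_isClosed_subset ?_ Set.inter_subset_left
    exact (hrc.mono hballW).preimage_isClosed_of_isClosed Metric.isClosed_closedBall isClosed_Iic
  have hKW : K ⊆ W := fun x hx => hballW hx.1
  set u := defectSq g r φ (φ x₀ ^ 2)
  have hu0 : ∀ x, 0 ≤ u x := defectSq_nonneg _ _ _ _
  -- At x₀ both H and κ − φ² vanish, and the quotient by H is zero by the convention for division by
  -- zero. This value agrees with the limit, which makes u continuous on K.
  have hux₀ : u x₀ = 0 := by
    refine defectSq_eq_zero fun i l => ?_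
    ext a b
    simp [defect, hH0]
  have hreg : ∀ x ∈ K, x ≠ x₀ → gradSq g r x ≠ 0 := fun x hx hne h0 =>
    hne ((hcrit x (hKW hx)).1 ((h.gradSq_eq_zero_iff (hKW hx)).1 h0))
  have huc : ContinuousOn u K := by
    intro x hx
    by_cases hne : x = x₀
    · subst hne
      have : Filter.Tendsto u (𝓝 x) (𝓝 (u x)) := by
        rw [hux₀]
        have := tendsto_finsetSum (Finset.univ : Finset ((Fin k × Fin k) × Fin k × Fin k)) fun p _ =>
          (h.tendsto_defect_of_critical hx₀ hc p.1.1 p.1.2 p.2.1 p.2.2).pow 2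
        simp only [ne_eq, OfNat.ofNat_ne_zero, not_false_eq_true, zero_pow,
          Finset.sum_const_zero] at this
        exact this
      exact ContinuousAt.continuousWithinAt this
    · exact ((h.defectSq_smooth _).continuousOn.continuousAt
        (h.isOpen_regular.mem_nhds ⟨hKW hx, hreg x hx hne⟩)).continuousWithinAt
  have hHc : ContinuousOn (gradSq g r) K := h.smooth_gradSq.continuousOn.mono hKW
  obtain ⟨A, hA0, hA⟩ := exists_uniform_bound
    (f := fun (p : Fin k × Fin k × Fin k) x => chrMat g p.1 x p.2.1 p.2.2) hKc
    fun p => ((h.chrMat_smooth p.1 p.2.1 p.2.2).continuousOn).mono hKW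
  obtain ⟨B, hB0, hB⟩ := exists_uniform_bound (f := fun (a : Fin k) x => (g x)⁻¹ a a) hKc
    fun a => (h.inv_smooth a a).continuousOn.mono hKW
  set c₁ : ℝ := (k * k * (k * k)) * (8 * k * (k * (√B * A)))
  have hc₁ : 0 ≤ c₁ := by positivity
  have hderu : ∀ x ∈ K, gradSq g r x ≠ 0 →
      |dGrad g r u x| ≤ c₁ * √(gradSq g r x) * u x := by
    intro x hx hHx
    have hq : ∀ a b, |gradChr g r x a b| ≤ k * (√B * √(gradSq g r x) * A) := fun a b => by
      rw [gradChr_apply]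
      have := abs_sum_le_of_forall_le (f := fun c => grad g r c x * chrMat g c x a b)
        (c := √B * √(gradSq g r x) * A) fun c => by
          rw [abs_mul, ← Real.sqrt_mul hB0]
          refine mul_le_mul ?_ (hA (c, a, b) x hx) (abs_nonneg _) (Real.sqrt_nonneg _)
          refine Real.abs_le_sqrt ((h.grad_sq_le (hKW hx) c).trans ?_)
          exact mul_le_mul_of_nonneg_right ((le_abs_self _).trans (hB c x hx))
            (h.gradSq_nonneg (hKW hx))
      simpa using this
    refine (h.abs_dGrad_defectSq_le (hKW hx) hHx _ (by positivity) hq).trans_eq ?_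
    simp only [c₁, u]; ring
  -- With φ(x₀)φ > φ(x₀)²/2 on the ball, this makes λφ(x₀)φ exceed |φ(x₀)|c₁, the most that u can
  -- lose.
  set lam : ℝ := 2 * |φ x₀| * c₁ / φ x₀ ^ 2 + 1
  obtain ⟨z, hz, hmax⟩ := hKc.exists_isMaxOn ⟨x₁, hx₁, le_refl ε'⟩
    (f := fun x => u x * Real.exp (-lam * √(gradSq g r x)))
    (huc.mul (Real.continuous_exp.comp_continuousOn (continuousOn_const.mul hHc.sqrt)))
  by_contra hne
  have hx₁u : 0 < u x₁ := lt_of_le_of_ne (hu0 _) (Ne.symm hne)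
  have hzu : 0 < u z := by
    have h1 : u x₁ * Real.exp (-lam * √(gradSq g r x₁)) ≤ u z * Real.exp (-lam * √(gradSq g r z)) :=
      hmax ⟨hx₁, le_refl ε'⟩
    have h2 : 0 < u z * Real.exp (-lam * √(gradSq g r z)) := lt_of_lt_of_le (by positivity) h1
    exact pos_of_mul_pos_left h2 (Real.exp_pos _).le
  have hzx₀ : z ≠ x₀ := by rintro rfl; rw [hux₀] at hzu; exact lt_irrefl _ hzu
  have hHz := hreg z hz hzx₀
  have hHpos : 0 < gradSq g r z := lt_of_le_of_ne (h.gradSq_nonneg (hKW hz)) (Ne.symm hHz)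
  have hφz := (hball hz.1).2
  -- move against the gradient
  set v : Coord k := WithLp.toLp 2 fun a => -(φ x₀ * grad g r a z)
  have hline : ∀ f : Coord k → ℝ, DifferentiableAt ℝ f z →
      HasDerivAt (fun s : ℝ => f (z + s • v)) (-(φ x₀ * dGrad g r f z)) 0 := by
    intro f hf
    have := hasDerivAt_along_line (x := z) (w := v) (t := 0) (by simpa using hf)
    refine this.congr_deriv ?_
    simp only [zero_smul, add_zero, dGrad, Finset.mul_sum, ← Finset.sum_neg_distrib, v]
    exact Finset.sum_congr rfl fun c _ => by ring
  have hdu : DifferentiableAt ℝ u z :=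
    differentiableAt_of_contDiffOn h.isOpen_regular (h.defectSq_smooth _) ⟨hKW hz, hHz⟩
  have hdr := hline _ (differentiableAt_of_contDiffOn hW h.smooth_fun (hKW hz))
  have hdH := hline _ (differentiableAt_of_contDiffOn hW h.smooth_gradSq (hKW hz))
  rw [h.dGrad_gradSq (hKW hz)] at hdH
  have hdw : HasDerivAt (fun s : ℝ => u (z + s • v) * Real.exp (-lam * √(gradSq g r (z + s • v))))
      (Real.exp (-lam * √(gradSq g r z)) * (-(φ x₀ * dGrad g r u z)
        + lam * (φ x₀ * φ z) * √(gradSq g r z) * u z)) 0 := by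
    have h1 := (hline u hdu).mul ((((hdH.sqrt (by simpa using hHz)).const_mul (-lam)).exp))
    refine h1.congr_deriv ?_
    simp only [zero_smul, add_zero]
    have : √(gradSq g r z) ≠ 0 := (Real.sqrt_pos.2 hHpos).ne'
    have h2 : √(gradSq g r z) ^ 2 = gradSq g r z := Real.sq_sqrt hHpos.le
    generalize √(gradSq g r z) = S at *
    rw [← h2]
    field_simp
  have hdpos : 0 < Real.exp (-lam * √(gradSq g r z)) * (-(φ x₀ * dGrad g r u z)
        + lam * (φ x₀ * φ z) * √(gradSq g r z) * u z) := by
    refine mul_pos (Real.exp_pos _) ?_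
    have h1 : φ x₀ * dGrad g r u z ≤ |φ x₀| * (c₁ * √(gradSq g r z) * u z) := by
      refine (le_abs_self _).trans ?_
      rw [abs_mul]
      exact mul_le_mul_of_nonneg_left (hderu z hz hHz) (abs_nonneg _)
    have hsu : 0 < √(gradSq g r z) * u z := mul_pos (Real.sqrt_pos.2 hHpos) hzu
    have hlam0 : 0 < lam := by positivity
    have h2 : |φ x₀| * c₁ < lam * (φ x₀ * φ z) := by
      have h3 : lam * (φ x₀ ^ 2 / 2) = |φ x₀| * c₁ + φ x₀ ^ 2 / 2 := by
        simp only [lam]; field_simp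
      nlinarith
    nlinarith
  have hrneg : -(φ x₀ * (φ x₀ * dGrad g r r z)) < 0 := by
    have : dGrad g r r z = gradSq g r z := rfl
    rw [this]
    nlinarith
  have hs0 : ∀ᶠ s : ℝ in 𝓝[>] 0, z + s • v ∈ K := by
    have hcont : Filter.Tendsto (fun s : ℝ => z + s • v) (𝓝[>] 0) (𝓝 z) := by
      have : Continuous fun s : ℝ => z + s • v := by fun_prop
      have := (this.tendsto 0).mono_left (nhdsWithin_le_nhds (s := Set.Ioi 0))
      simpa using this
    -- On the sphere φ(x₀)(r − r(x₀)) is at least ε > ε', so the maximum lies in the open ball and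
    -- can be moved in any direction that lowers φ(x₀)r.
    have hzin : z ∈ Metric.ball x₀ ρ := by
      refine lt_of_le_of_ne (Metric.mem_closedBall.1 hz.1) fun he => ?_
      have := hsph z he
      have := hz.2
      simp only [Set.mem_ofPred_eq] at this
      linarith
    have h1 := hcont.eventually (Metric.isOpen_ball.mem_nhds hzin)
    have h2 : ∀ᶠ s : ℝ in 𝓝[>] 0, φ x₀ * (r (z + s • v)) < φ x₀ * r (z + (0 : ℝ) • v) := by
      have h3 := (hdr.const_mul (φ x₀))
      have h4 := h3.hasDerivWithinAt (s := Set.Ioi 0)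
      have h5 := ((hasDerivWithinAt_iff_tendsto_slope' (by simp)).1 h4).eventually_lt_const
        (show φ x₀ * -(φ x₀ * dGrad g r r z) < 0 by linarith)
      · filter_upwards [h5, self_mem_nhdsWithin] with s hs hs0
        rw [slope_def_field, sub_zero] at hs
        have := (div_neg_iff.1 hs).resolve_left fun hh => absurd hh.2 (not_lt.2 (le_of_lt hs0))
        linarith [this.1]
    filter_upwards [h1, h2] with s hs1 hs2
    refine ⟨Metric.ball_subset_closedBall hs1, ?_⟩
    have := hz.2
    simp only [Set.mem_ofPred_eq, zero_smul, add_zero] at this hs2 ⊢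
    linarith
  have h5 := ((hasDerivWithinAt_iff_tendsto_slope' (by simp)).1
    (hdw.hasDerivWithinAt (s := Set.Ioi 0))).eventually_const_lt hdpos
  obtain ⟨s, ⟨hs1, hs2⟩, hs3⟩ := ((h5.and hs0).and self_mem_nhdsWithin).exists
  rw [slope_def_field, sub_zero] at hs1
  have h6 := (div_pos_iff.1 hs1).resolve_right fun hh => absurd hh.2 (not_lt.2 (le_of_lt hs3))
  have h7 : u (z + s • v) * Real.exp (-lam * √(gradSq g r (z + s • v)))
      ≤ u z * Real.exp (-lam * √(gradSq g r z)) := hmax hs2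
  simp only [zero_smul, add_zero] at h6
  linarith [h6.1]

end IsHess

end DefectVanishes

end FinslerGeom

namespace FinslerGeom

/-! ### Pullback of connection and curvature: the formula and the equation of Gauss. -/

section Pullback

variable {k n : ℕ}

/-- The Jacobian matrix of a map between coordinate spaces. -/
noncomputable def jac (χ : Coord k → Coord n) (x : Coord k) : Matrix (Fin n) (Fin k) ℝ :=
  Matrix.of fun i a => partialD a (fun z => χ z i) x

/-- The connection matrices of `g` pulled back by `χ`. -/
noncomputable def pullChr (g : Coord n → Matrix (Fin n) (Fin n) ℝ) (χ : Coord k → Coord n)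
    (a : Fin k) (x : Coord k) : Matrix (Fin n) (Fin n) ℝ :=
  ∑ i, jac χ x i a • chrMat g i (χ x)

/-- The covariant derivative of the Jacobian matrix. -/
noncomputable def covJac (g : Coord n → Matrix (Fin n) (Fin n) ℝ) (χ : Coord k → Coord n)
    (a : Fin k) (x : Coord k) : Matrix (Fin n) (Fin k) ℝ :=
  matD a (jac χ) x + pullChr g χ a x * jac χ x

theorem fderiv_single_apply {χ : Coord k → Coord n} {x : Coord k} (hχ : DifferentiableAt ℝ χ x)
    (a : Fin k) (i : Fin n) :
    (fderiv ℝ χ x (EuclideanSpace.single a 1)) i = jac χ x i a := by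
  have : HasFDerivAt (fun z => χ z i) ((EuclideanSpace.proj i : Coord n →L[ℝ] ℝ).comp
      (fderiv ℝ χ x)) x :=
    (EuclideanSpace.proj i : Coord n →L[ℝ] ℝ).hasFDerivAt.comp x hχ.hasFDerivAt
  simp only [jac, Matrix.of_apply, partialD, this.fderiv]
  rfl

theorem fderiv_apply_eq_mulVec {χ : Coord k → Coord n} {x : Coord k} (hχ : DifferentiableAt ℝ χ x)
    (v : Coord k) (i : Fin n) :
    (fderiv ℝ χ x v) i = ∑ a, jac χ x i a * v a := by
  conv_lhs => rw [coord_eq_sum_single v]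
  simp only [map_sum, map_smul, WithLp.ofLp_sum, Finset.sum_apply, PiLp.smul_apply, smul_eq_mul,
    fderiv_single_apply hχ]
  exact Finset.sum_congr rfl fun a _ => mul_comm _ _

theorem partialD_comp {f : Coord n → ℝ} {χ : Coord k → Coord n} {x : Coord k}
    (hf : DifferentiableAt ℝ f (χ x)) (hχ : DifferentiableAt ℝ χ x) (a : Fin k) :
    partialD a (fun z => f (χ z)) x = ∑ i, jac χ x i a * partialD i f (χ x) := by
  have : HasFDerivAt (fun z => f (χ z)) ((fderiv ℝ f (χ x)).comp (fderiv ℝ χ x)) x :=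
    hf.hasFDerivAt.comp x hχ.hasFDerivAt
  rw [partialD, this.fderiv, ContinuousLinearMap.comp_apply, fderiv_eq_sum_partialD]
  exact Finset.sum_congr rfl fun i _ => by rw [fderiv_single_apply hχ]

variable {W' : Set (Coord k)} {W : Set (Coord n)} {χ : Coord k → Coord n}

theorem jac_smooth (hW' : IsOpen W') (hχ : ContDiffOn ℝ ∞ χ W') : MSmooth W' (jac χ) := fun i a =>
  contDiffOn_partialD hW' ((contDiffOn_piLp 2).1 hχ i) a

theorem matD_jac_symm (hW' : IsOpen W') (hχ : ContDiffOn ℝ ∞ χ W') {x : Coord k} (hx : x ∈ W')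
    (a b : Fin k) (i : Fin n) : matD a (jac χ) x i b = matD b (jac χ) x i a :=
  partialD_comm hW' ((contDiffOn_piLp 2).1 hχ i) hx a b

theorem MSmooth.comp {p q : Type*} {A : Coord n → Matrix p q ℝ} (hA : MSmooth W A)
    (hχ : ContDiffOn ℝ ∞ χ W') (hm : Set.MapsTo χ W' W) : MSmooth W' fun x => A (χ x) :=
  fun a b => (hA a b).comp hχ hm

theorem matD_comp {p q : Type*} {A : Coord n → Matrix p q ℝ} (hW : IsOpen W) (hW' : IsOpen W')
    (hA : MSmooth W A) (hχ : ContDiffOn ℝ ∞ χ W') (hm : Set.MapsTo χ W' W) {x : Coord k}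
    (hx : x ∈ W') (a : Fin k) :
    matD a (fun x => A (χ x)) x = ∑ i, jac χ x i a • matD i A (χ x) := by
  ext c d
  rw [Matrix.sum_apply]
  exact partialD_comp (hA.differentiableAt hW (hm hx) c d)
    (differentiableAt_of_contDiffOn hW' hχ hx) a

variable {g : Coord n → Matrix (Fin n) (Fin n) ℝ}

theorem pullChr_smooth (hg : IsRiem W g) (hW' : IsOpen W') (hχ : ContDiffOn ℝ ∞ χ W')
    (hm : Set.MapsTo χ W' W) (a : Fin k) : MSmooth W' (pullChr g χ a) := fun c d => by
  simp only [pullChr, Matrix.sum_apply, Matrix.smul_apply, smul_eq_mul]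
  exact ContDiffOn.sum fun i _ => (jac_smooth hW' hχ i a).mul ((hg.chrMat_smooth i c d).comp hχ hm)

theorem covJac_symm (hg : IsRiem W g) (hW' : IsOpen W') (hχ : ContDiffOn ℝ ∞ χ W')
    (hm : Set.MapsTo χ W' W) {x : Coord k} (hx : x ∈ W') (a b : Fin k) (i : Fin n) :
    covJac g χ a x i b = covJac g χ b x i a := by
  simp only [covJac, Matrix.add_apply, matD_jac_symm hW' hχ hx a b i, pullChr, Matrix.mul_apply,
    Matrix.sum_apply, Matrix.smul_apply, smul_eq_mul, Finset.sum_mul]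
  congr 1
  rw [Finset.sum_comm]
  refine Finset.sum_congr rfl fun c _ => Finset.sum_congr rfl fun d _ => ?_
  rw [hg.chrMat_symm (hm hx) d i c]; ring

theorem matD_comp_metric (hg : IsRiem W g) (hW' : IsOpen W') (hχ : ContDiffOn ℝ ∞ χ W')
    (hm : Set.MapsTo χ W' W) {x : Coord k} (hx : x ∈ W') (a : Fin k) :
    matD a (fun x => g (χ x)) x
      = (pullChr g χ a x).transpose * g (χ x) + g (χ x) * pullChr g χ a x := by
  rw [matD_comp hg.isOpen hW' hg.smooth hχ hm hx]
  simp only [hg.compat (hm hx), pullChr, Matrix.transpose_sum, Matrix.transpose_smul,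
    Matrix.sum_mul, Matrix.mul_sum, Matrix.smul_mul, Matrix.mul_smul, smul_add,
    Finset.sum_add_distrib]

theorem matD_transpose {p q : Type*} (A : Coord k → Matrix p q ℝ) (a : Fin k) (x : Coord k) :
    matD a (fun z => (A z).transpose) x = (matD a A x).transpose := rfl

/-- The tangential part of the Gauss formula. -/
theorem metric_covJac (hg : IsRiem W g) {g' : Coord k → Matrix (Fin k) (Fin k) ℝ}
    (hg' : IsRiem W' g') (hχ : ContDiffOn ℝ ∞ χ W')
    (hm : Set.MapsTo χ W' W) {c : ℝ}
    (hpull : ∀ x ∈ W', c • g' x = (jac χ x).transpose * g (χ x) * jac χ x)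
    {x : Coord k} (hx : x ∈ W') (a : Fin k) :
    (jac χ x).transpose * g (χ x) * covJac g χ a x
      = (jac χ x).transpose * g (χ x) * (jac χ x * chrMat g' a x) := by
  have hW' := hg'.isOpen
  have hJ := jac_smooth hW' hχ
  have hgc := hg.smooth.comp hχ hm
  set S : Fin k → Matrix (Fin k) (Fin k) ℝ := fun a =>
    (jac χ x).transpose * g (χ x) * covJac g χ a x
  have hS : ∀ a b h, S a h b = S b h a := by
    intro a b h
    simp only [S]
    rw [Matrix.mul_apply, Matrix.mul_apply]
    exact Finset.sum_congr rfl fun i _ => by rw [covJac_symm hg hW' hχ hm hx a b i]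
  have hD : ∀ a, c • matD a g' x = (S a).transpose + S a := by
    intro a
    have e1 : c • matD a g' x = matD a (fun z => c • g' z) x := by
      ext p q; exact (partialD_const_mul _ _ _ _).symm
    rw [e1, matD_congr hW' hpull hx, matD_mul hW' (hJ.transpose.mul hgc) hJ hx,
      matD_mul hW' hJ.transpose hgc hx, matD_comp_metric hg hW' hχ hm hx, matD_transpose]
    simp only [S, covJac, Matrix.transpose_mul, Matrix.transpose_add, Matrix.transpose_transpose,
      hg.transpose (hm hx), Matrix.mul_add, Matrix.add_mul, Matrix.mul_assoc]
    abel
  -- Koszul's trick: S is symmetric in the derivative index and the last index, and symmetrised in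
  -- the other pair it is c ∂g'. Permuting the three indices determines S.
  have hk : c • (g' x * chrMat g' a x) = S a := by
    rw [hg'.mul_chrMat hx]
    ext h b
    have d : ∀ a p q, c * partialD a (fun z => g' z p q) x = S a q p + S a p q := fun a p q =>
      congrFun (congrFun (hD a) p) q
    simp only [Matrix.smul_apply, Matrix.of_apply, smul_eq_mul]
    have := d a h b
    have := d b h a
    have := d h a b
    have := hS a b h
    have := hS a h b
    have := hS b h a
    linarith
  rw [← Matrix.mul_assoc _ (jac χ x), ← hpull x hx, Matrix.smul_mul, hk]

/-- The Gauss equation: curvature under a map whose second fundamental form is `N ⊗ b`. -/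
theorem curvature_pullback (hg : IsRiem W g) {g' : Coord k → Matrix (Fin k) (Fin k) ℝ}
    (hg' : IsRiem W' g') (hχ : ContDiffOn ℝ ∞ χ W') (hm : Set.MapsTo χ W' W)
    {N : Coord k → Matrix (Fin n) Unit ℝ} {b : Fin k → Coord k → Matrix Unit (Fin k) ℝ}
    (hN : MSmooth W' N) (hb : ∀ a, MSmooth W' (b a))
    (hcov : ∀ x ∈ W', ∀ a, covJac g χ a x = jac χ x * chrMat g' a x + N x * b a x)
    {x : Coord k} (hx : x ∈ W') (d a : Fin k) :
    (∑ i, ∑ l, (jac χ x i d * jac χ x l a) • riem g i l (χ x)) * jac χ x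
      = jac χ x * riem g' d a x
        + (matD d N x + pullChr g χ d x * N x) * b a x
        - (matD a N x + pullChr g χ a x * N x) * b d x
        + N x * (matD d (b a) x + b d x * chrMat g' a x
          - (matD a (b d) x + b a x * chrMat g' d x)) := by
  have hW' := hg'.isOpen
  have hJ := jac_smooth hW' hχ
  have hP := pullChr_smooth hg hW' hχ hm
  -- the curvature of the pulled back connection
  have hdP : ∀ d a, matD d (pullChr g χ a) x = ∑ i, matD d (jac χ) x i a • chrMat g i (χ x)
      + ∑ i, ∑ l, (jac χ x i d * jac χ x l a) • matD i (chrMat g l) (χ x) := by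
    intro d a
    ext p q
    have e1 : (fun z => pullChr g χ a z p q)
        = fun z => ∑ i, jac χ z i a * chrMat g i (χ z) p q := by
      funext z; simp [pullChr, Matrix.sum_apply]
    have dJ : ∀ i, DifferentiableAt ℝ (fun z => jac χ z i a) x := fun i =>
      hJ.differentiableAt hW' hx i a
    have dG : ∀ i, DifferentiableAt ℝ (fun z => chrMat g i (χ z) p q) x := fun i =>
      ((hg.chrMat_smooth i).comp hχ hm).differentiableAt hW' hx p q
    have e2 : matD d (pullChr g χ a) x p q = partialD d (fun z => pullChr g χ a z p q) x := rfl
    rw [e2, e1, partialD_sum _ _ fun i _ => (dJ i).fun_mul (dG i)]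
    simp only [partialD_mul d (dJ _) (dG _), Finset.sum_add_distrib, Matrix.add_apply,
      Matrix.sum_apply, Matrix.smul_apply, smul_eq_mul]
    congr 1
    rw [Finset.sum_comm]
    refine Finset.sum_congr rfl fun l _ => ?_
    have := congrFun (congrFun (matD_comp hg.isOpen hW' (hg.chrMat_smooth l) hχ hm hx d) p) q
    simp only [Matrix.sum_apply, Matrix.smul_apply, smul_eq_mul] at this
    rw [show partialD d (fun z => chrMat g l (χ z) p q) x
      = ∑ i, jac χ x i d * matD i (chrMat g l) (χ x) p q from this, Finset.mul_sum]
    exact Finset.sum_congr rfl fun i _ => by ring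
  have hPP : ∀ d a, pullChr g χ d x * pullChr g χ a x
      = ∑ i, ∑ l, (jac χ x i d * jac χ x l a) • (chrMat g i (χ x) * chrMat g l (χ x)) := by
    intro d a
    simp only [pullChr, Matrix.sum_mul, Matrix.mul_sum, Matrix.smul_mul, Matrix.mul_smul,
      Finset.smul_sum, smul_smul]
    rw [Finset.sum_comm]
    exact Finset.sum_congr rfl fun i _ => Finset.sum_congr rfl fun l _ => by rw [mul_comm]
  have hswap : ∀ M : Fin n → Fin n → Matrix (Fin n) (Fin n) ℝ,
      ∑ i, ∑ l, (jac χ x i d * jac χ x l a) • M l i = ∑ i, ∑ l, (jac χ x i a * jac χ x l d) • M i l := by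
    intro M
    rw [Finset.sum_comm]
    exact Finset.sum_congr rfl fun i _ => Finset.sum_congr rfl fun l _ => by rw [mul_comm]
  have hcurv : ∑ i, ∑ l, (jac χ x i d * jac χ x l a) • riem g i l (χ x)
      = matD d (pullChr g χ a) x - matD a (pullChr g χ d) x
        + (pullChr g χ d x * pullChr g χ a x - pullChr g χ a x * pullChr g χ d x) := by
    rw [hdP, hdP, hPP, hPP]
    simp only [riem, smul_add, smul_sub, Finset.sum_add_distrib, Finset.sum_sub_distrib]
    rw [hswap fun i l => matD i (chrMat g l) (χ x), hswap fun i l => chrMat g i (χ x) * chrMat g l (χ x)]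
    have : ∑ i, matD d (jac χ) x i a • chrMat g i (χ x) = ∑ i, matD a (jac χ) x i d • chrMat g i (χ x) :=
      Finset.sum_congr rfl fun i _ => by rw [matD_jac_symm hW' hχ hx]
    rw [this]
    abel
  -- differentiate the Gauss formula
  have hE : ∀ d a, matD d (matD a (jac χ)) x
        + (matD d (pullChr g χ a) x * jac χ x + pullChr g χ a x * matD d (jac χ) x)
      = (matD d (jac χ) x * chrMat g' a x + jac χ x * matD d (chrMat g' a) x)
        + (matD d N x * b a x + N x * matD d (b a) x) := by
    intro d a
    have h1 := matD_congr hW' (A := fun z => matD a (jac χ) z + pullChr g χ a z * jac χ z)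
      (B := fun z => jac χ z * chrMat g' a z + N z * b a z) (fun z hz => hcov z hz a) hx d
    rwa [matD_add hW' (hJ.matD hW' a) ((hP a).mul hJ) hx, matD_mul hW' (hP a) hJ hx,
      matD_add hW' (hJ.mul (hg'.chrMat_smooth a)) (hN.mul (hb a)) hx,
      matD_mul hW' hJ (hg'.chrMat_smooth a) hx, matD_mul hW' hN (hb a) hx] at h1
  have hJd : ∀ a, matD a (jac χ) x = jac χ x * chrMat g' a x + N x * b a x
      - pullChr g χ a x * jac χ x := fun a => by
    rw [← hcov x hx a, covJac]; abel
  have h1 := hE d a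
  have h2 := hE a d
  rw [matD_comm hW' hJ hx a d] at h2
  -- Subtracting the two orders of differentiation removes the second derivatives of the Jacobian
  -- matrix and leaves the curvature of the pulled back connection.
  have h3 := congrArg₂ (· - ·) h1 h2
  simp only [add_sub_add_left_eq_sub] at h3
  rw [hJd d, hJd a] at h3
  have h4 : (matD d (pullChr g χ a) x - matD a (pullChr g χ d) x) * jac χ x
      = (((jac χ x * chrMat g' d x + N x * b d x - pullChr g χ d x * jac χ x) * chrMat g' a x
          + jac χ x * matD d (chrMat g' a) x) + (matD d N x * b a x + N x * matD d (b a) x))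
        - (((jac χ x * chrMat g' a x + N x * b a x - pullChr g χ a x * jac χ x) * chrMat g' d x
          + jac χ x * matD a (chrMat g' d) x) + (matD a N x * b d x + N x * matD a (b d) x))
        - pullChr g χ a x * (jac χ x * chrMat g' d x + N x * b d x - pullChr g χ d x * jac χ x)
        + pullChr g χ d x * (jac χ x * chrMat g' a x + N x * b a x - pullChr g χ a x * jac χ x) := by
    rw [← h3, Matrix.sub_mul]; abel
  rw [hcurv, Matrix.add_mul, h4]
  simp only [riem, Matrix.mul_add, Matrix.mul_sub, Matrix.add_mul, Matrix.sub_mul, Matrix.mul_assoc]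
  abel

end Pullback

end FinslerGeom

namespace FinslerGeom

/-! ### The curvature terms of the defect along a map. -/

section LevelSets

variable {k n : ℕ}

theorem pullTwo_roundCurv (g : Coord n → Matrix (Fin n) (Fin n) ℝ) (y : Coord n)
    (J : Matrix (Fin n) (Fin k) ℝ) (d a : Fin k) (p : Fin n) (b : Fin k) :
    ((∑ i, ∑ l, (J i d * J l a) • roundCurv g i l y) * J) p b
      = J p d * (J.transpose * g y * J) a b - J p a * (J.transpose * g y * J) d b := by
  have h : ∀ q, (∑ i, ∑ l, (J i d * J l a) • roundCurv g i l y) p q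
      = J p d * (J.transpose * g y) a q - J p a * (J.transpose * g y) d q := by
    intro q
    simp only [Matrix.sum_apply, Matrix.smul_apply, roundCurv, Matrix.of_apply, smul_eq_mul,
      mul_sub, Finset.sum_sub_distrib, mul_ite, mul_zero, Finset.sum_ite_irrel,
      Finset.sum_const_zero, Finset.sum_ite_eq, Finset.mem_univ, if_true, Matrix.mul_apply,
      Matrix.transpose_apply, Finset.mul_sum]
    congr 1
    · exact Finset.sum_congr rfl fun i _ => by ring
    · exact Finset.sum_congr rfl fun i _ => by ring
  rw [Matrix.mul_apply, Matrix.mul_apply (M := J.transpose * g y),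
    Matrix.mul_apply (M := J.transpose * g y), Finset.mul_sum, Finset.mul_sum,
    ← Finset.sum_sub_distrib]
  exact Finset.sum_congr rfl fun q _ => by rw [h]; ring

/-- D collects the derivatives of r along the columns of J. It is zero for a map into a level set,
which kills the whole term, and it is the differential of the transformed function for a change of
coordinates. -/
theorem pullTwo_mixedCurv (g : Coord n → Matrix (Fin n) (Fin n) ℝ) (r : Coord n → ℝ) (y : Coord n)
    (J : Matrix (Fin n) (Fin k) ℝ) {D : Fin k → ℝ} (hD : ∀ a, ∑ i, J i a * partialD i r y = D a)
    (d a : Fin k) (p : Fin n) (b : Fin k) :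
    ((∑ i, ∑ l, (J i d * J l a) • mixedCurv g r i l y) * J) p b
      = J p d * (D a * D b) - J p a * (D d * D b)
        + grad g r p y * (D d * (J.transpose * g y * J) a b - D a * (J.transpose * g y * J) d b) := by
  have h : ∀ q, (∑ i, ∑ l, (J i d * J l a) • mixedCurv g r i l y) p q
      = J p d * (D a * partialD q r y) - J p a * (D d * partialD q r y)
        + grad g r p y * (D d * (J.transpose * g y) a q - D a * (J.transpose * g y) d q) := by
    intro q
    have e1 : ∀ a (z : ℝ), D a * z = ∑ i, J i a * partialD i r y * z := fun a z => by
      rw [← hD, Finset.sum_mul]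
    simp only [Matrix.sum_apply, Matrix.smul_apply, mixedCurv, Matrix.of_apply, smul_eq_mul,
      mul_add, mul_sub, Finset.sum_sub_distrib, mul_ite, mul_zero, Finset.sum_ite_irrel,
      Finset.sum_const_zero, Finset.sum_ite_eq, Finset.mem_univ, if_true, Finset.sum_add_distrib]
    congr 1
    · congr 1
      · rw [e1, Finset.mul_sum]
        exact Finset.sum_congr rfl fun i _ => by ring
      · rw [e1, Finset.mul_sum]
        exact Finset.sum_congr rfl fun i _ => by ring
    · congr 1
      · rw [e1, Finset.mul_sum]
        refine Finset.sum_congr rfl fun i _ => ?_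
        simp only [Matrix.mul_apply, Matrix.transpose_apply, Finset.mul_sum]
        exact Finset.sum_congr rfl fun l _ => by ring
      · rw [Finset.sum_comm, e1, Finset.mul_sum]
        refine Finset.sum_congr rfl fun i _ => ?_
        simp only [Matrix.mul_apply, Matrix.transpose_apply, Finset.mul_sum]
        exact Finset.sum_congr rfl fun l _ => by ring
  rw [Matrix.mul_apply, Matrix.mul_apply (M := J.transpose * g y),
    Matrix.mul_apply (M := J.transpose * g y)]
  simp only [h]
  rw [← hD b]
  simp only [Finset.mul_sum, ← Finset.sum_sub_distrib, ← Finset.sum_add_distrib]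
  exact Finset.sum_congr rfl fun q _ => by ring

theorem pullTwo_linear (J : Matrix (Fin n) (Fin k) ℝ)
    (A B C : Fin n → Fin n → Matrix (Fin n) (Fin n) ℝ) (α β γ : ℝ) (d a : Fin k) :
    (∑ i, ∑ l, (J i d * J l a) • (α • A i l - β • B i l + γ • C i l)) * J
      = α • ((∑ i, ∑ l, (J i d * J l a) • A i l) * J)
        - β • ((∑ i, ∑ l, (J i d * J l a) • B i l) * J)
        + γ • ((∑ i, ∑ l, (J i d * J l a) • C i l) * J) := by
  have e : ∀ (c : ℝ) (T : Fin n → Fin n → Matrix (Fin n) (Fin n) ℝ),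
      ∑ i, ∑ l, (J i d * J l a) • (c • T i l) = c • ∑ i, ∑ l, (J i d * J l a) • T i l := by
    intro c T
    simp only [Finset.smul_sum]
    exact Finset.sum_congr rfl fun i _ => Finset.sum_congr rfl fun l _ => by rw [smul_comm]
  simp only [smul_add, smul_sub, Finset.sum_add_distrib, Finset.sum_sub_distrib, e,
    Matrix.add_mul, Matrix.sub_mul, Matrix.smul_mul]

variable {W' : Set (Coord k)} {W : Set (Coord n)} {χ : Coord k → Coord n}
  {g : Coord n → Matrix (Fin n) (Fin n) ℝ} {r φ : Coord n → ℝ}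

/-- ∇N = φ Id read along χ: N changes only tangentially, by φ times the velocity. -/
theorem IsHess.covDeriv_grad (h : IsHess W g r φ) (hW' : IsOpen W') (hχ : ContDiffOn ℝ ∞ χ W')
    (hm : Set.MapsTo χ W' W) {x : Coord k} (hx : x ∈ W') (a : Fin k) :
    matD a (fun z => Matrix.of fun (i : Fin n) (_ : Unit) => grad g r i (χ z)) x
      + pullChr g χ a x * Matrix.of (fun (i : Fin n) (_ : Unit) => grad g r i (χ x))
      = φ (χ x) • Matrix.of fun (i : Fin n) (_ : Unit) => jac χ x i a := by
  ext i u
  simp only [Matrix.add_apply, matD, Matrix.of_apply, Matrix.smul_apply, smul_eq_mul]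
  rw [partialD_comp (differentiableAt_of_contDiffOn h.isOpen (h.smooth_grad i) (hm hx))
    (differentiableAt_of_contDiffOn hW' hχ hx)]
  simp only [h.partialD_grad (hm hx), mul_sub, Finset.sum_sub_distrib, mul_ite, mul_zero,
    Finset.sum_ite_eq, Finset.mem_univ, if_true, Matrix.mul_apply, pullChr, Matrix.sum_apply,
    Matrix.smul_apply, smul_eq_mul, Finset.sum_mul, Matrix.of_apply]
  have : ∑ j, jac χ x j a * ∑ b, chrMat g j (χ x) i b * grad g r b (χ x)
      = ∑ b, ∑ j, jac χ x j a * chrMat g j (χ x) i b * grad g r b (χ x) := by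
    rw [Finset.sum_comm]
    refine Finset.sum_congr rfl fun j _ => ?_
    rw [Finset.mul_sum]
    exact Finset.sum_congr rfl fun b _ => by ring
  rw [this]; ring

/-- The normal part of the Gauss formula of a level set. -/
theorem IsHess.sum_partialD_covJac (h : IsHess W g r φ) (hW' : IsOpen W')
    (hχ : ContDiffOn ℝ ∞ χ W') (hm : Set.MapsTo χ W' W)
    (htan : ∀ x ∈ W', ∀ a, ∑ i, jac χ x i a * partialD i r (χ x) = 0)
    {x : Coord k} (hx : x ∈ W') (a b : Fin k) :
    ∑ i, partialD i r (χ x) * covJac g χ a x i b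
      = -(φ (χ x) * ((jac χ x).transpose * g (χ x) * jac χ x) a b) := by
  have hd : ∀ i, DifferentiableAt ℝ (fun z => partialD i r (χ z)) x := fun i =>
    (differentiableAt_of_contDiffOn h.isOpen (h.smooth_partialD i) (hm hx)).comp x
      (differentiableAt_of_contDiffOn hW' hχ hx)
  have hJ : ∀ i, DifferentiableAt ℝ (fun z => jac χ z i b) x := fun i =>
    (jac_smooth hW' hχ).differentiableAt hW' hx i b
  have h1 := partialD_congr_of_eqOn hW' hx a (f := fun z => ∑ i, jac χ z i b * partialD i r (χ z))
    (h := fun _ => 0) fun z hz => htan z hz b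
  rw [partialD_const, partialD_sum _ _ fun i _ => (hJ i).fun_mul (hd i)] at h1
  have h2 : ∀ i, partialD a (fun z => partialD i r (χ z)) x
      = ∑ l, jac χ x l a * (∑ j, chrMat g l (χ x) j i * partialD j r (χ x)
        + φ (χ x) * g (χ x) l i) := by
    intro i
    rw [partialD_comp (differentiableAt_of_contDiffOn h.isOpen (h.smooth_partialD i) (hm hx))
      (differentiableAt_of_contDiffOn hW' hχ hx)]
    refine Finset.sum_congr rfl fun l _ => ?_
    rw [h.hess _ (hm hx)]
    congr 2
    exact Finset.sum_congr rfl fun j _ => by rw [h.chrMat_symm (hm hx)]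
  simp only [partialD_mul a (hJ _) (hd _), h2, Finset.sum_add_distrib] at h1
  have h3 : ∑ i, partialD i r (χ x) * covJac g χ a x i b
      = ∑ i, partialD a (fun z => jac χ z i b) x * partialD i r (χ x)
        + ∑ i, jac χ x i b * ∑ l, jac χ x l a * ∑ j, chrMat g l (χ x) j i * partialD j r (χ x) := by
    simp only [covJac, Matrix.add_apply, mul_add, Finset.sum_add_distrib]
    congr 1
    · exact Finset.sum_congr rfl fun i _ => mul_comm _ _
    · simp only [pullChr, Matrix.mul_apply, Matrix.sum_apply, Matrix.smul_apply, smul_eq_mul,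
        Finset.mul_sum, Finset.sum_mul]
      rw [Finset.sum_comm]
      refine Finset.sum_congr rfl fun i _ => ?_
      rw [Finset.sum_comm]
      exact Finset.sum_congr rfl fun l _ => Finset.sum_congr rfl fun j _ => by ring
  have h4 : φ (χ x) * ((jac χ x).transpose * g (χ x) * jac χ x) a b
      = ∑ i, jac χ x i b * ∑ l, jac χ x l a * (φ (χ x) * g (χ x) l i) := by
    simp only [Matrix.mul_apply, Matrix.transpose_apply, Finset.mul_sum, Finset.sum_mul]
    exact Finset.sum_congr rfl fun i _ => Finset.sum_congr rfl fun l _ => by ring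
  rw [h3, h4]
  simp only [mul_add, Finset.sum_add_distrib] at h1
  linarith

end LevelSets

/-! ### Level sets have constant curvature where the defect vanishes. -/

section Hypersurface

variable {m : ℕ} {W' : Set (Coord m)} {W : Set (Coord (m + 1))} {χ : Coord m → Coord (m + 1)}
  {g : Coord (m + 1) → Matrix (Fin (m + 1)) (Fin (m + 1)) ℝ} {r φ : Coord (m + 1) → ℝ}

/-- A vector normal to a hypersurface and to its normal vector vanishes. -/
theorem eq_zero_of_normal {G : Matrix (Fin (m + 1)) (Fin (m + 1)) ℝ} (hG : G.PosDef)
    {J : Matrix (Fin (m + 1)) (Fin m) ℝ} {G' : Matrix (Fin m) (Fin m) ℝ} (hG' : G'.PosDef)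
    {c : ℝ} (hc : c ≠ 0) (hpull : c • G' = J.transpose * G * J) {N : Fin (m + 1) → ℝ}
    (hNJ : ∀ a, ∑ i, J i a * (G.mulVec N) i = 0) (hN : N ⬝ᵥ G.mulVec N ≠ 0) {z : Fin (m + 1) → ℝ}
    (hz : (J.transpose * G).mulVec z = 0) (hzN : N ⬝ᵥ G.mulVec z = 0) : z = 0 := by
  have hGT : G.transpose = G := by
    ext i j
    simpa using hG.isHermitian.apply i j
  have hsymm : ∀ u v, u ⬝ᵥ G.mulVec v = v ⬝ᵥ G.mulVec u := fun u v => by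
    rw [Matrix.dotProduct_mulVec, ← Matrix.mulVec_transpose, hGT, dotProduct_comm]
  -- The columns of J together with N span: E is injective between spaces of the same dimension m +
  -- 1.
  set E : (Fin m → ℝ) × ℝ →ₗ[ℝ] (Fin (m + 1) → ℝ) :=
    J.mulVecLin.comp (LinearMap.fst ℝ _ _) + (LinearMap.toSpanSingleton ℝ _ N).comp (LinearMap.snd ℝ _ _)
  have hE : ∀ v t, E (v, t) = J.mulVec v + t • N := fun v t => by simp [E]
  have hNJ' : ∀ v, N ⬝ᵥ G.mulVec (J.mulVec v) = 0 := by
    intro v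
    rw [hsymm, dotProduct_comm, Matrix.dotProduct_mulVec]
    have : Matrix.vecMul (G.mulVec N) J = 0 := by
      ext a
      exact (Finset.sum_congr rfl fun i _ => mul_comm _ _).trans (hNJ a)
    rw [this, zero_dotProduct]
  have hinj : Function.Injective E := by
    rw [← LinearMap.ker_eq_bot, LinearMap.ker_eq_bot']
    rintro ⟨v, t⟩ h0
    rw [hE] at h0
    have ht : t = 0 := by
      have h1 := congrArg (fun u => N ⬝ᵥ G.mulVec u) h0
      simp only [Matrix.mulVec_add, Matrix.mulVec_smul, dotProduct_add, dotProduct_smul, hNJ',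
        Matrix.mulVec_zero, dotProduct_zero, zero_add, smul_eq_mul] at h1
      exact (mul_eq_zero.1 h1).resolve_right hN
    rw [ht, zero_smul, add_zero] at h0
    have hv : G'.mulVec v = 0 := by
      have h1 : (c • G').mulVec v = 0 := by
        rw [hpull, ← Matrix.mulVec_mulVec, h0, Matrix.mulVec_zero]
      rw [Matrix.smul_mulVec] at h1
      exact (smul_eq_zero.1 h1).resolve_left hc
    have hv0 : v = 0 := by
      refine Matrix.mulVec_injective_of_isUnit ((Matrix.isUnit_iff_isUnit_det _).2
        hG'.det_pos.ne'.isUnit) ?_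
      rw [hv, Matrix.mulVec_zero]
    rw [ht, hv0]; rfl
  obtain ⟨⟨v, t⟩, hvt⟩ := (LinearMap.injective_iff_surjective_of_finrank_eq_finrank
    (by simp)).1 hinj z
  rw [hE] at hvt
  have hzz : z ⬝ᵥ G.mulVec z = 0 := by
    have h1 : (J.mulVec v) ⬝ᵥ G.mulVec z = 0 := by
      rw [dotProduct_comm, Matrix.dotProduct_mulVec]
      have : Matrix.vecMul (G.mulVec z) J = 0 := by
        rw [← Matrix.mulVec_transpose, Matrix.mulVec_mulVec, hz]
      rw [this, zero_dotProduct]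
    calc z ⬝ᵥ G.mulVec z = (J.mulVec v + t • N) ⬝ᵥ G.mulVec z := by rw [hvt]
      _ = 0 := by rw [add_dotProduct, smul_dotProduct, h1, hzN]; simp
  by_contra hne
  have := hG.dotProduct_mulVec_pos hne
  rw [star_trivial, hzz] at this
  exact lt_irrefl _ this

/-- The level sets of `r`, with the metric `g / ‖grad r‖²`, have constant curvature. -/
theorem IsHess.riem_levelSet (h : IsHess W g r φ) {g' : Coord m → Matrix (Fin m) (Fin m) ℝ}
    (hg' : IsRiem W' g') (hχ : ContDiffOn ℝ ∞ χ W') (hm : Set.MapsTo χ W' W)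
    (htan : ∀ x ∈ W', ∀ a, ∑ i, jac χ x i a * partialD i r (χ x) = 0)
    {c κ : ℝ} (hc : c ≠ 0) (hH : ∀ x ∈ W', gradSq g r (χ x) = c)
    (hpull : ∀ x ∈ W', c • g' x = (jac χ x).transpose * g (χ x) * jac χ x)
    (hdef : ∀ x ∈ W', ∀ i l, defect g r φ κ i l (χ x) = 0)
    {x : Coord m} (hx : x ∈ W') (d a : Fin m) :
    riem g' d a x = κ • roundCurv g' d a x := by
  have hW' := hg'.isOpen
  have i0 : Fin (m + 1) := 0
  set N : Coord m → Matrix (Fin (m + 1)) Unit ℝ := fun z => Matrix.of fun i _ => grad g r i (χ z)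
  -- The second fundamental form. The covariant derivative of the Jacobian pairs with dr to −φ c g',
  -- while dr(N) = c, so its coefficient in front of N is −φ g'.
  set b : Fin m → Coord m → Matrix Unit (Fin m) ℝ := fun a z =>
    Matrix.of fun _ e => -(φ (χ z) * g' z a e)
  have hN : MSmooth W' N := fun i _ => (h.smooth_grad i).comp hχ hm
  have hb : ∀ a, MSmooth W' (b a) := fun a _ e =>
    (((h.smooth_phi i0).comp hχ hm).mul (hg'.smooth a e)).neg
  have hgN : ∀ z ∈ W', (g (χ z)).mulVec (fun i => grad g r i (χ z)) = fun i => partialD i r (χ z) :=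
    fun z hz => funext fun i => h.sum_mul_grad (hm hz) i
  have hJN : ∀ z ∈ W', (jac χ z).transpose * g (χ z) * N z = 0 := by
    intro z hz
    ext a u
    have := htan z hz a
    rw [Matrix.mul_assoc, Matrix.mul_apply, Matrix.zero_apply, ← this]
    refine Finset.sum_congr rfl fun i _ => ?_
    rw [← congrFun (hgN z hz) i]; rfl
  have hNH : ∀ z ∈ W', ∑ i, partialD i r (χ z) * grad g r i (χ z) = c := fun z hz => by
    rw [← hH z hz]; exact Finset.sum_congr rfl fun i _ => mul_comm _ _
  have hcov : ∀ z ∈ W', ∀ a, covJac g χ a z = jac χ z * chrMat g' a z + N z * b a z := by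
    intro z hz a
    rw [← sub_eq_zero]
    set Z := covJac g χ a z - (jac χ z * chrMat g' a z + N z * b a z)
    have h1 : (jac χ z).transpose * g (χ z) * Z = 0 := by
      simp only [Z, Matrix.mul_sub, Matrix.mul_add]
      rw [metric_covJac h.toIsRiem hg' hχ hm hpull hz, ← Matrix.mul_assoc _ (N z), hJN z hz,
        Matrix.zero_mul, add_zero, sub_self]
    have h2 : ∀ e, ∑ i, partialD i r (χ z) * Z i e = 0 := by
      intro e
      simp only [Z, Matrix.sub_apply, Matrix.add_apply, mul_sub, mul_add, Finset.sum_sub_distrib,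
        Finset.sum_add_distrib]
      rw [h.sum_partialD_covJac hW' hχ hm htan hz, ← hpull z hz]
      have e1 : ∑ i, partialD i r (χ z) * (jac χ z * chrMat g' a z) i e = 0 := by
        simp only [Matrix.mul_apply, Finset.mul_sum]
        rw [Finset.sum_comm]
        refine Finset.sum_eq_zero fun q _ => ?_
        have := htan z hz q
        have e2 : ∑ i, partialD i r (χ z) * (jac χ z i q * chrMat g' a z q e)
            = (∑ i, jac χ z i q * partialD i r (χ z)) * chrMat g' a z q e := by
          rw [Finset.sum_mul]; exact Finset.sum_congr rfl fun i _ => by ring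
        rw [e2, this, zero_mul]
      have e3 : ∑ i, partialD i r (χ z) * (N z * b a z) i e = -(φ (χ z) * (c * g' z a e)) := by
        have : ∀ i, partialD i r (χ z) * (N z * b a z) i e
            = (partialD i r (χ z) * grad g r i (χ z)) * -(φ (χ z) * g' z a e) := fun i => by
          simp [Matrix.mul_apply, N, b]; ring
        simp only [this]
        rw [← Finset.sum_mul, hNH z hz]; ring
      rw [e1, e3]
      simp
    ext i e
    refine congrFun (eq_zero_of_normal (h.posDef _ (hm hz)) (hg'.posDef z hz) hc (hpull z hz)
      (N := fun i => grad g r i (χ z)) (z := fun i => Z i e) ?_ ?_ ?_ ?_) i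
    · intro a; rw [hgN z hz]; exact htan z hz a
    · rw [hgN z hz]
      simp only [dotProduct]
      rw [show ∑ i, grad g r i (χ z) * partialD i r (χ z) = c from hH z hz]
      exact hc
    · ext q
      exact congrFun (congrFun h1 q) e
    · have hGT := h.transpose (hm hz)
      rw [Matrix.dotProduct_mulVec, ← Matrix.mulVec_transpose, hGT, hgN z hz]
      exact h2 e
  have key := curvature_pullback h.toIsRiem hg' hχ hm hN hb hcov hx d a
  rw [h.covDeriv_grad hW' hχ hm hx, h.covDeriv_grad hW' hχ hm hx] at key
  set J := jac χ x
  set A := J.transpose * g (χ x)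
  have hAJ : A * J = c • g' x := (hpull x hx).symm
  have key2 := congrArg (fun M => A * M) key
  -- Contraction with JᵀG removes everything proportional to N, in particular the Codazzi terms with
  -- derivatives of b.
  have hAN : ∀ M : Matrix Unit (Fin m) ℝ, A * (N x * M) = 0 := fun M => by
    rw [← Matrix.mul_assoc, hJN x hx, Matrix.zero_mul]
  simp only [Matrix.mul_add, Matrix.mul_sub, hAN, add_zero, sub_zero] at key2
  rw [← Matrix.mul_assoc A J, hAJ] at key2
  have hcol : ∀ d, A * Matrix.of (fun (i : Fin (m + 1)) (_ : Unit) => J i d)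
      = c • Matrix.of fun (p : Fin m) (_ : Unit) => g' x p d := by
    intro d
    ext p u
    exact congrFun (congrFun hAJ p) d
  -- the same contraction computed from the vanishing of the defect
  have hdef2 : c • ((∑ i, ∑ l, (J i d * J l a) • riem g i l (χ x)) * J)
      = (κ - φ (χ x) ^ 2) • ((∑ i, ∑ l, (J i d * J l a) • roundCurv g i l (χ x)) * J) := by
    have h0 := pullTwo_linear J (fun i l => riem g i l (χ x)) (fun i l => roundCurv g i l (χ x))
      (fun i l => mixedCurv g r i l (χ x)) (gradSq g r (χ x)) (κ - φ (χ x) ^ 2)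
      ((κ - φ (χ x) ^ 2 + dGrad g r φ (χ x)) / gradSq g r (χ x)) d a
    have h1 : (∑ i, ∑ l, (J i d * J l a) • mixedCurv g r i l (χ x)) * J = 0 := by
      ext p e
      rw [pullTwo_mixedCurv g r (χ x) J (D := fun _ => 0) (htan x hx)]
      simp
    have h2 : ∀ i l, gradSq g r (χ x) • riem g i l (χ x)
        - (κ - φ (χ x) ^ 2) • roundCurv g i l (χ x)
        + ((κ - φ (χ x) ^ 2 + dGrad g r φ (χ x)) / gradSq g r (χ x)) • mixedCurv g r i l (χ x)
        = 0 := hdef x hx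
    simp only [hH x hx] at h0 h2
    simp only [h2, h1, smul_zero, Finset.sum_const_zero, Matrix.zero_mul, add_zero] at h0
    exact (sub_eq_zero.1 h0.symm)
  have hround : A * ((∑ i, ∑ l, (J i d * J l a) • roundCurv g i l (χ x)) * J)
      = (c * c) • Matrix.of fun p e => g' x p d * g' x a e - g' x p a * g' x d e := by
    ext p e
    rw [Matrix.mul_apply]
    simp only [pullTwo_roundCurv]
    rw [show J.transpose * g (χ x) * J = c • g' x from hAJ]
    have hAJ' : ∀ p d, ∑ i, A p i * J i d = c * g' x p d := fun p d =>
      congrFun (congrFun hAJ p) d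
    simp only [Matrix.smul_apply, Matrix.of_apply, smul_eq_mul, mul_sub, Finset.sum_sub_distrib,
      ← mul_assoc, ← Finset.sum_mul, hAJ']
    ring
  have key3 : c • (A * ((∑ i, ∑ l, (J i d * J l a) • riem g i l (χ x)) * J))
      = ((κ - φ (χ x) ^ 2) * (c * c)) •
        Matrix.of fun p e => g' x p d * g' x a e - g' x p a * g' x d e := by
    rw [← Matrix.mul_smul, hdef2, Matrix.mul_smul, hround, smul_smul]
  rw [key2] at key3
  -- The ambient curvature contributes κ − φ² and the umbilic second fundamental form contributes
  -- φ².
  have hfin : g' x * riem g' d a x = g' x * (κ • roundCurv g' d a x) := by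
    ext p e
    have h1 := congrFun (congrFun key3 p) e
    have h2 : ∀ u v, (A * (φ (χ x) • (Matrix.of fun (i : Fin (m + 1)) (_ : Unit) => J i u)
        * b v x)) p e = -(φ (χ x) ^ 2 * c * (g' x p u * g' x v e)) := by
      intro u v
      rw [Matrix.smul_mul, Matrix.mul_smul, ← Matrix.mul_assoc, hcol]
      simp [Matrix.mul_apply, b]
      ring
    have h3 : (g' x * (κ • roundCurv g' d a x)) p e
        = κ * (g' x p d * g' x a e - g' x p a * g' x d e) := by
      simp [Matrix.mul_apply, roundCurv, mul_sub, Finset.sum_sub_distrib]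
      ring
    rw [h3]
    simp only [Matrix.smul_apply, Matrix.add_apply, Matrix.sub_apply, h2, smul_eq_mul,
      Matrix.of_apply] at h1
    rw [Matrix.smul_mul, Matrix.smul_apply, smul_eq_mul] at h1
    have hcc : c * c ≠ 0 := mul_ne_zero hc hc
    refine mul_left_cancel₀ hcc ?_
    linear_combination h1
  let _ := (g' x).invertibleOfIsUnitDet (hg'.isUnit_det hx)
  exact (Matrix.mul_right_inj_of_invertible (g' x)).1 hfin

end Hypersurface

end FinslerGeom

namespace FinslerGeom

/-! ### Tensoriality of the defect under a change of coordinates. -/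

section CoordinateChange

variable {n : ℕ} {W' W : Set (Coord n)} {χ : Coord n → Coord n}
  {g g' : Coord n → Matrix (Fin n) (Fin n) ℝ} {r φ r' φ' : Coord n → ℝ}

namespace IsHess

variable (h : IsHess W g r φ) (h' : IsHess W' g' r' φ') (hχ : ContDiffOn ℝ ∞ χ W')
  (hm : Set.MapsTo χ W' W) (hr : ∀ x ∈ W', r' x = r (χ x))
  (hpull : ∀ x ∈ W', g' x = (jac χ x).transpose * g (χ x) * jac χ x)
include h h' hχ hm hpull

omit h hχ hm in
theorem isUnit_det_jac {x : Coord n} (hx : x ∈ W') : IsUnit (jac χ x).det := by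
  have h1 := h'.isUnit_det hx
  rw [hpull x hx, Matrix.det_mul] at h1
  exact isUnit_of_mul_isUnit_right h1

/-- In equal dimensions JᵀG is invertible, and the tangential Gauss formula becomes the
transformation law of the Christoffel symbols. -/
theorem covJac_eq {x : Coord n} (hx : x ∈ W') (a : Fin n) :
    covJac g χ a x = jac χ x * chrMat g' a x := by
  have h1 := metric_covJac h.toIsRiem h'.toIsRiem hχ hm (c := 1)
    (fun x hx => by rw [one_smul]; exact hpull x hx) hx a
  have hu : IsUnit ((jac χ x).transpose * g (χ x)).det := by
    rw [Matrix.det_mul, Matrix.det_transpose]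
    exact (isUnit_det_jac h' hpull hx).mul (h.isUnit_det (hm hx))
  let _ := ((jac χ x).transpose * g (χ x)).invertibleOfIsUnitDet hu
  exact (Matrix.mul_right_inj_of_invertible _).1 h1

/-- The Gauss equation without a normal part. -/
theorem riem_comp {x : Coord n} (hx : x ∈ W') (d a : Fin n) :
    (∑ i, ∑ l, (jac χ x i d * jac χ x l a) • riem g i l (χ x)) * jac χ x
      = jac χ x * riem g' d a x := by
  have := curvature_pullback h.toIsRiem h'.toIsRiem hχ hm (N := fun _ => 0) (b := fun _ _ => 0)
    (fun _ _ => contDiffOn_const) (fun _ _ _ => contDiffOn_const)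
    (fun x hx a => by rw [h.covJac_eq h' hχ hm hpull hx]; simp) hx d a
  simpa using this

omit hpull in
include hr in
theorem partialD_fun_comp {x : Coord n} (hx : x ∈ W') (a : Fin n) :
    ∑ i, jac χ x i a * partialD i r (χ x) = partialD a r' x := by
  rw [partialD_congr_of_eqOn h'.isOpen hx a (h := fun z => r (χ z)) hr,
    partialD_comp (differentiableAt_of_contDiffOn h.isOpen h.smooth_fun (hm hx))
      (differentiableAt_of_contDiffOn h'.isOpen hχ hx)]

include hr

theorem grad_comp {x : Coord n} (hx : x ∈ W') (i : Fin n) :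
    ∑ a, jac χ x i a * grad g' r' a x = grad g r i (χ x) := by
  have hJ := isUnit_det_jac h' hpull hx
  have h1 : (g' x).mulVec (fun a => grad g' r' a x) = fun a => partialD a r' x :=
    funext fun a => h'.sum_mul_grad hx a
  have h2 : (g (χ x)).mulVec (fun i => grad g r i (χ x)) = fun i => partialD i r (χ x) :=
    funext fun i => h.sum_mul_grad (hm hx) i
  have h3 : (fun a => partialD a r' x) = (jac χ x).transpose.mulVec fun i => partialD i r (χ x) :=
    funext fun a => (h.partialD_fun_comp h' hχ hm hr hx a).symm
  have hu : IsUnit ((jac χ x).transpose * g (χ x)) := by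
    rw [Matrix.isUnit_iff_isUnit_det, Matrix.det_mul, Matrix.det_transpose]
    exact hJ.mul (h.isUnit_det (hm hx))
  have h4 : ((jac χ x).transpose * g (χ x)).mulVec ((jac χ x).mulVec fun a => grad g' r' a x)
      = ((jac χ x).transpose * g (χ x)).mulVec fun i => grad g r i (χ x) := by
    rw [Matrix.mulVec_mulVec, ← hpull x hx, h1, h3, ← h2, Matrix.mulVec_mulVec]
  exact congrFun (Matrix.mulVec_injective_of_isUnit hu h4) i

theorem dGrad_comp {x : Coord n} (hx : x ∈ W') {f f' : Coord n → ℝ} (hf : ContDiffOn ℝ ∞ f W)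
    (hff : ∀ x ∈ W', f' x = f (χ x)) : dGrad g' r' f' x = dGrad g r f (χ x) := by
  simp only [dGrad, ← h.grad_comp h' hχ hm hr hpull hx, Finset.sum_mul]
  rw [Finset.sum_comm]
  refine Finset.sum_congr rfl fun a _ => ?_
  rw [partialD_congr_of_eqOn h'.isOpen hx a (h := fun z => f (χ z)) hff,
    partialD_comp (differentiableAt_of_contDiffOn h.isOpen hf (hm hx))
      (differentiableAt_of_contDiffOn h'.isOpen hχ hx), Finset.mul_sum]
  exact Finset.sum_congr rfl fun i _ => by ring

theorem gradSq_comp {x : Coord n} (hx : x ∈ W') : gradSq g' r' x = gradSq g r (χ x) :=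
  h.dGrad_comp h' hχ hm hr hpull hx h.smooth_fun hr

/-- Each ingredient is a tensor or a scalar. This makes the vanishing of the defect a property of a
point of the manifold. -/
theorem defect_comp (hφ : ∀ x ∈ W', φ' x = φ (χ x)) (κ : ℝ) {x : Coord n} (hx : x ∈ W')
    (d a : Fin n) :
    (∑ i, ∑ l, (jac χ x i d * jac χ x l a) • defect g r φ κ i l (χ x)) * jac χ x
      = jac χ x * defect g' r' φ' κ d a x := by
  have h1 : (∑ i, ∑ l, (jac χ x i d * jac χ x l a) • roundCurv g i l (χ x)) * jac χ x
      = jac χ x * roundCurv g' d a x := by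
    ext p b
    rw [pullTwo_roundCurv, ← hpull x hx]
    simp [Matrix.mul_apply, roundCurv, mul_sub, Finset.sum_sub_distrib]
  have h2 : (∑ i, ∑ l, (jac χ x i d * jac χ x l a) • mixedCurv g r i l (χ x)) * jac χ x
      = jac χ x * mixedCurv g' r' d a x := by
    ext p b
    rw [pullTwo_mixedCurv g r (χ x) _ (h.partialD_fun_comp h' hχ hm hr hx), ← hpull x hx,
      ← h.grad_comp h' hχ hm hr hpull hx]
    simp only [Matrix.mul_apply, mixedCurv, Matrix.of_apply, mul_add, mul_sub,
      Finset.sum_add_distrib, Finset.sum_sub_distrib, mul_ite, mul_zero, Finset.sum_ite_eq',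
      Finset.mem_univ, if_true, Finset.sum_mul]
    congr 1
    congr 1 <;> exact Finset.sum_congr rfl fun c _ => by ring
  have h3 : dGrad g' r' φ' x = dGrad g r φ (χ x) :=
    h.dGrad_comp h' hχ hm hr hpull hx (h.smooth_phi d) hφ
  have := pullTwo_linear (jac χ x) (fun i l => riem g i l (χ x)) (fun i l => roundCurv g i l (χ x))
    (fun i l => mixedCurv g r i l (χ x)) (gradSq g r (χ x)) (κ - φ (χ x) ^ 2)
    ((κ - φ (χ x) ^ 2 + dGrad g r φ (χ x)) / gradSq g r (χ x)) d a
  rw [h.riem_comp h' hχ hm hpull hx, h1, h2] at this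
  simp only [defect]
  rw [this, h3, h.gradSq_comp h' hχ hm hr hpull hx, hφ x hx]
  simp only [Matrix.mul_add, Matrix.mul_sub, Matrix.mul_smul]

theorem defect_eq_zero_comp (hφ : ∀ x ∈ W', φ' x = φ (χ x)) (κ : ℝ) {x : Coord n} (hx : x ∈ W')
    (h0 : ∀ i l, defect g r φ κ i l (χ x) = 0) (d a : Fin n) : defect g' r' φ' κ d a x = 0 := by
  have h1 := h.defect_comp h' hχ hm hr hpull hφ κ hx d a
  simp only [h0, smul_zero, Finset.sum_const_zero, Matrix.zero_mul] at h1
  let _ := (jac χ x).invertibleOfIsUnitDet (isUnit_det_jac h' hpull hx)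
  exact (Matrix.mul_right_inj_of_invertible (jac χ x)).1 (by rw [← h1, Matrix.mul_zero])

end IsHess

end CoordinateChange

/-! ### From the curvature tensor to sectional curvature. -/

section SectionalCurvature

variable {k : ℕ} {W : Set (Coord k)} {g : Coord k → Matrix (Fin k) (Fin k) ℝ}

/-- With t = G(v, v) and s = G(X, v), the value of G on the nonzero vector tX − sv is t times the
Gram determinant. -/
theorem gram_pos {G : Matrix (Fin k) (Fin k) ℝ} (hG : G.PosDef) {v X : Fin k → ℝ}
    (hlin : ∀ s t : ℝ, s • v + t • X = 0 → s = 0 ∧ t = 0) :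
    0 < (X ⬝ᵥ G.mulVec X) * (v ⬝ᵥ G.mulVec v) - (X ⬝ᵥ G.mulVec v) ^ 2 := by
  have hGT : G.transpose = G := by
    ext i j
    simpa using hG.isHermitian.apply i j
  have hsymm : v ⬝ᵥ G.mulVec X = X ⬝ᵥ G.mulVec v := by
    rw [Matrix.dotProduct_mulVec, ← Matrix.mulVec_transpose, hGT, dotProduct_comm]
  have hv : v ≠ 0 := by
    rintro rfl
    have := (hlin 1 0 (by simp)).1
    exact one_ne_zero this
  have hvv := hG.dotProduct_mulVec_pos hv
  rw [star_trivial] at hvv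
  set s := X ⬝ᵥ G.mulVec v
  set t := v ⬝ᵥ G.mulVec v
  have hne : (-s) • v + t • X ≠ 0 := fun h0 => hvv.ne' (hlin _ _ h0).2
  have h1 := hG.dotProduct_mulVec_pos hne
  simp only [star_trivial, Matrix.mulVec_add, Matrix.mulVec_smul, add_dotProduct, dotProduct_add,
    smul_dotProduct, dotProduct_smul, smul_eq_mul, hsymm] at h1
  change 0 < -s * (-s * t + t * s) + t * (-s * s + t * (X ⬝ᵥ G.mulVec X)) at h1
  have h2 : 0 < t * ((X ⬝ᵥ G.mulVec X) * t - s ^ 2) := by nlinarith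
  exact pos_of_mul_pos_right h2 hvv.le

/-- Here R(X, v)v = κ(g(v, v)X − g(X, v)v), so the numerator is κ times the Gram determinant, which
is nonzero by independence. -/
theorem IsRiem.secCurv_eq (hg : IsRiem W g) {L : Coord k → Coord k → ℝ} (hL : IsNormOf W L g)
    {x : Coord k} (hx : x ∈ W) {κ : ℝ} (hκ : ∀ i l, riem g i l x = κ • roundCurv g i l x)
    {v X : Coord k} (hlin : LinearIndependent ℝ ![v, X]) : secCurv L x v X = κ := by
  have hin : ∀ Y Z : Coord k, gInner L x v Y Z = (Y : Fin k → ℝ) ⬝ᵥ (g x).mulVec (Z : Fin k → ℝ) := by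
    intro Y Z
    simp only [gInner, hg.gLow_eq hL hx, dotProduct, Matrix.mulVec, Finset.mul_sum]
    exact Finset.sum_congr rfl fun i _ => Finset.sum_congr rfl fun j _ => by ring
  have hc : curvVec L x v X = κ • (gInner L x v v v • X - gInner L x v X v • v) := by
    ext i
    simp only [curvVec, hg.hCurv_eq hL hx, hκ, Matrix.smul_apply, roundCurv, Matrix.of_apply,
      smul_eq_mul, PiLp.smul_apply, PiLp.sub_apply, gInner, hg.gLow_eq hL hx]
    simp only [mul_sub, sub_mul, Finset.sum_sub_distrib, mul_ite, ite_mul, mul_zero, zero_mul,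
      Finset.sum_ite_eq, Finset.sum_ite_irrel, Finset.sum_const_zero, Finset.mem_univ, if_true,
      Finset.sum_mul, Finset.mul_sum]
    congr 1
    · rw [Finset.sum_comm]
      refine Finset.sum_congr rfl fun a _ => Finset.sum_congr rfl fun b _ => by ring
    · rw [Finset.sum_comm]
      refine Finset.sum_congr rfl fun a _ => Finset.sum_congr rfl fun b _ => by ring
  have hpos := gram_pos (hg.posDef x hx) (v := (v : Fin k → ℝ)) (X := (X : Fin k → ℝ)) (by
    intro s t h0
    refine LinearIndependent.pair_iff.1 hlin s t ?_
    ext i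
    exact congrFun h0 i)
  rw [secCurv, hc, div_eq_iff]
  · simp only [hin]
    have : ((κ • (((v : Fin k → ℝ) ⬝ᵥ (g x).mulVec (v : Fin k → ℝ)) • X
        - ((X : Fin k → ℝ) ⬝ᵥ (g x).mulVec (v : Fin k → ℝ)) • v) : Coord k) : Fin k → ℝ)
        = κ • (((v : Fin k → ℝ) ⬝ᵥ (g x).mulVec (v : Fin k → ℝ)) • (X : Fin k → ℝ)
        - ((X : Fin k → ℝ) ⬝ᵥ (g x).mulVec (v : Fin k → ℝ)) • (v : Fin k → ℝ)) := rfl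
    rw [this]
    have hsymm : (v : Fin k → ℝ) ⬝ᵥ (g x).mulVec (X : Fin k → ℝ)
        = (X : Fin k → ℝ) ⬝ᵥ (g x).mulVec (v : Fin k → ℝ) := by
      rw [Matrix.dotProduct_mulVec, ← Matrix.mulVec_transpose, hg.transpose hx, dotProduct_comm]
    simp only [smul_dotProduct, sub_dotProduct, smul_eq_mul, hsymm]
    ring
  · simp only [hin]
    exact hpos.ne'

end SectionalCurvature

end FinslerGeom

namespace FinslerGeom

/-! ### Maps and Finsler functions read in charts. -/

section Charts

variable {k n : ℕ}
variable {M : Type*} [TopologicalSpace M] [ChartedSpace (Coord n) M]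
variable {N : Type*} [TopologicalSpace N] [ChartedSpace (Coord k) N]
variable {e : OpenPartialHomeomorph M (Coord n)} {e' : OpenPartialHomeomorph N (Coord k)}

theorem mdifferentiable_chart (he : e ∈ IsManifold.maximalAtlas (𝓡 n) ∞ M) :
    e.MDifferentiable (𝓡 n) (𝓡 n) :=
  ⟨(contMDiffOn_of_mem_maximalAtlas he).mdifferentiableOn (by simp),
    (contMDiffOn_symm_of_mem_maximalAtlas he).mdifferentiableOn (by simp)⟩

theorem mdifferentiableAt_chart_symm (he : e ∈ IsManifold.maximalAtlas (𝓡 n) ∞ M) {x : Coord n}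
    (hx : x ∈ e.target) : MDifferentiableAt (𝓡 n) (𝓡 n) e.symm x :=
  (mdifferentiable_chart he).symm.mdifferentiableAt hx

theorem mfderiv_chart_symm_bijective (he : e ∈ IsManifold.maximalAtlas (𝓡 n) ∞ M) {x : Coord n}
    (hx : x ∈ e.target) : Function.Bijective (mfderiv (𝓡 n) (𝓡 n) e.symm x) :=
  (mdifferentiable_chart he).symm.mfderiv_bijective hx

/-- Tangent spaces at different points are the same type by definition, so one coordinate vector may
be used over both points. -/
theorem TangentFun.congr_base (F : TangentFun n M) {p q : M} (h : p = q) (v : Coord n) :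
    F p v = F q v := by subst h; rfl

/-- The expression of a map in charts. -/
def localExpr (e' : OpenPartialHomeomorph N (Coord k)) (ι : N → M)
    (e : OpenPartialHomeomorph M (Coord n)) : Coord k → Coord n :=
  fun z => e (ι (e'.symm z))

theorem mfderiv_localExpr (he : e ∈ IsManifold.maximalAtlas (𝓡 n) ∞ M)
    (he' : e' ∈ IsManifold.maximalAtlas (𝓡 k) ∞ N) {ι : N → M} {u : Coord k} (hu : u ∈ e'.target)
    (hι : MDifferentiableAt (𝓡 k) (𝓡 n) ι (e'.symm u)) (hs : ι (e'.symm u) ∈ e.source)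
    (v : Coord k) :
    (mfderiv (𝓡 n) (𝓡 n) e.symm (localExpr e' ι e u) (fderiv ℝ (localExpr e' ι e) u v) : Coord n)
      = mfderiv (𝓡 k) (𝓡 n) ι (e'.symm u) (mfderiv (𝓡 k) (𝓡 k) e'.symm u v) := by
  have hd := mdifferentiableAt_chart_symm he' hu
  have hc : MDifferentiableAt (𝓡 k) (𝓡 n) (ι ∘ e'.symm) u := hι.comp u hd
  have hχ : MDifferentiableAt (𝓡 k) (𝓡 n) (localExpr e' ι e) u :=
    ((mdifferentiable_chart he).mdifferentiableAt hs).comp u hc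
  have hev : (e.symm ∘ localExpr e' ι e) =ᶠ[𝓝 u] (ι ∘ e'.symm) := by
    filter_upwards [hc.continuousAt.preimage_mem_nhds (e.open_source.mem_nhds hs)] with z hz
    exact e.left_inv hz
  have h1 := hev.mfderiv_eq (I := 𝓡 k) (I' := 𝓡 n)
  rw [mfderiv_comp u hι hd, mfderiv_comp u
    (mdifferentiableAt_chart_symm he (e.map_source hs)) hχ] at h1
  have h2 := congrArg (fun A : Coord k →L[ℝ] Coord n => A v) h1
  rw [← mfderiv_eq_fderiv]
  exact h2

theorem inChart_induced (he : e ∈ IsManifold.maximalAtlas (𝓡 n) ∞ M)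
    (he' : e' ∈ IsManifold.maximalAtlas (𝓡 k) ∞ N) {ι : N → M} {u : Coord k} (hu : u ∈ e'.target)
    (hι : MDifferentiableAt (𝓡 k) (𝓡 n) ι (e'.symm u)) (hs : ι (e'.symm u) ∈ e.source)
    (F : TangentFun n M) (v : Coord k) :
    inChart (induced (k := k) F ι) e' u v
      = inChart F e (localExpr e' ι e u) (fderiv ℝ (localExpr e' ι e) u v) := by
  have h := mfderiv_localExpr he he' hu hι hs v
  have hb : e.symm (localExpr e' ι e u) = ι (e'.symm u) := e.left_inv hs
  change F (ι (e'.symm u)) (mfderiv (𝓡 k) (𝓡 n) ι (e'.symm u) (mfderiv (𝓡 k) (𝓡 k) e'.symm u v))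
    = F (e.symm (localExpr e' ι e u)) (mfderiv (𝓡 n) (𝓡 n) e.symm (localExpr e' ι e u)
      (fderiv ℝ (localExpr e' ι e) u v))
  exact (F.congr_base hb.symm _).trans (congrArg (F _) h.symm)

theorem fderiv_localExpr_injective (he : e ∈ IsManifold.maximalAtlas (𝓡 n) ∞ M)
    (he' : e' ∈ IsManifold.maximalAtlas (𝓡 k) ∞ N) {ι : N → M} {u : Coord k} (hu : u ∈ e'.target)
    (hι : MDifferentiableAt (𝓡 k) (𝓡 n) ι (e'.symm u)) (hs : ι (e'.symm u) ∈ e.source)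
    (hinj : Function.Injective (mfderiv (𝓡 k) (𝓡 n) ι (e'.symm u))) :
    Function.Injective (fderiv ℝ (localExpr e' ι e) u) := by
  intro v w hvw
  have h1 := mfderiv_localExpr he he' hu hι hs v
  have h2 := mfderiv_localExpr he he' hu hι hs w
  rw [hvw] at h1
  exact (mfderiv_chart_symm_bijective he' hu).1 (hinj (h1.symm.trans h2))

theorem induced_id (F : TangentFun n M) : induced (k := n) F (id : M → M) = F := by
  funext u v
  simp only [induced, mfderiv_id]
  rfl

/-- The domain on which `localExpr` is the expression of the map. -/
def localDom (e' : OpenPartialHomeomorph N (Coord k)) (ι : N → M)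
    (e : OpenPartialHomeomorph M (Coord n)) : Set (Coord k) :=
  {u | u ∈ e'.target ∧ ι (e'.symm u) ∈ e.source}

omit [ChartedSpace (Coord n) M] [ChartedSpace (Coord k) N] in
theorem isOpen_localDom {ι : N → M} (hι : Continuous ι) : IsOpen (localDom e' ι e) :=
  e'.continuousOn_symm.isOpen_inter_preimage e'.open_target (e.open_source.preimage hι)

omit [ChartedSpace (Coord n) M] [ChartedSpace (Coord k) N] in
theorem mapsTo_localExpr {ι : N → M} :
    Set.MapsTo (localExpr e' ι e) (localDom e' ι e) e.target := fun _ hu => e.map_source hu.2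

theorem contDiffOn_localExpr (he : e ∈ IsManifold.maximalAtlas (𝓡 n) ∞ M)
    (he' : e' ∈ IsManifold.maximalAtlas (𝓡 k) ∞ N) {ι : N → M}
    (hι : ContMDiff (𝓡 k) (𝓡 n) ∞ ι) :
    ContDiffOn ℝ ∞ (localExpr e' ι e) (localDom e' ι e) := by
  rw [← contMDiffOn_iff_contDiffOn]
  refine (contMDiffOn_of_mem_maximalAtlas he).comp (hι.comp_contMDiffOn
    ((contMDiffOn_symm_of_mem_maximalAtlas he').mono fun u hu => hu.1)) fun u hu => hu.2

theorem contDiffOn_fun_chart (he : e ∈ IsManifold.maximalAtlas (𝓡 n) ∞ M) {ρ : M → ℝ}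
    (hρ : ContMDiff (𝓡 n) 𝓘(ℝ, ℝ) ∞ ρ) : ContDiffOn ℝ ∞ (fun z => ρ (e.symm z)) e.target := by
  rw [← contMDiffOn_iff_contDiffOn]
  exact hρ.comp_contMDiffOn (contMDiffOn_symm_of_mem_maximalAtlas he)

theorem isCritical_iff_partialD (he : e ∈ IsManifold.maximalAtlas (𝓡 n) ∞ M) {ρ : M → ℝ}
    (hρ : ContMDiff (𝓡 n) 𝓘(ℝ, ℝ) ∞ ρ) {x : Coord n} (hx : x ∈ e.target) :
    IsCritical n ρ (e.symm x) ↔ ∀ a, partialD a (fun z => ρ (e.symm z)) x = 0 := by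
  have h1 : mfderiv (𝓡 n) 𝓘(ℝ, ℝ) (ρ ∘ e.symm) x
      = (mfderiv (𝓡 n) 𝓘(ℝ, ℝ) ρ (e.symm x)).comp (mfderiv (𝓡 n) (𝓡 n) e.symm x) :=
    mfderiv_comp x (hρ.mdifferentiableAt (by simp)) (mdifferentiableAt_chart_symm he hx)
  rw [mfderiv_eq_fderiv] at h1
  have h2 : ∀ v, fderiv ℝ (fun z => ρ (e.symm z)) x v
      = mfderiv (𝓡 n) 𝓘(ℝ, ℝ) ρ (e.symm x) (mfderiv (𝓡 n) (𝓡 n) e.symm x v) := fun v =>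
    congrArg (fun A : Coord n →L[ℝ] ℝ => A v) h1
  constructor
  · intro h a
    rw [partialD, h2, h]; rfl
  · intro h
    ext w
    obtain ⟨v, rfl⟩ := (mfderiv_chart_symm_bijective he hx).2 w
    have h3 : ∀ v : Coord n, fderiv ℝ (fun z => ρ (e.symm z)) x v = 0 := fun v => by
      rw [fderiv_eq_sum_partialD]; simp [h]
    exact (h2 v).symm.trans (h3 v)

end Charts

/-! ### A chart-free form of independence of the direction. -/

section Quadratic

variable {n : ℕ} {M : Type*} [TopologicalSpace M] [ChartedSpace (Coord n) M]
  {e : OpenPartialHomeomorph M (Coord n)} {F : TangentFun n M}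

/-- `F²` is a quadratic form on the tangent space at `p`. -/
def QuadAt (F : TangentFun n M) (p : M) : Prop :=
  ∃ B : TangentSpace (𝓡 n) p →ₗ[ℝ] TangentSpace (𝓡 n) p →ₗ[ℝ] ℝ, ∀ v, F p v ^ 2 = B v v

/-- The `g_{ij}` in coordinates do not depend on the direction. -/
def ConstAt (L : Coord n → Coord n → ℝ) (x : Coord n) : Prop :=
  ∀ i j y y', y ≠ 0 → y' ≠ 0 → gLow L i j x y = gLow L i j x y'

/-- B need not be symmetric; its symmetrisation G has the same quadratic form and is the metric
tensor in every direction. -/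
theorem QuadAt.constAt {x : Coord n} (h : QuadAt F (e.symm x)) : ConstAt (inChart F e) x := by
  obtain ⟨B, hB⟩ := h
  set A : Coord n →L[ℝ] TangentSpace (𝓡 n) (e.symm x) := mfderiv (𝓡 n) (𝓡 n) e.symm x
  set G : Matrix (Fin n) (Fin n) ℝ := Matrix.of fun i j =>
    (B (A (EuclideanSpace.single i 1)) (A (EuclideanSpace.single j 1))
      + B (A (EuclideanSpace.single j 1)) (A (EuclideanSpace.single i 1))) / 2
  have hq : ∀ y, inChart F e x y ^ 2 = ∑ a, ∑ b, G a b * y a * y b := by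
    intro y
    have h1 : inChart F e x y ^ 2 = B (A y) (A y) := hB (A y)
    have h2 : A y = ∑ i, y i • A (EuclideanSpace.single i 1) := by
      conv_lhs => rw [coord_eq_sum_single y]
      rw [map_sum]
      exact Finset.sum_congr rfl fun i _ => map_smul A _ _
    have h3 : B (A y) (A y) = ∑ a, ∑ b, y a * (y b
        * B (A (EuclideanSpace.single a 1)) (A (EuclideanSpace.single b 1))) := by
      rw [h2]
      simp only [map_sum, map_smul, LinearMap.sum_apply, LinearMap.smul_apply, smul_eq_mul,
        Finset.mul_sum]
      rw [Finset.sum_comm]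
      exact Finset.sum_congr rfl fun a _ => Finset.sum_congr rfl fun b _ => by ring
    have h4 : B (A y) (A y) = ∑ a, ∑ b, y a * (y b
        * B (A (EuclideanSpace.single b 1)) (A (EuclideanSpace.single a 1))) := by
      rw [h3, Finset.sum_comm]
      exact Finset.sum_congr rfl fun a _ => Finset.sum_congr rfl fun b _ => by ring
    have h5 : inChart F e x y ^ 2 = (B (A y) (A y) + B (A y) (A y)) / 2 := by rw [h1]; ring
    rw [h5]
    nth_rewrite 1 [h3]
    rw [h4, ← Finset.sum_add_distrib, Finset.sum_div]
    refine Finset.sum_congr rfl fun a _ => ?_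
    rw [← Finset.sum_add_distrib, Finset.sum_div]
    refine Finset.sum_congr rfl fun b _ => ?_
    simp only [G, Matrix.of_apply]; ring
  have hG : ∀ a b, G a b = G b a := fun a b => by simp only [G, Matrix.of_apply]; ring
  intro i j y y' _ _
  rw [gLow_of_quadratic hG hq, gLow_of_quadratic hG hq]

theorem ConstAt.sq_eq {L : Coord n → Coord n → ℝ} {W : Set (Coord n)} (hL : IsFinslerOn W L)
    {x : Coord n} (hx : x ∈ W) (hc : ConstAt L x) {y₀ : Coord n} (hy₀ : y₀ ≠ 0) (y : Coord n) :
    L x y ^ 2 = ∑ a, ∑ b, gLow L a b x y₀ * y a * y b := by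
  by_cases hy : y = 0
  · subst hy
    rw [hL.map_zero hx]; simp
  · rw [hL.sq_eq_sum hx hy]
    exact Finset.sum_congr rfl fun a _ => Finset.sum_congr rfl fun b _ => by
      rw [hc a b y y₀ hy hy₀]

/-- By Euler's relation L² is the quadratic form of the constant g_{ij}; the differential of the
chart carries it to the tangent space. -/
theorem QuadAt.of_constAt (he : e ∈ IsManifold.maximalAtlas (𝓡 n) ∞ M)
    (hL : IsFinslerOn e.target (inChart F e)) {x : Coord n} (hx : x ∈ e.target)
    (hc : ConstAt (inChart F e) x) {y₀ : Coord n} (hy₀ : y₀ ≠ 0) : QuadAt F (e.symm x) := by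
  set A : TangentSpace (𝓡 n) (e.symm x) →L[ℝ] Coord n := mfderiv (𝓡 n) (𝓡 n) e (e.symm x)
  have hA : ∀ v : TangentSpace (𝓡 n) (e.symm x), mfderiv (𝓡 n) (𝓡 n) e.symm x (A v) = v := by
    intro v
    obtain ⟨w, rfl⟩ := (mfderiv_chart_symm_bijective he hx).2 v
    have := (mdifferentiable_chart he).comp_symm_deriv hx
    have h1 : A (mfderiv (𝓡 n) (𝓡 n) e.symm x w) = w :=
      congrArg (fun T : Coord n →L[ℝ] Coord n => T w) this
    rw [h1]
  set G := fun i j => gLow (inChart F e) i j x y₀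
  refine ⟨LinearMap.mk₂ ℝ (fun v w => ∑ i, ∑ j, G i j * A v i * A w j) ?_ ?_ ?_ ?_, fun v => ?_⟩
  · intro u v w
    simp only [map_add, PiLp.add_apply, mul_add, add_mul, Finset.sum_add_distrib]
  · intro c u v
    simp only [map_smul, PiLp.smul_apply, smul_eq_mul, Finset.mul_sum]
    exact Finset.sum_congr rfl fun a _ => Finset.sum_congr rfl fun b _ => by ring
  · intro u v w
    simp only [map_add, PiLp.add_apply, mul_add, Finset.sum_add_distrib]
  · intro c u v
    simp only [map_smul, PiLp.smul_apply, smul_eq_mul, Finset.mul_sum]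
    exact Finset.sum_congr rfl fun a _ => Finset.sum_congr rfl fun b _ => by ring
  · have := hc.sq_eq hL hx hy₀ (A v)
    rw [show inChart F e x (A v) = F (e.symm x) v from congrArg (F (e.symm x)) (hA v)] at this
    exact this

end Quadratic

end FinslerGeom

namespace FinslerGeom

/-! ### The Finsler metric is Riemannian on the whole manifold. -/

section Global

theorem IsRiem.mono {k : ℕ} {W W' : Set (Coord k)} {g : Coord k → Matrix (Fin k) (Fin k) ℝ}
    (hg : IsRiem W g) (hW' : IsOpen W') (hs : W' ⊆ W) : IsRiem W' g :=
  ⟨hW', fun a b => (hg.smooth a b).mono hs, fun x hx => hg.posDef x (hs hx)⟩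

theorem IsHess.mono {k : ℕ} {W W' : Set (Coord k)} {g : Coord k → Matrix (Fin k) (Fin k) ℝ}
    {r φ : Coord k → ℝ} (h : IsHess W g r φ) (hW' : IsOpen W') (hs : W' ⊆ W) : IsHess W' g r φ :=
  ⟨h.toIsRiem.mono hW' hs, h.smooth_fun.mono hs, fun x hx => h.hess x (hs hx)⟩

theorem quadForm_eq {k : ℕ} (A : Matrix (Fin k) (Fin k) ℝ) (v : Fin k → ℝ) :
    v ⬝ᵥ A.mulVec v = ∑ a, ∑ b, A a b * v a * v b := by
  simp only [dotProduct, Matrix.mulVec, Finset.mul_sum]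
  exact Finset.sum_congr rfl fun a _ => Finset.sum_congr rfl fun b _ => by ring

variable {n : ℕ} {M : Type*} [TopologicalSpace M] [ChartedSpace (Coord n) M]

/-- A Finsler manifold with a solution of `∇^H ∇^H ρ = φ g` whose only critical point is `o`. -/
structure HessData (F : TangentFun n M) (ρ φ : M → ℝ) (o : M) : Prop where
  two_le : 2 ≤ n
  finsler : IsFinsler F
  smooth : ContMDiff (𝓡 n) 𝓘(ℝ, ℝ) ∞ ρ
  hess : SolvesHessianEq F ρ φ
  crit : ∀ p, IsCritical n ρ p ↔ p = o

/-- The vector with all coordinates equal to one. -/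
noncomputable def unitDir (n : ℕ) : Coord n := WithLp.toLp 2 fun _ => 1

theorem unitDir_ne_zero (hn : 2 ≤ n) : unitDir n ≠ 0 := fun h => by
  have : (unitDir n) ⟨0, by omega⟩ = 0 := by rw [h]; rfl
  exact one_ne_zero this

/-- The metric in a chart, evaluated in a fixed direction. -/
noncomputable def chartMetric (F : TangentFun n M) (e : OpenPartialHomeomorph M (Coord n))
    (x : Coord n) : Matrix (Fin n) (Fin n) ℝ :=
  Matrix.of fun i j => gLow (inChart F e) i j x (unitDir n)

namespace HessData

variable {F : TangentFun n M} {ρ φ : M → ℝ} {o : M} (h : HessData F ρ φ o)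
  {e : OpenPartialHomeomorph M (Coord n)}
include h

/-- A ball contains the segment from x₁ to x, so `gLow_const_of_segment` applies when x is not
critical. At the critical point the property follows by continuity from the punctured ball. -/
theorem constAt_of_mem_ball (he : e ∈ IsManifold.maximalAtlas (𝓡 n) ∞ M) {c : Coord n} {δ : ℝ}
    (hb : Metric.ball c δ ⊆ e.target) {x₁ : Coord n} (hx₁ : x₁ ∈ Metric.ball c δ)
    (h₁ : e.symm x₁ = o ∨ ConstAt (inChart F e) x₁) {x : Coord n} (hx : x ∈ Metric.ball c δ) :
    ConstAt (inChart F e) x := by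
  have hL := h.finsler e he
  have hW := e.open_target
  have main : ∀ x ∈ Metric.ball c δ, e.symm x ≠ o → ConstAt (inChart F e) x := by
    intro x hx hne i j y y' hy hy'
    have hd : ∃ i, partialD i (fun z => ρ (e.symm z)) (x₁ + (x - x₁)) ≠ 0 := by
      rw [add_sub_cancel]
      by_contra! hcon
      exact hne ((h.crit _).1 ((isCritical_iff_partialD he h.smooth (hb hx)).2 hcon))
    have h2 := hL.gLow_const_of_segment hW (contDiffOn_fun_chart he h.smooth) (h.hess e he) h.two_le
      (x := x₁) (w := x - x₁) (fun t ht => hb ?_) ?_ hd i j hy hy'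
    · rwa [add_sub_cancel] at h2
    · have := (convex_ball c δ).add_smul_sub_mem hx₁ hx ht
      exact this
    · rcases h₁ with h₁ | h₁
      · exact Or.inl ((isCritical_iff_partialD he h.smooth (hb hx₁)).1 ((h.crit _).2 h₁))
      · exact Or.inr h₁
  by_cases hxo : e.symm x = o
  swap
  · exact main x hx hxo
  intro i j y y' hy hy'
  have hcont : ∀ y : Coord n, y ≠ 0 → ContinuousAt (fun z => gLow (inChart F e) i j z y) x := by
    intro y hy
    have h1 := (hL.jsmooth_gLow hW i j).continuousOn.continuousAt
      ((hW.prod isOpen_ne).mem_nhds (⟨hb hx, hy⟩ : (x, y) ∈ e.target ×ˢ {y | y ≠ 0}))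
    exact h1.comp (f := fun z => (z, y)) (by fun_prop)
  have : Nonempty (Fin n) := ⟨⟨0, by have := h.two_le; omega⟩⟩
  have hne : (𝓝[≠] x).NeBot := Module.punctured_nhds_neBot ℝ (Coord n) x
  have t1 := ((hcont y hy).tendsto).mono_left (nhdsWithin_le_nhds (s := {x}ᶜ))
  have t2 := ((hcont y' hy').tendsto).mono_left (nhdsWithin_le_nhds (s := {x}ᶜ))
  refine tendsto_nhds_unique_of_eventuallyEq t1 t2 ?_
  filter_upwards [self_mem_nhdsWithin, mem_nhdsWithin_of_mem_nhds (Metric.isOpen_ball.mem_nhds hx)]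
    with z hz hzb
  refine main z hzb (fun hzo => hz ?_) i j y y' hy hy'
  exact e.symm.injOn (hb hzb) (hb hx) (hzo.trans hxo.symm)

/-- In a coordinate ball one good point, or the point `o`, makes all points good. Hence both the set
of good points and its complement are open. -/
theorem exists_nhd_quadAt [IsManifold (𝓡 n) ∞ M] (p : M) :
    ∃ U, IsOpen U ∧ p ∈ U ∧ ((∃ q ∈ U, q = o ∨ QuadAt F q) → ∀ q ∈ U, QuadAt F q) := by
  set e := chartAt (Coord n) p
  have he : e ∈ IsManifold.maximalAtlas (𝓡 n) ∞ M := IsManifold.chart_mem_maximalAtlas p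
  have hp : p ∈ e.source := mem_chart_source _ p
  obtain ⟨δ, hδ, hb⟩ := Metric.isOpen_iff.1 e.open_target _ (e.map_source hp)
  refine ⟨e.source ∩ e ⁻¹' Metric.ball (e p) δ, e.isOpen_inter_preimage Metric.isOpen_ball,
    ⟨hp, Metric.mem_ball_self hδ⟩, ?_⟩
  rintro ⟨q, ⟨hqs, hqb⟩, hq⟩ z ⟨hzs, hzb⟩
  have hq' : e.symm (e q) = o ∨ ConstAt (inChart F e) (e q) := by
    rw [e.left_inv hqs]
    refine hq.imp id fun hq => ?_
    rw [← e.left_inv hqs] at hq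
    exact hq.constAt
  have := QuadAt.of_constAt he (h.finsler e he) (hb hzb) (h.constAt_of_mem_ball he hb hqb hq' hzb)
    (unitDir_ne_zero h.two_le)
  rwa [e.left_inv hzs] at this

/-- Open, closed, and containing `o`: connectedness does the rest. -/
theorem quadAt [IsManifold (𝓡 n) ∞ M] [ConnectedSpace M] (p : M) : QuadAt F p := by
  have hS : IsClopen {p | QuadAt F p} := by
    constructor
    · rw [← isOpen_compl_iff, isOpen_iff_mem_nhds]
      intro p hp
      obtain ⟨U, hU, hpU, hUq⟩ := h.exists_nhd_quadAt p
      filter_upwards [hU.mem_nhds hpU] with q hq hqq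
      exact hp (hUq ⟨q, hq, Or.inr hqq⟩ p hpU)
    · rw [isOpen_iff_mem_nhds]
      intro p hp
      obtain ⟨U, hU, hpU, hUq⟩ := h.exists_nhd_quadAt p
      filter_upwards [hU.mem_nhds hpU] with q hq
      exact hUq ⟨p, hpU, Or.inr hp⟩ q hq
  have hne : {p | QuadAt F p}.Nonempty := by
    obtain ⟨U, hU, hpU, hUq⟩ := h.exists_nhd_quadAt o
    exact ⟨o, hUq ⟨o, hpU, Or.inl rfl⟩ o hpU⟩
  have := hS.eq_univ hne
  have hp : p ∈ {p | QuadAt F p} := by rw [this]; trivial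
  exact hp

variable [IsManifold (𝓡 n) ∞ M] [ConnectedSpace M]

theorem constAt {x : Coord n} : ConstAt (inChart F e) x := (h.quadAt (e.symm x)).constAt

theorem isNormOf (he : e ∈ IsManifold.maximalAtlas (𝓡 n) ∞ M) :
    IsNormOf e.target (inChart F e) (chartMetric F e) := fun _ hx y =>
  h.constAt.sq_eq (h.finsler e he) hx (unitDir_ne_zero h.two_le) y

omit [IsManifold (𝓡 n) ∞ M] [ConnectedSpace M] in
theorem isRiem (he : e ∈ IsManifold.maximalAtlas (𝓡 n) ∞ M) :
    IsRiem e.target (chartMetric F e) where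
  isOpen := e.open_target
  smooth i j := by
    have h1 := (h.finsler e he).jsmooth_gLow e.open_target i j
    refine ContDiffOn.comp (g := fun p : Coord n × Coord n => gLow (inChart F e) i j p.1 p.2)
      (f := fun z => (z, unitDir n)) h1 (by fun_prop) fun x hx => ⟨hx, unitDir_ne_zero h.two_le⟩
  posDef x hx := (h.finsler e he).posDef x hx _ (unitDir_ne_zero h.two_le)

theorem isHess (he : e ∈ IsManifold.maximalAtlas (𝓡 n) ∞ M) :
    IsHess e.target (chartMetric F e) (fun z => ρ (e.symm z)) (fun z => φ (e.symm z)) where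
  toIsRiem := h.isRiem he
  smooth_fun := contDiffOn_fun_chart he h.smooth
  hess x hx a b := by
    have h1 := h.hess e he x hx (unitDir n) (unitDir_ne_zero h.two_le) a b
    rw [(h.isRiem he).hessHor_eq (h.isNormOf he) hx] at h1
    rw [← sub_eq_iff_eq_add', h1]; rfl

omit [IsManifold (𝓡 n) ∞ M] [ConnectedSpace M] in
theorem crit_chart (he : e ∈ IsManifold.maximalAtlas (𝓡 n) ∞ M) {x : Coord n} (hx : x ∈ e.target) :
    (∀ a, partialD a (fun z => ρ (e.symm z)) x = 0) ↔ e.symm x = o :=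
  (isCritical_iff_partialD he h.smooth hx).symm.trans (h.crit _)

theorem gradSq_eq_zero_iff (he : e ∈ IsManifold.maximalAtlas (𝓡 n) ∞ M) {x : Coord n}
    (hx : x ∈ e.target) :
    gradSq (chartMetric F e) (fun z => ρ (e.symm z)) x = 0 ↔ e.symm x = o :=
  ((h.isHess he).gradSq_eq_zero_iff hx).trans (h.crit_chart he hx)

theorem gradNorm_eq (he : e ∈ IsManifold.maximalAtlas (𝓡 n) ∞ M) {x : Coord n}
    (hx : x ∈ e.target) (y : Coord n) :
    gradNorm (inChart F e) (fun z => ρ (e.symm z)) x y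
      = √(gradSq (chartMetric F e) (fun z => ρ (e.symm z)) x) := by
  simp only [gradNorm, (h.isRiem he).gUp_eq (h.isNormOf he) hx, gradSq, grad, Finset.sum_mul]
  congr 1
  exact Finset.sum_congr rfl fun i _ => Finset.sum_congr rfl fun j _ => by ring

/-- The metric induced by a map is `JᵀgJ`. -/
theorem induced_sq (he : e ∈ IsManifold.maximalAtlas (𝓡 n) ∞ M) {k : ℕ} {N : Type*}
    [TopologicalSpace N] [ChartedSpace (Coord k) N] {e' : OpenPartialHomeomorph N (Coord k)}
    (he' : e' ∈ IsManifold.maximalAtlas (𝓡 k) ∞ N) {ι : N → M} (hι : ContMDiff (𝓡 k) (𝓡 n) ∞ ι)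
    {u : Coord k} (hu : u ∈ localDom e' ι e) (v : Coord k) :
    inChart (induced (k := k) F ι) e' u v ^ 2
      = ∑ a, ∑ b, ((jac (localExpr e' ι e) u).transpose * chartMetric F e (localExpr e' ι e u)
        * jac (localExpr e' ι e) u) a b * v a * v b := by
  have hd : DifferentiableAt ℝ (localExpr e' ι e) u :=
    differentiableAt_of_contDiffOn (isOpen_localDom hι.continuous)
      (contDiffOn_localExpr he he' hι) hu
  rw [inChart_induced he he' hu.1 (hι.mdifferentiableAt (by simp)) hu.2,
    h.isNormOf he _ (mapsTo_localExpr hu)]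
  simp only [← quadForm_eq]
  have e1 : ((fderiv ℝ (localExpr e' ι e) u v : Coord n) : Fin n → ℝ)
      = (jac (localExpr e' ι e) u).mulVec (v : Fin k → ℝ) :=
    funext fun i => fderiv_apply_eq_mulVec hd v i
  rw [e1, ← Matrix.mulVec_mulVec, ← Matrix.mulVec_mulVec, Matrix.mulVec_transpose,
    dotProduct_comm (v : Fin k → ℝ), ← Matrix.dotProduct_mulVec, dotProduct_comm]

theorem chartMetric_comp {e' : OpenPartialHomeomorph M (Coord n)}
    (he : e ∈ IsManifold.maximalAtlas (𝓡 n) ∞ M) (he' : e' ∈ IsManifold.maximalAtlas (𝓡 n) ∞ M)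
    {u : Coord n} (hu : u ∈ localDom e' id e) :
    chartMetric F e' u = (jac (localExpr e' id e) u).transpose
      * chartMetric F e (localExpr e' id e u) * jac (localExpr e' id e) u := by
  have h1 := fun v => h.induced_sq he he' contMDiff_id hu v
  rw [induced_id] at h1
  ext i j
  refine gLow_of_quadratic (fun a b => ?_) h1 i j _
  have hT := (h.isRiem he).transpose (mapsTo_localExpr hu)
  have : ((jac (localExpr e' id e) u).transpose * chartMetric F e (localExpr e' id e u)
      * jac (localExpr e' id e) u).transpose = (jac (localExpr e' id e) u).transpose
      * chartMetric F e (localExpr e' id e u) * jac (localExpr e' id e) u := by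
    rw [Matrix.transpose_mul, Matrix.transpose_mul, Matrix.transpose_transpose, hT, Matrix.mul_assoc]
  exact congrFun (congrFun this b) a

omit [ConnectedSpace M] [IsManifold (𝓡 n) ∞ M] [ChartedSpace (Coord n) M] h in
theorem comp_localExpr_id {e' : OpenPartialHomeomorph M (Coord n)} (f : M → ℝ) :
    ∀ u ∈ localDom e' id e, f (e'.symm u) = f (e.symm (localExpr e' id e u)) := fun u hu => by
  rw [show e.symm (localExpr e' id e u) = e'.symm u from e.left_inv hu.2]

theorem isHess_localDom {e' : OpenPartialHomeomorph M (Coord n)}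
    (he' : e' ∈ IsManifold.maximalAtlas (𝓡 n) ∞ M) (e : OpenPartialHomeomorph M (Coord n)) :
    IsHess (localDom e' id e) (chartMetric F e') (fun z => ρ (e'.symm z)) (fun z => φ (e'.symm z)) :=
  (h.isHess he').mono (isOpen_localDom continuous_id) fun _ hu => hu.1

theorem grad_chart_comp {e' : OpenPartialHomeomorph M (Coord n)}
    (he : e ∈ IsManifold.maximalAtlas (𝓡 n) ∞ M) (he' : e' ∈ IsManifold.maximalAtlas (𝓡 n) ∞ M)
    {u : Coord n} (hu : u ∈ localDom e' id e) (i : Fin n) :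
    ∑ a, jac (localExpr e' id e) u i a * grad (chartMetric F e') (fun z => ρ (e'.symm z)) a u
      = grad (chartMetric F e) (fun z => ρ (e.symm z)) i (localExpr e' id e u) :=
  (h.isHess he).grad_comp (h.isHess_localDom he' e) (contDiffOn_localExpr he he' contMDiff_id)
    mapsTo_localExpr (comp_localExpr_id ρ) (fun _ hx => h.chartMetric_comp he he' hx) hu i

theorem gradSq_chart_comp {e' : OpenPartialHomeomorph M (Coord n)}
    (he : e ∈ IsManifold.maximalAtlas (𝓡 n) ∞ M) (he' : e' ∈ IsManifold.maximalAtlas (𝓡 n) ∞ M)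
    {u : Coord n} (hu : u ∈ localDom e' id e) :
    gradSq (chartMetric F e') (fun z => ρ (e'.symm z)) u
      = gradSq (chartMetric F e) (fun z => ρ (e.symm z)) (localExpr e' id e u) :=
  (h.isHess he).gradSq_comp (h.isHess_localDom he' e) (contDiffOn_localExpr he he' contMDiff_id)
    mapsTo_localExpr (comp_localExpr_id ρ) (fun _ hx => h.chartMetric_comp he he' hx) hu

theorem defect_chart_comp {e' : OpenPartialHomeomorph M (Coord n)}
    (he : e ∈ IsManifold.maximalAtlas (𝓡 n) ∞ M) (he' : e' ∈ IsManifold.maximalAtlas (𝓡 n) ∞ M)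
    {u : Coord n} (hu : u ∈ localDom e' id e) (κ : ℝ)
    (h0 : ∀ i l, defect (chartMetric F e) (fun z => ρ (e.symm z)) (fun z => φ (e.symm z)) κ i l
      (localExpr e' id e u) = 0) (i l : Fin n) :
    defect (chartMetric F e') (fun z => ρ (e'.symm z)) (fun z => φ (e'.symm z)) κ i l u = 0 :=
  (h.isHess he).defect_eq_zero_comp (h.isHess_localDom he' e)
    (contDiffOn_localExpr he he' contMDiff_id) mapsTo_localExpr (comp_localExpr_id ρ)
    (fun _ hx => h.chartMetric_comp he he' hx) (comp_localExpr_id φ) κ hu h0 i l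

end HessData

/-- The function `‖grad ρ‖²` on the manifold. -/
noncomputable def normSq (F : TangentFun n M) (ρ : M → ℝ) (p : M) : ℝ :=
  gradSq (chartMetric F (chartAt (Coord n) p)) (fun z => ρ ((chartAt (Coord n) p).symm z))
    (chartAt (Coord n) p p)

/-- The vanishing of the defect tensor at a point. -/
def DefectZero (F : TangentFun n M) (ρ φ : M → ℝ) (κ : ℝ) (p : M) : Prop :=
  ∀ i l, defect (chartMetric F (chartAt (Coord n) p)) (fun z => ρ ((chartAt (Coord n) p).symm z))
    (fun z => φ ((chartAt (Coord n) p).symm z)) κ i l (chartAt (Coord n) p p) = 0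

namespace HessData

variable {F : TangentFun n M} {ρ φ : M → ℝ} {o : M} (h : HessData F ρ φ o)
  {e : OpenPartialHomeomorph M (Coord n)} [IsManifold (𝓡 n) ∞ M] [ConnectedSpace M]
include h

omit h [IsManifold (𝓡 n) ∞ M] [ConnectedSpace M] [ChartedSpace (Coord n) M] in
theorem mem_localDom_id {e' : OpenPartialHomeomorph M (Coord n)} {p : M} (hp' : p ∈ e'.source)
    (hp : p ∈ e.source) : e' p ∈ localDom e' id e ∧ localExpr e' id e (e' p) = e p := by
  refine ⟨⟨e'.map_source hp', ?_⟩, ?_⟩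
  · rwa [e'.left_inv hp']
  · simp only [localExpr, id, e'.left_inv hp']

/-- The preferred chart at p used in the definition may be replaced by any chart around p, which
turns local computations into statements about a function on M. -/
theorem normSq_eq (he : e ∈ IsManifold.maximalAtlas (𝓡 n) ∞ M) {p : M} (hp : p ∈ e.source) :
    normSq F ρ p = gradSq (chartMetric F e) (fun z => ρ (e.symm z)) (e p) := by
  obtain ⟨h1, h2⟩ := mem_localDom_id (mem_chart_source (Coord n) p) hp
  rw [← h2]
  exact h.gradSq_chart_comp he (IsManifold.chart_mem_maximalAtlas p) h1

theorem normSq_symm (he : e ∈ IsManifold.maximalAtlas (𝓡 n) ∞ M) {x : Coord n}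
    (hx : x ∈ e.target) :
    normSq F ρ (e.symm x) = gradSq (chartMetric F e) (fun z => ρ (e.symm z)) x := by
  rw [h.normSq_eq he (e.map_target hx), e.right_inv hx]

theorem defectZero_iff (he : e ∈ IsManifold.maximalAtlas (𝓡 n) ∞ M) {p : M} (hp : p ∈ e.source)
    {κ : ℝ} : DefectZero F ρ φ κ p ↔ ∀ i l, defect (chartMetric F e) (fun z => ρ (e.symm z))
      (fun z => φ (e.symm z)) κ i l (e p) = 0 := by
  have hc := IsManifold.chart_mem_maximalAtlas (I := 𝓡 n) (n := ∞) p
  constructor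
  · intro h0
    obtain ⟨h1, h2⟩ := mem_localDom_id hp (mem_chart_source (Coord n) p)
    exact h.defect_chart_comp hc he h1 κ (by rw [h2]; exact h0)
  · intro h0
    obtain ⟨h1, h2⟩ := mem_localDom_id (mem_chart_source (Coord n) p) hp
    exact h.defect_chart_comp he hc h1 κ (by rw [h2]; exact h0)

theorem normSq_nonneg (p : M) : 0 ≤ normSq F ρ p :=
  (h.isHess (IsManifold.chart_mem_maximalAtlas p)).gradSq_nonneg (mem_chart_target _ p)

theorem normSq_eq_zero_iff (p : M) : normSq F ρ p = 0 ↔ p = o := by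
  rw [normSq, h.gradSq_eq_zero_iff (IsManifold.chart_mem_maximalAtlas p) (mem_chart_target _ p),
    (chartAt (Coord n) p).left_inv (mem_chart_source _ p)]

theorem normSq_pos {p : M} (hp : p ≠ o) : 0 < normSq F ρ p :=
  lt_of_le_of_ne (h.normSq_nonneg p) fun h0 => hp ((h.normSq_eq_zero_iff p).1 h0.symm)

end HessData

end Global

end FinslerGeom

namespace FinslerGeom

/-! ### Local boxes in which r is one of the coordinates. -/

section Box

variable {k : ℕ} {W : Set (Coord k)} {g : Coord k → Matrix (Fin k) (Fin k) ℝ} {r φ : Coord k → ℝ}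

/-- The `j`-th coordinate replaced by the function `r`. -/
noncomputable def straighten (r : Coord k → ℝ) (j : Fin k) (x : Coord k) : Coord k :=
  x + (r x - x j) • EuclideanSpace.single j 1

theorem straighten_apply (r : Coord k → ℝ) (j : Fin k) (x : Coord k) : straighten r j x j = r x := by
  simp [straighten]

theorem exists_hasFDerivAt_straighten {r : Coord k → ℝ} {j : Fin k} {x : Coord k}
    (hr : DifferentiableAt ℝ r x) (hj : partialD j r x ≠ 0) :
    ∃ f' : Coord k ≃L[ℝ] Coord k, HasFDerivAt (straighten r j) (f' : Coord k →L[ℝ] Coord k) x := by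
  set A : Coord k →L[ℝ] Coord k := ContinuousLinearMap.id ℝ _
    + (fderiv ℝ r x - EuclideanSpace.proj j).smulRight (EuclideanSpace.single j (1 : ℝ))
  have hA : HasFDerivAt (straighten r j) A x := by
    have h1 : HasFDerivAt (fun z : Coord k => z j) (EuclideanSpace.proj j : Coord k →L[ℝ] ℝ) x :=
      (EuclideanSpace.proj j : Coord k →L[ℝ] ℝ).hasFDerivAt
    exact (hasFDerivAt_id x).add ((hr.hasFDerivAt.sub h1).smul_const _)
  have hAv : ∀ v i, A v i = v i + (fderiv ℝ r x v - v j) * (if i = j then 1 else 0) := by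
    intro v i
    simp [A]
  have hinj : Function.Injective (A : Coord k →ₗ[ℝ] Coord k) := by
    rw [← LinearMap.ker_eq_bot, LinearMap.ker_eq_bot']
    intro v hv
    have hv' : ∀ i, A v i = 0 := fun i => by
      have : A v = 0 := hv
      rw [this]; rfl
    have h1 : ∀ i, i ≠ j → v i = 0 := fun i hi => by
      have := hv' i
      rw [hAv, if_neg hi, mul_zero, add_zero] at this
      exact this
    have h2 : fderiv ℝ r x v = 0 := by
      have := hv' j
      rw [hAv, if_pos rfl] at this
      linarith
    rw [fderiv_eq_sum_partialD, Finset.sum_eq_single j (fun i _ hi => by rw [h1 i hi, zero_mul])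
      (by simp)] at h2
    ext i
    by_cases hi : i = j
    · rw [hi]; exact (mul_eq_zero.1 h2).resolve_right hj
    · exact h1 i hi
  refine ⟨(LinearEquiv.ofInjectiveEndo _ hinj).toContinuousLinearEquiv, ?_⟩
  convert hA using 1
  exact ContinuousLinearMap.ext fun v => rfl

/-- Near a regular point the function `gradSq` depends on `r` only, and level sets are connected. -/
theorem IsHess.exists_box (h : IsHess W g r φ) {x₀ : Coord k} (hx₀ : x₀ ∈ W)
    (hreg : ∃ j, partialD j r x₀ ≠ 0) {O : Set (Coord k)} (hO : O ∈ 𝓝 x₀) :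
    ∃ U ∈ 𝓝 x₀, U ⊆ O ∧
      (∃ K, 0 ≤ K ∧ ∀ a ∈ U, ∀ b ∈ U, |gradSq g r a - gradSq g r b| ≤ K * |r a - r b|) ∧
      ∀ a ∈ U, ∀ b ∈ U, r a = r b → ∃ S ⊆ O, IsPreconnected S ∧ a ∈ S ∧ b ∈ S ∧
        ∀ z ∈ S, r z = r a := by
  obtain ⟨j, hj⟩ := hreg
  have hW := h.isOpen
  have hrd : ∀ x ∈ W, DifferentiableAt ℝ r x := fun x hx =>
    differentiableAt_of_contDiffOn hW h.smooth_fun hx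
  obtain ⟨f', hf'⟩ := exists_hasFDerivAt_straighten (hrd x₀ hx₀) hj
  have hrC : ContDiffAt ℝ ∞ r x₀ := h.smooth_fun.contDiffAt (hW.mem_nhds hx₀)
  have hC : ContDiffAt ℝ 1 (straighten r j) x₀ := by
    have h1 : ContDiffAt ℝ 1 (fun z : Coord k => z j) x₀ :=
      (EuclideanSpace.proj j : Coord k →L[ℝ] ℝ).contDiff.contDiffAt
    exact contDiffAt_id.add (((hrC.of_le (by simp)).sub h1).smul contDiffAt_const)
  have hs : HasStrictFDerivAt (straighten r j) (f' : Coord k →L[ℝ] Coord k) x₀ :=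
    hC.hasStrictFDerivAt' hf' (by simp)
  set Ψ := straighten r j
  set ψ := hC.localInverse hf' (by simp)
  have hψC : ContDiffAt ℝ 1 ψ (Ψ x₀) := hC.to_localInverse hf' (by simp)
  have hψ0 : ψ (Ψ x₀) = x₀ := hC.localInverse_apply_image hf' (by simp)
  have hφc : ContinuousAt (fun x => |2 * φ x|) x₀ :=
    (((h.smooth_phi j).continuousOn.continuousAt (hW.mem_nhds hx₀)).const_mul 2).abs
  set K := |2 * φ x₀| + 1
  have hG : {x | x ∈ O ∧ x ∈ W ∧ |2 * φ x| < K} ∈ 𝓝 x₀ :=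
    Filter.inter_mem hO (Filter.inter_mem (hW.mem_nhds hx₀)
      (hφc.eventually_lt_const (by simp [K])))
  have hev : ∀ᶠ z in 𝓝 (Ψ x₀), ContDiffAt ℝ 1 ψ z ∧ Ψ (ψ z) = z ∧
      (ψ z ∈ O ∧ ψ z ∈ W ∧ |2 * φ (ψ z)| < K) := by
    refine (hψC.eventually (by simp)).and (hs.eventually_right_inverse.and ?_)
    have := hψC.continuousAt
    rw [ContinuousAt, hψ0] at this
    exact this hG
  obtain ⟨ε, hε, hB⟩ := Metric.eventually_nhds_iff_ball.1 hev
  set B := Metric.ball (Ψ x₀) ε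
  have hconv : Convex ℝ B := convex_ball _ _
  have hrψ : ∀ z ∈ B, r (ψ z) = z j := fun z hz => by
    rw [← straighten_apply r j (ψ z)]
    exact congrArg (fun w : Coord k => w j) (hB z hz).2.1
  refine ⟨{x | x ∈ O ∧ Ψ x ∈ B ∧ ψ (Ψ x) = x}, ?_, fun x hx => hx.1, ⟨K, by positivity, ?_⟩, ?_⟩
  · refine Filter.inter_mem hO (Filter.inter_mem ?_ hs.eventually_left_inverse)
    exact hC.continuousAt (Metric.ball_mem_nhds _ hε)
  · rintro a ⟨-, haB, ha⟩ b ⟨-, hbB, hb⟩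
    -- A straight line in the straightened coordinates: r is affine along its image with slope r a −
    -- r b, so H has derivative 2φ(r a − r b), bounded by K|r a − r b|.
    set c : ℝ → Coord k := fun s => ψ (Ψ b + s • (Ψ a - Ψ b))
    have hmem : ∀ s ∈ Set.Icc (0 : ℝ) 1, Ψ b + s • (Ψ a - Ψ b) ∈ B := fun s hs =>
      hconv.add_smul_sub_mem hbB haB hs
    have hder : ∀ s ∈ Set.Icc (0 : ℝ) 1, HasDerivAt (fun s => gradSq g r (c s))
        (2 * φ (c s) * (r a - r b)) s := by
      intro s hs
      have hz := hmem s hs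
      obtain ⟨z1, -, -, z4, -⟩ := hB _ hz
      have hl : HasDerivAt (fun s : ℝ => Ψ b + s • (Ψ a - Ψ b)) (Ψ a - Ψ b) s := by
        simpa using ((hasDerivAt_id s).smul_const (Ψ a - Ψ b)).const_add (Ψ b)
      have hc : HasDerivAt c (fderiv ℝ ψ (Ψ b + s • (Ψ a - Ψ b)) (Ψ a - Ψ b)) s :=
        (z1.differentiableAt (by simp)).hasFDerivAt.comp_hasDerivAt s hl
      set v := fderiv ℝ ψ (Ψ b + s • (Ψ a - Ψ b)) (Ψ a - Ψ b)
      have h1 := (hrd _ z4).hasFDerivAt.comp_hasDerivAt s hc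
      have h2 : HasDerivAt (r ∘ c) (r a - r b) s := by
        have h3 : HasDerivAt (fun s : ℝ => (Ψ b + s • (Ψ a - Ψ b)) j) ((Ψ a - Ψ b) j) s :=
          (EuclideanSpace.proj j : Coord k →L[ℝ] ℝ).hasFDerivAt.comp_hasDerivAt s hl
        have h4 : (Ψ a - Ψ b) j = r a - r b := by
          rw [PiLp.sub_apply, straighten_apply, straighten_apply]
        rw [h4] at h3
        refine h3.congr_of_eventuallyEq ?_
        have : ∀ᶠ s' in 𝓝 s, Ψ b + s' • (Ψ a - Ψ b) ∈ B :=
          hl.continuousAt (Metric.isOpen_ball.mem_nhds hz)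
        filter_upwards [this] with s' hs'
        exact hrψ _ hs'
      have h5 := h1.unique h2
      have h6 := (differentiableAt_of_contDiffOn hW h.smooth_gradSq z4).hasFDerivAt.comp_hasDerivAt s hc
      refine h6.congr_deriv ?_
      rw [← h5, fderiv_eq_sum_partialD, fderiv_eq_sum_partialD, Finset.mul_sum]
      refine Finset.sum_congr rfl fun i _ => ?_
      rw [h.partialD_gradSq z4]; ring
    have hmv := norm_image_sub_le_of_norm_deriv_le_segment_01' (f := fun s => gradSq g r (c s))
      (C := K * |r a - r b|) (fun s hs => (hder s hs).hasDerivWithinAt) fun s hs => by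
        rw [Real.norm_eq_abs, abs_mul]
        exact mul_le_mul_of_nonneg_right (hB _ (hmem s ⟨hs.1, hs.2.le⟩)).2.2.2.2.le (abs_nonneg _)
    simpa [c, ha, hb] using hmv
  · rintro a ⟨-, haB, ha⟩ b ⟨-, hbB, hb⟩ hab
    -- A hyperplane slice of the ball is convex, and ψ maps it into one level of r.
    refine ⟨ψ '' (B ∩ {z | z j = r a}), ?_, ?_, ⟨Ψ a, ⟨haB, straighten_apply r j a⟩, ha⟩,
      ⟨Ψ b, ⟨hbB, (straighten_apply r j b).trans hab.symm⟩, hb⟩, ?_⟩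
    · rintro _ ⟨z, ⟨hz, -⟩, rfl⟩
      exact (hB z hz).2.2.1
    · refine IsPreconnected.image ?_ _ fun z hz => (hB z hz.1).1.continuousAt.continuousWithinAt
      refine (hconv.inter ?_).isPreconnected
      exact convex_hyperplane (f := fun z : Coord k => z j) (EuclideanSpace.proj j).isLinear (r a)
    · rintro _ ⟨z, ⟨hz, hzj⟩, rfl⟩
      rw [hrψ z hz]; exact hzj

end Box

/-! ### Level sets on the manifold. -/

section LevelSets

variable {n : ℕ} {M : Type*} [TopologicalSpace M] [ChartedSpace (Coord n) M]
  [IsManifold (𝓡 n) ∞ M] [ConnectedSpace M]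
  {F : TangentFun n M} {ρ φ : M → ℝ} {o : M}

theorem HessData.exists_box (h : HessData F ρ φ o) {p : M} (hp : p ≠ o) {O : Set M} (hO : O ∈ 𝓝 p) :
    ∃ U ∈ 𝓝 p, U ⊆ O ∧
      (∃ K, 0 ≤ K ∧ ∀ a ∈ U, ∀ b ∈ U, |normSq F ρ a - normSq F ρ b| ≤ K * |ρ a - ρ b|) ∧
      ∀ a ∈ U, ∀ b ∈ U, ρ a = ρ b → ∃ S ⊆ O, IsPreconnected S ∧ a ∈ S ∧ b ∈ S ∧
        ∀ z ∈ S, ρ z = ρ a := by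
  set e := chartAt (Coord n) p
  have he : e ∈ IsManifold.maximalAtlas (𝓡 n) ∞ M := IsManifold.chart_mem_maximalAtlas p
  have hps : p ∈ e.source := mem_chart_source _ p
  have hpt := e.map_source hps
  have hreg : ∃ j, partialD j (fun z => ρ (e.symm z)) (e p) ≠ 0 := by
    by_contra! hcon
    exact hp (by rw [← e.left_inv hps]; exact (h.crit_chart he hpt).1 hcon)
  have hO' : e.target ∩ e.symm ⁻¹' O ∈ 𝓝 (e p) := by
    refine Filter.inter_mem (e.open_target.mem_nhds hpt) (e.continuousAt_symm hpt ?_)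
    rwa [e.left_inv hps]
  obtain ⟨U, hU, hUO, ⟨K, hK0, hK⟩, hS⟩ := (h.isHess he).exists_box hpt hreg hO'
  refine ⟨e.source ∩ e ⁻¹' U, Filter.inter_mem (e.open_source.mem_nhds hps) (e.continuousAt hps hU),
    ?_, ⟨K, hK0, ?_⟩, ?_⟩
  · rintro q ⟨hqs, hqU⟩
    have := (hUO hqU).2
    rwa [Set.mem_preimage, e.left_inv hqs] at this
  · rintro a ⟨has, haU⟩ b ⟨hbs, hbU⟩
    have := hK _ haU _ hbU
    rwa [← h.normSq_eq he has, ← h.normSq_eq he hbs, e.left_inv has, e.left_inv hbs] at this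
  · rintro a ⟨has, haU⟩ b ⟨hbs, hbU⟩ hab
    obtain ⟨S, hSO, hSc, haS, hbS, hSr⟩ := hS _ haU _ hbU (by rwa [e.left_inv has, e.left_inv hbs])
    refine ⟨e.symm '' S, ?_, hSc.image _ (e.continuousOn_symm.mono fun z hz => (hSO hz).1),
      ⟨_, haS, e.left_inv has⟩, ⟨_, hbS, e.left_inv hbs⟩, ?_⟩
    · rintro _ ⟨z, hz, rfl⟩
      exact (hSO hz).2
    · rintro _ ⟨z, hz, rfl⟩
      have := hSr z hz
      rwa [e.left_inv has] at this

/-- A function locally constant on a preconnected set is constant on it. -/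
theorem IsPreconnected.eq_of_eventually_eq {X Y : Type*} [TopologicalSpace X] {S : Set X}
    (hS : IsPreconnected S) {f : X → Y} (hf : ∀ x ∈ S, ∀ᶠ y in 𝓝[S] x, f y = f x) {a b : X}
    (ha : a ∈ S) (hb : b ∈ S) : f a = f b := by
  have : PreconnectedSpace S := isPreconnected_iff_preconnectedSpace.1 hS
  have hl : IsLocallyConstant fun x : S => f x := by
    rw [IsLocallyConstant.iff_eventually_eq]
    intro x
    have := hf x x.2
    rw [nhdsWithin_eq_map_subtype_coe x.2] at this
    exact this
  exact hl.apply_eq_of_preconnectedSpace ⟨a, ha⟩ ⟨b, hb⟩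

omit [IsManifold (𝓡 n) ∞ M] [ConnectedSpace M] in
theorem HessData.tLevel_subset (h : HessData F ρ φ o) (p : M) :
    tLevel n ρ p ⊆ {x | ρ x = ρ p ∧ x ≠ o} := fun x hx =>
  ⟨(connectedComponentIn_subset _ _ hx).1,
    fun hxo => (connectedComponentIn_subset _ _ hx).2 ((h.crit x).2 hxo)⟩

omit [IsManifold (𝓡 n) ∞ M] [ConnectedSpace M] in
-- The component of p is by convention empty when p is not in the set, so any member forces p to
-- belong.
theorem mem_tLevel (ρ : M → ℝ) {p x : M} (hx : x ∈ tLevel n ρ p) : p ∈ tLevel n ρ p := by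
  refine mem_connectedComponentIn ?_
  by_contra hcon
  rw [tLevel, connectedComponentIn_eq_empty hcon] at hx
  exact hx

/-- Inside a box H differs by at most K times the difference of ρ, so H is locally constant on the
level, hence constant on a connected part of it. -/
theorem HessData.normSq_tLevel (h : HessData F ρ φ o) {p x : M} (hx : x ∈ tLevel n ρ p) :
    normSq F ρ x = normSq F ρ p := by
  have hp := mem_tLevel ρ hx
  refine IsPreconnected.eq_of_eventually_eq isPreconnected_connectedComponentIn
    (f := normSq F ρ) (fun y hy => ?_) hx hp
  obtain ⟨hy1, hy2⟩ := h.tLevel_subset p hy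
  obtain ⟨U, hU, -, ⟨K, -, hK⟩, -⟩ := h.exists_box hy2 Filter.univ_mem
  filter_upwards [mem_nhdsWithin_of_mem_nhds hU, self_mem_nhdsWithin] with z hz hzl
  have := hK z hz y (mem_of_mem_nhds hU)
  rw [(h.tLevel_subset p hzl).1, hy1, sub_self, abs_zero, mul_zero] at this
  exact sub_eq_zero.1 (abs_eq_zero.1 (le_antisymm this (abs_nonneg _)))

end LevelSets

end FinslerGeom

namespace FinslerGeom

/-! ### Riemannian metrics as Finsler structures. -/

section Local

variable {k : ℕ} {W : Set (Coord k)} {g : Coord k → Matrix (Fin k) (Fin k) ℝ}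
  {L : Coord k → Coord k → ℝ}

theorem IsRiem.quad_pos (hg : IsRiem W g) {x y : Coord k} (hx : x ∈ W) (hy : y ≠ 0) :
    0 < ∑ a, ∑ b, g x a b * y a * y b := by
  have hy' : (y : Fin k → ℝ) ≠ 0 := fun h => hy (by ext i; exact congrFun h i)
  have := (hg.posDef x hx).dotProduct_mulVec_pos hy'
  rwa [star_trivial, quadForm_eq] at this

/-- A Riemannian metric is a Finsler structure. -/
theorem IsRiem.isFinslerOn (hg : IsRiem W g) (hL : IsNormOf W L g)
    (h0 : ∀ x ∈ W, ∀ y, 0 ≤ L x y) : IsFinslerOn W L where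
  nonneg := h0
  smooth := by
    have h1 : ContDiffOn ℝ ∞ (fun p : Coord k × Coord k => √(∑ a, ∑ b, g p.1 a b * p.2 a * p.2 b))
        (W ×ˢ {y | y ≠ 0}) := by
      refine ContDiffOn.sqrt (ContDiffOn.sum fun a _ => ContDiffOn.sum fun b _ => ?_)
        fun p hp => (hg.quad_pos hp.1 hp.2).ne'
      have hc : ∀ a : Fin k, ContDiff ℝ ∞ fun p : Coord k × Coord k => p.2 a := fun a =>
        (EuclideanSpace.proj a : Coord k →L[ℝ] ℝ).contDiff.comp contDiff_snd
      exact (((hg.smooth a b).comp contDiffOn_fst fun p hp => hp.1).mul (hc a).contDiffOn).mul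
        (hc b).contDiffOn
    refine h1.congr fun p hp => ?_
    rw [← hL p.1 hp.1 p.2, Real.sqrt_sq (h0 _ hp.1 _)]
  homogeneous x hx y c hc := by
    refine (sq_eq_sq₀ (h0 x hx _) (mul_nonneg hc.le (h0 x hx y))).1 ?_
    rw [mul_pow, hL x hx, hL x hx, Finset.mul_sum]
    refine Finset.sum_congr rfl fun a _ => ?_
    rw [Finset.mul_sum]
    refine Finset.sum_congr rfl fun b _ => ?_
    simp only [PiLp.smul_apply, smul_eq_mul]; ring
  posDef x hx y _ := by
    have : gMat L x y = g x := by
      ext i j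
      exact hg.gLow_eq hL hx i j y
    rw [this]
    exact hg.posDef x hx

/-- Needed because the metric of a hypersurface is computed in a chart of M that depends on the
point. -/
theorem isFinslerOn_of_local {T : Set (Coord k)}
    (h : ∀ x ∈ T, ∃ W, IsOpen W ∧ x ∈ W ∧ IsFinslerOn W L) : IsFinslerOn T L where
  nonneg x hx := by obtain ⟨W, -, hxW, hW⟩ := h x hx; exact hW.nonneg x hxW
  smooth := by
    rintro ⟨x, y⟩ ⟨hx, hy⟩
    obtain ⟨W, hWo, hxW, hW⟩ := h x hx
    exact (hW.smooth.contDiffAt ((hWo.prod isOpen_ne).mem_nhds ⟨hxW, hy⟩)).contDiffWithinAt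
  homogeneous x hx := by obtain ⟨W, -, hxW, hW⟩ := h x hx; exact hW.homogeneous x hxW
  posDef x hx := by obtain ⟨W, -, hxW, hW⟩ := h x hx; exact hW.posDef x hxW

theorem gLow_div (L : Coord k → Coord k → ℝ) {c : ℝ} (hc : c ≠ 0) (i j : Fin k) (x y : Coord k) :
    gLow L i j x y = c ^ 2 * gLow (fun x y => L x y / c) i j x y := by
  have h1 : ∀ y, L x y ^ 2 = c ^ 2 * (L x y / c) ^ 2 := fun y => by field_simp
  simp only [gLow, dDir]
  conv_lhs => simp only [h1, partialD_const_mul]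
  ring

end Local

/-! ### The rescaled metric on hypersurfaces immersed in a level set. -/

section Hypersurface

variable {m : ℕ} {M : Type*} [TopologicalSpace M] [ChartedSpace (Coord (m + 1)) M]
  [IsManifold (𝓡 (m + 1)) ∞ M] [ConnectedSpace M]
  {F : TangentFun (m + 1) M} {ρ φ : M → ℝ} {o : M}

namespace HessData

variable (h : HessData F ρ φ o)
include h

theorem gradNorm_tLevel {p : M} {e : OpenPartialHomeomorph M (Coord (m + 1))}
    (he : e ∈ IsManifold.maximalAtlas (𝓡 (m + 1)) ∞ M) {x : Coord (m + 1)} (hx : x ∈ e.target)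
    (hxl : e.symm x ∈ tLevel (m + 1) ρ p) (y : Coord (m + 1)) :
    gradNorm (inChart F e) (fun z => ρ (e.symm z)) x y = √(normSq F ρ p) := by
  rw [h.gradNorm_eq he hx, ← h.normSq_symm he hx, h.normSq_tLevel hxl]

variable {N : Type*} [TopologicalSpace N] [ChartedSpace (Coord m) N]

/-- Near u the map ι is read in the chart of M at its image point. There the metric is JᵀgJ/c with c
= `normSq F ρ p`, constant along the level. Injectivity of the differential makes it positive
definite, and `riem_levelSet` computes its curvature. -/
theorem exists_levelMetric {p : M} (hp : p ≠ o) {κ : ℝ}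
    (hdef : ∀ x ∈ tLevel (m + 1) ρ p, DefectZero F ρ φ κ x) {ι : N → M}
    (hι : ContMDiff (𝓡 m) (𝓡 (m + 1)) ∞ ι)
    (hinj : ∀ u : N, Function.Injective (mfderiv (𝓡 m) (𝓡 (m + 1)) ι u))
    (hr : Set.range ι ⊆ tLevel (m + 1) ρ p) {e' : OpenPartialHomeomorph N (Coord m)}
    (he' : e' ∈ IsManifold.maximalAtlas (𝓡 m) ∞ N) {u : Coord m} (hu : u ∈ e'.target) :
    ∃ (W : Set (Coord m)) (g : Coord m → Matrix (Fin m) (Fin m) ℝ), u ∈ W ∧ IsRiem W g ∧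
      IsNormOf W (fun x y => inChart (induced (k := m) F ι) e' x y / √(normSq F ρ p)) g ∧
      (∀ x ∈ W, ∀ y, 0 ≤ inChart (induced (k := m) F ι) e' x y / √(normSq F ρ p)) ∧
      ∀ x ∈ W, ∀ i l, riem g i l x = κ • roundCurv g i l x := by
  set c := normSq F ρ p
  have hc : 0 < c := h.normSq_pos hp
  set e := chartAt (Coord (m + 1)) (ι (e'.symm u))
  have he : e ∈ IsManifold.maximalAtlas (𝓡 (m + 1)) ∞ M := IsManifold.chart_mem_maximalAtlas _
  set χ := localExpr e' ι e
  set W := localDom e' ι e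
  have hWo : IsOpen W := isOpen_localDom hι.continuous
  have hχ : ContDiffOn ℝ ∞ χ W := contDiffOn_localExpr he he' hι
  have hm : Set.MapsTo χ W e.target := mapsTo_localExpr
  have hdx : ∀ x ∈ W, DifferentiableAt ℝ χ x := fun x hx => differentiableAt_of_contDiffOn hWo hχ hx
  have hlev : ∀ x ∈ W, ι (e'.symm x) ∈ tLevel (m + 1) ρ p := fun x _ => hr ⟨_, rfl⟩
  have hback : ∀ x ∈ W, e.symm (χ x) = ι (e'.symm x) := fun x hx => e.left_inv hx.2
  set A : Coord m → Matrix (Fin m) (Fin m) ℝ := fun x =>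
    (jac χ x).transpose * chartMetric F e (χ x) * jac χ x
  have hAs : MSmooth W A :=
    ((jac_smooth hWo hχ).transpose.mul (MSmooth.comp (h.isRiem he).smooth hχ hm)).mul
      (jac_smooth hWo hχ)
  have hApos : ∀ x ∈ W, (A x).PosDef := by
    intro x hx
    have h1 := (h.isRiem he).posDef _ (hm hx)
    have h2 := h1.conjTranspose_mul_mul_same (B := jac χ x) (by
      intro v w hvw
      have h3 := fderiv_localExpr_injective he he' hx.1 (hι.mdifferentiableAt (by simp)) hx.2
        (hinj _) (a₁ := WithLp.toLp 2 v) (a₂ := WithLp.toLp 2 w) (by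
          ext i
          rw [fderiv_apply_eq_mulVec (hdx x hx), fderiv_apply_eq_mulVec (hdx x hx)]
          exact congrFun hvw i)
      exact congrArg (fun z : Coord m => (z : Fin m → ℝ)) h3)
    rwa [Matrix.conjTranspose_eq_transpose_of_trivial] at h2
  have hg : IsRiem W fun x => c⁻¹ • A x := by
    refine ⟨hWo, fun i j => contDiffOn_const.mul (hAs i j), fun x hx => ?_⟩
    exact (hApos x hx).smul (inv_pos.2 hc)
  have hsq : √c ^ 2 = c := Real.sq_sqrt hc.le
  refine ⟨W, _, ⟨hu, mem_chart_source _ _⟩, hg, ?_, ?_, ?_⟩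
  · intro x hx y
    rw [div_pow, hsq, h.induced_sq he he' hι hx, div_eq_inv_mul, Finset.mul_sum]
    refine Finset.sum_congr rfl fun a _ => ?_
    rw [Finset.mul_sum]
    refine Finset.sum_congr rfl fun b _ => ?_
    simp only [Matrix.smul_apply, smul_eq_mul, A, χ]; ring
  · intro x hx y
    refine div_nonneg ?_ (Real.sqrt_nonneg _)
    rw [inChart_induced he he' hx.1 (hι.mdifferentiableAt (by simp)) hx.2]
    exact (h.finsler e he).nonneg _ (hm hx) _
  · intro x hx i l
    refine (h.isHess he).riem_levelSet hg hχ hm (c := c) ?_ hc.ne' ?_ ?_ ?_ hx i l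
    · intro z hz a
      have h1 : partialD a (fun w => ρ (e.symm (χ w))) z = 0 := by
        rw [partialD_congr_of_eqOn (h := fun _ => ρ p) hWo hz a fun w hw => ?_, partialD_const]
        simp only [hback w hw]
        exact (h.tLevel_subset p (hlev w hw)).1
      rw [partialD_comp (f := fun w => ρ (e.symm w)) (differentiableAt_of_contDiffOn
        e.open_target (contDiffOn_fun_chart he h.smooth) (hm hz)) (hdx z hz)] at h1
      exact h1
    · intro z hz
      rw [← h.normSq_symm he (hm hz), hback z hz, h.normSq_tLevel (hlev z hz)]
    · intro z hz
      rw [smul_smul, mul_inv_cancel₀ hc.ne', one_smul]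
    · intro z hz
      exact (h.defectZero_iff he hz.2).1 (hdef _ (hlev z hz))

/-- Hypersurfaces immersed in a level set carry a metric of constant curvature. -/
theorem exists_hypersurface [IsManifold (𝓡 m) ∞ N] {p : M} (hp : p ≠ o) {κ : ℝ}
    (hdef : ∀ x ∈ tLevel (m + 1) ρ p, DefectZero F ρ φ κ x) {ι : N → M}
    (hι : ContMDiff (𝓡 m) (𝓡 (m + 1)) ∞ ι)
    (hinj : ∀ u : N, Function.Injective (mfderiv (𝓡 m) (𝓡 (m + 1)) ι u))
    (hr : Set.range ι ⊆ tLevel (m + 1) ρ p) :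
    ∃ f : TangentFun m N, IsFinsler f ∧
      (∀ e ∈ IsManifold.maximalAtlas (𝓡 m) ∞ N, ∀ u ∈ e.target, ∀ v : Coord m, v ≠ 0 →
        ∀ γ β : Fin m, gLow (inChart (induced (k := m) F ι) e) γ β u v
          = √(normSq F ρ p) ^ 2 * gLow (inChart f e) γ β u v) ∧
      HasConstantCurvature f κ := by
  refine ⟨fun u v => induced (k := m) F ι u v / √(normSq F ρ p), fun e' he' => ?_, ?_, ?_⟩
  · refine isFinslerOn_of_local fun u hu => ?_
    obtain ⟨W, g, huW, hg, hL, h0, -⟩ := h.exists_levelMetric hp hdef hι hinj hr he' hu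
    exact ⟨W, hg.isOpen, huW, hg.isFinslerOn hL h0⟩
  · intro e' _ u _ v _ γ β
    exact gLow_div _ (Real.sqrt_pos.2 (h.normSq_pos hp)).ne' _ _ _ _
  · intro e' he' u hu v X hlin
    obtain ⟨W, g, huW, hg, hL, -, hR⟩ := h.exists_levelMetric hp hdef hι hinj hr he' hu
    exact hg.secCurv_eq hL huW (hR u huW) hlin

end HessData

end Hypersurface

end FinslerGeom

namespace FinslerGeom

/-! ### Vector fields given in charts and their local flows. -/

section Field

variable {n : ℕ} {M : Type*} [TopologicalSpace M] [ChartedSpace (Coord n) M]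

/-- The vector field `v` has the smooth expression `V e` in every chart `e`. -/
structure IsChartField (v : (p : M) → TangentSpace (𝓡 n) p)
    (V : OpenPartialHomeomorph M (Coord n) → Coord n → Coord n) : Prop where
  smooth : ∀ e ∈ IsManifold.maximalAtlas (𝓡 n) ∞ M, ContDiffOn ℝ ∞ (V e) e.target
  eq : ∀ e ∈ IsManifold.maximalAtlas (𝓡 n) ∞ M, ∀ x ∈ e.target,
    v (e.symm x) = mfderiv (𝓡 n) (𝓡 n) e.symm x (V e x)

namespace IsChartField

variable {v : (p : M) → TangentSpace (𝓡 n) p}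
  {V : OpenPartialHomeomorph M (Coord n) → Coord n → Coord n} (hv : IsChartField v V)
  {e : OpenPartialHomeomorph M (Coord n)}
include hv

theorem neg : IsChartField (fun p => -v p) fun e x => -V e x where
  smooth e he := (hv.smooth e he).neg
  eq e he x hx := by
    rw [hv.eq e he x hx]
    exact (map_neg (mfderiv (𝓡 n) (𝓡 n) e.symm x) (V e x)).symm

theorem mfderiv_chart (he : e ∈ IsManifold.maximalAtlas (𝓡 n) ∞ M) {p : M} (hp : p ∈ e.source) :
    mfderiv (𝓡 n) (𝓡 n) e p (v p) = V e (e p) := by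
  obtain ⟨x, hx, rfl⟩ : ∃ x ∈ e.target, e.symm x = p := ⟨e p, e.map_source hp, e.left_inv hp⟩
  rw [e.right_inv hx, hv.eq e he x hx]
  exact congrArg (fun T : Coord n →L[ℝ] Coord n => T (V e x))
    ((mdifferentiable_chart he).comp_symm_deriv hx)

theorem hasDerivAt_chart (he : e ∈ IsManifold.maximalAtlas (𝓡 n) ∞ M) {γ : ℝ → M} {t : ℝ}
    (hγ : HasMFDerivAt 𝓘(ℝ, ℝ) (𝓡 n) γ t ((1 : ℝ →L[ℝ] ℝ).smulRight (v (γ t))))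
    (ht : γ t ∈ e.source) : HasDerivAt (fun s => e (γ s)) (V e (e (γ t))) t := by
  have h1 := (((mdifferentiable_chart he).mdifferentiableAt ht).hasMFDerivAt.comp t hγ)
  have h2 : HasFDerivAt (fun s => e (γ s)) ((1 : ℝ →L[ℝ] ℝ).smulRight (V e (e (γ t)))) t := by
    refine (hasMFDerivAt_iff_hasFDerivAt.1 h1).congr_fderiv ?_
    refine ContinuousLinearMap.ext fun r => ?_
    rw [← hv.mfderiv_chart he ht]
    exact map_smul (mfderiv (𝓡 n) (𝓡 n) e (γ t)) (show ℝ from r) (v (γ t))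
  simpa using h2.hasDerivAt

theorem isMIntegralCurveOn_of_chart (he : e ∈ IsManifold.maximalAtlas (𝓡 n) ∞ M) {c : ℝ → Coord n}
    {s : Set ℝ} (hc : ∀ t ∈ s, HasDerivAt c (V e (c t)) t ∧ c t ∈ e.target) :
    IsMIntegralCurveOn (fun t => e.symm (c t)) v s := by
  intro t ht
  obtain ⟨h1, h2⟩ := hc t ht
  have h3 : HasMFDerivAt 𝓘(ℝ, ℝ) (𝓡 n) c t ((1 : ℝ →L[ℝ] ℝ).smulRight (V e (c t))) :=
    hasMFDerivAt_iff_hasFDerivAt.2 h1.hasFDerivAt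
  have h4 := (mdifferentiableAt_chart_symm he h2).hasMFDerivAt.comp t h3
  refine (h4.congr_mfderiv ?_).hasMFDerivWithinAt
  refine ContinuousLinearMap.ext fun r => ?_
  rw [hv.eq e he _ h2]
  exact map_smul (mfderiv (𝓡 n) (𝓡 n) e.symm (c t)) (show ℝ from r) (V e (c t))

/-- Bootstrapping the differential equation in a chart. The Finsler distance only admits piecewise
smooth curves, so this is needed to measure integral curves. -/
theorem contMDiffOn_of_isMIntegralCurveOn [IsManifold (𝓡 n) ∞ M] {γ : ℝ → M} {a b : ℝ}
    (hγ : IsMIntegralCurveOn γ v (Set.Ioo a b)) :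
    ContMDiffOn 𝓘(ℝ, ℝ) (𝓡 n) ∞ γ (Set.Ioo a b) := by
  intro t ht
  set e := chartAt (Coord n) (γ t)
  have he : e ∈ IsManifold.maximalAtlas (𝓡 n) ∞ M := IsManifold.chart_mem_maximalAtlas _
  have hder : ∀ s ∈ Set.Ioo a b, HasMFDerivAt 𝓘(ℝ, ℝ) (𝓡 n) γ s
      ((1 : ℝ →L[ℝ] ℝ).smulRight (v (γ s))) := fun s hs =>
    (hγ s hs).hasMFDerivAt (isOpen_Ioo.mem_nhds hs)
  have hev : {s | s ∈ Set.Ioo a b ∧ γ s ∈ e.source} ∈ 𝓝 t :=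
    Filter.inter_mem (isOpen_Ioo.mem_nhds ht)
      ((hder t ht).continuousAt (e.open_source.mem_nhds (mem_chart_source _ _)))
  obtain ⟨δ, hδ, hB⟩ := Metric.nhds_basis_closedBall.mem_iff.1 hev
  rw [Real.closedBall_eq_Icc] at hB
  have h1 : ContDiffOn ℝ ∞ (fun s => e (γ s)) (Set.Icc (t - δ) (t + δ)) := by
    refine ODE.contDiffOn_enat_Icc_of_hasDerivWithinAt (f := fun _ => V e) (u := e.target) ?_
      (fun s hs => (hv.hasDerivAt_chart he (hder s (hB hs).1) (hB hs).2).hasDerivWithinAt)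
      fun s hs => e.map_source (hB hs).2
    exact (hv.smooth e he).comp contDiffOn_snd fun p hp => hp.2
  have hI : Set.Icc (t - δ) (t + δ) ∈ 𝓝 t := Icc_mem_nhds (by linarith) (by linarith)
  have h2 : ContMDiffAt 𝓘(ℝ, ℝ) (𝓡 n) ∞ (fun s => e.symm (e (γ s))) t := by
    have h3 : ContMDiffAt (𝓡 n) (𝓡 n) ∞ e.symm (e (γ t)) :=
      (contMDiffOn_symm_of_mem_maximalAtlas he).contMDiffAt
        (e.open_target.mem_nhds (e.map_source (mem_chart_source _ _)))
    exact h3.comp t (h1.contDiffAt hI).contMDiffAt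
  refine (h2.congr_of_eventuallyEq ?_).contMDiffWithinAt
  filter_upwards [hI] with s hs
  exact (e.left_inv (hB hs).2).symm

variable [IsManifold (𝓡 n) ∞ M]

theorem contMDiff : ContMDiff (𝓡 n) (𝓡 n).tangent 1
    fun p => (⟨p, v p⟩ : TangentBundle (𝓡 n) M) := by
  have : IsManifold (𝓡 n) 1 M := IsManifold.of_le (n := ∞) (by simp)
  intro p
  rw [Bundle.contMDiffAt_section]
  set e := chartAt (Coord n) p
  have he : e ∈ IsManifold.maximalAtlas (𝓡 n) ∞ M := IsManifold.chart_mem_maximalAtlas _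
  have hp : p ∈ e.source := mem_chart_source _ p
  have h1 : ContMDiffAt (𝓡 n) 𝓘(ℝ, Coord n) 1 (fun q => V e (e q)) p := by
    have h2 : ContDiffAt ℝ ∞ (V e) (e p) :=
      (hv.smooth e he).contDiffAt (e.open_target.mem_nhds (e.map_source hp))
    have h3 : ContMDiffAt (𝓡 n) (𝓡 n) ∞ e p :=
      (contMDiffOn_of_mem_maximalAtlas he).contMDiffAt (e.open_source.mem_nhds hp)
    exact (h2.contMDiffAt.comp p h3).of_le (by simp)
  refine h1.congr_of_eventuallyEq ?_
  filter_upwards [e.open_source.mem_nhds hp] with q hq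
  have h4 : (trivializationAt (Coord n) (TangentSpace (𝓡 n)) p ⟨q, v q⟩).2
      = (trivializationAt (Coord n) (TangentSpace (𝓡 n)) p).continuousLinearMapAt ℝ q (v q) := by
    rw [Bundle.Trivialization.continuousLinearMapAt_apply,
      Bundle.Trivialization.linearMapAt_apply, if_pos]
    simpa using hq
  rw [h4, TangentBundle.continuousLinearMapAt_trivializationAt hq, ← hv.mfderiv_chart he hq]
  rfl

/-- Picard-Lindelöf in a chart: the time ε is uniform for starting points near p, and it is shrunk
until the solutions stay in the chart domain. -/
theorem exists_localFlow [T2Space M] (p : M) :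
    ∃ O ∈ 𝓝 p, ∃ ε > 0, ∃ β : M × ℝ → M,
      (∀ q ∈ O, β (q, 0) = q ∧ IsMIntegralCurveOn (fun t => β (q, t)) v (Set.Ioo (-ε) ε)) ∧
      ContinuousOn β (O ×ˢ Set.Ioo (-ε) ε) := by
  set e := chartAt (Coord n) p
  have he : e ∈ IsManifold.maximalAtlas (𝓡 n) ∞ M := IsManifold.chart_mem_maximalAtlas _
  have hp : p ∈ e.source := mem_chart_source _ p
  have hV : ContDiffAt ℝ 1 (V e) (e p) :=
    ((hv.smooth e he).contDiffAt (e.open_target.mem_nhds (e.map_source hp))).of_le (by simp)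
  obtain ⟨ε₀, hε₀, a, r, L, K, hr, hpl⟩ := IsPicardLindelof.of_contDiffAt_one hV
  obtain ⟨α, hα, hαc⟩ := (hpl 0).exists_forall_mem_closedBall_eq_hasDerivWithinAt_continuousOn
  simp only [zero_sub, zero_add] at hα hαc
  have hIcc : Set.Icc (-ε₀) ε₀ ∈ 𝓝 (0 : ℝ) := Icc_mem_nhds (by linarith) hε₀
  have hball : Metric.closedBall (e p) r ∈ 𝓝 (e p) := Metric.closedBall_mem_nhds _ (by simpa using hr)
  have hα0 : ContinuousAt α (e p, 0) := hαc.continuousAt (prod_mem_nhds hball hIcc)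
  have h1 : α ⁻¹' e.target ∈ 𝓝 (e p, (0 : ℝ)) := by
    refine hα0 ?_
    rw [(hα _ (mem_of_mem_nhds hball)).1]
    exact e.open_target.mem_nhds (e.map_source hp)
  rw [nhds_prod_eq, Filter.mem_prod_iff] at h1
  obtain ⟨B, hB, J, hJ, hBJ⟩ := h1
  obtain ⟨ε, hε, hεJ⟩ := Metric.mem_nhds_iff.1 (Filter.inter_mem hJ hIcc)
  rw [Real.ball_eq_Ioo, zero_sub, zero_add] at hεJ
  have hder : ∀ x ∈ Metric.closedBall (e p) r, ∀ t ∈ Set.Ioo (-ε) ε,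
      HasDerivAt (fun t => α (x, t)) (V e (α (x, t))) t := fun x hx t ht =>
    ((hα x hx).2 t (hεJ ht).2).hasDerivAt
      (Filter.mem_of_superset (isOpen_Ioo.mem_nhds ht) fun s hs => (hεJ hs).2)
  refine ⟨e.source ∩ e ⁻¹' (B ∩ Metric.closedBall (e p) r),
    Filter.inter_mem (e.open_source.mem_nhds hp) (e.continuousAt hp (Filter.inter_mem hB hball)),
    ε, hε, fun q => e.symm (α (e q.1, q.2)), ?_, ?_⟩
  · rintro q ⟨hqs, hqB, hqr⟩
    refine ⟨?_, hv.isMIntegralCurveOn_of_chart he fun t ht =>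
      ⟨hder _ hqr t ht, hBJ ⟨hqB, (hεJ ht).1⟩⟩⟩
    simp only [(hα _ hqr).1, e.left_inv hqs]
  · refine e.continuousOn_symm.comp (hαc.comp ?_ ?_) ?_
    · exact (e.continuousOn.comp continuousOn_fst fun q hq => hq.1.1).prodMk continuousOn_snd
    · exact fun q hq => ⟨hq.1.2.2, (hεJ hq.2).2⟩
    · exact fun q hq => hBJ ⟨hq.1.2.1, (hεJ hq.2).1⟩

end IsChartField

end Field

end FinslerGeom

namespace FinslerGeom

/-! ### Bounded fields on complete Finsler manifolds have global integral curves. -/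

section Completeness

variable {n : ℕ} {M : Type*} [TopologicalSpace M] [ChartedSpace (Coord n) M]
  [IsManifold (𝓡 n) ∞ M] {F : TangentFun n M}

omit [IsManifold (𝓡 n) ∞ M] in
theorem isMIntegralCurveOn_comp_neg {v : (p : M) → TangentSpace (𝓡 n) p} {γ : ℝ → M} {a b : ℝ}
    (h : IsMIntegralCurveOn γ v (Set.Ioo a b)) :
    IsMIntegralCurveOn (fun z => γ (-z)) (fun p => -v p) (Set.Ioo (-b) (-a)) := by
  have h2 := h.comp_mul (-1)
  have e1 : ((-1 : ℝ) • v) = fun p => -v p := funext fun p => neg_one_smul ℝ (v p)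
  have e2 : (γ ∘ fun z => z * (-1 : ℝ)) = fun z => γ (-z) := funext fun z => by simp
  rw [e1, e2] at h2
  exact h2.mono fun z hz => ⟨by linarith [hz.2], by linarith [hz.1]⟩

namespace IsChartField

variable {v : (p : M) → TangentSpace (𝓡 n) p}
  {V : OpenPartialHomeomorph M (Coord n) → Coord n → Coord n} (hv : IsChartField v V)
include hv

/-- The curve is smooth with speed at most one, so its length is at most the elapsed time. -/
theorem finslerDist_le (hF : ∀ p, F p (v p) ≤ 1) {γ : ℝ → M} {a b s t : ℝ}
    (hγ : IsMIntegralCurveOn γ v (Set.Ioo a b)) (has : a < s) (hst : s ≤ t) (htb : t < b) :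
    finslerDist F (γ s) (γ t) ≤ ENNReal.ofReal (t - s) := by
  have hsub : Set.Icc s t ⊆ Set.Ioo a b := fun z hz => ⟨has.trans_le hz.1, hz.2.trans_lt htb⟩
  have hpw : IsPiecewiseSmooth n γ s t := by
    refine ⟨fun i => if i = 0 then s else t, 1, ?_, by simp, by simp, ?_⟩
    · refine monotone_nat_of_le_succ fun i => ?_
      by_cases hi : i = 0 <;> simp [hi, hst]
    · intro i hi
      obtain rfl : i = 0 := by omega
      simpa using (hv.contMDiffOn_of_isMIntegralCurveOn hγ).mono hsub
  have h0 : finslerDist F (γ s) (γ t) ≤ curveLength F γ s t := by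
    unfold finslerDist
    exact iInf_le_of_le γ (iInf_le_of_le s (iInf_le_of_le t (iInf_le _ ⟨hpw, rfl, rfl⟩)))
  refine h0.trans ?_
  calc curveLength F γ s t ≤ ∫⁻ _ in Set.Icc s t, 1 := by
        refine MeasureTheory.setLIntegral_mono' measurableSet_Icc fun z hz => ?_
        have h1 := (hγ z (hsub hz)).hasMFDerivAt (isOpen_Ioo.mem_nhds (hsub hz))
        have h2 : mfderiv 𝓘(ℝ, ℝ) (𝓡 n) γ z (1 : ℝ) = v (γ z) := by
          rw [h1.mfderiv]
          exact one_smul ℝ (v (γ z))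
        rw [h2]
        exact ENNReal.ofReal_le_one.2 (hF _)
    _ = ENNReal.ofReal (t - s) := by simp

/-- Backward motion along v is forward motion along −v; both bounds are needed because F need not be
symmetric. -/
theorem finslerDist_le' (hF : ∀ p, F p (v p) ≤ 1) (hF' : ∀ p, F p (-v p) ≤ 1) {γ : ℝ → M}
    {a b : ℝ} (hγ : IsMIntegralCurveOn γ v (Set.Ioo a b)) {s t : ℝ} (hs : s ∈ Set.Ioo a b)
    (ht : t ∈ Set.Ioo a b) : finslerDist F (γ s) (γ t) ≤ ENNReal.ofReal |t - s| := by
  rcases le_total s t with hst | hst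
  · rw [abs_of_nonneg (sub_nonneg.2 hst)]
    exact hv.finslerDist_le hF hγ hs.1 hst ht.2
  · have h1 := isMIntegralCurveOn_comp_neg hγ
    have h3 := hv.neg.finslerDist_le hF' h1 (s := -s) (t := -t) (by linarith [hs.2]) (by linarith)
      (by linarith [ht.1])
    rw [abs_of_nonpos (sub_nonpos.2 hst)]
    simpa [neg_add_eq_sub, sub_eq_add_neg, add_comm] using h3

theorem exists_tendsto (hc : FinslerComplete F) (hF : ∀ p, F p (v p) ≤ 1)
    (hF' : ∀ p, F p (-v p) ≤ 1) {γ : ℝ → M} {a b : ℝ}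
    (hγ : IsMIntegralCurveOn γ v (Set.Ioo a b)) {s : ℕ → ℝ} (hs : ∀ i, s i ∈ Set.Ioo a b)
    (hsb : Filter.Tendsto s Filter.atTop (𝓝 b)) :
    ∃ p, Filter.Tendsto (fun i => γ (s i)) Filter.atTop (𝓝 p) := by
  refine hc _ fun ε hε => ?_
  obtain ⟨δ, hδ, hδε⟩ : ∃ δ : ℝ, 0 < δ ∧ ENNReal.ofReal δ < ε := by
    obtain ⟨r, hr, hrε⟩ := ENNReal.lt_iff_exists_nnreal_btwn.1 hε
    exact ⟨r, by simpa using hr, by simpa using hrε⟩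
  obtain ⟨l, hl⟩ := Metric.cauchySeq_iff.1 hsb.cauchySeq δ hδ
  refine ⟨l, fun i j hi hj => (hv.finslerDist_le' hF hF' hγ (hs i) (hs j)).trans_lt ?_⟩
  refine lt_of_le_of_lt (ENNReal.ofReal_le_ofReal ?_) hδε
  exact (hl j hj i hi).le

variable [T2Space M]

/-- Completeness gives a limit point p of γ(s_i) for times s_i tending to b. Integral curves started
near p live for a time ε; started at γ(s_i) with b − s_i < ε/2, such a curve continues γ to b + ε/2.
-/
theorem exists_extend_right (hc : FinslerComplete F) (hF : ∀ p, F p (v p) ≤ 1)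
    (hF' : ∀ p, F p (-v p) ≤ 1) {γ : ℝ → M} {a b : ℝ} (hab : a < b)
    (hγ : IsMIntegralCurveOn γ v (Set.Ioo a b)) :
    ∃ ε > 0, ∃ γ', IsMIntegralCurveOn γ' v (Set.Ioo a (b + ε)) ∧ Set.EqOn γ' γ (Set.Ioo a b) := by
  have : IsManifold (𝓡 n) 1 M := IsManifold.of_le (n := ∞) (by simp)
  obtain ⟨s, -, hs, hsb⟩ := exists_seq_strictMono_tendsto' hab
  obtain ⟨p, hp⟩ := hv.exists_tendsto hc hF hF' hγ hs hsb
  obtain ⟨O, hO, ε, hε, β, hβ, -⟩ := hv.exists_localFlow p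
  obtain ⟨i, hi, hib⟩ := ((hp.eventually hO).and
    (hsb.eventually (lt_mem_nhds (show b - ε / 2 < b by linarith)))).exists
  obtain ⟨h0, h1⟩ := hβ _ hi
  have h2 : IsMIntegralCurveOn (fun t => β (γ (s i), t - s i)) v (Set.Ioo (s i - ε) (s i + ε)) :=
    (h1.comp_add (-s i)).mono fun t ht => ⟨by linarith [ht.1], by linarith [ht.2]⟩
  refine ⟨ε / 2, by positivity, _, (isMIntegralCurveOn_piecewise hv.contMDiff hγ h2 (t₀ := s i)
    ⟨hs i, by linarith, by linarith⟩ (by simp [h0])).mono ?_, Set.piecewise_eqOn _ _ _⟩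
  exact Set.Ioo_subset_Ioo_union_Ioo le_rfl (by linarith [(hs i).2]) (by linarith)

/-- The extension to the right is applied to v and, after time reversal, to −v. -/
theorem exists_extend (hc : FinslerComplete F) (hF : ∀ p, F p (v p) ≤ 1)
    (hF' : ∀ p, F p (-v p) ≤ 1) {γ : ℝ → M} {c : ℝ} (hc0 : 0 < c)
    (hγ : IsMIntegralCurveOn γ v (Set.Ioo (-c) c)) :
    ∃ c' > c, ∃ γ', γ' 0 = γ 0 ∧ IsMIntegralCurveOn γ' v (Set.Ioo (-c') c') := by
  obtain ⟨ε, hε, γ₁, h1, e1⟩ := hv.exists_extend_right hc hF hF' (by linarith) hγ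
  obtain ⟨ε', hε', γ₂, h2, e2⟩ := hv.neg.exists_extend_right hc hF'
    (fun p => by simpa using hF p) (by linarith) (isMIntegralCurveOn_comp_neg h1)
  have h3 := isMIntegralCurveOn_comp_neg h2
  simp only [neg_neg] at h3
  refine ⟨c + min ε ε', by have := lt_min hε hε'; linarith, fun z => γ₂ (-z), ?_, h3.mono ?_⟩
  · have h4 := e2 (x := -0) ⟨by linarith, by linarith⟩
    simp only [neg_zero] at h4 ⊢
    rw [h4, e1 ⟨by linarith, hc0⟩]
  · intro z hz
    have := min_le_left ε ε'
    have := min_le_right ε ε'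
    exact ⟨by linarith [hz.1], by linarith [hz.2]⟩

theorem exists_glue {x : M} {c : ℝ} (hc : 0 < c)
    (h : ∀ a < c, ∃ γ, γ 0 = x ∧ IsMIntegralCurveOn γ v (Set.Ioo (-a) a)) :
    ∃ γ, γ 0 = x ∧ IsMIntegralCurveOn γ v (Set.Ioo (-c) c) := by
  have : IsManifold (𝓡 n) 1 M := IsManifold.of_le (n := ∞) (by simp)
  have : Nonempty M := ⟨x⟩
  choose! g hg0 hg using h
  have key : ∀ a b, a ≤ b → b < c → Set.EqOn (g a) (g b) (Set.Ioo (-a) a) := by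
    intro a b hab hbc t ht
    have ha : 0 < a := by linarith [ht.1, ht.2]
    exact isMIntegralCurveOn_Ioo_eqOn_of_contMDiff_boundaryless (t₀ := 0) ⟨by linarith, ha⟩
      hv.contMDiff (hg a (hab.trans_lt hbc))
      ((hg b hbc).mono (Set.Ioo_subset_Ioo (by linarith) hab))
      ((hg0 a (hab.trans_lt hbc)).trans (hg0 b hbc).symm) ht
  -- At time t the curve of radius halfway between |t| and c is used; by uniqueness any two of the
  -- curves agree where both live.
  refine ⟨fun t => g ((|t| + c) / 2) t, ?_, fun t ht => ?_⟩
  · simpa using hg0 (c / 2) (by linarith)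
  set a := (|t| + c) / 2
  have htc : |t| < c := abs_lt.2 ht
  have hac : a < c := by simp only [a]; linarith
  have hta : t ∈ Set.Ioo (-a) a := abs_lt.1 (by simp only [a]; linarith)
  have h1 := (hg a hac t hta).hasMFDerivAt (isOpen_Ioo.mem_nhds hta)
  suffices h2 : (fun t => g ((|t| + c) / 2) t) =ᶠ[𝓝 t] g a from
    (h1.congr_of_eventuallyEq h2).hasMFDerivWithinAt
  filter_upwards [isOpen_Ioo.mem_nhds hta] with s hs
  have hsa : |s| < a := abs_lt.2 hs
  have hsb : |s| < (|s| + c) / 2 := by linarith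
  rcases le_total ((|s| + c) / 2) a with h1 | h1
  · exact key _ _ h1 hac (abs_lt.1 hsb)
  · exact (key _ _ h1 (by linarith) hs).symm

/-- Bounded vector fields on a complete Finsler manifold are complete. -/
theorem exists_isMIntegralCurve (hc : FinslerComplete F) (hF : ∀ p, F p (v p) ≤ 1)
    (hF' : ∀ p, F p (-v p) ≤ 1) (x : M) : ∃ γ, γ 0 = x ∧ IsMIntegralCurve γ v := by
  have : IsManifold (𝓡 n) 1 M := IsManifold.of_le (n := ∞) (by simp)
  set S := {c : ℝ | ∃ γ, γ 0 = x ∧ IsMIntegralCurveOn γ v (Set.Ioo (-c) c)}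
  have hmono : ∀ c ∈ S, ∀ a ≤ c, a ∈ S := fun c ⟨γ, h0, h1⟩ a ha =>
    ⟨γ, h0, h1.mono (Set.Ioo_subset_Ioo (by linarith) ha)⟩
  obtain ⟨ε, hε, hεS⟩ : ∃ ε > 0, ε ∈ S := by
    obtain ⟨O, hO, ε, hε, β, hβ, -⟩ := hv.exists_localFlow x
    exact ⟨ε, hε, fun t => β (x, t), hβ x (mem_of_mem_nhds hO)⟩
  suffices hbdd : ¬ BddAbove S by
    rw [exists_isMIntegralCurve_iff_exists_isMIntegralCurveOn_Ioo hv.contMDiff]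
    intro a
    obtain ⟨c, hc, hac⟩ := not_bddAbove_iff.1 hbdd a
    exact hmono c hc a hac.le
  intro hbdd
  have hpos : 0 < sSup S := hε.trans_le (le_csSup hbdd hεS)
  obtain ⟨γ, h0, h1⟩ := hv.exists_glue (x := x) hpos fun a ha => by
    obtain ⟨c, hcS, hac⟩ := exists_lt_of_lt_csSup ⟨ε, hεS⟩ ha
    exact hmono c hcS a hac.le
  obtain ⟨c', hc', γ', h0', h1'⟩ := hv.exists_extend hc hF hF' hpos h1
  exact (le_csSup hbdd ⟨γ', h0'.trans h0, h1'⟩).not_gt hc'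

end IsChartField

end Completeness

end FinslerGeom

namespace FinslerGeom

/-! ### Global flows and their joint continuity. -/

section Flow

variable {n : ℕ} {M : Type*} [TopologicalSpace M] [ChartedSpace (Coord n) M]

/-- `Φ` is the global flow of the vector field `v`. -/
structure IsFlow (v : (p : M) → TangentSpace (𝓡 n) p) (Φ : ℝ → M → M) : Prop where
  zero : ∀ x, Φ 0 x = x
  curve : ∀ x, IsMIntegralCurve (fun t => Φ t x) v
  add : ∀ s t x, Φ (s + t) x = Φ s (Φ t x)
  cont : Continuous fun p : ℝ × M => Φ p.1 p.2

variable [IsManifold (𝓡 n) ∞ M] [T2Space M] {v : (p : M) → TangentSpace (𝓡 n) p}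
  {V : OpenPartialHomeomorph M (Coord n) → Coord n → Coord n}

/-- Local flows give joint continuity for short times near every point. For fixed x, continuity of
the time-t map at x does not change under small changes of t, and holds at t = 0. Joint continuity
at (t, x) is then a short-time flow composed with the time-t map. -/
theorem IsChartField.exists_isFlow (hv : IsChartField v V)
    (h : ∀ x, ∃ γ, γ 0 = x ∧ IsMIntegralCurve γ v) : ∃ Φ, IsFlow v Φ := by
  have : IsManifold (𝓡 n) 1 M := IsManifold.of_le (n := ∞) (by simp)
  choose γ h0 hγ using h
  have hadd : ∀ s t x, γ x (s + t) = γ (γ x t) s := fun s t x =>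
    congrFun (isMIntegralCurve_Ioo_eq_of_contMDiff_boundaryless (t₀ := 0) hv.contMDiff
      ((hγ x).comp_add t) (hγ (γ x t)) (by simp [h0])) s
  have hloc : ∀ p, ∃ O, IsOpen O ∧ p ∈ O ∧ ∃ ε > 0, ∀ q ∈ O, ∀ s ∈ Set.Ioo (-ε) ε,
      ContinuousAt (fun z : ℝ × M => γ z.2 z.1) (s, q) := by
    intro p
    obtain ⟨O, hO, ε, hε, β, hβ, hβc⟩ := hv.exists_localFlow p
    refine ⟨interior O, isOpen_interior, mem_interior_iff_mem_nhds.2 hO, ε, hε, fun q hq s hs => ?_⟩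
    have hn : Set.Ioo (-ε) ε ×ˢ O ∈ 𝓝 (s, q) :=
      prod_mem_nhds (isOpen_Ioo.mem_nhds hs) (mem_interior_iff_mem_nhds.1 hq)
    have h1 : ContinuousAt (fun z : ℝ × M => β (z.2, z.1)) (s, q) :=
      (hβc.comp (f := fun z : ℝ × M => (z.2, z.1)) (by fun_prop)
        fun z hz => ⟨hz.2, hz.1⟩).continuousAt hn
    refine h1.congr ?_
    filter_upwards [hn] with z hz
    exact isMIntegralCurveOn_Ioo_eqOn_of_contMDiff_boundaryless (t₀ := 0) ⟨by linarith, hε⟩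
      hv.contMDiff (hβ _ hz.2).2 ((hγ z.2).isMIntegralCurveOn _)
      ((hβ _ hz.2).1.trans (h0 _).symm) hz.1
  have hslice : ∀ x t, ContinuousAt (fun y => γ y t) x := by
    intro x t
    have hP : ∀ t, ∀ᶠ t' in 𝓝 t,
        (ContinuousAt (fun y => γ y t') x) = ContinuousAt (fun y => γ y t) x := by
      intro t
      obtain ⟨O, hO, hz, ε, hε, hc⟩ := hloc (γ x t)
      have hstep : ∀ s s', γ x s ∈ O → s' - s ∈ Set.Ioo (-ε) ε →
          ContinuousAt (fun y => γ y s) x → ContinuousAt (fun y => γ y s') x := by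
        intro s s' hs hss h1
        have h2 : ContinuousAt (fun w => γ w (s' - s)) (γ x s) :=
          (hc _ hs _ hss).comp (f := fun w : M => (s' - s, w)) (by fun_prop)
        have h3 := h2.comp (f := fun y => γ y s) h1
        refine h3.congr (Filter.Eventually.of_forall fun y => ?_)
        simp only [Function.comp_apply, ← hadd, sub_add_cancel]
      filter_upwards [(hγ x).continuous.continuousAt (hO.mem_nhds hz),
        Ioo_mem_nhds (show t - ε < t by linarith) (show t < t + ε by linarith)] with t' h1 h2
      exact propext ⟨hstep t' t h1 ⟨by linarith [h2.2], by linarith [h2.1]⟩,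
        hstep t t' hz ⟨by linarith [h2.1], by linarith [h2.2]⟩⟩
    have h1 := IsPreconnected.eq_of_eventually_eq isPreconnected_univ
      (f := fun t => ContinuousAt (fun y => γ y t) x)
      (fun t _ => by rw [nhdsWithin_univ]; exact hP t) (Set.mem_univ t) (Set.mem_univ 0)
    refine h1.mpr ?_
    simp only [h0]
    exact continuousAt_id
  refine ⟨fun t x => γ x t, h0, hγ, hadd, continuous_iff_continuousAt.2 ?_⟩
  rintro ⟨t, x⟩
  obtain ⟨O, -, hz, ε, hε, hc⟩ := hloc (γ x t)
  have h1 : ContinuousAt (fun z : ℝ × M => (z.1 - t, γ z.2 t)) (t, x) :=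
    (continuousAt_fst.sub continuousAt_const).prodMk (ContinuousAt.comp
      (g := fun y => γ y t) (f := Prod.snd) (x := (t, x)) (hslice x t) continuousAt_snd)
  have h2 := hc _ hz 0 ⟨by linarith, hε⟩
  have h3 := ContinuousAt.comp_of_eq h2 h1 (by simp)
  refine h3.congr (Filter.Eventually.of_forall fun z => ?_)
  simp only [Function.comp_apply, ← hadd, sub_add_cancel]

theorem IsFlow.eq_of_zero (hv : IsChartField v V) {Φ : ℝ → M → M} (h : IsFlow v Φ) {o : M}
    (ho : v o = 0) (t : ℝ) : Φ t o = o := by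
  have : IsManifold (𝓡 n) 1 M := IsManifold.of_le (n := ∞) (by simp)
  exact congrFun (isMIntegralCurve_Ioo_eq_of_contMDiff_boundaryless (t₀ := 0) hv.contMDiff
    (h.curve o) (isMIntegralCurve_const ho) (h.zero o)) t

theorem IsFlow.ne_of_ne (hv : IsChartField v V) {Φ : ℝ → M → M} (h : IsFlow v Φ) {o x : M}
    (ho : v o = 0) (hx : x ≠ o) (t : ℝ) : Φ t x ≠ o := fun h1 => hx <| by
  rw [← h.zero x, ← neg_add_cancel t, h.add, h1, h.eq_of_zero hv ho]

end Flow

/-! ### The gradient rescaled to a bounded field. -/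

section GradientField

variable {n : ℕ} {M : Type*} [TopologicalSpace M] [ChartedSpace (Coord n) M]

/-- The coordinates of the vector field `grad ρ / (1 + ‖grad ρ‖²)`. -/
noncomputable def gradFieldCoord (F : TangentFun n M) (ρ : M → ℝ)
    (e : OpenPartialHomeomorph M (Coord n)) (x : Coord n) : Coord n :=
  WithLp.toLp 2 fun a => grad (chartMetric F e) (fun z => ρ (e.symm z)) a x
    / (1 + gradSq (chartMetric F e) (fun z => ρ (e.symm z)) x)

/-- The vector field `grad ρ / (1 + ‖grad ρ‖²)`. -/
noncomputable def gradField (F : TangentFun n M) (ρ : M → ℝ) (p : M) : TangentSpace (𝓡 n) p :=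
  (mfderiv (𝓡 n) (𝓡 n) (chartAt (Coord n) p).symm (chartAt (Coord n) p p)
    (gradFieldCoord F ρ (chartAt (Coord n) p) (chartAt (Coord n) p p)) : Coord n)

namespace HessData

variable [IsManifold (𝓡 n) ∞ M] [ConnectedSpace M]
  {F : TangentFun n M} {ρ φ : M → ℝ} {o : M} (h : HessData F ρ φ o)
  {e : OpenPartialHomeomorph M (Coord n)}
include h

/-- The field is defined by the preferred chart at each point; the transformation laws of the
gradient and of its norm give the same formula in every chart. -/
theorem isChartField : IsChartField (gradField F ρ) (gradFieldCoord F ρ) where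
  smooth e he := by
    have hH := h.isHess he
    refine (contDiffOn_piLp 2).2 fun a => (hH.smooth_grad a).div
      (contDiffOn_const.add hH.smooth_gradSq) fun x hx => ?_
    have := hH.gradSq_nonneg hx
    positivity
  eq e he x hx := by
    set p := e.symm x
    set e₀ := chartAt (Coord n) p
    have he₀ : e₀ ∈ IsManifold.maximalAtlas (𝓡 n) ∞ M := IsManifold.chart_mem_maximalAtlas p
    have hp : p ∈ e₀.source := mem_chart_source _ p
    obtain ⟨hu, hux⟩ := mem_localDom_id hp (e.map_target hx)
    rw [e.right_inv hx] at hux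
    have h1 := mfderiv_localExpr he he₀ (ι := id) hu.1 mdifferentiableAt_id hu.2
      (gradFieldCoord F ρ e₀ (e₀ p))
    have hd : DifferentiableAt ℝ (localExpr e₀ id e) (e₀ p) :=
      differentiableAt_of_contDiffOn (isOpen_localDom continuous_id)
        (contDiffOn_localExpr he he₀ contMDiff_id) hu
    have h2 : fderiv ℝ (localExpr e₀ id e) (e₀ p) (gradFieldCoord F ρ e₀ (e₀ p))
        = gradFieldCoord F ρ e x := by
      ext i
      rw [fderiv_apply_eq_mulVec hd]
      simp only [gradFieldCoord]
      rw [← hux, ← h.grad_chart_comp he he₀ hu i, ← h.gradSq_chart_comp he he₀ hu, Finset.sum_div]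
      exact Finset.sum_congr rfl fun a _ => (mul_div_assoc _ _ _).symm
    rw [h2, hux, mfderiv_id] at h1
    exact h1.symm

omit [ConnectedSpace M] in
theorem gradField_eq_zero : gradField F ρ o = 0 := by
  set e := chartAt (Coord n) o
  have he : e ∈ IsManifold.maximalAtlas (𝓡 n) ∞ M := IsManifold.chart_mem_maximalAtlas o
  have ho : o ∈ e.source := mem_chart_source _ o
  have h1 := (h.crit_chart he (e.map_source ho)).2 (e.left_inv ho)
  have h2 : gradFieldCoord F ρ e (e o) = 0 := by
    ext a
    simp [gradFieldCoord, grad, h1]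
  change mfderiv (𝓡 n) (𝓡 n) e.symm (e o) (gradFieldCoord F ρ e (e o)) = 0
  rw [h2]
  exact map_zero (mfderiv (𝓡 n) (𝓡 n) e.symm (e o))

/-- The squared length is H/(1 + H)² ≤ 1. Division by 1 + H instead of √H keeps the field smooth at
`o`. The sign σ covers the field and its negative. -/
theorem norm_gradField_le {σ : ℝ} (hσ : σ ^ 2 = 1) (p : M) : F p (σ • gradField F ρ p) ≤ 1 := by
  set e := chartAt (Coord n) p
  have he : e ∈ IsManifold.maximalAtlas (𝓡 n) ∞ M := IsManifold.chart_mem_maximalAtlas p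
  have hp : p ∈ e.source := mem_chart_source _ p
  have hx := e.map_source hp
  have h1 : F p (σ • gradField F ρ p) = inChart F e (e p) (σ • gradFieldCoord F ρ e (e p)) := by
    have h2 : (σ • gradField F ρ p : TangentSpace (𝓡 n) p)
        = (mfderiv (𝓡 n) (𝓡 n) e.symm (e p) (σ • gradFieldCoord F ρ e (e p)) : Coord n) :=
      (map_smul (mfderiv (𝓡 n) (𝓡 n) e.symm (e p)) σ (gradFieldCoord F ρ e (e p))).symm
    rw [h2]
    exact F.congr_base (e.left_inv hp).symm _
  have hH := h.isHess he
  set H := gradSq (chartMetric F e) (fun z => ρ (e.symm z)) (e p)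
  have hH0 : 0 ≤ H := hH.gradSq_nonneg hx
  have h3 : F p (σ • gradField F ρ p) ^ 2 = H / (1 + H) ^ 2 := by
    rw [h1, h.isNormOf he _ hx]
    have h4 : H = ∑ a, ∑ b, chartMetric F e (e p) a b
        * grad (chartMetric F e) (fun z => ρ (e.symm z)) a (e p)
        * grad (chartMetric F e) (fun z => ρ (e.symm z)) b (e p) := by
      simp only [H, gradSq]
      refine Finset.sum_congr rfl fun a _ => ?_
      rw [← hH.sum_mul_grad hx a, Finset.mul_sum]
      exact Finset.sum_congr rfl fun b _ => by ring
    nth_rewrite 1 [h4]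
    rw [Finset.sum_div]
    refine Finset.sum_congr rfl fun a _ => ?_
    rw [Finset.sum_div]
    refine Finset.sum_congr rfl fun b _ => ?_
    simp only [gradFieldCoord, PiLp.smul_apply, smul_eq_mul]
    rw [show ∀ A B C D : ℝ, A * (σ * (B / D)) * (σ * (C / D)) = σ ^ 2 * (A * B * C / D ^ 2) from
      fun A B C D => by ring, hσ, one_mul]
  have h5 : F p (σ • gradField F ρ p) ^ 2 ≤ 1 := by
    rw [h3, div_le_one (by positivity)]
    nlinarith
  nlinarith

/-- The flow of `grad ρ / (1 + ‖grad ρ‖²)` on a complete manifold. -/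
theorem exists_isFlow [T2Space M] (hc : FinslerComplete F) : ∃ Φ, IsFlow (gradField F ρ) Φ := by
  refine h.isChartField.exists_isFlow fun x => h.isChartField.exists_isMIntegralCurve hc
    (fun p => ?_) (fun p => ?_) x
  · simpa using h.norm_gradField_le (σ := 1) (by norm_num) p
  · simpa using h.norm_gradField_le (σ := -1) (by norm_num) p

theorem hasDerivAt_comp (he : e ∈ IsManifold.maximalAtlas (𝓡 n) ∞ M) {γ : ℝ → M}
    (hγ : IsMIntegralCurve γ (gradField F ρ)) {t : ℝ} (ht : γ t ∈ e.source) {f : Coord n → ℝ}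
    (hf : DifferentiableAt ℝ f (e (γ t))) :
    HasDerivAt (fun s => f (e (γ s)))
      (dGrad (chartMetric F e) (fun z => ρ (e.symm z)) f (e (γ t)) / (1 + normSq F ρ (γ t))) t := by
  have h1 := h.isChartField.hasDerivAt_chart he (hγ t) ht
  refine (hf.hasFDerivAt.comp_hasDerivAt t h1).congr_deriv ?_
  rw [fderiv_eq_sum_partialD, dGrad, Finset.sum_div, h.normSq_eq he ht]
  exact Finset.sum_congr rfl fun a _ => div_mul_eq_mul_div _ _ _

theorem hasDerivAt_fun {γ : ℝ → M} (hγ : IsMIntegralCurve γ (gradField F ρ)) (t : ℝ) :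
    HasDerivAt (fun s => ρ (γ s)) (normSq F ρ (γ t) / (1 + normSq F ρ (γ t))) t := by
  set e := chartAt (Coord n) (γ t)
  have he : e ∈ IsManifold.maximalAtlas (𝓡 n) ∞ M := IsManifold.chart_mem_maximalAtlas _
  have hs : γ t ∈ e.source := mem_chart_source _ _
  have h1 := h.hasDerivAt_comp he hγ hs (differentiableAt_of_contDiffOn e.open_target
    (contDiffOn_fun_chart he h.smooth) (e.map_source hs))
  nth_rewrite 1 [h.normSq_eq he hs]
  refine HasDerivAt.congr_of_eventuallyEq h1 ?_
  filter_upwards [hγ.continuous.continuousAt (e.open_source.mem_nhds hs)] with s hs'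
  rw [e.left_inv hs']

end HessData

end GradientField

end FinslerGeom

/-! ### Propagation of the vanishing defect. -/

namespace FinslerGeom

/-- Grönwall in both directions of time, the backward one after reflection. -/
theorem eq_zero_of_abs_deriv_le {f f' : ℝ → ℝ} {a b K : ℝ}
    (hf : ∀ s ∈ Set.Ioo a b, HasDerivAt f (f' s) s) (hb : ∀ s ∈ Set.Ioo a b, |f' s| ≤ K * |f s|)
    {t t' : ℝ} (ht : t ∈ Set.Ioo a b) (ht' : t' ∈ Set.Ioo a b) (h0 : f t = 0) : f t' = 0 := by
  rcases le_total t t' with h | h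
  · have hs : Set.Icc t t' ⊆ Set.Ioo a b := fun z hz => ⟨ht.1.trans_le hz.1, hz.2.trans_lt ht'.2⟩
    exact eq_zero_of_abs_deriv_le_mul_abs_self_of_eq_zero_right
      (fun s hs' => (hf s (hs hs')).continuousAt.continuousWithinAt)
      (fun s hs' => (hf s (hs (Set.Ico_subset_Icc_self hs'))).hasDerivWithinAt) h0
      (fun s hs' => hb s (hs (Set.Ico_subset_Icc_self hs'))) t' ⟨h, le_rfl⟩
  · have hs : ∀ z ∈ Set.Icc (-t) (-t'), -z ∈ Set.Ioo a b := fun z hz =>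
      ⟨by linarith [ht'.1, hz.2], by linarith [ht.2, hz.1]⟩
    have hd : ∀ z ∈ Set.Icc (-t) (-t'), HasDerivAt (fun z => f (-z)) (-f' (-z)) z := fun z hz => by
      simpa [Function.comp_def] using (hf _ (hs z hz)).comp z (hasDerivAt_neg z)
    have := eq_zero_of_abs_deriv_le_mul_abs_self_of_eq_zero_right (f := fun z => f (-z)) (K := K)
      (fun s hs' => (hd s hs').continuousAt.continuousWithinAt)
      (fun s hs' => (hd s (Set.Ico_subset_Icc_self hs')).hasDerivWithinAt) (by simpa using h0)
      (fun s hs' => by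
        simpa using hb _ (hs s (Set.Ico_subset_Icc_self hs'))) (-t') ⟨neg_le_neg h, le_rfl⟩
    simpa using this

theorem abs_div_one_add_sub_le {A B : ℝ} (hA : 0 ≤ A) (hB : 0 ≤ B) :
    |A / (1 + A) - B / (1 + B)| ≤ |A - B| := by
  have h1 : A / (1 + A) - B / (1 + B) = (A - B) / ((1 + A) * (1 + B)) := by field_simp; ring
  rw [h1, abs_div, abs_of_pos (show 0 < (1 + A) * (1 + B) by positivity)]
  exact div_le_self (abs_nonneg _) (by nlinarith [mul_nonneg hA hB])

section Propagation

variable {n : ℕ} {M : Type*} [TopologicalSpace M] [ChartedSpace (Coord n) M]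
  [IsManifold (𝓡 n) ∞ M] [ConnectedSpace M] [T2Space M]
  {F : TangentFun n M} {ρ φ : M → ℝ} {o : M}

namespace HessData

variable (h : HessData F ρ φ o)
include h

/-- A neighbourhood of the critical point on which the defect vanishes. -/
theorem exists_core : φ o ≠ 0 ∧ ∃ B, IsOpen B ∧ o ∈ B ∧
    (∀ p ∈ B, DefectZero F ρ φ (φ o ^ 2) p) ∧ ∀ c, IsClosed (B ∩ {x | ρ x = c}) := by
  set e := chartAt (Coord n) o
  have he : e ∈ IsManifold.maximalAtlas (𝓡 n) ∞ M := IsManifold.chart_mem_maximalAtlas o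
  have ho : o ∈ e.source := mem_chart_source _ o
  have hx := e.map_source ho
  have hcrit : ∀ x ∈ e.target, (∀ a, partialD a (fun z => ρ (e.symm z)) x = 0) ↔ x = e o := by
    intro x hx'
    rw [h.crit_chart he hx']
    exact ⟨fun h1 => by rw [← h1, e.right_inv hx'], fun h1 => by rw [h1, e.left_inv ho]⟩
  have hφ := (h.isHess he).phi_ne_zero h.two_le hx hcrit
  obtain ⟨R, hR, ε, hε, hball, hsph, -, hdef⟩ :=
    (h.isHess he).exists_defect_eq_zero h.two_le hx hcrit
  simp only [e.left_inv ho] at hφ hsph hdef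
  refine ⟨hφ, e.source ∩ e ⁻¹' Metric.ball (e o) R ∩ {x | φ o * (ρ x - ρ o) < ε}, ?_, ?_, ?_, ?_⟩
  · refine (e.isOpen_inter_preimage Metric.isOpen_ball).inter (isOpen_lt ?_ continuous_const)
    exact continuous_const.mul (h.smooth.continuous.sub continuous_const)
  · exact ⟨⟨ho, Metric.mem_ball_self hR⟩, by simpa using hε⟩
  · rintro p ⟨⟨hps, hpb⟩, hpε⟩
    refine (h.defectZero_iff he hps).2 (hdef _ (Metric.ball_subset_closedBall hpb) ?_)
    rw [e.left_inv hps]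
    exact hpε
  · intro c
    -- Such a level avoids the sphere, where φ(o)(ρ − ρ(o)) ≥ ε, so the open ball may be replaced by
    -- the closed one and the slice is compact. Otherwise the slice is empty.
    by_cases hc : φ o * (c - ρ o) < ε
    · have h1 : IsCompact (Metric.closedBall (e o) R ∩ {z | ρ (e.symm z) = c}) := by
        refine (isCompact_closedBall (e o) R).of_isClosed_subset ?_ Set.inter_subset_left
        exact ((contDiffOn_fun_chart he h.smooth).continuousOn.mono
          hball).preimage_isClosed_of_isClosed Metric.isClosed_closedBall isClosed_singleton
      have h2 := (h1.image_of_continuousOn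
        (e.continuousOn_symm.mono fun z hz => hball hz.1)).isClosed
      convert h2 using 1
      ext p
      constructor
      · rintro ⟨⟨⟨hps, hpb⟩, -⟩, hpc⟩
        refine ⟨e p, ⟨Metric.ball_subset_closedBall hpb, ?_⟩, e.left_inv hps⟩
        rw [Set.mem_ofPred_eq, e.left_inv hps]
        exact hpc
      · rintro ⟨z, ⟨hz, hzc⟩, rfl⟩
        have hzt := hball hz
        refine ⟨⟨⟨e.map_target hzt, ?_⟩, ?_⟩, hzc⟩
        · rw [Set.mem_preimage, e.right_inv hzt]
          refine lt_of_le_of_ne (Metric.mem_closedBall.1 hz) fun hzR => ?_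
          have h3 := hsph z (Metric.mem_sphere.2 hzR)
          rw [show ρ (e.symm z) = c from hzc] at h3
          linarith
        · rw [Set.mem_ofPred_eq, show ρ (e.symm z) = c from hzc]
          exact hc
    · convert isClosed_empty using 1
      refine Set.eq_empty_of_forall_notMem ?_
      rintro p ⟨⟨-, hp⟩, hpc⟩
      rw [Set.mem_ofPred_eq, show ρ p = c from hpc] at hp
      exact hc hp

omit h [IsManifold (𝓡 n) ∞ M] [ConnectedSpace M] [T2Space M] [ChartedSpace (Coord n) M] in
-- B is open, and closed within each level, so a connected part of a level that meets B cannot leave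
-- it.
theorem subset_core {B : Set M} (hB : IsOpen B) (hc : ∀ c, IsClosed (B ∩ {x | ρ x = c})) {S : Set M}
    (hS : IsPreconnected S) {p : M} (hp : p ∈ S) (hpB : p ∈ B) (hρ : ∀ z ∈ S, ρ z = ρ p) :
    S ⊆ B := by
  intro z hz
  have h1 := IsPreconnected.eq_of_eventually_eq hS (f := fun x => x ∈ B) (fun x hx => ?_) hp hz
  · exact h1 ▸ hpB
  by_cases hxB : x ∈ B
  · filter_upwards [mem_nhdsWithin_of_mem_nhds (hB.mem_nhds hxB)] with y hy
    exact propext ⟨fun _ => hxB, fun _ => hy⟩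
  · have h2 : (B ∩ {x | ρ x = ρ p})ᶜ ∈ 𝓝 x := (hc _).isOpen_compl.mem_nhds fun h3 => hxB h3.1
    filter_upwards [mem_nhdsWithin_of_mem_nhds h2, self_mem_nhdsWithin] with y hy hyS
    exact propext ⟨fun h3 => absurd ⟨h3, hρ y hyS⟩ hy, fun h3 => absurd h3 hxB⟩

variable {Φ : ℝ → M → M} (hΦ : IsFlow (gradField F ρ) Φ)
include hΦ

theorem flow_ne {x : M} (hx : x ≠ o) (t : ℝ) : Φ t x ≠ o :=
  hΦ.ne_of_ne h.isChartField h.gradField_eq_zero hx t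

/-- The vanishing of the defect propagates along the gradient flow. -/
theorem defectZero_flow {κ : ℝ} {x : M} (hx : x ≠ o) {t : ℝ}
    (h0 : DefectZero F ρ φ κ (Φ t x)) : DefectZero F ρ φ κ x := by
  -- The truth value is locally constant in time: in a chart the square of the defect satisfies |u'|
  -- ≤ Cu along the flow line, so a zero at one time of a short interval forces zeros at all of
  -- them.
  have key := IsPreconnected.eq_of_eventually_eq isPreconnected_univ
    (f := fun t => DefectZero F ρ φ κ (Φ t x)) (fun t _ => ?_) (Set.mem_univ t) (Set.mem_univ 0)
  · simp only [hΦ.zero] at key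
    exact key ▸ h0
  rw [nhdsWithin_univ]
  set e := chartAt (Coord n) (Φ t x)
  have he : e ∈ IsManifold.maximalAtlas (𝓡 n) ∞ M := IsManifold.chart_mem_maximalAtlas _
  have hs : Φ t x ∈ e.source := mem_chart_source _ _
  have hH := h.isHess he
  obtain ⟨R, hR, hball⟩ := Metric.nhds_basis_closedBall.mem_iff.1
    (e.open_target.mem_nhds (e.map_source hs))
  obtain ⟨q, hq0, hq⟩ := exists_uniform_bound
    (f := fun (p : Fin n × Fin n) z => gradChr (chartMetric F e) (fun z => ρ (e.symm z)) z p.1 p.2)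
    (isCompact_closedBall (e (Φ t x)) R) fun p => (hH.continuousOn_gradChr p.1 p.2).mono hball
  have hev : {s | Φ s x ∈ e.source ∧ e (Φ s x) ∈ Metric.closedBall (e (Φ t x)) R} ∈ 𝓝 t := by
    have hc : ContinuousAt (fun s => Φ s x) t := (hΦ.curve x).continuous.continuousAt
    exact Filter.inter_mem (hc (e.open_source.mem_nhds hs))
      (hc (e.continuousAt hs (Metric.closedBall_mem_nhds _ hR)))
  obtain ⟨δ, hδ, hwin⟩ := Metric.mem_nhds_iff.1 hev
  rw [Real.ball_eq_Ioo] at hwin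
  set u := defectSq (chartMetric F e) (fun z => ρ (e.symm z)) (fun z => φ (e.symm z)) κ
  have hiff : ∀ s ∈ Set.Ioo (t - δ) (t + δ), DefectZero F ρ φ κ (Φ s x) ↔ u (e (Φ s x)) = 0 :=
    fun s hs' => (h.defectZero_iff he (hwin hs').1).trans
      ⟨fun h1 => defectSq_eq_zero h1, fun h1 => defect_eq_zero_of_defectSq h1⟩
  have hreg : ∀ s ∈ Set.Ioo (t - δ) (t + δ),
      gradSq (chartMetric F e) (fun z => ρ (e.symm z)) (e (Φ s x)) ≠ 0 := fun s hs' h1 => by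
    rw [← h.normSq_eq he (hwin hs').1, h.normSq_eq_zero_iff] at h1
    exact h.flow_ne hΦ hx s h1
  have hder : ∀ s ∈ Set.Ioo (t - δ) (t + δ), HasDerivAt (fun s => u (e (Φ s x))) _ s :=
    fun s hs' => h.hasDerivAt_comp he (hΦ.curve x) (hwin hs').1
      (differentiableAt_of_contDiffOn hH.isOpen_regular (hH.defectSq_smooth κ)
        ⟨e.map_source (hwin hs').1, hreg s hs'⟩)
  have hmem : t ∈ Set.Ioo (t - δ) (t + δ) := ⟨by linarith, by linarith⟩
  filter_upwards [isOpen_Ioo.mem_nhds hmem] with s hs'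
  have hbd : ∀ s ∈ Set.Ioo (t - δ) (t + δ), |dGrad (chartMetric F e) (fun z => ρ (e.symm z)) u
      (e (Φ s x)) / (1 + normSq F ρ (Φ s x))| ≤ (n * n * (n * n)) * (8 * n * q)
        * |u (e (Φ s x))| := by
    intro s hs'
    have h1 := hH.abs_dGrad_defectSq_le (e.map_source (hwin hs').1) (hreg s hs') κ hq0
      fun a b => hq (a, b) _ (hwin hs').2
    have h2 := h.normSq_nonneg (Φ s x)
    rw [abs_div, abs_of_nonneg (show 0 ≤ u (e (Φ s x)) from defectSq_nonneg _ _ _ _ _),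
      abs_of_pos (show 0 < 1 + normSq F ρ (Φ s x) by linarith)]
    exact (div_le_self (abs_nonneg _) (by linarith)).trans h1
  exact propext (((hiff s hs').trans ⟨eq_zero_of_abs_deriv_le hder hbd hs' hmem,
    eq_zero_of_abs_deriv_le hder hbd hmem hs'⟩).trans (hiff t hmem).symm)

/-- The gradient flow maps level sets to level sets. -/
theorem eventually_level {z : M} (hz : z ≠ o) (t : ℝ) :
    ∀ᶠ z' in 𝓝 z, ρ z' = ρ z → ρ (Φ t z') = ρ (Φ t z) := by
  have key := IsPreconnected.eq_of_eventually_eq isPreconnected_univ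
    (f := fun t => ∀ᶠ z' in 𝓝 z, ρ z' = ρ z → ρ (Φ t z') = ρ (Φ t z)) (fun t _ => ?_)
    (Set.mem_univ t) (Set.mem_univ 0)
  · refine key.mpr ?_
    simp only [hΦ.zero]
    exact Filter.Eventually.of_forall fun _ h1 => h1
  rw [nhdsWithin_univ]
  obtain ⟨U, hU, -, ⟨K, -, hK⟩, -⟩ := h.exists_box (h.flow_ne hΦ hz t) Filter.univ_mem
  have h1 : (fun p : ℝ × M => Φ p.1 p.2) ⁻¹' U ∈ 𝓝 (t, z) := hΦ.cont.continuousAt hU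
  rw [nhds_prod_eq, Filter.mem_prod_iff] at h1
  obtain ⟨J, hJ, O, hO, hJO'⟩ := h1
  have hJO : ∀ s ∈ J, ∀ q ∈ O, Φ s q ∈ U := fun s hs q hq => hJO' (Set.mk_mem_prod hs hq)
  obtain ⟨δ, hδ, hwin⟩ := Metric.mem_nhds_iff.1 hJ
  rw [Real.ball_eq_Ioo] at hwin
  have hmem : t ∈ Set.Ioo (t - δ) (t + δ) := ⟨by linarith, by linarith⟩
  -- The difference of ρ on two nearby flow lines has a derivative bounded by K times itself,
  -- because in a box H is Lipschitz in ρ. Equal levels at one time therefore stay equal; the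
  -- neighbourhood of z may shrink from one interval to the next.
  have hstep : ∀ s ∈ Set.Ioo (t - δ) (t + δ), ∀ s' ∈ Set.Ioo (t - δ) (t + δ),
      (∀ᶠ z' in 𝓝 z, ρ z' = ρ z → ρ (Φ s z') = ρ (Φ s z)) →
      ∀ᶠ z' in 𝓝 z, ρ z' = ρ z → ρ (Φ s' z') = ρ (Φ s' z) := by
    intro s hs s' hs' hev
    filter_upwards [hev, hO] with z' h2 hz' h3
    have hd : ∀ r ∈ Set.Ioo (t - δ) (t + δ), HasDerivAt (fun r => ρ (Φ r z') - ρ (Φ r z))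
        (normSq F ρ (Φ r z') / (1 + normSq F ρ (Φ r z'))
          - normSq F ρ (Φ r z) / (1 + normSq F ρ (Φ r z))) r := fun r _ =>
      (h.hasDerivAt_fun (hΦ.curve z') r).fun_sub (h.hasDerivAt_fun (hΦ.curve z) r)
    refine sub_eq_zero.1 (eq_zero_of_abs_deriv_le (K := K) hd (fun r hr => ?_) hs hs'
      (sub_eq_zero.2 (h2 h3)))
    exact (abs_div_one_add_sub_le (h.normSq_nonneg _) (h.normSq_nonneg _)).trans
      (hK _ (hJO r (hwin hr) z' hz') _ (hJO r (hwin hr) z (mem_of_mem_nhds hO)))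
  filter_upwards [isOpen_Ioo.mem_nhds hmem] with s hs
  exact propext ⟨hstep s hs t hmem, hstep t hmem s hs⟩

theorem strictMono_flow {z : M} (hz : z ≠ o) : StrictMono fun t => ρ (Φ t z) :=
  strictMono_of_hasDerivAt_pos (fun t => h.hasDerivAt_fun (hΦ.curve z) t) fun t => by
    have := h.normSq_pos (h.flow_ne hΦ hz t)
    positivity

/-- The gradient flow lines of a point and of the nearby points both reach a saturated set. -/
theorem eventually_reach {B : Set M} (hB : IsOpen B) (hc : ∀ c, IsClosed (B ∩ {x | ρ x = c}))
    {p : M} (hp : p ≠ o) : ∀ᶠ q in 𝓝 p, (∃ t, Φ t q ∈ B) → ∃ t, Φ t p ∈ B := by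
  obtain ⟨U, hU, -, -, hslice⟩ := h.exists_box hp (isOpen_ne.mem_nhds hp)
  have h1 : (fun p : ℝ × M => Φ p.1 p.2) ⁻¹' U ∈ 𝓝 ((0 : ℝ), p) :=
    hΦ.cont.continuousAt (by rwa [hΦ.zero])
  rw [nhds_prod_eq, Filter.mem_prod_iff] at h1
  obtain ⟨J, hJ, O, hO, hJO'⟩ := h1
  have hJO : ∀ s ∈ J, ∀ q ∈ O, Φ s q ∈ U := fun s hs q hq => hJO' (Set.mk_mem_prod hs hq)
  obtain ⟨δ, hδ, hwin⟩ := Metric.nhds_basis_closedBall.mem_iff.1 hJ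
  rw [Real.closedBall_eq_Icc, zero_sub, zero_add] at hwin
  have hmono := h.strictMono_flow hΦ hp
  have hlo : ρ (Φ (-δ) p) < ρ p := by simpa [hΦ.zero] using hmono (show -δ < 0 by linarith)
  have hhi : ρ p < ρ (Φ δ p) := by simpa [hΦ.zero] using hmono hδ
  have hcont : ∀ t, Continuous fun q => ρ (Φ t q) := fun t =>
    h.smooth.continuous.comp (hΦ.cont.comp (by fun_prop : Continuous fun q : M => (t, q)))
  filter_upwards [hO, (hcont (-δ)).continuousAt.eventually_lt_const hlo,
    (hcont δ).continuousAt.eventually_const_lt hhi] with q hqO hq1 hq2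
  rintro ⟨t, ht⟩
  -- A time shift brings q to the level of p. Both points then lie on one connected slice of the
  -- box, on which ρ is constant.
  obtain ⟨τ, hτ, hτρ⟩ := intermediate_value_Icc (f := fun s => ρ (Φ s q)) (by linarith : -δ ≤ δ)
    (h.smooth.continuous.comp (hΦ.curve q).continuous).continuousOn ⟨hq1.le, hq2.le⟩
  obtain ⟨S, hSo, hSc, hpS, hqS, hSρ⟩ := hslice p (mem_of_mem_nhds hU) (Φ τ q)
    (hJO τ (hwin hτ) q hqO) hτρ.symm
  have hlev : ∀ z ∈ S, ρ (Φ (t - τ) z) = ρ (Φ (t - τ) (Φ τ q)) := fun z hz =>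
    IsPreconnected.eq_of_eventually_eq hSc (f := fun z => ρ (Φ (t - τ) z)) (fun x hx => by
      filter_upwards [mem_nhdsWithin_of_mem_nhds (h.eventually_level hΦ (hSo hx) (t - τ)),
        self_mem_nhdsWithin] with y hy hyS
      exact hy ((hSρ y hyS).trans (hSρ x hx).symm)) hz hqS
  have hcT : Continuous (Φ (t - τ)) := hΦ.cont.comp (by fun_prop : Continuous fun q : M => (t - τ, q))
  -- The flow carries this slice into a single level, where its image is connected and meets B at
  -- the image of q; so it lies in B, and with it the image of p.
  refine ⟨t - τ, subset_core hB hc (hSc.image _ hcT.continuousOn) ⟨_, hqS, rfl⟩ ?_ ?_ ⟨p, hpS, rfl⟩⟩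
  · rwa [← hΦ.add, sub_add_cancel]
  · rintro _ ⟨z, hz, rfl⟩
    exact hlev z hz

omit hΦ in
/-- On a complete manifold the defect vanishes everywhere. -/
theorem defectZero_of_complete (hcomp : FinslerComplete F) (x : M) :
    DefectZero F ρ φ (φ o ^ 2) x := by
  obtain ⟨-, B, hB, hoB, hBdef, hc⟩ := h.exists_core
  obtain ⟨Φ, hΦ⟩ := h.exists_isFlow hcomp
  by_cases hx : x = o
  · exact hx ▸ hBdef o hoB
  -- Openness of the complement is `eventually_reach`; the point `o` is in the set at time zero.
  have hA : IsClopen {p | ∃ t, Φ t p ∈ B} := by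
    constructor
    · rw [← isOpen_compl_iff, isOpen_iff_mem_nhds]
      intro p hp
      have hpo : p ≠ o := by
        rintro rfl
        exact hp ⟨0, by rwa [hΦ.zero]⟩
      filter_upwards [h.eventually_reach hΦ hB hc hpo] with q hq hqA
      exact hp (hq hqA)
    · simp only [Set.ofPred_exists]
      exact isOpen_iUnion fun t =>
        hB.preimage (hΦ.cont.comp (by fun_prop : Continuous fun q : M => (t, q)))
  have huniv := hA.eq_univ ⟨o, 0, by rwa [hΦ.zero]⟩
  obtain ⟨t, ht⟩ : x ∈ {p | ∃ t, Φ t p ∈ B} := huniv ▸ Set.mem_univ x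
  exact h.defectZero_flow hΦ hx (hBdef _ ht)

omit hΦ in
-- Without completeness the core itself serves, since it contains the level component of each of its
-- noncritical points.
theorem exists_nhd_defectZero : ∃ U, IsOpen U ∧ o ∈ U ∧ (FinslerComplete F → U = Set.univ) ∧
    ∀ p ∈ U, p ≠ o → ∀ x ∈ tLevel n ρ p, DefectZero F ρ φ (φ o ^ 2) x := by
  by_cases hcomp : FinslerComplete F
  · exact ⟨Set.univ, isOpen_univ, Set.mem_univ o, fun _ => rfl, fun _ _ _ x _ =>
      h.defectZero_of_complete hcomp x⟩
  · obtain ⟨-, B, hB, hoB, hBdef, hc⟩ := h.exists_core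
    exact ⟨B, hB, hoB, fun h1 => absurd h1 hcomp, fun p hpB _ x hx => hBdef x
      (subset_core hB hc isPreconnected_connectedComponentIn (mem_tLevel ρ hx) hpB
        (fun z hz => (h.tLevel_subset p hz).1) hx)⟩

end HessData

end Propagation

end FinslerGeom

/-! ### The theorem assembled. -/

theorem mainTheorem3
    (m : ℕ) (hm : 1 ≤ m)
    (M : Type*) [TopologicalSpace M] [T2Space M] [SecondCountableTopology M] [ConnectedSpace M]
    [ChartedSpace (FinslerGeom.Coord (m + 1)) M] [IsManifold (𝓡 (m + 1)) ∞ M]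
    (F : FinslerGeom.TangentFun (m + 1) M) (hF : FinslerGeom.IsFinsler F)
    (ρ φ : M → ℝ) (hρ : ContMDiff (𝓡 (m + 1)) 𝓘(ℝ, ℝ) ∞ ρ)
    (hsol : FinslerGeom.SolvesHessianEq F ρ φ)
    (o : M) (ho : ∀ p : M, FinslerGeom.IsCritical (m + 1) ρ p ↔ p = o) :
    0 < φ o ^ 2 ∧
    ∃ U : Set M, IsOpen U ∧ o ∈ U ∧ (FinslerGeom.FinslerComplete F → U = Set.univ) ∧
      ∀ p ∈ U, p ≠ o →
        ∃ ρ' : ℝ, 0 < ρ' ∧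
          -- on the level set through `p` the norm of the gradient of `ρ` is the constant `ρ'`
          (∀ e ∈ IsManifold.maximalAtlas (𝓡 (m + 1)) ∞ M, ∀ x ∈ e.target,
            e.symm x ∈ FinslerGeom.tLevel (m + 1) ρ p → ∀ y : FinslerGeom.Coord (m + 1), y ≠ 0 →
              FinslerGeom.gradNorm (FinslerGeom.inChart F e) (fun z => ρ (e.symm z)) x y = ρ') ∧
          -- for the level set through `p`, or any hypersurface `N` immersed in it
          ∀ (N : Type*) [TopologicalSpace N] [ChartedSpace (FinslerGeom.Coord m) N]
            [IsManifold (𝓡 m) ∞ N] (ι : N → M),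
            ContMDiff (𝓡 m) (𝓡 (m + 1)) ∞ ι →
            (∀ u : N, Function.Injective (mfderiv (𝓡 m) (𝓡 (m + 1)) ι u)) →
            Set.range ι ⊆ FinslerGeom.tLevel (m + 1) ρ p →
            ∃ f : FinslerGeom.TangentFun m N, FinslerGeom.IsFinsler f ∧
              -- `g_{γβ} = ρ'^2 f_{γβ}` for the induced metric `g_{γβ}`
              (∀ e ∈ IsManifold.maximalAtlas (𝓡 m) ∞ N, ∀ u ∈ e.target,
                ∀ v : FinslerGeom.Coord m, v ≠ 0 → ∀ γ β : Fin m,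
                  FinslerGeom.gLow
                      (FinslerGeom.inChart (FinslerGeom.induced (k := m) F ι) e) γ β u v
                    = ρ' ^ 2 * FinslerGeom.gLow (FinslerGeom.inChart f e) γ β u v) ∧
              FinslerGeom.HasConstantCurvature f (φ o ^ 2) := by
  have h : FinslerGeom.HessData F ρ φ o := ⟨by omega, hF, hρ, hsol, ho⟩
  have hφ := h.exists_core.1
  obtain ⟨U, hU, hoU, hcU, hdef⟩ := h.exists_nhd_defectZero
  refine ⟨by positivity, U, hU, hoU, hcU, fun p hpU hp => ?_⟩
  exact ⟨√(FinslerGeom.normSq F ρ p), Real.sqrt_pos.2 (h.normSq_pos hp),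
    fun _ he _ hx hxl y _ => h.gradNorm_tLevel he hx hxl y,
    fun _ _ _ _ _ hι hinj hr => h.exists_hypersurface hp (hdef p hpU hp) hι hinj hr⟩
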